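/- Let $L>0$ and let $q:\mathbb R\to\mathbb C$ be $L$-periodic, not identically zero, with $q\in C^2([0,L])$. Let $\sigma_1=\begin{pmatrix}0&1\\1&0\end{pmatrix}$, $\sigma_3=\mathrm{diag}(1,-1)$, $Q=\begin{pmatrix}0&q\\ \bar q&0\end{pmatrix}$, $U=\begin{pmatrix}1&1\\-i&i\end{pmatrix}$. Let $Y(x,z)$ be the solution of $Y_x=(-iz\sigma_3+Q)Y$, $Y(0,z)=I$, let $\tilde Y=UYU^{-1}$ with entries $\tilde y_{ij}$, and let $\Delta(z)=\frac12\operatorname{tr}Y(L,z)$. **Spectral data.** The zeros of $\Delta^2-1$ and the Dirichlet eigenvalues (those $\mu$ for which $v_x=(-i\mu\sigma_3+Q)v$ has a nontrivial solution on $[0,L]$ with $v_1+v_2=0$ at $x=0$ and $x=L$) are real. They can be enumerated, double zeros of $\Delta^2-1$ being listed twice, as $(\zeta_j)_{j\in\mathbb Z}$ and $(\mu_j)_{j\in\mathbb Z}$ with $\zeta_{2j-1}\le\mu_j\le\zeta_{2j}<\zeta_{2j+1}$, $\{z\in\mathbb C:\Delta(z)\in[-1,1]\}=\bigcup_j[\zeta_{2j},\zeta_{2j+1}]$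 and $\zeta_{-2}<0\le\zeta_0$. The gap $[\zeta_{2j-1},\zeta_{2j}]$ is called open if $\zeta_{2j-1}<\zeta_{2j}$. Number the open gaps consecutively, in increasing order, as $(E_{2n-1},E_{2n})$, where $n=0$ belongs to the first open gap with right end $\ge0$ (if there is none, the last open gap has $n=-1$). The bands are the closures of the intervals between consecutive open gaps, $[E_{2n-2},E_{2n-1}]$, including the unbounded ones (with $E_{2n-2}=-\infty$ or $E_{2n-1}=\infty$) if there are any. Put $\sigma_j=-\operatorname{sgn}\log|\tilde y_{22}(L,\mu_j)|$. Let $\Gamma$ be the set of the $\mu_j$ in the closures of open gaps with $\sigma_j=0$. If $\Gamma=\emptyset$ let $m\equiv0$. Otherwise let $\gamma_*$ be an element of $\Gamma$ closest to $0$ and let $m(z)=|\{\gamma\in\Gamma:\gamma_*\le\gamma\le z\}|$ for real $z\ge\gamma_*$ and $m(z)=|\{\gamma\in\Gamma:z<\gamma<\gamma_*\}|$ for real $z<\gamma_*$. **Bloch–Floquet solutions.** For $z\in\mathbb C\setminus\mathbb R$ let $\rho(z)$ be the root of $\rho^2-2\Delta(z)\rho+1=0$ with $|\rho|<1$. Let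 $\psi^\pm(x,z)$ be the solutions of $\psi_x=U(-iz\sigma_3+Q)U^{-1}\psi$ with $\psi^\pm(x+L,z)=\rho(z)^{\pm1}\psi^\pm(x,z)$ and first component $\psi_1^\pm(0,z)=1$. Let $\Psi=(\psi^-,\psi^+)$ in $\mathbb C^+$ and $\Psi=(\psi^+,\psi^-)$ in $\mathbb C^-$. **The matrix $B$.** There are constants $A_1,B_1$ with $\tilde y_{12}(L,z)=e^{A_1z+B_1}\prod_j(1-z/\mu_j)e^{z/\mu_j}$, where here and below a factor with $\mu_j=0$ is replaced by $z$. Let $f^\pm(z)=\prod_{\sigma_j=\pm1}(1-z/\mu_j)e^{z/\mu_j}$ and $f^0(z)=\frac12e^{A_1z+B_1}\prod_{\sigma_j=0}(1-z/\mu_j)e^{z/\mu_j}$. Let $\sqrt[4]{\Delta^2-1}$ be the holomorphic branch in $\mathbb C\setminus\mathbb R$ whose boundary values on $(\zeta_{-2},\zeta_{-1})$ from $\mathbb C^\pm$ are $|\Delta^2-1|^{1/4}e^{\pm i\pi/4}$. Let $\sqrt{f^0}$ be a holomorphic branch in $\mathbb C\setminus\mathbb R$ whose boundary values satisfy $(\sqrt{f^0})_-=(-1)^{m}(\sqrt{f^0})_+$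 on $(\zeta_{-2},\zeta_{-1})$. Such branches exist. Put $$B=\frac{i\sqrt{f^0}}{\sqrt[4]{\Delta^2-1}}\,\mathrm{diag}(f^-,f^+)\ \text{ in }\mathbb C^+,\qquad B=\frac{\sqrt{f^0}}{\sqrt[4]{\Delta^2-1}}\,\mathrm{diag}(f^+,f^-)\ \text{ in }\mathbb C^-.$$ **Domain.** Let $R=\max_n(E_{2n}-E_{2n-1})$ and let $\mathcal D$ be the complement in $\mathbb C\setminus\mathbb R$ of the closed discs of radius $R$ centred at the midpoints of the open gaps. **Theorem.** For every $x\in\mathbb R$ the function $\Phi(x,z)=\Psi(x,z)B(z)e^{izx\sigma_3}$ has the following properties. 1. $\Phi(x,\cdot)$ is holomorphic in $\mathbb C\setminus\mathbb R$. 2. $\Phi(x,\cdot)$ has boundary values $\Phi^\pm(x,\cdot)$ from $\mathbb C^\pm$ that are continuous on $\mathbb R\setminus\{E_k\}$, and $\Phi(x,z)=O(|z-E_k|^{-1/4})$ as $z\to E_k$, $z\in\mathbb C\setminus\mathbb R$. 3. $\Phi^+=\Phi^-V$ on $\mathbb R\setminus\{E_k\}$, where $$V(x,z)=\begin{cases}(-1)^{n+m(z)}\,\mathrm{diag}\big(f^-(z)/f^+(z),\,f^+(z)/f^-(z)\big),&z\in[E_{2n-2},E_{2n-1}],\\(-1)^{n+m(z)}\,i\,e^{-2izx\sigma_3}\sigma_1,&z\in[E_{2n-1},E_{2n}].\end{cases}$$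 4. $\Phi(x,z)=U\,(I+O(1/z))\,B(z)$ as $z\to\infty$ in $\mathcal D$. 5. There are constants $c,M>0$ (which may depend on $x$) with $|\Phi_{ij}(x,z)|\le Me^{c|z|^2}$ for all $z\in\mathcal D$ and $i,j\in\{1,2\}$. -/

import Mathlib

open Filter Topology Set

noncomputable section

namespace ZSP

/-! ### The Zakharov-Shabat system, its principal solution and the Floquet discriminant -/

/-- Coefficient matrix `-i z σ₃ + Q(x)` of the Zakharov-Shabat system `v_x = (-i z σ₃ + Q) v`. -/
def zsMatrix (q : ℝ → ℂ) (z : ℂ) (x : ℝ) : Matrix (Fin 2) (Fin 2) ℂ :=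
  !![-(Complex.I * z), q x; (starRingEnd ℂ) (q x), Complex.I * z]

/-- `Y` is the principal matrix solution at spectral parameter `z`: `Y' = (-i z σ₃ + Q) Y` on `ℝ`
and `Y(0) = I`. -/
def IsPrincipalSolution (q : ℝ → ℂ) (z : ℂ) (Y : ℝ → Matrix (Fin 2) (Fin 2) ℂ) : Prop :=
  Y 0 = 1 ∧ ∀ (x : ℝ) (i j : Fin 2),
    HasDerivAt (fun t => Y t i j) ((zsMatrix q z x * Y x) i j) x

/-- The principal matrix solution `Y(x,z)` (unique, and existing for every continuous `q`). -/
def principalSolution (q : ℝ → ℂ) (x : ℝ) (z : ℂ) : Matrix (Fin 2) (Fin 2) ℂ :=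
  Classical.epsilon (IsPrincipalSolution q z) x

/-- The Floquet discriminant `Δ(z) = ½ tr Y(L,z)`. -/
def discriminant (q : ℝ → ℂ) (L : ℝ) (z : ℂ) : ℂ :=
  (principalSolution q L z).trace / 2

/-- The matrix `U`. -/
def matU : Matrix (Fin 2) (Fin 2) ℂ := !![1, 1; -Complex.I, Complex.I]

/-- The modified fundamental matrix `Ỹ(x,z) = U Y(x,z) U⁻¹`. -/
def modSolution (q : ℝ → ℂ) (x : ℝ) (z : ℂ) : Matrix (Fin 2) (Fin 2) ℂ :=
  matU * principalSolution q x z * matU⁻¹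

/-- The Dirichlet spectrum with base point `0`: those `z` for which `v_x = (-i z σ₃ + Q) v` has a
nontrivial solution on `[0,L]` with `v₁ + v₂ = 0` at both ends. -/
def dirichletSpectrum (q : ℝ → ℂ) (L : ℝ) : Set ℂ :=
  {z | ∃ v : ℝ → Fin 2 → ℂ,
    (∀ x ∈ Icc 0 L, ∀ i, HasDerivWithinAt (fun t => v t i)
      ((zsMatrix q z x).mulVec (v x) i) (Icc 0 L) x) ∧
    (∃ x ∈ Icc 0 L, v x ≠ 0) ∧
    v 0 0 + v 0 1 = 0 ∧ v L 0 + v L 1 = 0}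

/-! ### Enumeration of the main and Dirichlet spectra -/

/-- `ζ` enumerates the main spectrum `{Δ² = 1}` in increasing order, double points twice, so that
`{Δ ∈ [-1,1]}` is the union of the bands `[ζ_{2j}, ζ_{2j+1}]` and `[ζ_{2j-1}, ζ_{2j}]` are the
(degenerate or non-degenerate) gaps; `j = 0` is the first gap whose right end is `≥ 0`.
`μ_j` is the Dirichlet eigenvalue in the `j`-th gap. -/
structure IsSpectralEnumeration (q : ℝ → ℂ) (L : ℝ) (ζ μ : ℤ → ℝ) : Prop where
  main_iff : ∀ z : ℂ, discriminant q L z ^ 2 = 1 ↔ ∃ j, z = ζ j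
  gap_le : ∀ j, ζ (2 * j - 1) ≤ ζ (2 * j)
  band_lt : ∀ j, ζ (2 * j) < ζ (2 * j + 1)
  band_iff : ∀ z : ℂ, (∃ t ∈ Icc (-1 : ℝ) 1, discriminant q L z = t) ↔
    ∃ j, ∃ s ∈ Icc (ζ (2 * j)) (ζ (2 * j + 1)), z = (s : ℂ)
  base_neg : ζ (-2) < 0
  base_nonneg : 0 ≤ ζ 0
  dirichlet_iff : ∀ z : ℂ, z ∈ dirichletSpectrum q L ↔ ∃ j, z = μ j
  dirichlet_mem : ∀ j, μ j ∈ Icc (ζ (2 * j - 1)) (ζ (2 * j))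

/-- The `j`-th gap is non-degenerate. -/
def IsOpenGap (ζ : ℤ → ℝ) (j : ℤ) : Prop := ζ (2 * j - 1) < ζ (2 * j)

/-- The set `{E_k}` of non-degenerate band edges. -/
def bandEdges (ζ : ℤ → ℝ) : Set ℝ :=
  {e | ∃ j, IsOpenGap ζ j ∧ (e = ζ (2 * j - 1) ∨ e = ζ (2 * j))}

/-- The Lax spectrum (union of the bands) on the real line. -/
def bands (ζ : ℤ → ℝ) : Set ℝ := {s | ∃ j, s ∈ Icc (ζ (2 * j)) (ζ (2 * j + 1))}

/-- Number the non-degenerate gaps consecutively as `(E_{2n-1}, E_{2n})`, with `n = 0` for the first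
one whose right end is `≥ 0`. For `s` off the edges, `edgeIndex ζ s` is the `n` for which `s` lies in
the band `[E_{2n-2}, E_{2n-1}]` or in the gap `[E_{2n-1}, E_{2n}]`: the signed number of right ends
`E_{2k}` passed on the way to `s`. (The two unbounded bands, if any, are included, with
`E_{2n-2} = -∞` resp. `E_{2n-1} = ∞`.) -/
def edgeIndex (ζ : ℤ → ℝ) (s : ℝ) : ℤ :=
  ({j : ℤ | 0 ≤ j ∧ IsOpenGap ζ j ∧ ζ (2 * j) < s}.ncard : ℤ) -
    ({j : ℤ | j < 0 ∧ IsOpenGap ζ j ∧ s ≤ ζ (2 * j)}.ncard : ℤ)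

/-- `σ_j = - sgn log |ỹ₂₂(L, μ_j)|`. -/
def dirSign (q : ℝ → ℂ) (L : ℝ) (μ : ℤ → ℝ) (j : ℤ) : SignType :=
  -SignType.sign (Real.log ‖modSolution q L (μ j) 1 1‖)

/-- The movable Dirichlet eigenvalues `γ_k` (those in non-degenerate gaps) with `σ_k = 0`. -/
def zeroSignMovable (q : ℝ → ℂ) (L : ℝ) (ζ μ : ℤ → ℝ) : Set ℝ :=
  {g | ∃ j, IsOpenGap ζ j ∧ dirSign q L μ j = 0 ∧ g = μ j}

/-- If `Γ` is nonempty, `g` is an element of `Γ` closest to zero. -/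
def IsClosestToZero (Γ : Set ℝ) (g : ℝ) : Prop :=
  Γ.Nonempty → g ∈ Γ ∧ ∀ g' ∈ Γ, |g| ≤ |g'|

open Classical in
/-- The counting function `m(z)` for the set `Γ` of movable eigenvalues with zero sign and its
element `g = γ_*`; it vanishes identically if `Γ` is empty. -/
def countM (Γ : Set ℝ) (g s : ℝ) : ℕ :=
  if g ≤ s then {g' ∈ Γ | g ≤ g' ∧ g' ≤ s}.ncard else {g' ∈ Γ | s < g' ∧ g' < g}.ncard

/-! ### Infinite products and branches -/

open Classical in
/-- The genus-one factor `(1 - z/a) e^{z/a}`, to be replaced by `z` if `a = 0`. -/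
def hadamardFactor (a : ℝ) (z : ℂ) : ℂ :=
  if a = 0 then z else (1 - z / a) * Complex.exp (z / a)

/-- `ỹ₁₂(L,z) = e^{A₁ z + B₁} ∏_j (1 - z/μ_j) e^{z/μ_j}` (absolutely convergent product). -/
def IsHadamardConstants (q : ℝ → ℂ) (L : ℝ) (μ : ℤ → ℝ) (A₁ B₁ : ℂ) : Prop :=
  ∀ z : ℂ, Multipliable (fun j : ℤ => hadamardFactor (μ j) z) ∧
    modSolution q L z 0 1 = Complex.exp (A₁ * z + B₁) * ∏' j : ℤ, hadamardFactor (μ j) z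

/-- The product of the factors with `σ_j = τ`; `signProduct 1 = f⁺` and `signProduct (-1) = f⁻`. -/
def signProduct (q : ℝ → ℂ) (L : ℝ) (μ : ℤ → ℝ) (τ : SignType) (z : ℂ) : ℂ :=
  ∏' j : {j : ℤ // dirSign q L μ j = τ}, hadamardFactor (μ j) z

/-- `f⁰(z) = ½ e^{A₁ z + B₁} ∏_{σ_j = 0} (1 - z/μ_j) e^{z/μ_j}`. -/
def fZero (q : ℝ → ℂ) (L : ℝ) (μ : ℤ → ℝ) (A₁ B₁ z : ℂ) : ℂ :=
  1 / 2 * Complex.exp (A₁ * z + B₁) * signProduct q L μ 0 z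

/-- The open upper half-plane `ℂ⁺`. -/
def upper : Set ℂ := {z | 0 < z.im}

/-- The open lower half-plane `ℂ⁻`. -/
def lower : Set ℂ := {z | z.im < 0}

/-- `S` is the branch of `√f` in `ℂ ∖ ℝ` (unique up to a sign common to both half-planes) whose
boundary values satisfy `S₋ = (-1)^m S₊` on the band `(ζ₋₂, ζ₋₁)`. This fixes the relative sign in
the two half-planes. -/
def IsSqrtBranch (ζ : ℤ → ℝ) (m : ℝ → ℕ) (f S : ℂ → ℂ) : Prop :=
  DifferentiableOn ℂ S (upper ∪ lower) ∧
  (∀ z ∈ upper ∪ lower, S z ^ 2 = f z) ∧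
  ∀ s ∈ Ioo (ζ (-2)) (ζ (-1)), ∃ w : ℂ,
    Tendsto S (𝓝[upper] (s : ℂ)) (𝓝 w) ∧
    Tendsto S (𝓝[lower] (s : ℂ)) (𝓝 ((-1) ^ m s * w))

/-- `F` is the branch of the fourth root of `D` in `ℂ ∖ ℝ` with boundary values
`|D|^{1/4} e^{± iπ/4}` on the band `(ζ₋₂, ζ₋₁)`. For `D = Δ² - 1` this is the branch which has its
cuts on the intervals `[ζ_{4n-4}, ζ_{4n-1}]` and, if the gap `(ζ₋₁, ζ₀)` is open, is positive
there. -/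
def IsFourthRootBranch (ζ : ℤ → ℝ) (D F : ℂ → ℂ) : Prop :=
  DifferentiableOn ℂ F (upper ∪ lower) ∧
  (∀ z ∈ upper ∪ lower, F z ^ 4 = D z) ∧
  ∀ s ∈ Ioo (ζ (-2)) (ζ (-1)),
    Tendsto F (𝓝[upper] (s : ℂ))
      (𝓝 (((‖D s‖ ^ (1 / 4 : ℝ) : ℝ) : ℂ) * Complex.exp (Complex.I * Real.pi / 4))) ∧
    Tendsto F (𝓝[lower] (s : ℂ))
      (𝓝 (((‖D s‖ ^ (1 / 4 : ℝ) : ℝ) : ℂ) * Complex.exp (-(Complex.I * Real.pi / 4))))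

/-! ### Bloch-Floquet solutions and the matrices `Ψ`, `B`, `Φ`, `V` -/

/-- The Floquet multiplier with `|ρ(z)| < 1` (used for `z ∉ ℝ`): the root of
`ρ² - 2 Δ(z) ρ + 1 = 0` inside the unit circle. -/
def multiplier (q : ℝ → ℂ) (L : ℝ) (z : ℂ) : ℂ :=
  Classical.epsilon fun r : ℂ => r ^ 2 - 2 * discriminant q L z * r + 1 = 0 ∧ ‖r‖ < 1

/-- `ψ` solves `ψ_x = U (-i z σ₃ + Q) U⁻¹ ψ`, `ψ(x+L) = r ψ(x)` and `ψ₁(0) = 1`. -/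
def IsBlochFloquet (q : ℝ → ℂ) (L : ℝ) (z r : ℂ) (ψ : ℝ → Fin 2 → ℂ) : Prop :=
  (∀ (x : ℝ) (i : Fin 2), HasDerivAt (fun t => ψ t i)
    ((matU * zsMatrix q z x * matU⁻¹).mulVec (ψ x) i) x) ∧
  (∀ x : ℝ, ψ (x + L) = r • ψ x) ∧ ψ 0 0 = 1

/-- `ψ⁺(x,z)`, with multiplier `ρ(z)`. -/
def blochPlus (q : ℝ → ℂ) (L x : ℝ) (z : ℂ) : Fin 2 → ℂ :=
  Classical.epsilon (IsBlochFloquet q L z (multiplier q L z)) x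

/-- `ψ⁻(x,z)`, with multiplier `ρ(z)⁻¹`. -/
def blochMinus (q : ℝ → ℂ) (L x : ℝ) (z : ℂ) : Fin 2 → ℂ :=
  Classical.epsilon (IsBlochFloquet q L z (multiplier q L z)⁻¹) x

/-- The matrix with columns `u`, `v`. -/
def ofCols (u v : Fin 2 → ℂ) : Matrix (Fin 2) (Fin 2) ℂ := !![u 0, v 0; u 1, v 1]

open Classical in
/-- `Ψ = (ψ⁻, ψ⁺)` in `ℂ⁺` and `Ψ = (ψ⁺, ψ⁻)` in `ℂ⁻`. -/
def matPsi (q : ℝ → ℂ) (L x : ℝ) (z : ℂ) : Matrix (Fin 2) (Fin 2) ℂ :=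
  if z ∈ upper then ofCols (blochMinus q L x z) (blochPlus q L x z)
  else ofCols (blochPlus q L x z) (blochMinus q L x z)

open Classical in
/-- The diagonal matrix `B(z)`, where `S = √f⁰` and `F` is the fourth root of `Δ² - 1`. -/
def matB (q : ℝ → ℂ) (L : ℝ) (μ : ℤ → ℝ) (S F : ℂ → ℂ) (z : ℂ) : Matrix (Fin 2) (Fin 2) ℂ :=
  if z ∈ upper then
    (Complex.I * S z / F z) •
      Matrix.diagonal ![signProduct q L μ (-1) z, signProduct q L μ 1 z]
  else
    (S z / F z) • Matrix.diagonal ![signProduct q L μ 1 z, signProduct q L μ (-1) z]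

/-- `e^{w σ₃}`. -/
def expSigmaThree (w : ℂ) : Matrix (Fin 2) (Fin 2) ℂ :=
  Matrix.diagonal ![Complex.exp w, Complex.exp (-w)]

/-- `Φ(x,z) = Ψ(x,z) B(z) e^{i z x σ₃}`. -/
def matPhi (q : ℝ → ℂ) (L : ℝ) (μ : ℤ → ℝ) (S F : ℂ → ℂ) (x : ℝ) (z : ℂ) :
    Matrix (Fin 2) (Fin 2) ℂ :=
  matPsi q L x z * matB q L μ S F z * expSigmaThree (Complex.I * z * x)

open Classical in
/-- The jump matrix `V(x,s)`, with `n = edgeIndex ζ s` and a counting function `m`. -/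
def matV (q : ℝ → ℂ) (L : ℝ) (ζ μ : ℤ → ℝ) (m : ℝ → ℕ) (x s : ℝ) : Matrix (Fin 2) (Fin 2) ℂ :=
  if s ∈ bands ζ then
    ((-1 : ℂ) ^ (edgeIndex ζ s + (m s : ℤ))) • Matrix.diagonal
      ![signProduct q L μ (-1) s / signProduct q L μ 1 s,
        signProduct q L μ 1 s / signProduct q L μ (-1) s]
  else
    ((-1 : ℂ) ^ (edgeIndex ζ s + (m s : ℤ)) * Complex.I) •
      (expSigmaThree (-(2 * Complex.I * s * x)) * !![0, 1; 1, 0])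

/-! ### The Riemann-Hilbert problem -/

/-- The maximal length `R` of the non-degenerate gaps. -/
def maxGap (ζ : ℤ → ℝ) : ℝ := sSup {r | ∃ j, IsOpenGap ζ j ∧ r = ζ (2 * j) - ζ (2 * j - 1)}

/-- The domain `𝒟`: the plane without the real line and without the closed discs of radius `R`
centred at the midpoints of the non-degenerate gaps. -/
def domainD (ζ : ℤ → ℝ) : Set ℂ :=
  {z | z.im ≠ 0 ∧ ∀ j, IsOpenGap ζ j →
    z ∉ Metric.closedBall (((ζ (2 * j) + ζ (2 * j - 1)) / 2 : ℝ) : ℂ) (maxGap ζ)}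

/-- `Φ` solves the Riemann-Hilbert problem with singular set `E ⊂ ℝ`, jump matrix `V`,
normalization `U (I + O(1/z)) B(z)` and growth of order two in the domain `𝒟`. -/
structure SolvesRHP (E : Set ℝ) (V : ℝ → Matrix (Fin 2) (Fin 2) ℂ)
    (B : ℂ → Matrix (Fin 2) (Fin 2) ℂ) (𝒟 : Set ℂ)
    (Φ : ℂ → Matrix (Fin 2) (Fin 2) ℂ) : Prop where
  holomorphic : ∀ i j, DifferentiableOn ℂ (fun z => Φ z i j) {z | z.im ≠ 0}
  boundary : ∃ Φp Φm : ℝ → Matrix (Fin 2) (Fin 2) ℂ,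
    (∀ s ∉ E, Tendsto Φ (𝓝[upper] (s : ℂ)) (𝓝 (Φp s))) ∧
    (∀ s ∉ E, Tendsto Φ (𝓝[lower] (s : ℂ)) (𝓝 (Φm s))) ∧
    ContinuousOn Φp Eᶜ ∧ ContinuousOn Φm Eᶜ ∧
    (∀ s ∉ E, Φp s = Φm s * V s)
  quartic : ∀ e ∈ E, ∃ C r : ℝ, 0 < r ∧ ∀ z : ℂ, z.im ≠ 0 → ‖z - e‖ < r →
    ∀ i j, ‖Φ z i j‖ ≤ C * ‖z - e‖ ^ (-(1 / 4) : ℝ)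
  asymptotic : ∃ C K : ℝ, ∀ z ∈ 𝒟, K ≤ ‖z‖ → ∃ N : Matrix (Fin 2) (Fin 2) ℂ,
    Φ z = matU * (1 + N) * B z ∧ ∀ i j, ‖N i j‖ ≤ C / ‖z‖
  growth : ∃ c M : ℝ, 0 < c ∧ 0 < M ∧ ∀ z ∈ 𝒟, ∀ i j, ‖Φ z i j‖ ≤ M * Real.exp (c * ‖z‖ ^ 2)

end ZSP

end

/-!
# The Riemann-Hilbert problem for the periodic self-adjoint Zakharov-Shabat system

Write `R` for the root of `Δ² - 1` with `ρ = Δ - R`, and `w± = (ỹ₂₂ - ỹ₁₁ ∓ 2R) / (2ỹ₁₂)` for the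
second components of `ψ±(0,·)`.

*Spectral data.* The quantity `|v₁|² - |v₂|²` is strictly monotone along solutions for nonreal `z`
(`normSq_sub_lt`). Hence both spectra are real and `w₊` maps the upper half-plane to itself. By
the Lagrange identity (`ps_sub_ps`) the monodromy matrix is entire in `z`, the real zeros of `ỹ₁₂`
are simple, and `Δ' ỹ₁₂ < 0` where `|Δ| ≤ 1` and `ỹ₁₂ ≠ 0`. So exactly one band lies between two
neighbouring Dirichlet eigenvalues (`Admissible.exists_band`), which enumerates the spectra. For
real points beyond a large radius the asymptotics `Δ = cos zL + O(e^{L|Im z|}/z)` and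
`ỹ₁₂ = sin zL + O(e^{L|Im z|}/z)` locate the zeros.

*Hadamard's factorization.* The quotient `G` of `ỹ₁₂(L,·)` by the canonical product over its zeros
is entire without zeros. Its second logarithmic derivative is bounded on circles between the zeros
of `sin zL`, hence constant, and it tends to zero along the imaginary axis. So it vanishes and
`G = e^{A₁z+B₁}` (`exists_isHadamardConstants`). No theory of entire functions of finite order is
needed.

*Boundary values.* `R`, `S = √f⁰`, `F = ⁴√(Δ²-1)` are roots of entire functions, so that `R` and
`S/F` continue analytically from each half-plane through every real point which is not a band
edge: apart from the edges, `f⁰` vanishes exactly at the double zeros of `Δ² - 1`, and its zeros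
are simple. The products `f^±w±` have no poles there, since at a Dirichlet eigenvalue `σ_j` tells
which of the two numerators vanishes (`numerators_eq_zero`). This gives the continuation of `Φ`
(`exists_matPhi`), and from `|S/F|⁴ = |(f⁰)²/(Δ²-1)|`, with a simple zero of `Δ² - 1` at each band
edge, the bound `O(|z - E_k|^{-1/4})`.

*Jump.* Complex conjugation maps `ψ±` to themselves, so the lower boundary values of `Φ` are, up
to a constant sign and a factor `i`, the conjugates of the upper ones with the columns exchanged.
In a band `R` is imaginary on the real line and in a gap it is real; the jump matrix follows up to
sign from `(S/F)² = ±f⁰/R`. The sign is the parity of `n + m`: comparing a point with the base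
band, every sign change of `f⁰`, `f⁺f⁻` and `R` is accounted for by a Dirichlet eigenvalue or an
open gap (`sign_total`, `jump_of_generic`). Isolated exceptional points follow by continuity
(`boundary`).

*Normalization and growth.* A growing Floquet solution `(a, b)` in the upper half-plane satisfies
`|b| ≤ |a|` and `(κ - e^{2izL}) b(0) = O(1/z) a(0)` with `κ = e^{izL}r = 1 + O(1/z)`, whence
`b(0) = O(1/z) a(0)` away from the zeros of `sin zL` (`Admissible.exists_floquet_bound`).
Reflection `x ↦ L - x` treats the decaying solution and conjugation the lower half-plane, so that
`N = U⁻¹Ψe^{izxσ₃} - I` is `O(1/z)` away from those zeros. The discs around these zeros that meet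
`𝒟` contain no point of an open gap, so that `N` continues analytically through the real line
there, and the maximum principle removes them (`exists_norm_le_domainD`). Finally `Φ = U(I + N)B`,
where `f^±` grow at most like `e^{C|z|²}` and `|S/F|⁴` is bounded by the same maximum principle.
-/

open Complex Metric
open SignType (sign)
open scoped Real

notation "conj" => starRingEnd ℂ

notation "Mat₂" => Matrix (Fin 2) (Fin 2) ℂ

noncomputable section

namespace ZSP

/-! ### Global solutions of linear differential equations -/

/-- The terms of the Picard series of `α' = A(t) α`, `α(0) = v`. -/
def picardTerm {E : Type*} [NormedAddCommGroup E] [NormedSpace ℂ E]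
    (A : ℝ → E →L[ℂ] E) (v : E) : ℕ → ℝ → E
  | 0 => fun _ => v
  | n + 1 => fun t => ∫ s in (0 : ℝ)..t, A s (picardTerm A v n s)

section Picard

variable {E : Type*} [NormedAddCommGroup E] [NormedSpace ℂ E] [CompleteSpace E]
  {A : ℝ → E →L[ℂ] E} {v : E}

theorem hasDerivAt_picardTerm_succ (hA : Continuous A) {n : ℕ}
    (hn : Continuous (picardTerm A v n)) (t : ℝ) :
    HasDerivAt (picardTerm A v (n + 1)) (A t (picardTerm A v n t)) t := by
  have hc : Continuous fun s => A s (picardTerm A v n s) := hA.clm_apply hn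
  exact intervalIntegral.integral_hasDerivAt_right (hc.intervalIntegrable _ _)
    hc.stronglyMeasurable.stronglyMeasurableAtFilter hc.continuousAt

theorem continuous_picardTerm (hA : Continuous A) (n : ℕ) : Continuous (picardTerm A v n) := by
  induction n with
  | zero => exact continuous_const
  | succ n ih =>
    exact continuous_iff_continuousAt.2 fun t => (hasDerivAt_picardTerm_succ hA ih t).continuousAt

omit [CompleteSpace E] in
theorem norm_picardTerm_le {b C : ℝ}
    (hC : ∀ t, |t| ≤ b → ‖A t‖ ≤ C) (n : ℕ) {t : ℝ} (ht : |t| ≤ b) :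
    ‖picardTerm A v n t‖ ≤ ‖v‖ * (C ^ n * |t| ^ n / n.factorial) := by
  have hC0 : 0 ≤ C := (norm_nonneg _).trans (hC t ht)
  induction n generalizing t with
  | zero => simp [picardTerm]
  | succ n ih =>
    have hmem : ∀ s ∈ uIoc 0 t, |s| ≤ b := fun s hs => by
      have := abs_sub_left_of_mem_uIcc (uIoc_subset_uIcc hs)
      simp only [sub_zero] at this
      linarith
    calc ‖∫ s in (0 : ℝ)..t, A s (picardTerm A v n s)‖
        ≤ |∫ s in (0 : ℝ)..t, C * (‖v‖ * (C ^ n * |s| ^ n / n.factorial))| := by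
          refine intervalIntegral.norm_integral_le_abs_of_norm_le ?_ ?_
          · refine MeasureTheory.ae_restrict_of_forall_mem measurableSet_uIoc fun s hs => ?_
            exact (A s).le_of_opNorm_le_of_le (hC s (hmem s hs)) (ih (hmem s hs))
          · exact Continuous.intervalIntegrable (by fun_prop) _ _
      _ = ‖v‖ * (C ^ (n + 1) * |t| ^ (n + 1) / (n + 1).factorial) := by
          rw [show (fun s : ℝ => C * (‖v‖ * (C ^ n * |s| ^ n / n.factorial))) =
            fun s => (‖v‖ * (C ^ (n + 1) / n.factorial)) * |s| ^ n by ext s; ring]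
          rw [intervalIntegral.abs_integral_eq_abs_integral_uIoc, MeasureTheory.integral_const_mul]
          have := integral_pow_abs_sub_uIoc (a := 0) (b := t) n
          simp only [sub_zero] at this
          rw [this, abs_of_nonneg (by positivity), Nat.factorial_succ]
          push_cast
          field_simp

theorem exists_hasDerivAt_linear (hA : Continuous A) (v : E) :
    ∃ α : ℝ → E, α 0 = v ∧ ∀ t, HasDerivAt α (A t (α t)) t := by
  have key : ∀ b : ℝ, 0 < b → ∃ C : ℝ, ∀ t, |t| ≤ b → ‖A t‖ ≤ C := fun b _ => by
    obtain ⟨C, hC⟩ := (isCompact_Icc (a := -b) (b := b)).exists_bound_of_continuousOn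
      hA.continuousOn
    exact ⟨C, fun t ht => hC t (abs_le.1 ht)⟩
  have hsum : ∀ b C : ℝ, Summable fun n : ℕ => ‖v‖ * (C ^ n * b ^ n / n.factorial) := fun b C => by
    simp_rw [← mul_pow]
    exact (Real.summable_pow_div_factorial (C * b)).mul_left _
  have hzero : ∀ n, picardTerm A v (n + 1) 0 = 0 := fun n => by simp [picardTerm]
  have hsumm : ∀ t, Summable fun n => picardTerm A v n t := fun t => by
    obtain ⟨C, hC⟩ := key (|t| + 1) (by positivity)
    refine Summable.of_norm_bounded (hsum |t| C) fun n => ?_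
    exact norm_picardTerm_le hC n (by linarith)
  refine ⟨fun t => ∑' n, picardTerm A v n t, ?_, fun t => ?_⟩
  · have : (fun n => picardTerm A v n 0) = fun n => if n = 0 then v else 0 := by
      ext n
      cases n with
      | zero => simp [picardTerm]
      | succ n => simp [hzero]
    simp only [this, tsum_ite_eq]
  · set b := |t| + 1
    obtain ⟨C, hC⟩ := key b (by positivity)
    have htb : t ∈ ball (0 : ℝ) b := by simp [b]
    have hC0 : 0 ≤ C := (norm_nonneg _).trans (hC 0 (by simp [b]; positivity))
    set g' : ℕ → ℝ → E := fun n s => Nat.casesOn n 0 fun m => A s (picardTerm A v m s) with hg'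
    set u : ℕ → ℝ := fun n => Nat.casesOn n 0 fun m => C * (‖v‖ * (C ^ m * b ^ m / m.factorial))
      with hu_def
    have hu : Summable u := (summable_nat_add_iff 1).1 ((hsum b C).mul_left C)
    have hd := hasDerivAt_tsum_of_isPreconnected (g := fun n s => picardTerm A v n s) (g' := g')
      hu isOpen_ball (convex_ball (0 : ℝ) b).isPreconnected
      (fun n s _ => ?_) (fun n s hs => ?_) htb (hsumm t) htb
    · convert hd using 1
      have h1 : Summable fun n => g' n t := by
        refine (summable_nat_add_iff 1).1 ?_
        exact (hsumm t).mapL (A t)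
      rw [h1.tsum_eq_zero_add]
      simp [hg', (A t).map_tsum (hsumm t)]
    · cases n with
      | zero => exact hasDerivAt_const s v
      | succ n => exact hasDerivAt_picardTerm_succ hA (continuous_picardTerm hA n) s
    · have hs' : |s| ≤ b := by simpa using (mem_ball_zero_iff.1 hs).le
      cases n with
      | zero => simp [hg', hu_def]
      | succ n =>
        refine (A s).le_of_opNorm_le_of_le (hC s hs')
          ((norm_picardTerm_le hC n hs').trans ?_)
        gcongr

end Picard

/-! ### The principal solution -/

theorem exists_isPrincipalSolution {q : ℝ → ℂ} (hq : Continuous q) (z : ℂ) :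
    ∃ Y, IsPrincipalSolution q z Y := by
  let i1 : ℂ →L[ℂ] ℂ × ℂ := ContinuousLinearMap.inl ℂ ℂ ℂ
  let i2 : ℂ →L[ℂ] ℂ × ℂ := ContinuousLinearMap.inr ℂ ℂ ℂ
  let p1 : ℂ × ℂ →L[ℂ] ℂ := ContinuousLinearMap.fst ℂ ℂ ℂ
  let p2 : ℂ × ℂ →L[ℂ] ℂ := ContinuousLinearMap.snd ℂ ℂ ℂ
  let A : ℝ → ℂ × ℂ →L[ℂ] ℂ × ℂ := fun t =>
    (-(I * z)) • (i1 ∘L p1) + q t • (i1 ∘L p2) + (conj (q t)) • (i2 ∘L p1) + (I * z) • (i2 ∘L p2)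
  have hA : Continuous A := by
    have := continuous_conj.comp hq
    simp only [Function.comp_def] at this
    fun_prop
  obtain ⟨α, hα0, hα⟩ := exists_hasDerivAt_linear hA ((1, 0) : ℂ × ℂ)
  obtain ⟨β, hβ0, hβ⟩ := exists_hasDerivAt_linear hA ((0, 1) : ℂ × ℂ)
  refine ⟨fun x => !![(α x).1, (β x).1; (α x).2, (β x).2], ?_, fun x i j => ?_⟩
  · ext i j
    fin_cases i <;> fin_cases j <;> simp [hα0, hβ0]
  · have h1 := (hα x).hasFDerivAt.fst.hasDerivAt
    have h2 := (hα x).hasFDerivAt.snd.hasDerivAt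
    have h3 := (hβ x).hasFDerivAt.fst.hasDerivAt
    have h4 := (hβ x).hasFDerivAt.snd.hasDerivAt
    have e : ∀ w : ℂ × ℂ, A x w = (-(I * z) * w.1 + q x * w.2,
        conj (q x) * w.1 + I * z * w.2) := fun w => by
      simp [A, i1, i2, p1, p2]
    fin_cases i <;> fin_cases j
    · exact h1.congr_deriv (by simp [e, zsMatrix, Matrix.mul_apply, Fin.sum_univ_two])
    · exact h3.congr_deriv (by simp [e, zsMatrix, Matrix.mul_apply, Fin.sum_univ_two])
    · exact h2.congr_deriv (by simp [e, zsMatrix, Matrix.mul_apply, Fin.sum_univ_two])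
    · exact h4.congr_deriv (by simp [e, zsMatrix, Matrix.mul_apply, Fin.sum_univ_two])

/-- Entries `y_{ij}(x,z)` of the principal solution. -/
abbrev ps (q : ℝ → ℂ) (i j : Fin 2) (x : ℝ) (z : ℂ) : ℂ := principalSolution q x z i j

theorem principalSolution_spec {q : ℝ → ℂ} (hq : Continuous q) (z : ℂ) :
    IsPrincipalSolution q z fun x => principalSolution q x z :=
  Classical.epsilon_spec (exists_isPrincipalSolution hq z)

variable {q : ℝ → ℂ} {z : ℂ}

theorem fin_two (i : Fin 2) : i = 0 ∨ i = 1 := by fin_cases i <;> simp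

theorem differentiable_deriv {f : ℂ → ℂ} (hf : Differentiable ℂ f) : Differentiable ℂ (deriv f) :=
  differentiableOn_univ.1 (hf.differentiableOn.deriv isOpen_univ)

theorem differentiable_dslope {f : ℂ → ℂ} (hf : Differentiable ℂ f) (s : ℂ) :
    Differentiable ℂ (dslope f s) :=
  differentiableOn_univ.1 ((Complex.differentiableOn_dslope univ_mem).2 hf.differentiableOn)

theorem principalSolution_zero (hq : Continuous q) (z : ℂ) : principalSolution q 0 z = 1 :=
  (principalSolution_spec hq z).1

theorem hasDerivAt_ps_zero (hq : Continuous q) (z : ℂ) (j : Fin 2) (x : ℝ) :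
    HasDerivAt (fun t => ps q 0 j t z)
      (-(I * z) * ps q 0 j x z + q x * ps q 1 j x z) x := by
  have := (principalSolution_spec hq z).2 x 0 j
  simpa [zsMatrix, Matrix.mul_apply, Fin.sum_univ_two] using this

theorem hasDerivAt_ps_one (hq : Continuous q) (z : ℂ) (j : Fin 2) (x : ℝ) :
    HasDerivAt (fun t => ps q 1 j t z)
      (conj (q x) * ps q 0 j x z + I * z * ps q 1 j x z) x := by
  have := (principalSolution_spec hq z).2 x 1 j
  simpa [zsMatrix, Matrix.mul_apply, Fin.sum_univ_two] using this

theorem continuous_ps (hq : Continuous q) (z : ℂ) (i j : Fin 2) :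
    Continuous fun t => ps q i j t z := by
  refine continuous_iff_continuousAt.2 fun x => ?_
  fin_cases i
  · exact (hasDerivAt_ps_zero hq z j x).continuousAt
  · exact (hasDerivAt_ps_one hq z j x).continuousAt

theorem ps_det (hq : Continuous q) (z : ℂ) (x : ℝ) :
    ps q 0 0 x z * ps q 1 1 x z - ps q 0 1 x z * ps q 1 0 x z = 1 := by
  have hd : ∀ x, HasDerivAt (fun x => ps q 0 0 x z * ps q 1 1 x z - ps q 0 1 x z * ps q 1 0 x z)
      0 x := fun x => by
    have := ((hasDerivAt_ps_zero hq z 0 x).mul (hasDerivAt_ps_one hq z 1 x)).sub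
      ((hasDerivAt_ps_zero hq z 1 x).mul (hasDerivAt_ps_one hq z 0 x))
    exact this.congr_deriv (by ring)
  have := is_const_of_deriv_eq_zero (fun x => (hd x).differentiableAt) (fun x => (hd x).deriv) x 0
  rw [this]
  simp [ps, principalSolution_zero hq]

/-- A solution of the Zakharov-Shabat system on an interval is the principal solution applied to
its initial value: `Y⁻¹ v` has derivative zero. -/
theorem eq_ps_mul_of_hasDerivWithinAt (hq : Continuous q) {s : Set ℝ} (hs : Convex ℝ s)
    (h0 : (0 : ℝ) ∈ s) {a b : ℝ → ℂ}
    (ha : ∀ x ∈ s, HasDerivWithinAt a (-(I * z) * a x + q x * b x) s x)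
    (hb : ∀ x ∈ s, HasDerivWithinAt b (conj (q x) * a x + I * z * b x) s x)
    {x : ℝ} (hx : x ∈ s) :
    a x = ps q 0 0 x z * a 0 + ps q 0 1 x z * b 0 ∧
      b x = ps q 1 0 x z * a 0 + ps q 1 1 x z * b 0 := by
  have hconst : ∀ {f : ℝ → ℂ}, (∀ x ∈ s, HasDerivWithinAt f 0 s x) → f x = f 0 := fun {f} hf => by
    have := hs.norm_image_sub_le_of_norm_hasDerivWithin_le (C := 0) hf (by simp) h0 hx
    simpa [sub_eq_zero] using this
  have c1 := hconst (f := fun x => ps q 1 1 x z * a x - ps q 0 1 x z * b x) fun x hx => by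
    have := ((hasDerivAt_ps_one hq z 1 x).hasDerivWithinAt.mul (ha x hx)).sub
      ((hasDerivAt_ps_zero hq z 1 x).hasDerivWithinAt.mul (hb x hx))
    exact this.congr_deriv (by ring)
  have c2 := hconst (f := fun x => ps q 0 0 x z * b x - ps q 1 0 x z * a x) fun x hx => by
    have := ((hasDerivAt_ps_zero hq z 0 x).hasDerivWithinAt.mul (hb x hx)).sub
      ((hasDerivAt_ps_one hq z 0 x).hasDerivWithinAt.mul (ha x hx))
    exact this.congr_deriv (by ring)
  have e11 : ps q 1 1 0 z = 1 := by simp [ps, principalSolution_zero hq]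
  have e00 : ps q 0 0 0 z = 1 := by simp [ps, principalSolution_zero hq]
  have e01 : ps q 0 1 0 z = 0 := by simp [ps, principalSolution_zero hq]
  have e10 : ps q 1 0 0 z = 0 := by simp [ps, principalSolution_zero hq]
  simp only [e11, e01, e00, e10] at c1 c2
  have hdet := ps_det hq z x
  constructor
  · linear_combination (-a x) * hdet + ps q 0 0 x z * c1 + ps q 0 1 x z * c2
  · linear_combination (-b x) * hdet + ps q 1 0 x z * c1 + ps q 1 1 x z * c2

theorem eq_ps_mul_of_hasDerivAt (hq : Continuous q) {a b : ℝ → ℂ}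
    (ha : ∀ x, HasDerivAt a (-(I * z) * a x + q x * b x) x)
    (hb : ∀ x, HasDerivAt b (conj (q x) * a x + I * z * b x) x) (x : ℝ) :
    a x = ps q 0 0 x z * a 0 + ps q 0 1 x z * b 0 ∧ b x = ps q 1 0 x z * a 0 + ps q 1 1 x z * b 0 :=
  eq_ps_mul_of_hasDerivWithinAt hq convex_univ (mem_univ _)
    (fun x _ => (ha x).hasDerivWithinAt) (fun x _ => (hb x).hasDerivWithinAt) (mem_univ x)

theorem ps_conj (hq : Continuous q) (z : ℂ) (x : ℝ) :
    ps q 1 1 x (conj z) = conj (ps q 0 0 x z) ∧ ps q 0 1 x (conj z) = conj (ps q 1 0 x z) ∧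
      ps q 1 0 x (conj z) = conj (ps q 0 1 x z) ∧
      ps q 0 0 x (conj z) = conj (ps q 1 1 x z) := by
  have key : ∀ j, _ := fun j : Fin 2 => eq_ps_mul_of_hasDerivAt hq (z := conj z)
    (a := fun t => conj (ps q 1 j t z)) (b := fun t => conj (ps q 0 j t z))
    (fun x => by
      have := (hasDerivAt_ps_one hq z j x).star
      exact this.congr_deriv (by simp; ring)) (fun x => by
      have := (hasDerivAt_ps_zero hq z j x).star
      exact this.congr_deriv (by simp [add_comm])) x
  have h0 := key 0
  have h1 := key 1
  simp only [ps, principalSolution_zero hq, Matrix.one_apply_eq, ne_eq, one_ne_zero,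
    not_false_eq_true, Matrix.one_apply_ne, map_one, map_zero, mul_zero, mul_one, zero_ne_one,
    zero_add, add_zero] at h0 h1
  exact ⟨h0.2.symm, h0.1.symm, h1.2.symm, h1.1.symm⟩

theorem ps_add_period (hq : Continuous q) {L : ℝ} (hper : ∀ x, q (x + L) = q x) (z : ℂ) (x : ℝ)
    (j : Fin 2) :
    ps q 0 j (x + L) z = ps q 0 0 x z * ps q 0 j L z + ps q 0 1 x z * ps q 1 j L z ∧
      ps q 1 j (x + L) z = ps q 1 0 x z * ps q 0 j L z + ps q 1 1 x z * ps q 1 j L z := by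
  have := eq_ps_mul_of_hasDerivAt hq (z := z)
    (a := fun t => ps q 0 j (t + L) z) (b := fun t => ps q 1 j (t + L) z)
    (fun x => by
      have := (hasDerivAt_ps_zero hq z j (x + L)).comp_add_const x L
      simpa [hper] using this)
    (fun x => by
      have := (hasDerivAt_ps_one hq z j (x + L)).comp_add_const x L
      simpa [hper] using this) x
  simpa using this

/-! ### The energy identity and exponential bounds -/

theorem hasDerivAt_normSq {f : ℝ → ℂ} {f' : ℂ} {x : ℝ} (h : HasDerivAt f f' x) :
    HasDerivAt (fun t => normSq (f t)) (2 * (f'.re * (f x).re + f'.im * (f x).im)) x := by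
  have hre : HasDerivAt (fun t => (f t).re) f'.re x := by
    have := (Complex.reCLM.hasFDerivAt (x := f x)).comp_hasDerivAt x h
    exact this.congr_deriv (by simp)
  have him : HasDerivAt (fun t => (f t).im) f'.im x := by
    have := (Complex.imCLM.hasFDerivAt (x := f x)).comp_hasDerivAt x h
    exact this.congr_deriv (by simp)
  simp only [normSq_apply]
  exact ((hre.mul hre).add (him.mul him)).congr_deriv (by ring)

/-- `(a, b)` solves the Zakharov-Shabat system on the line. -/
structure IsZSPair (q : ℝ → ℂ) (z : ℂ) (a b : ℝ → ℂ) : Prop where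
  fst : ∀ x, HasDerivAt a (-(I * z) * a x + q x * b x) x
  snd : ∀ x, HasDerivAt b (conj (q x) * a x + I * z * b x) x

theorem isZSPair_ps (hq : Continuous q) (z : ℂ) (j : Fin 2) :
    IsZSPair q z (fun x => ps q 0 j x z) (fun x => ps q 1 j x z) :=
  ⟨hasDerivAt_ps_zero hq z j, hasDerivAt_ps_one hq z j⟩

namespace IsZSPair

variable {a b : ℝ → ℂ}

theorem hasDerivAt_normSq_sub (h : IsZSPair q z a b) (x : ℝ) :
    HasDerivAt (fun t => normSq (a t) - normSq (b t))
      (2 * z.im * (normSq (a x) + normSq (b x))) x := by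
  refine ((hasDerivAt_normSq (h.fst x)).sub (hasDerivAt_normSq (h.snd x))).congr_deriv ?_
  simp [normSq_apply]
  ring

theorem hasDerivAt_normSq_add (h : IsZSPair q z a b) (x : ℝ) :
    HasDerivAt (fun t => normSq (a t) + normSq (b t))
      (2 * z.im * (normSq (a x) - normSq (b x)) + 4 * (q x * b x * conj (a x)).re) x := by
  refine ((hasDerivAt_normSq (h.fst x)).add (hasDerivAt_normSq (h.snd x))).congr_deriv ?_
  simp [normSq_apply]
  ring

theorem normSq_add_le (h : IsZSPair q z a b) {Q : ℝ} (hQ : ∀ x, ‖q x‖ ≤ Q) (x : ℝ) :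
    normSq (a x) + normSq (b x) ≤ (normSq (a 0) + normSq (b 0)) *
        Real.exp (2 * (|z.im| + Q) * |x|) := by
  set g : ℝ → ℝ := fun t => normSq (a t) + normSq (b t) with hg
  set c := 2 * (|z.im| + Q) with hc
  have hb : ∀ t, |2 * z.im * (normSq (a t) - normSq (b t)) +
        4 * (q t * b t * conj (a t)).re| ≤ c * g t := fun t => by
    have h1 : |(q t * b t * conj (a t)).re| ≤ Q * (‖b t‖ * ‖a t‖) := by
      refine (Complex.abs_re_le_norm _).trans ?_
      rw [norm_mul, norm_mul, norm_conj, mul_assoc]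
      exact mul_le_mul_of_nonneg_right (hQ t) (by positivity)
    have h2 : |normSq (a t) - normSq (b t)| ≤ g t := by
      rw [abs_le]; constructor <;> simp only [hg] <;>
        linarith [normSq_nonneg (a t), normSq_nonneg (b t)]
    have h3 : 2 * (‖b t‖ * ‖a t‖) ≤ g t := by
      simp only [hg, normSq_eq_norm_sq]; nlinarith [sq_nonneg (‖b t‖ - ‖a t‖)]
    have hQ0 : 0 ≤ Q := (norm_nonneg _).trans (hQ 0)
    calc _ ≤ |2 * z.im * (normSq (a t) - normSq (b t))| +
          |4 * (q t * b t * conj (a t)).re| := abs_add_le _ _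
      _ = 2 * (|z.im| * |normSq (a t) - normSq (b t)|) + 4 * |(q t * b t * conj (a t)).re| := by
          simp only [abs_mul, abs_two, abs_of_pos (four_pos : (0 : ℝ) < 4)]; ring
      _ ≤ 2 * (|z.im| * g t) + 4 * (Q * (‖b t‖ * ‖a t‖)) := by gcongr
      _ ≤ c * g t := by
          have := mul_le_mul_of_nonneg_left h3 hQ0
          rw [hc]; linarith
  have hexp : ∀ s t : ℝ, HasDerivAt (fun t => Real.exp (s * t)) (Real.exp (s * t) * s) t :=
    fun s t => by simpa using ((hasDerivAt_id t).const_mul s).exp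
  rcases le_total 0 x with hx | hx
  · have hanti : Antitone fun t => g t * Real.exp (-c * t) := by
      refine antitone_of_deriv_nonpos
        (fun t => ((h.hasDerivAt_normSq_add t).mul (hexp (-c) t)).differentiableAt) fun t => ?_
      have hd : deriv (fun t => g t * Real.exp (-c * t)) t = _ :=
        ((h.hasDerivAt_normSq_add t).mul (hexp (-c) t)).deriv
      rw [hd]
      have := (abs_le.1 (hb t)).2
      nlinarith [Real.exp_pos (-c * t)]
    have := hanti hx
    simp only [mul_zero, Real.exp_zero, mul_one] at this
    rw [abs_of_nonneg hx]
    calc g x = g x * Real.exp (-c * x) * Real.exp (c * x) := by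
          rw [mul_assoc, ← Real.exp_add]; simp
      _ ≤ _ := by gcongr
  · have hmono : Monotone fun t => g t * Real.exp (c * t) := by
      refine monotone_of_deriv_nonneg
        (fun t => ((h.hasDerivAt_normSq_add t).mul (hexp c t)).differentiableAt) fun t => ?_
      have hd : deriv (fun t => g t * Real.exp (c * t)) t = _ :=
        ((h.hasDerivAt_normSq_add t).mul (hexp c t)).deriv
      rw [hd]
      have := (abs_le.1 (hb t)).1
      nlinarith [Real.exp_pos (c * t)]
    have := hmono hx
    simp only [mul_zero, Real.exp_zero, mul_one] at this
    rw [abs_of_nonpos hx]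
    calc g x = g x * Real.exp (c * x) * Real.exp (c * -x) := by
          rw [mul_assoc, ← Real.exp_add]; simp
      _ ≤ _ := by gcongr

end IsZSPair

theorem norm_ps_le (hq : Continuous q) {Q : ℝ} (hQ : ∀ x, ‖q x‖ ≤ Q) (i j : Fin 2) (x : ℝ) (z : ℂ) :
    ‖ps q i j x z‖ ≤ Real.exp ((|z.im| + Q) * |x|) := by
  have h := (isZSPair_ps hq z j).normSq_add_le hQ x
  have h0 : normSq (ps q 0 j 0 z) + normSq (ps q 1 j 0 z) = 1 := by
    obtain rfl | rfl := fin_two j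
    all_goals simp [ps, principalSolution_zero hq]
  rw [h0, one_mul] at h
  have hi : normSq (ps q i j x z) ≤ Real.exp (2 * (|z.im| + Q) * |x|) := by
    fin_cases i
    · exact le_trans (le_add_of_nonneg_right (normSq_nonneg _)) h
    · exact le_trans (le_add_of_nonneg_left (normSq_nonneg _)) h
  rw [normSq_eq_norm_sq] at hi
  refine le_of_sq_le_sq ?_ (Real.exp_pos _).le
  have e : Real.exp ((|z.im| + Q) * |x|) ^ 2 = Real.exp (2 * (|z.im| + Q) * |x|) := by
    rw [← Real.exp_nat_mul]
    congr 1
    push_cast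
    ring
  rwa [e]

theorem exists_norm_le_of_periodic {L : ℝ} (hL : 0 < L) (hq : Continuous q)
    (hper : ∀ x, q (x + L) = q x) : ∃ Q : ℝ, 0 < Q ∧ ∀ x, ‖q x‖ ≤ Q := by
  obtain ⟨C, hC⟩ := (isCompact_Icc (a := 0) (b := L)).exists_bound_of_continuousOn hq.continuousOn
  refine ⟨max C 1, by positivity, fun x => ?_⟩
  have hp : Function.Periodic q L := hper
  obtain ⟨y, hy, hxy⟩ := hp.exists_mem_Ico₀ hL x
  rw [hxy]
  exact (hC y (Ico_subset_Icc_self hy)).trans (le_max_left _ _)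

/-! ### Analytic dependence on the spectral parameter -/

/-- First row of `∫₀ˣ Y(t,w)⁻¹ (-i σ₃) Y(t,z) dt`. -/
def lagrange₀ (q : ℝ → ℂ) (j : Fin 2) (x : ℝ) (w z : ℂ) : ℂ :=
  ∫ t in (0 : ℝ)..x, -I * (ps q 1 1 t w * ps q 0 j t z + ps q 0 1 t w * ps q 1 j t z)

/-- Second row of `∫₀ˣ Y(t,w)⁻¹ (-i σ₃) Y(t,z) dt`. -/
def lagrange₁ (q : ℝ → ℂ) (j : Fin 2) (x : ℝ) (w z : ℂ) : ℂ :=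
  ∫ t in (0 : ℝ)..x, I * (ps q 1 0 t w * ps q 0 j t z + ps q 0 0 t w * ps q 1 j t z)

/-- The Lagrange identity `Y(x,z) - Y(x,w) = (z - w) Y(x,w) ∫₀ˣ Y(t,w)⁻¹ (-i σ₃) Y(t,z) dt`. -/
theorem ps_sub_ps (hq : Continuous q) (i j : Fin 2) (x : ℝ) (w z : ℂ) :
    ps q i j x z - ps q i j x w =
      (z - w) * (ps q i 0 x w * lagrange₀ q j x w z + ps q i 1 x w * lagrange₁ q j x w z) := by
  have hc := continuous_ps hq
  have i0 : (z - w) * lagrange₀ q j x w z =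
      (ps q 1 1 x w * ps q 0 j x z - ps q 0 1 x w * ps q 1 j x z) -
        (ps q 1 1 0 w * ps q 0 j 0 z - ps q 0 1 0 w * ps q 1 j 0 z) := by
    rw [lagrange₀, ← intervalIntegral.integral_const_mul]
    refine intervalIntegral.integral_eq_sub_of_hasDerivAt
      (f := fun x => ps q 1 1 x w * ps q 0 j x z - ps q 0 1 x w * ps q 1 j x z)
      (fun t _ => ?_) ?_
    · exact (((hasDerivAt_ps_one hq w 1 t).mul (hasDerivAt_ps_zero hq z j t)).sub
        ((hasDerivAt_ps_zero hq w 1 t).mul (hasDerivAt_ps_one hq z j t))).congr_deriv (by ring)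
    · exact Continuous.intervalIntegrable (by fun_prop) _ _
  have i1 : (z - w) * lagrange₁ q j x w z =
      (ps q 0 0 x w * ps q 1 j x z - ps q 1 0 x w * ps q 0 j x z) -
        (ps q 0 0 0 w * ps q 1 j 0 z - ps q 1 0 0 w * ps q 0 j 0 z) := by
    rw [lagrange₁, ← intervalIntegral.integral_const_mul]
    refine intervalIntegral.integral_eq_sub_of_hasDerivAt
      (f := fun x => ps q 0 0 x w * ps q 1 j x z - ps q 1 0 x w * ps q 0 j x z)
      (fun t _ => ?_) ?_
    · exact (((hasDerivAt_ps_zero hq w 0 t).mul (hasDerivAt_ps_one hq z j t)).sub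
        ((hasDerivAt_ps_one hq w 0 t).mul (hasDerivAt_ps_zero hq z j t))).congr_deriv (by ring)
    · exact Continuous.intervalIntegrable (by fun_prop) _ _
  have hdet := ps_det hq w x
  have e : ∀ y, ps q 0 0 0 y = 1 ∧ ps q 1 1 0 y = 1 ∧ ps q 0 1 0 y = 0 ∧ ps q 1 0 0 y = 0 :=
    fun y => by simp [ps, principalSolution_zero hq]
  simp only [(e w).1, (e w).2.1, (e w).2.2.1, (e w).2.2.2] at i0 i1
  have hj : ps q i j x w = ps q i 0 x w * ps q 0 j 0 z + ps q i 1 x w * ps q 1 j 0 z := by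
    fin_cases j <;> simp [(e z).1, (e z).2.1, (e z).2.2.1, (e z).2.2.2]
  fin_cases i
  · simp only [Fin.zero_eta, Fin.isValue] at hj ⊢
    linear_combination (-ps q 0 j x z) * hdet - hj - ps q 0 0 x w * i0 - ps q 0 1 x w * i1
  · simp only [Fin.mk_one, Fin.isValue] at hj ⊢
    linear_combination (-ps q 1 j x z) * hdet - hj - ps q 1 0 x w * i0 - ps q 1 1 x w * i1

section Param

variable {Q : ℝ}

/-- A bound for the principal solutions near a fixed parameter. -/
theorem norm_ps_le_of_near (hq : Continuous q) (hQ : ∀ x, ‖q x‖ ≤ Q) {w z : ℂ}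
    (hz : ‖z - w‖ ≤ 1) {x t : ℝ} (ht : |t| ≤ |x|) (i j : Fin 2) :
    ‖ps q i j t z‖ ≤ Real.exp ((|w.im| + 1 + Q) * |x|) := by
  have hQ0 : 0 ≤ Q := (norm_nonneg _).trans (hQ 0)
  have h1 : |z.im| ≤ |w.im| + 1 := by
    have := (abs_im_le_norm (z - w)).trans hz
    rw [sub_im] at this
    linarith [abs_sub_abs_le_abs_sub z.im w.im]
  refine (norm_ps_le hq hQ i j t z).trans (Real.exp_le_exp.2 ?_)
  gcongr

theorem norm_lagrange_le (hq : Continuous q) (hQ : ∀ x, ‖q x‖ ≤ Q) {w z : ℂ}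
    (hz : ‖z - w‖ ≤ 1) (x : ℝ) (j : Fin 2) :
    ‖lagrange₀ q j x w z‖ ≤ 2 * Real.exp ((|w.im| + 1 + Q) * |x|) ^ 2 * |x| ∧
      ‖lagrange₁ q j x w z‖ ≤ 2 * Real.exp ((|w.im| + 1 + Q) * |x|) ^ 2 * |x| := by
  set E := Real.exp ((|w.im| + 1 + Q) * |x|)
  have hE : 0 < E := Real.exp_pos _
  have hmem : ∀ t ∈ uIoc 0 x, |t| ≤ |x| := fun t ht => by
    simpa using abs_sub_left_of_mem_uIcc (uIoc_subset_uIcc ht)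
  have key : ∀ (c : ℂ) (i k : Fin 2) (l m : Fin 2) (t : ℝ), t ∈ uIoc 0 x → ‖c‖ = 1 →
      ‖c * (ps q i k t w * ps q 0 j t z + ps q l m t w * ps q 1 j t z)‖ ≤ 2 * E ^ 2 :=
    fun c i k l m t ht hc => by
    have b := fun i k => norm_ps_le_of_near (w := w) (z := z) hq hQ hz (hmem t ht) i k
    have b' := fun i k => norm_ps_le_of_near (w := w) (z := w) hq hQ (by simp) (hmem t ht) i k
    rw [norm_mul, hc, one_mul]
    calc _ ≤ ‖ps q i k t w‖ * ‖ps q 0 j t z‖ + ‖ps q l m t w‖ * ‖ps q 1 j t z‖ := by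
          simpa only [norm_mul] using norm_add_le (ps q i k t w * ps q 0 j t z)
            (ps q l m t w * ps q 1 j t z)
      _ ≤ E * E + E * E := by
          gcongr
          exacts [b' i k, b 0 j, b' l m, b 1 j]
      _ = 2 * E ^ 2 := by ring
  constructor
  · simpa only [sub_zero, lagrange₀, lagrange₁] using
      intervalIntegral.norm_integral_le_of_norm_le_const
      fun t ht => key (-I) 1 1 0 1 t ht (by simp)
  · simpa only [sub_zero, lagrange₀, lagrange₁] using
      intervalIntegral.norm_integral_le_of_norm_le_const
      fun t ht => key I 1 0 0 0 t ht (by simp)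

theorem continuous_ps_param (hq : Continuous q) (hQ : ∀ x, ‖q x‖ ≤ Q) (i j : Fin 2) (x : ℝ) :
    Continuous fun z => ps q i j x z := by
  refine continuous_iff_continuousAt.2 fun w => ?_
  set E := Real.exp ((|w.im| + 1 + Q) * |x|)
  refine continuousAt_of_locally_lipschitz (r := 1) one_pos
    (E * (2 * E ^ 2 * |x|) + E * (2 * E ^ 2 * |x|)) fun z hz => ?_
  rw [dist_eq_norm] at hz ⊢
  rw [dist_eq_norm, ps_sub_ps hq, norm_mul, mul_comm]
  have h := norm_lagrange_le hq hQ hz.le x j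
  have b := fun k => norm_ps_le_of_near (w := w) (z := w) hq hQ (by simp) (le_refl |x|) i k
  refine mul_le_mul_of_nonneg_right ?_ (norm_nonneg _)
  refine (norm_add_le _ _).trans ?_
  rw [norm_mul, norm_mul]
  gcongr
  exacts [b 0, h.1, b 1, h.2]

theorem continuousAt_lagrange (hq : Continuous q) (hQ : ∀ x, ‖q x‖ ≤ Q) (j : Fin 2) (x : ℝ)
    (w : ℂ) : ContinuousAt (lagrange₀ q j x w) w ∧ ContinuousAt (lagrange₁ q j x w) w := by
  set E := Real.exp ((|w.im| + 1 + Q) * |x|)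
  have hmem : ∀ t ∈ uIoc 0 x, |t| ≤ |x| := fun t ht => by
    simpa using abs_sub_left_of_mem_uIcc (uIoc_subset_uIcc ht)
  have hc := continuous_ps hq
  have hp := fun i j t => continuous_ps_param hq hQ i j t
  have hnear : ∀ᶠ z in 𝓝 w, ‖z - w‖ ≤ 1 := by
    filter_upwards [closedBall_mem_nhds w one_pos] with z hz
    simpa [dist_eq_norm] using hz
  have key : ∀ (c : ℂ) (i k : Fin 2) (l m : Fin 2) (z : ℂ), ‖z - w‖ ≤ 1 → ∀ t : ℝ,
      t ∈ uIoc 0 x → ‖c * (ps q i k t w * ps q 0 j t z + ps q l m t w * ps q 1 j t z)‖ ≤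
        ‖c‖ * (2 * E ^ 2) :=
    fun c i k l m z hz t ht => by
    have b := fun i k => norm_ps_le_of_near (w := w) (z := z) hq hQ hz (hmem t ht) i k
    have b' := fun i k => norm_ps_le_of_near (w := w) (z := w) hq hQ (by simp) (hmem t ht) i k
    rw [norm_mul]
    gcongr
    calc _ ≤ ‖ps q i k t w‖ * ‖ps q 0 j t z‖ + ‖ps q l m t w‖ * ‖ps q 1 j t z‖ := by
          simpa only [norm_mul] using norm_add_le (ps q i k t w * ps q 0 j t z)
            (ps q l m t w * ps q 1 j t z)
      _ ≤ E * E + E * E := by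
          gcongr
          exacts [b' i k, b 0 j, b' l m, b 1 j]
      _ = 2 * E ^ 2 := by ring
  constructor
  · refine intervalIntegral.continuousAt_of_dominated_interval
      (bound := fun _ => ‖-I‖ * (2 * E ^ 2)) ?_ ?_ intervalIntegrable_const ?_
    · exact Eventually.of_forall fun z => Continuous.aestronglyMeasurable (by fun_prop)
    · filter_upwards [hnear] with z hz
      exact Eventually.of_forall fun t ht => key _ 1 1 0 1 z hz t ht
    · exact Eventually.of_forall fun t _ => by fun_prop
  · refine intervalIntegral.continuousAt_of_dominated_interval
      (bound := fun _ => ‖I‖ * (2 * E ^ 2)) ?_ ?_ intervalIntegrable_const ?_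
    · exact Eventually.of_forall fun z => Continuous.aestronglyMeasurable (by fun_prop)
    · filter_upwards [hnear] with z hz
      exact Eventually.of_forall fun t ht => key _ 1 0 0 0 z hz t ht
    · exact Eventually.of_forall fun t _ => by fun_prop

theorem hasDerivAt_ps_param (hq : Continuous q) (hQ : ∀ x, ‖q x‖ ≤ Q) (i j : Fin 2) (x : ℝ)
    (w : ℂ) : HasDerivAt (fun z => ps q i j x z)
      (ps q i 0 x w * lagrange₀ q j x w w + ps q i 1 x w * lagrange₁ q j x w w) w := by
  rw [hasDerivAt_iff_tendsto_slope]
  have h := continuousAt_lagrange hq hQ j x w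
  have ht : Tendsto (fun z => ps q i 0 x w * lagrange₀ q j x w z +
      ps q i 1 x w * lagrange₁ q j x w z) (𝓝[≠] w)
      (𝓝 (ps q i 0 x w * lagrange₀ q j x w w + ps q i 1 x w * lagrange₁ q j x w w)) :=
    (((continuousAt_const.mul h.1).add (continuousAt_const.mul h.2)).tendsto).mono_left
      nhdsWithin_le_nhds
  refine ht.congr' ?_
  filter_upwards [self_mem_nhdsWithin] with z hz
  have : z - w ≠ 0 := sub_ne_zero.2 hz
  rw [slope_def_field, ps_sub_ps hq]
  field_simp

theorem differentiable_ps (hq : Continuous q) (hQ : ∀ x, ‖q x‖ ≤ Q) (i j : Fin 2) (x : ℝ) :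
    Differentiable ℂ fun z => ps q i j x z :=
  fun w => (hasDerivAt_ps_param hq hQ i j x w).differentiableAt

end Param

variable {L : ℝ}

local notation "Δ" => discriminant q L

/-! ### The monodromy matrix in the real frame -/

theorem matU_inv : matU⁻¹ = !![1 / 2, I / 2; 1 / 2, -I / 2] := by
  refine Matrix.inv_eq_right_inv ?_
  ext i j
  fin_cases i <;> fin_cases j <;> simp [matU, Matrix.mul_apply, Fin.sum_univ_two] <;>
    ring_nf <;> simp

/-- Entries of the modified fundamental matrix `Ỹ(x,z)`. -/
abbrev ms (q : ℝ → ℂ) (i j : Fin 2) (x : ℝ) (z : ℂ) : ℂ := modSolution q x z i j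

theorem ms_formulas (q : ℝ → ℂ) (x : ℝ) (z : ℂ) :
    ms q 0 0 x z = (ps q 0 0 x z + ps q 0 1 x z + ps q 1 0 x z + ps q 1 1 x z) / 2 ∧
    ms q 0 1 x z = I * (ps q 0 0 x z - ps q 0 1 x z + ps q 1 0 x z - ps q 1 1 x z) / 2 ∧
    ms q 1 0 x z = -I * (ps q 0 0 x z + ps q 0 1 x z - ps q 1 0 x z - ps q 1 1 x z) / 2 ∧
    ms q 1 1 x z = (ps q 0 0 x z - ps q 0 1 x z - ps q 1 0 x z + ps q 1 1 x z) / 2 := by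
  have hI : I * I = -1 := I_mul_I
  simp only [ms, modSolution, matU_inv]
  simp only [matU, ps, Matrix.mul_apply, Fin.sum_univ_two, Matrix.of_apply, Matrix.cons_val',
    Matrix.cons_val_zero, Matrix.cons_val_one, Matrix.cons_val_fin_one]
  refine ⟨by ring, by ring, by ring, ?_⟩
  linear_combination (-(principalSolution q x z 0 0 - principalSolution q x z 0 1 -
    principalSolution q x z 1 0 + principalSolution q x z 1 1) / 2) * hI

theorem discriminant_eq_ps (q : ℝ → ℂ) (L : ℝ) (z : ℂ) :
    discriminant q L z = (ps q 0 0 L z + ps q 1 1 L z) / 2 := by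
  simp [discriminant, Matrix.trace, Fin.sum_univ_two]

theorem discriminant_eq_ms (q : ℝ → ℂ) (L : ℝ) (z : ℂ) :
    discriminant q L z = (ms q 0 0 L z + ms q 1 1 L z) / 2 := by
  obtain ⟨h1, -, -, h4⟩ := ms_formulas q L z
  rw [discriminant_eq_ps, h1, h4]
  ring

theorem ms_det (hq : Continuous q) (x : ℝ) (z : ℂ) :
    ms q 0 0 x z * ms q 1 1 x z - ms q 0 1 x z * ms q 1 0 x z = 1 := by
  obtain ⟨h1, h2, h3, h4⟩ := ms_formulas q x z
  have hI : I * I = -1 := I_mul_I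
  rw [← ps_det hq z x, h1, h2, h3, h4]
  linear_combination ((ps q 0 0 x z - ps q 0 1 x z + ps q 1 0 x z - ps q 1 1 x z) *
    (ps q 0 0 x z + ps q 0 1 x z - ps q 1 0 x z - ps q 1 1 x z) / 4) * hI

theorem ms_conj (hq : Continuous q) (i j : Fin 2) (x : ℝ) (z : ℂ) :
    ms q i j x (conj z) = conj (ms q i j x z) := by
  obtain ⟨h1, h2, h3, h4⟩ := ms_formulas q x z
  obtain ⟨k1, k2, k3, k4⟩ := ms_formulas q x (conj z)
  obtain ⟨c1, c2, c3, c4⟩ := ps_conj hq z x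
  fin_cases i <;> fin_cases j
  all_goals
    simp only [Fin.zero_eta, Fin.mk_one, h1, h2, h3, h4, k1, k2, k3, k4, c1, c2, c3, c4, map_div₀,
      map_add, map_sub, map_mul, map_neg, conj_I, map_ofNat]
    ring

theorem discriminant_conj (hq : Continuous q) (L : ℝ) (z : ℂ) :
    discriminant q L (conj z) = conj (discriminant q L z) := by
  rw [discriminant_eq_ms, discriminant_eq_ms, ms_conj hq, ms_conj hq, map_div₀, map_add, map_ofNat]

/-- The off-diagonal combination in `Δ² - 1 = ((ỹ₂₂ - ỹ₁₁)/2)² + ỹ₁₂ ỹ₂₁`. -/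
theorem discriminant_sq_sub_one_ms (hq : Continuous q) (z : ℂ) :
    Δ z ^ 2 - 1 = ((ms q 1 1 L z - ms q 0 0 L z) / 2) ^ 2 + ms q 0 1 L z * ms q 1 0 L z := by
  rw [discriminant_eq_ms]
  linear_combination ms_det hq L z

theorem discriminant_sq_sub_one_ps (hq : Continuous q) (z : ℂ) :
    Δ z ^ 2 - 1 = ((ps q 0 0 L z - ps q 1 1 L z) / 2) ^ 2 + ps q 0 1 L z * ps q 1 0 L z := by
  rw [discriminant_eq_ps]
  linear_combination ps_det hq z L

theorem differentiable_ms {Q : ℝ} (hq : Continuous q) (hQ : ∀ x, ‖q x‖ ≤ Q) (i j : Fin 2)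
    (x : ℝ) : Differentiable ℂ fun z => ms q i j x z := by
  have h := fun i j => differentiable_ps hq hQ i j x
  have f := ms_formulas q x
  fin_cases i <;> fin_cases j <;> simp only [Fin.zero_eta, Fin.mk_one, f] <;> fun_prop

theorem differentiable_discriminant {Q : ℝ} (hq : Continuous q) (hQ : ∀ x, ‖q x‖ ≤ Q) :
    Differentiable ℂ (Δ) := by
  have h := fun i j => differentiable_ms hq hQ i j L
  rw [show Δ = fun z => (ms q 0 0 L z + ms q 1 1 L z) / 2 from
    funext fun z => discriminant_eq_ms q L z]
  fun_prop

/-! ### Reality of the spectra -/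

theorem IsZSPair.ps_combination (hq : Continuous q) (z v w : ℂ) :
    IsZSPair q z (fun x => ps q 0 0 x z * v + ps q 0 1 x z * w)
      (fun x => ps q 1 0 x z * v + ps q 1 1 x z * w) where
  fst x := (((hasDerivAt_ps_zero hq z 0 x).mul_const v).add
    ((hasDerivAt_ps_zero hq z 1 x).mul_const w)).congr_deriv (by ring)
  snd x := (((hasDerivAt_ps_one hq z 0 x).mul_const v).add
    ((hasDerivAt_ps_one hq z 1 x).mul_const w)).congr_deriv (by ring)

/-- In the upper half-plane `|v₁|² - |v₂|²` strictly increases along nontrivial solutions. -/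
theorem normSq_sub_lt (hq : Continuous q) (hL : 0 < L) (hz : 0 < z.im) {v w : ℂ}
    (hv : v ≠ 0 ∨ w ≠ 0) :
    normSq v - normSq w < normSq (ps q 0 0 L z * v + ps q 0 1 L z * w) -
        normSq (ps q 1 0 L z * v + ps q 1 1 L z * w) := by
  have h := IsZSPair.ps_combination hq z v w
  have hmono : StrictMono fun x =>
      normSq (ps q 0 0 x z * v + ps q 0 1 x z * w) -
        normSq (ps q 1 0 x z * v + ps q 1 1 x z * w) := by
    refine strictMono_of_deriv_pos fun x => ?_
    rw [(h.hasDerivAt_normSq_sub x).deriv]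
    refine mul_pos (by linarith) ?_
    by_contra! hle
    have h1 := normSq_nonneg (ps q 0 0 x z * v + ps q 0 1 x z * w)
    have h2 := normSq_nonneg (ps q 1 0 x z * v + ps q 1 1 x z * w)
    have e1 := Complex.normSq_eq_zero.1 (le_antisymm (by linarith) h1)
    have e2 := Complex.normSq_eq_zero.1 (le_antisymm (by linarith) h2)
    have hdet := ps_det hq z x
    have : v = 0 := by
      linear_combination (-v) * hdet + ps q 1 1 x z * e1 - ps q 0 1 x z * e2
    have : w = 0 := by
      linear_combination (-w) * hdet + ps q 0 0 x z * e2 - ps q 1 0 x z * e1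
    tauto
  simpa [ps, principalSolution_zero hq] using hmono hL

theorem im_eq_zero_of_discriminant_mem (hq : Continuous q) (hL : 0 < L) {t : ℝ}
    (ht : t ∈ Icc (-1 : ℝ) 1) (h : Δ z = t) : z.im = 0 := by
  have key : ∀ z : ℂ, Δ z = t → ¬ 0 < z.im := fun z h hz => by
    set r : ℂ := t + I * Real.sqrt (1 - t ^ 2) with hr
    have ht2 : 0 ≤ 1 - t ^ 2 := by nlinarith [ht.1, ht.2]
    have hs : ((Real.sqrt (1 - t ^ 2) : ℝ) : ℂ) ^ 2 = 1 - (t : ℂ) ^ 2 := by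
      rw [← ofReal_pow, Real.sq_sqrt ht2]; push_cast; ring
    have hr2 : r ^ 2 - 2 * Δ z * r + 1 = 0 := by
      rw [h, hr]
      linear_combination (((Real.sqrt (1 - t ^ 2) : ℝ) : ℂ) ^ 2) * I_sq - hs
    have hr1 : normSq r = 1 := by
      rw [hr, normSq_apply]
      simp only [add_re, ofReal_re, mul_re, I_re, zero_mul,
        I_im, ofReal_im, mul_zero, sub_zero, add_zero, add_im,
        mul_im, one_mul, zero_add]
      rw [Real.mul_self_sqrt ht2]; ring
    have hdet : (principalSolution q L z - r • (1 : Mat₂)).det = 0 := by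
      rw [Matrix.det_fin_two]
      simp only [Matrix.sub_apply, Matrix.smul_apply, Matrix.one_apply_eq, smul_eq_mul, mul_one,
        ne_eq, zero_ne_one, not_false_eq_true, Matrix.one_apply_ne, one_ne_zero, mul_zero,
        sub_zero]
      rw [discriminant_eq_ps] at hr2
      linear_combination hr2 + ps_det hq z L
    obtain ⟨v, hv, hv2⟩ := Matrix.exists_mulVec_eq_zero_iff.2 hdet
    have e0 := congrFun hv2 0
    have e1 := congrFun hv2 1
    simp only [Matrix.mulVec, dotProduct, Fin.sum_univ_two, Matrix.sub_apply, Matrix.smul_apply,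
      Matrix.one_apply_eq, smul_eq_mul, mul_one, ne_eq, zero_ne_one, not_false_eq_true,
      Matrix.one_apply_ne, one_ne_zero, mul_zero, sub_zero, Pi.zero_apply] at e0 e1
    have hv' : v 0 ≠ 0 ∨ v 1 ≠ 0 := by
      by_contra! hc
      exact hv (by ext i; fin_cases i <;> simp [hc.1, hc.2])
    have := normSq_sub_lt hq hL hz hv'
    rw [show ps q 0 0 L z * v 0 + ps q 0 1 L z * v 1 = r * v 0 by linear_combination e0,
      show ps q 1 0 L z * v 0 + ps q 1 1 L z * v 1 = r * v 1 by linear_combination e1,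
      normSq_mul, normSq_mul, hr1] at this
    linarith
  have h1 := key z h
  have h2 := key (conj z) (by rw [discriminant_conj hq, h, conj_ofReal])
  simp only [conj_im] at h2
  linarith

theorem im_eq_zero_of_ms_eq_zero (hq : Continuous q) (hL : 0 < L)
    (h : ms q 0 1 L z = 0) : z.im = 0 := by
  have key : ∀ z : ℂ, ms q 0 1 L z = 0 → ¬ 0 < z.im := fun z h hz => by
    have := normSq_sub_lt hq hL hz (v := 1) (w := -1) (by simp)
    rw [(ms_formulas q L z).2.1] at h
    have e : ps q 0 0 L z - ps q 0 1 L z = -(ps q 1 0 L z - ps q 1 1 L z) := by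
      have := mul_left_cancel₀ I_ne_zero (b := ps q 0 0 L z - ps q 0 1 L z +
        ps q 1 0 L z - ps q 1 1 L z) (c := 0) (by linear_combination 2 * h)
      linear_combination this
    rw [show ps q 0 0 L z * 1 + ps q 0 1 L z * -1 = ps q 0 0 L z - ps q 0 1 L z by ring, e,
      show ps q 1 0 L z * 1 + ps q 1 1 L z * -1 = ps q 1 0 L z - ps q 1 1 L z by ring,
      Complex.normSq_neg, Complex.normSq_neg] at this
    linarith
  have h1 := key z h
  have h2 := key (conj z) (by rw [ms_conj hq, h, map_zero])
  simp only [conj_im] at h2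
  linarith

theorem mem_dirichletSpectrum_iff (hq : Continuous q) (hL : 0 < L) (z : ℂ) :
    z ∈ dirichletSpectrum q L ↔ ms q 0 1 L z = 0 := by
  have hms := (ms_formulas q L z).2.1
  constructor
  · rintro ⟨v, hv, ⟨x, hx, hx0⟩, h0, hL0⟩
    have hv1 : ∀ x ∈ Icc 0 L, HasDerivWithinAt (fun t => v t 0)
        (-(I * z) * v x 0 + q x * v x 1) (Icc 0 L) x := fun x hx => by
      simpa [zsMatrix, Matrix.mulVec, dotProduct, Fin.sum_univ_two] using hv x hx 0
    have hv2 : ∀ x ∈ Icc 0 L, HasDerivWithinAt (fun t => v t 1)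
        (conj (q x) * v x 0 + I * z * v x 1) (Icc 0 L) x := fun x hx => by
      simpa [zsMatrix, Matrix.mulVec, dotProduct, Fin.sum_univ_two] using hv x hx 1
    have key := fun (x : ℝ) (hx : x ∈ Icc 0 L) => eq_ps_mul_of_hasDerivWithinAt hq (z := z)
      (convex_Icc 0 L) ⟨le_rfl, hL.le⟩ hv1 hv2 hx
    have hv0 : v 0 0 ≠ 0 := fun h => by
      have h1 : v 0 1 = 0 := by linear_combination h0 - h
      obtain ⟨k1, k2⟩ := key x hx
      simp only [h, h1, mul_zero, add_zero] at k1 k2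
      exact hx0 (by ext i; fin_cases i <;> simp [k1, k2])
    obtain ⟨k1, k2⟩ := key L ⟨hL.le, le_rfl⟩
    rw [hms]
    refine mul_right_cancel₀ hv0 ?_
    linear_combination (I / 2) * (hL0 - k1 - k2 - (ps q 0 1 L z + ps q 1 1 L z) * h0)
  · intro h
    refine ⟨fun x => ![ps q 0 0 x z - ps q 0 1 x z, ps q 1 0 x z - ps q 1 1 x z], ?_,
      ⟨0, ⟨le_rfl, hL.le⟩, ?_⟩, ?_, ?_⟩
    · intro x _ i
      obtain rfl | rfl := fin_two i
      · exact (((hasDerivAt_ps_zero hq z 0 x).sub (hasDerivAt_ps_zero hq z 1 x)).congr_deriv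
          (by simp [zsMatrix, Matrix.mulVec, dotProduct, Fin.sum_univ_two]; ring)).hasDerivWithinAt
      · exact (((hasDerivAt_ps_one hq z 0 x).sub (hasDerivAt_ps_one hq z 1 x)).congr_deriv
          (by simp [zsMatrix, Matrix.mulVec, dotProduct, Fin.sum_univ_two]; ring)).hasDerivWithinAt
    · intro h
      have := congrFun h 0
      simp [ps, principalSolution_zero hq] at this
    · simp [ps, principalSolution_zero hq]
    · rw [hms] at h
      have := mul_left_cancel₀ I_ne_zero (b := ps q 0 0 L z - ps q 0 1 L z +
        ps q 1 0 L z - ps q 1 1 L z) (c := 0) (by linear_combination 2 * h)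
      simp only [Matrix.cons_val_zero, Matrix.cons_val_one, Matrix.cons_val_fin_one]
      linear_combination this

/-! ### The square root of `Δ² - 1` and the Floquet multiplier -/

/-- The root `d √(1 - d⁻²)` of `d² - 1`, holomorphic off `[-1,1]`. -/
def joukowskiRoot (d : ℂ) : ℂ := d * (1 - (d ^ 2)⁻¹) ^ (1 / 2 : ℂ)

theorem one_sub_inv_sq_mem_slitPlane {d : ℂ} (hd : ∀ t ∈ Icc (-1 : ℝ) 1, d ≠ t) :
    1 - (d ^ 2)⁻¹ ∈ Complex.slitPlane := by
  by_contra h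
  rw [Complex.mem_slitPlane_iff_not_le_zero, not_not] at h
  have h0 : d ≠ 0 := by simpa using hd 0 (by norm_num)
  obtain ⟨hre, him⟩ := Complex.le_def.1 h
  set u := (d ^ 2)⁻¹ with hu
  have hur : u = (u.re : ℂ) := by
    apply Complex.ext <;> simp
    simpa using him
  have hu1 : 1 ≤ u.re := by simpa using hre
  have hd2 : d ^ 2 = ((u.re)⁻¹ : ℝ) := by
    rw [Complex.ofReal_inv, ← hur, hu, inv_inv]
  have hpos : 0 ≤ (u.re)⁻¹ := by positivity
  set t := Real.sqrt (u.re)⁻¹ with htdef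
  have ht2 : (t : ℂ) ^ 2 = d ^ 2 := by
    rw [hd2, ← ofReal_pow, Real.sq_sqrt hpos]
  have ht1 : t ≤ 1 := by
    rw [htdef, Real.sqrt_le_iff]
    exact ⟨zero_le_one, by simpa using inv_le_one_of_one_le₀ hu1⟩
  have ht0 : 0 ≤ t := Real.sqrt_nonneg _
  rcases sq_eq_sq_iff_eq_or_eq_neg.1 ht2.symm with h | h
  · exact hd t ⟨by linarith, ht1⟩ h
  · exact hd (-t) ⟨by linarith, by linarith⟩ (by rw [h]; push_cast; ring)

theorem re_cpow_half_pos {w : ℂ} (hw : w ∈ Complex.slitPlane) : 0 < (w ^ (1 / 2 : ℂ)).re := by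
  rw [Complex.cpow_def_of_ne_zero (Complex.slitPlane_ne_zero hw), Complex.exp_re]
  refine mul_pos (Real.exp_pos _) (Real.cos_pos_of_mem_Ioo ?_)
  have h1 := Complex.neg_pi_lt_arg w
  have h2 := (Complex.mem_slitPlane_iff_arg.1 hw).1
  have h3 : w.arg < π := lt_of_le_of_ne (Complex.arg_le_pi w) h2
  have : (Complex.log w * (1 / 2)).im = w.arg / 2 := by
    rw [show (1 / 2 : ℂ) = ((1 / 2 : ℝ) : ℂ) by norm_num, Complex.im_mul_ofReal, Complex.log_im]
    ring
  rw [this]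
  constructor <;> linarith

theorem joukowskiRoot_sq {d : ℂ} (hd : ∀ t ∈ Icc (-1 : ℝ) 1, d ≠ t) :
    joukowskiRoot d ^ 2 = d ^ 2 - 1 := by
  have h0 : d ≠ 0 := by simpa using hd 0 (by norm_num)
  have : ((1 - (d ^ 2)⁻¹) ^ (1 / 2 : ℂ)) ^ 2 = 1 - (d ^ 2)⁻¹ := by
    have := Complex.cpow_nat_inv_pow (1 - (d ^ 2)⁻¹) two_ne_zero
    simpa using this
  rw [joukowskiRoot, mul_pow, this]
  field_simp

theorem norm_sub_joukowskiRoot_lt {d : ℂ} (hd : ∀ t ∈ Icc (-1 : ℝ) 1, d ≠ t) :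
    ‖d - joukowskiRoot d‖ < 1 := by
  have h0 : d ≠ 0 := by simpa using hd 0 (by norm_num)
  have hprod : (d - joukowskiRoot d) * (d + joukowskiRoot d) = 1 := by
    linear_combination -joukowskiRoot_sq hd
  set s := (1 - (d ^ 2)⁻¹) ^ (1 / 2 : ℂ) with hs
  have hre : 0 < s.re := re_cpow_half_pos (one_sub_inv_sq_mem_slitPlane hd)
  have hlt : ‖d - joukowskiRoot d‖ < ‖d + joukowskiRoot d‖ := by
    have e1 : d - joukowskiRoot d = d * (1 - s) := by rw [joukowskiRoot]; ring
    have e2 : d + joukowskiRoot d = d * (1 + s) := by rw [joukowskiRoot]; ring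
    rw [e1, e2, norm_mul, norm_mul]
    refine mul_lt_mul_of_pos_left ?_ (norm_pos_iff.2 h0)
    refine lt_of_pow_lt_pow_left₀ 2 (norm_nonneg _) ?_
    rw [← normSq_eq_norm_sq, ← normSq_eq_norm_sq, normSq_apply, normSq_apply]
    simp
    nlinarith
  have hp : ‖d - joukowskiRoot d‖ * ‖d + joukowskiRoot d‖ = 1 := by
    rw [← norm_mul, hprod, norm_one]
  by_contra! h
  nlinarith [norm_nonneg (d - joukowskiRoot d)]

theorem differentiableAt_joukowskiRoot {d : ℂ} (hd : ∀ t ∈ Icc (-1 : ℝ) 1, d ≠ t) :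
    DifferentiableAt ℂ joukowskiRoot d := by
  have h0 : d ≠ 0 := by simpa using hd 0 (by norm_num)
  refine differentiableAt_id.mul (DifferentiableAt.cpow ?_ (differentiableAt_const _)
    (one_sub_inv_sq_mem_slitPlane hd))
  exact (differentiableAt_const _).sub ((differentiableAt_id.pow 2).inv (by simpa using h0))

theorem joukowskiRoot_conj {d : ℂ} (hd : ∀ t ∈ Icc (-1 : ℝ) 1, d ≠ t) :
    joukowskiRoot (conj d) = conj (joukowskiRoot d) := by
  have h := Complex.slitPlane_arg_ne_pi (one_sub_inv_sq_mem_slitPlane hd)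
  rw [joukowskiRoot, joukowskiRoot, map_mul]
  congr 1
  have := Complex.conj_cpow (1 - (d ^ 2)⁻¹) (1 / 2 : ℂ) h
  simp only [map_div₀, map_one, map_ofNat, map_sub, map_inv₀, map_pow] at this
  exact this

/-- For real `d` with `|d| > 1` the root is real and has the sign of `d`. -/
theorem joukowskiRoot_ofReal {d : ℝ} (hd : 1 < d ^ 2) :
    joukowskiRoot d = ((d * Real.sqrt (1 - (d ^ 2)⁻¹) : ℝ) : ℂ) := by
  have h : 0 ≤ 1 - (d ^ 2)⁻¹ := by
    have := inv_lt_one_of_one_lt₀ hd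
    linarith
  rw [joukowskiRoot, ofReal_mul, Real.sqrt_eq_rpow, Complex.ofReal_cpow h]
  norm_num

theorem ne_of_im_ne_zero (hq : Continuous q) (hL : 0 < L) (hz : z.im ≠ 0) :
    ∀ t ∈ Icc (-1 : ℝ) 1, Δ z ≠ t :=
  fun _ ht h => hz (im_eq_zero_of_discriminant_mem hq hL ht h)

/-- `R = (ρ⁻¹ - ρ)/2`, the root of `Δ² - 1` with `ρ = Δ - R`. -/
def rootR (q : ℝ → ℂ) (L : ℝ) (z : ℂ) : ℂ := joukowskiRoot (discriminant q L z)

theorem multiplier_eq (hd : ∀ t ∈ Icc (-1 : ℝ) 1, Δ z ≠ t) :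
    multiplier q L z = Δ z - rootR q L z := by
  set d := Δ z with hdd
  have hsq := joukowskiRoot_sq hd
  have hlt := norm_sub_joukowskiRoot_lt hd
  have hspec := Classical.epsilon_spec (p := fun r : ℂ =>
    r ^ 2 - 2 * Δ z * r + 1 = 0 ∧ ‖r‖ < 1)
    ⟨d - joukowskiRoot d, by linear_combination hsq, hlt⟩
  have h1 : multiplier q L z ^ 2 - 2 * d * multiplier q L z + 1 = 0 := hspec.1
  have h2 : ‖multiplier q L z‖ < 1 := hspec.2
  have h3 : (multiplier q L z - (d - joukowskiRoot d)) *
      (multiplier q L z - (d + joukowskiRoot d)) = 0 := by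
    linear_combination h1 - hsq
  rcases mul_eq_zero.1 h3 with h | h
  · exact sub_eq_zero.1 h
  · exfalso
    have hprod : (d - joukowskiRoot d) * (d + joukowskiRoot d) = 1 := by
      linear_combination -hsq
    have hn : ‖d - joukowskiRoot d‖ * ‖d + joukowskiRoot d‖ = 1 := by
      rw [← norm_mul, hprod, norm_one]
    rw [← sub_eq_zero.1 h] at hn
    nlinarith [norm_nonneg (multiplier q L z), norm_nonneg (d - joukowskiRoot d)]

theorem multiplier_inv_eq (hd : ∀ t ∈ Icc (-1 : ℝ) 1, Δ z ≠ t) :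
    (multiplier q L z)⁻¹ = Δ z + rootR q L z := by
  rw [multiplier_eq hd, inv_eq_of_mul_eq_one_right]
  rw [rootR]
  linear_combination -joukowskiRoot_sq hd

/-! ### Bloch-Floquet solutions -/

/-- The Weyl function `w₊ = (ρ - ỹ₁₁)/ỹ₁₂`, the second component of `ψ⁺(0,z)`. -/
def weylPlus (q : ℝ → ℂ) (L : ℝ) (z : ℂ) : ℂ :=
  ((ms q 1 1 L z - ms q 0 0 L z) / 2 - rootR q L z) / ms q 0 1 L z

/-- The Weyl function `w₋ = (ρ⁻¹ - ỹ₁₁)/ỹ₁₂`, the second component of `ψ⁻(0,z)`. -/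
def weylMinus (q : ℝ → ℂ) (L : ℝ) (z : ℂ) : ℂ :=
  ((ms q 1 1 L z - ms q 0 0 L z) / 2 + rootR q L z) / ms q 0 1 L z

/-- `(a, b)` solves the Zakharov-Shabat system and has Floquet multiplier `r`. -/
structure IsFloquetPair (q : ℝ → ℂ) (L : ℝ) (z r : ℂ) (a b : ℝ → ℂ) : Prop where
  pair : IsZSPair q z a b
  fst_add : ∀ x, a (x + L) = r * a x
  snd_add : ∀ x, b (x + L) = r * b x

theorem IsFloquetPair.normSq_sub_lt {z r : ℂ} {a b : ℝ → ℂ} (hf : IsFloquetPair q L z r a b)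
    (hq : Continuous q) (hL : 0 < L) (hz : 0 < z.im) (h : a 0 ≠ 0 ∨ b 0 ≠ 0) :
    normSq (a 0) - normSq (b 0) < ‖r‖ ^ 2 * (normSq (a 0) - normSq (b 0)) := by
  have h1 := ZSP.normSq_sub_lt hq hL hz h
  have h2 := eq_ps_mul_of_hasDerivAt hq hf.pair.fst hf.pair.snd L
  have h3 := hf.fst_add 0
  have h4 := hf.snd_add 0
  rw [zero_add] at h3 h4
  rwa [← h2.1, ← h2.2, h3, h4, normSq_mul, normSq_mul, ← mul_sub, normSq_eq_norm_sq r] at h1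

/-- The components of `U⁻¹ψ` for the solution `ψ` with `ψ(0) = (1, w)`. -/
def blochZS (q : ℝ → ℂ) (w : ℂ) (i : Fin 2) (x : ℝ) (z : ℂ) : ℂ :=
  ps q i 0 x z * ((1 + I * w) / 2) + ps q i 1 x z * ((1 - I * w) / 2)

theorem blochZS_zero (hq : Continuous q) (w z : ℂ) :
    blochZS q w 0 0 z = (1 + I * w) / 2 ∧ blochZS q w 1 0 z = (1 - I * w) / 2 := by
  simp [blochZS, ps, principalSolution_zero hq]

theorem matU_inv_mul_ms (q : ℝ → ℂ) (w : ℂ) (x : ℝ) (z : ℂ) :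
    1 / 2 * (ms q 0 0 x z + ms q 0 1 x z * w) +
        I / 2 * (ms q 1 0 x z + ms q 1 1 x z * w) = blochZS q w 0 x z ∧
      1 / 2 * (ms q 0 0 x z + ms q 0 1 x z * w) +
        -I / 2 * (ms q 1 0 x z + ms q 1 1 x z * w) = blochZS q w 1 x z := by
  obtain ⟨f1, f2, f3, f4⟩ := ms_formulas q x z
  rw [f1, f2, f3, f4, blochZS, blochZS]
  constructor
  · linear_combination (-(ps q 0 0 x z + ps q 0 1 x z - ps q 1 0 x z - ps q 1 1 x z) / 4) * I_sq
  · linear_combination (ps q 0 0 x z + ps q 0 1 x z - ps q 1 0 x z - ps q 1 1 x z) / 4 * I_sq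

theorem isFloquetPair_blochZS (hq : Continuous q) (hper : ∀ x, q (x + L) = q x) {z r w : ℂ}
    (hr : r ^ 2 - 2 * Δ z * r + 1 = 0) (h12 : ms q 0 1 L z ≠ 0)
    (hw : ms q 0 0 L z + ms q 0 1 L z * w = r) :
    IsFloquetPair q L z r (fun x => blochZS q w 0 x z) (fun x => blochZS q w 1 x z) := by
  have hw2 : ms q 1 0 L z + ms q 1 1 L z * w = r * w := by
    refine mul_left_cancel₀ h12 ?_
    rw [discriminant_eq_ms] at hr
    linear_combination (ms q 1 1 L z - r) * hw - ms_det hq L z - hr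
  obtain ⟨e1, e2⟩ := matU_inv_mul_ms q w L z
  rw [hw, hw2] at e1 e2
  simp only [blochZS] at e1 e2
  refine ⟨IsZSPair.ps_combination hq z _ _, fun x => ?_, fun x => ?_⟩ <;>
    simp only [blochZS, ps_add_period hq hper z x]
  · linear_combination (-ps q 0 0 x z) * e1 - ps q 0 1 x z * e2
  · linear_combination (-ps q 1 0 x z) * e1 - ps q 1 1 x z * e2

theorem matU_mul_zsMatrix (q : ℝ → ℂ) (z : ℂ) (x : ℝ) : matU * zsMatrix q z x * matU⁻¹ =
    !![(q x + conj (q x)) / 2, z + I * (conj (q x) - q x) / 2;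
      -z + I * (conj (q x) - q x) / 2, -((q x + conj (q x)) / 2)] := by
  rw [matU_inv, matU, zsMatrix]
  ext i j
  fin_cases i <;> fin_cases j <;> simp [Matrix.mul_apply, Fin.sum_univ_two] <;> ring_nf <;>
    simp only [I_sq] <;> ring

theorem epsilon_isBlochFloquet (hq : Continuous q) (hper : ∀ x, q (x + L) = q x) {z r : ℂ}
    (hr : r ^ 2 - 2 * Δ z * r + 1 = 0) (h12 : ms q 0 1 L z ≠ 0) (x : ℝ) :
    Classical.epsilon (IsBlochFloquet q L z r) x =
      ![ms q 0 0 x z + ms q 0 1 x z * ((r - ms q 0 0 L z) / ms q 0 1 L z),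
        ms q 1 0 x z + ms q 1 1 x z * ((r - ms q 0 0 L z) / ms q 0 1 L z)] := by
  have hms : ∀ w x, ms q 0 0 x z + ms q 0 1 x z * w = blochZS q w 0 x z + blochZS q w 1 x z ∧
      ms q 1 0 x z + ms q 1 1 x z * w = -I * blochZS q w 0 x z + I * blochZS q w 1 x z :=
    fun w x => by
      obtain ⟨e1, e2⟩ := matU_inv_mul_ms q w x z
      rw [← e1, ← e2]
      constructor
      · ring
      · linear_combination (ms q 1 0 x z + ms q 1 1 x z * w) * I_sq
  have hex : ∃ ψ, IsBlochFloquet q L z r ψ := by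
    set w := (r - ms q 0 0 L z) / ms q 0 1 L z with hw
    obtain ⟨⟨ha, hb⟩, ha', hb'⟩ := isFloquetPair_blochZS (w := w) hq hper hr h12
      (by rw [hw]; field_simp; ring)
    refine ⟨fun x => ![blochZS q w 0 x z + blochZS q w 1 x z,
      -I * blochZS q w 0 x z + I * blochZS q w 1 x z], fun x => Fin.forall_fin_two.2 ⟨?_, ?_⟩,
      fun x => ?_, ?_⟩
    · refine ((ha x).add (hb x)).congr_deriv ?_
      simp [matU_mul_zsMatrix, Matrix.mulVec, dotProduct, Fin.sum_univ_two]
      linear_combination (conj (q x) - q x) * (blochZS q w 0 x z - blochZS q w 1 x z) / 2 * I_sq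
    · refine (((ha x).const_mul (-I)).add ((hb x).const_mul I)).congr_deriv ?_
      simp [matU_mul_zsMatrix, Matrix.mulVec, dotProduct, Fin.sum_univ_two]
      linear_combination z * (blochZS q w 0 x z + blochZS q w 1 x z) * I_sq
    · ext i
      fin_cases i <;> simp [ha', hb'] <;> ring
    · simp [blochZS_zero hq]; ring
  obtain ⟨hd, hfl, h1⟩ := Classical.epsilon_spec hex
  set ψ := Classical.epsilon (IsBlochFloquet q L z r)
  have hv := fun x => eq_ps_mul_of_hasDerivAt hq (z := z)
    (a := fun t => (ψ t 0 + I * ψ t 1) / 2) (b := fun t => (ψ t 0 - I * ψ t 1) / 2)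
    (fun x => (((hd x 0).add ((hd x 1).const_mul I)).div_const 2).congr_deriv (by
      simp [matU_mul_zsMatrix, Matrix.mulVec, dotProduct, Fin.sum_univ_two]
      linear_combination (ψ x 1 * z + ψ x 0 * (conj (q x) - q x) / 2) / 2 * I_sq))
    (fun x => (((hd x 0).sub ((hd x 1).const_mul I)).div_const 2).congr_deriv (by
      simp [matU_mul_zsMatrix, Matrix.mulVec, dotProduct, Fin.sum_univ_two]
      linear_combination (ψ x 1 * z - ψ x 0 * (conj (q x) - q x) / 2) / 2 * I_sq)) x
  simp only [h1] at hv
  have hψ : ∀ x, ψ x 0 = blochZS q (ψ 0 1) 0 x z + blochZS q (ψ 0 1) 1 x z ∧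
      ψ x 1 = -I * blochZS q (ψ 0 1) 0 x z + I * blochZS q (ψ 0 1) 1 x z := fun x => by
    obtain ⟨e1, e2⟩ := hv x
    rw [blochZS, blochZS, ← e1, ← e2]
    constructor
    · ring
    · linear_combination ψ x 1 * I_sq
  have hw : ψ 0 1 = (r - ms q 0 0 L z) / ms q 0 1 L z := by
    have := congrFun (hfl 0) 0
    simp only [zero_add, Pi.smul_apply, smul_eq_mul, h1, mul_one, (hψ L).1, ← (hms _ L).1] at this
    rw [eq_div_iff h12]
    linear_combination this
  rw [(hms _ x).1, (hms _ x).2, ← hw, ← (hψ x).1, ← (hψ x).2]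
  ext i
  fin_cases i <;> rfl

theorem weylPlus_add (hq : Continuous q) (hL : 0 < L) (hz : z.im ≠ 0) :
    ms q 0 0 L z + ms q 0 1 L z * weylPlus q L z = Δ z - rootR q L z ∧
      ms q 0 0 L z + ms q 0 1 L z * weylMinus q L z = Δ z + rootR q L z := by
  have h12 : ms q 0 1 L z ≠ 0 := fun h => hz (im_eq_zero_of_ms_eq_zero hq hL h)
  rw [weylPlus, weylMinus, discriminant_eq_ms]
  constructor <;> field_simp <;> ring

section OffAxis

variable (hq : Continuous q) (hL : 0 < L) (hper : ∀ x, q (x + L) = q x)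
include hq hL hper

/-- The Bloch-Floquet solutions in the frame of `U⁻¹`. -/
theorem isFloquetPair_weyl (hz : z.im ≠ 0) :
    IsFloquetPair q L z (Δ z - rootR q L z)
        (fun x => blochZS q (weylPlus q L z) 0 x z) (fun x => blochZS q (weylPlus q L z) 1 x z) ∧
      IsFloquetPair q L z (Δ z + rootR q L z)
        (fun x => blochZS q (weylMinus q L z) 0 x z)
        (fun x => blochZS q (weylMinus q L z) 1 x z) := by
  have h12 : ms q 0 1 L z ≠ 0 := fun h => hz (im_eq_zero_of_ms_eq_zero hq hL h)
  have hsq := joukowskiRoot_sq (ne_of_im_ne_zero hq hL hz)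
  rw [← rootR] at hsq
  obtain ⟨h1, h2⟩ := weylPlus_add hq hL hz
  exact ⟨isFloquetPair_blochZS hq hper (by linear_combination hsq) h12 h1,
    isFloquetPair_blochZS hq hper (by linear_combination hsq) h12 h2⟩

theorem blochPlus_eq (hz : z.im ≠ 0) (x : ℝ) :
    blochPlus q L x z = ![ms q 0 0 x z + ms q 0 1 x z * weylPlus q L z,
      ms q 1 0 x z + ms q 1 1 x z * weylPlus q L z] := by
  have hd := ne_of_im_ne_zero hq hL hz
  have h12 : ms q 0 1 L z ≠ 0 := fun h => hz (im_eq_zero_of_ms_eq_zero hq hL h)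
  have hr := multiplier_eq hd
  have hsq : rootR q L z ^ 2 = Δ z ^ 2 - 1 := joukowskiRoot_sq hd
  rw [blochPlus, epsilon_isBlochFloquet hq hper (by rw [hr]; linear_combination hsq) h12, hr,
    ← (weylPlus_add hq hL hz).1, add_sub_cancel_left, mul_div_cancel_left₀ _ h12]

theorem blochMinus_eq (hz : z.im ≠ 0) (x : ℝ) :
    blochMinus q L x z = ![ms q 0 0 x z + ms q 0 1 x z * weylMinus q L z,
      ms q 1 0 x z + ms q 1 1 x z * weylMinus q L z] := by
  have hd := ne_of_im_ne_zero hq hL hz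
  have h12 : ms q 0 1 L z ≠ 0 := fun h => hz (im_eq_zero_of_ms_eq_zero hq hL h)
  have hr := multiplier_inv_eq hd
  have hsq : rootR q L z ^ 2 = Δ z ^ 2 - 1 := joukowskiRoot_sq hd
  rw [blochMinus, epsilon_isBlochFloquet hq hper (by rw [hr]; linear_combination hsq) h12, hr,
    ← (weylPlus_add hq hL hz).2, add_sub_cancel_left, mul_div_cancel_left₀ _ h12]

/-- `w₊` maps the upper half-plane to itself. -/
theorem weylPlus_im_pos (hz : 0 < z.im) : 0 < (weylPlus q L z).im := by
  have hlt := (isFloquetPair_weyl hq hL hper hz.ne').1.normSq_sub_lt hq hL hz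
    (by
      by_contra! h
      rw [(blochZS_zero hq _ z).1, (blochZS_zero hq _ z).2] at h
      exact one_ne_zero (α := ℂ) (by linear_combination h.1 + h.2))
  have hr := norm_sub_joukowskiRoot_lt (ne_of_im_ne_zero hq hL hz.ne')
  rw [← rootR] at hr
  -- `|v₁|² - |v₂|²` increases over a period and is multiplied by `|ρ|² < 1`, so it is negative
  have key : normSq ((1 + I * weylPlus q L z) / 2) - normSq ((1 - I * weylPlus q L z) / 2) =
      -(weylPlus q L z).im := by
    simp [normSq_apply]; ring
  simp only [(blochZS_zero hq _ z).1, (blochZS_zero hq _ z).2, key] at hlt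
  by_contra! hle
  nlinarith [mul_nonneg (sub_nonneg.2 (pow_le_one₀ (n := 2) (norm_nonneg _) hr.le))
    (neg_nonneg.2 hle)]

end OffAxis

/-! ### The monodromy matrix at real spectral parameters -/

theorem ps_ofReal_conj (hq : Continuous q) (x s : ℝ) :
    ps q 1 1 x s = conj (ps q 0 0 x s) ∧ ps q 1 0 x s = conj (ps q 0 1 x s) := by
  have := ps_conj hq s x
  rw [conj_ofReal] at this
  exact ⟨this.1, this.2.2.1⟩

theorem normSq_sub_eq_one (hq : Continuous q) (x s : ℝ) :
    normSq (ps q 0 0 x s) - normSq (ps q 0 1 x s) = 1 := by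
  have := ps_det hq s x
  rw [(ps_ofReal_conj hq x s).1, (ps_ofReal_conj hq x s).2, mul_conj, mul_conj,
    ← ofReal_sub] at this
  exact_mod_cast this

/-- At a real parameter `∂_z Y(L,z) = Y(L,z) K` with
`K = ( -iα -iβ ; i β̄ iα )` and `|β| < α`. -/
theorem exists_hasDerivAt_monodromy {Q : ℝ} (hq : Continuous q) (hQ : ∀ x, ‖q x‖ ≤ Q) (hL : 0 < L)
    (s : ℝ) : ∃ (α : ℝ) (β : ℂ), ‖β‖ < α ∧ ∀ i : Fin 2, HasDerivAt (fun z => ps q i 0 L z)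
        (ps q i 0 L s * (-I * α) + ps q i 1 L s * (I * conj β)) s ∧
      HasDerivAt (fun z => ps q i 1 L z)
        (ps q i 0 L s * (-I * β) + ps q i 1 L s * (I * α)) s := by
  have hc := fun i j => continuous_ps hq s i j
  have hcc := fun i j => continuous_conj.comp (hc i j)
  simp only [Function.comp_def] at hcc
  have hcn := fun i j => Complex.continuous_normSq.comp (hc i j)
  simp only [Function.comp_def] at hcn
  set α : ℝ := ∫ t in (0 : ℝ)..L, (normSq (ps q 0 0 t s) + normSq (ps q 0 1 t s))
  set β : ℂ := ∫ t in (0 : ℝ)..L, 2 * (conj (ps q 0 0 t s) * ps q 0 1 t s)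
  have hα : ∫ t in (0 : ℝ)..L, (conj (ps q 0 0 t s) * ps q 0 0 t s +
      ps q 0 1 t s * conj (ps q 0 1 t s)) = α := by
    rw [← intervalIntegral.integral_ofReal]
    congr 1
    ext t
    rw [mul_conj, ← Complex.normSq_eq_conj_mul_self]
    push_cast; ring
  have e00 : lagrange₀ q 0 L s s = -I * α := by
    rw [lagrange₀, intervalIntegral.integral_const_mul, ← hα]
    simp only [ps_ofReal_conj hq]
  have e01 : lagrange₀ q 1 L s s = -I * β := by
    rw [lagrange₀, intervalIntegral.integral_const_mul]
    congr 2
    ext t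
    rw [(ps_ofReal_conj hq t s).1]
    ring
  have e10 : lagrange₁ q 0 L s s = I * conj β := by
    rw [lagrange₁, intervalIntegral.integral_const_mul]
    congr 1
    simp only [β, intervalIntegral.integral_of_le hL.le]
    rw [← integral_conj]
    congr 1
    ext t
    rw [(ps_ofReal_conj hq t s).2]
    simp only [map_mul, map_ofNat, conj_conj]
    ring
  have e11 : lagrange₁ q 1 L s s = I * α := by
    rw [lagrange₁, intervalIntegral.integral_const_mul, ← hα]
    congr 2
    ext t
    rw [(ps_ofReal_conj hq t s).1, (ps_ofReal_conj hq t s).2]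
    ring
  refine ⟨α, β, ?_, fun i => ⟨?_, ?_⟩⟩
  · have h1 : ‖β‖ ≤ ∫ t in (0 : ℝ)..L, 2 * (‖ps q 0 0 t s‖ * ‖ps q 0 1 t s‖) := by
      refine (intervalIntegral.norm_integral_le_integral_norm hL.le).trans (le_of_eq ?_)
      congr 1
      ext t
      simp
    have h2 : 0 < ∫ t in (0 : ℝ)..L, ((normSq (ps q 0 0 t s) +
        normSq (ps q 0 1 t s)) - 2 * (‖ps q 0 0 t s‖ * ‖ps q 0 1 t s‖)) := by
      refine intervalIntegral.intervalIntegral_pos_of_pos (Continuous.intervalIntegrable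
        (by fun_prop) _ _) (fun t => ?_) hL
      have h := normSq_sub_eq_one hq t s
      simp only [normSq_eq_norm_sq] at h ⊢
      have hne : ‖ps q 0 0 t s‖ - ‖ps q 0 1 t s‖ ≠ 0 := fun h0 => by
        rw [sub_eq_zero.1 h0] at h; simp at h
      have := pow_pos (abs_pos.2 hne) 2
      rw [sq_abs] at this
      nlinarith
    rw [intervalIntegral.integral_sub (Continuous.intervalIntegrable (by fun_prop) _ _)
      (Continuous.intervalIntegrable (by fun_prop) _ _)] at h2
    linarith
  · have := hasDerivAt_ps_param hq hQ i 0 L s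
    rwa [e00, e10] at this
  · have := hasDerivAt_ps_param hq hQ i 1 L s
    rwa [e01, e11] at this

theorem discriminant_ofReal (hq : Continuous q) (s : ℝ) :
    Δ s = ((ps q 0 0 L s).re : ℂ) := by
  rw [discriminant_eq_ps, (ps_ofReal_conj hq L s).1, Complex.add_conj]
  push_cast; ring

theorem ms_zero_one_ofReal (hq : Continuous q) (s : ℝ) :
    ms q 0 1 L s = (((ps q 0 1 L s).im - (ps q 0 0 L s).im : ℝ) : ℂ) := by
  rw [(ms_formulas q L s).2.1, (ps_ofReal_conj hq L s).1, (ps_ofReal_conj hq L s).2]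
  apply Complex.ext <;> simp
  ring

theorem ms_zero_zero_ofReal (hq : Continuous q) (s : ℝ) :
    ms q 0 0 L s = (((ps q 0 0 L s).re + (ps q 0 1 L s).re : ℝ) : ℂ) := by
  rw [(ms_formulas q L s).1, (ps_ofReal_conj hq L s).1, (ps_ofReal_conj hq L s).2]
  apply Complex.ext <;> simp
  ring

section RealAxis

variable {Q : ℝ} (hq : Continuous q) (hQ : ∀ x, ‖q x‖ ≤ Q) (hL : 0 < L)
include hq hQ hL

/-- The zeros of `ỹ₁₂(L,·)` are simple, and the sign of the derivative is that of `ỹ₁₁`. -/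
theorem hasDerivAt_ms_of_eq_zero {s : ℝ} (h : ms q 0 1 L s = 0) :
    ∃ κ : ℝ, 0 < κ ∧ HasDerivAt (fun z => ms q 0 1 L z) (κ * ms q 0 0 L s) s := by
  obtain ⟨α, β, hαβ, hd⟩ := exists_hasDerivAt_monodromy hq hQ hL s
  refine ⟨α - β.re, by linarith [Complex.re_le_norm β], ?_⟩
  have hf : (fun z => ms q 0 1 L z) = fun z => I * (ps q 0 0 L z - ps q 0 1 L z +
      ps q 1 0 L z - ps q 1 1 L z) / 2 := funext fun z => (ms_formulas q L z).2.1
  rw [hf]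
  refine (((((hd 0).1.sub (hd 0).2).add (hd 1).1).sub (hd 1).2).const_mul I
    |>.div_const 2).congr_deriv ?_
  have e : ps q 0 0 L s - ps q 0 1 L s + ps q 1 0 L s - ps q 1 1 L s = 0 := by
    rw [(ms_formulas q L s).2.1] at h
    exact mul_left_cancel₀ I_ne_zero (by linear_combination 2 * h)
  have hβ : ((β.re : ℝ) : ℂ) = (β + conj β) / 2 := by
    rw [Complex.add_conj]; push_cast; ring
  rw [(ms_formulas q L s).1]
  push_cast
  rw [hβ]
  have hI : I * I = -1 := I_mul_I
  linear_combination ((β - conj β) / 4 * -e) + (-(α * (ps q 0 0 L s + ps q 0 1 L s +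
    ps q 1 0 L s + ps q 1 1 L s)) / 2 + (conj β * (ps q 0 1 L s + ps q 1 1 L s) +
    β * (ps q 0 0 L s + ps q 1 0 L s)) / 2) * hI

theorem hasDerivAt_discriminant (s : ℝ) :
    ∃ (α : ℝ) (β : ℂ), ‖β‖ < α ∧ HasDerivAt (Δ)
      ((α * (ps q 0 0 L s).im - (ps q 0 1 L s * conj β).im : ℝ) : ℂ) s := by
  obtain ⟨α, β, hαβ, hd⟩ := exists_hasDerivAt_monodromy hq hQ hL s
  refine ⟨α, β, hαβ, ?_⟩
  have hf : Δ = fun z => (ps q 0 0 L z + ps q 1 1 L z) / 2 :=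
    funext fun z => discriminant_eq_ps q L z
  rw [hf]
  refine (((hd 0).1.add (hd 1).2).div_const 2).congr_deriv ?_
  rw [(ps_ofReal_conj hq L s).1, (ps_ofReal_conj hq L s).2]
  apply Complex.ext <;> simp <;> ring

/-- Where `|Δ| ≤ 1` and `ỹ₁₂ ≠ 0`, the derivative of `Δ` has the sign opposite to `ỹ₁₂`. -/
theorem deriv_discriminant_mul_neg {s : ℝ} (h1 : (Δ s).re ^ 2 ≤ 1)
    (h : ms q 0 1 L s ≠ 0) : ∃ δ : ℝ, HasDerivAt (Δ) (δ : ℂ) s ∧ δ * (ms q 0 1 L s).re < 0 := by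
  obtain ⟨α, β, hαβ, hd⟩ := hasDerivAt_discriminant hq hQ hL s
  refine ⟨_, hd, ?_⟩
  rw [ms_zero_one_ofReal hq] at h ⊢
  rw [discriminant_ofReal hq] at h1
  have hdet := normSq_sub_eq_one hq L s
  have hn : normSq (ps q 0 1 L s) = ‖ps q 0 1 L s‖ ^ 2 := normSq_eq_norm_sq _
  have him := abs_im_le_norm (ps q 0 1 L s * conj β)
  rw [norm_mul, norm_conj] at him
  have hbim := abs_im_le_norm (ps q 0 1 L s)
  rw [hn, normSq_apply] at hdet
  simp only [ofReal_re] at h1 ⊢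
  have hne : (ps q 0 1 L s).im - (ps q 0 0 L s).im ≠ 0 := by
    intro h0; exact h (by rw [h0]; simp)
  set y := (ps q 0 0 L s).im
  set b := ‖ps q 0 1 L s‖
  set bi := (ps q 0 1 L s).im
  set τ := (ps q 0 1 L s * conj β).im
  have hb0 : 0 ≤ b := norm_nonneg _
  have hby : b ≤ |y| := by
    refine abs_le_of_sq_le_sq' ?_ (abs_nonneg y) |>.2
    rw [sq_abs]; nlinarith
  have hy0 : 0 < |y| := by
    by_contra! h0
    have hy : y = 0 := abs_nonpos_iff.1 h0
    have : bi = 0 := by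
      have : |bi| ≤ 0 := hbim.trans (hby.trans h0)
      exact abs_nonpos_iff.1 this
    exact hne (by rw [hy, this]; ring)
  have hβ0 := norm_nonneg β
  have hτ : |τ| < α * |y| := by
    calc |τ| ≤ b * ‖β‖ := him
      _ ≤ |y| * ‖β‖ := by gcongr
      _ < |y| * α := by gcongr
      _ = _ := mul_comm _ _
  have hbi : |bi| ≤ |y| := hbim.trans hby
  rcases lt_or_gt_of_ne (abs_pos.1 hy0) with hy | hy
  · rw [abs_of_neg hy] at hτ hbi
    have k1 : α * y - τ < 0 := by linarith [(abs_lt.1 hτ).1]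
    have k2 : 0 < bi - y := lt_of_le_of_ne (by linarith [(abs_le.1 hbi).1, (abs_le.1 hbi).2])
      hne.symm
    exact mul_neg_of_neg_of_pos k1 k2
  · rw [abs_of_pos hy] at hτ hbi
    have k1 : 0 < α * y - τ := by linarith [(abs_lt.1 hτ).2]
    have k2 : bi - y < 0 := lt_of_le_of_ne (by linarith [(abs_le.1 hbi).2]) hne
    exact mul_neg_of_pos_of_neg k1 k2

/-- At a critical point of `Δ` with `Δ = ±1` the monodromy matrix is `±I`. -/
theorem ps_eq_zero_of_deriv_eq_zero {s : ℝ} (h1 : Δ s ^ 2 = 1)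
    (h : deriv (Δ) s = 0) :
    ps q 0 1 L s = 0 ∧ (ps q 0 0 L s).im = 0 := by
  obtain ⟨α, β, hαβ, hd⟩ := hasDerivAt_discriminant hq hQ hL s
  rw [hd.deriv, Complex.ofReal_eq_zero] at h
  rw [discriminant_ofReal hq] at h1
  have hre : (ps q 0 0 L s).re ^ 2 = 1 := by exact_mod_cast h1
  have hdet := normSq_sub_eq_one hq L s
  have hn : normSq (ps q 0 1 L s) = ‖ps q 0 1 L s‖ ^ 2 := normSq_eq_norm_sq _
  have him := abs_im_le_norm (ps q 0 1 L s * conj β)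
  rw [norm_mul, norm_conj] at him
  rw [hn, normSq_apply] at hdet
  have hy : |(ps q 0 0 L s).im| = ‖ps q 0 1 L s‖ := by
    rw [← abs_of_nonneg (norm_nonneg (ps q 0 1 L s)), ← sq_eq_sq_iff_abs_eq_abs]
    nlinarith
  have hτ : |(ps q 0 1 L s * conj β).im| = α * ‖ps q 0 1 L s‖ := by
    have hα : 0 < α := (norm_nonneg _).trans_lt hαβ
    rw [← hy, ← sub_eq_zero.1 h, abs_mul, abs_of_pos hα]
  have hb : ‖ps q 0 1 L s‖ = 0 := by
    by_contra hb
    have : 0 < ‖ps q 0 1 L s‖ := lt_of_le_of_ne (norm_nonneg _) (Ne.symm hb)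
    nlinarith
  rw [hb] at hy
  exact ⟨norm_eq_zero.1 hb, abs_eq_zero.1 hy⟩

/-- Where the monodromy matrix is `±I`, `Δ² - 1` has a double zero with negative leading
coefficient. -/
theorem discriminant_double_zero {s : ℝ} (hb : ps q 0 1 L s = 0) (ha : (ps q 0 0 L s).im = 0) :
    ∃ d : ℂ → ℂ, Differentiable ℂ d ∧ (∃ c : ℝ, c < 0 ∧ d s = c) ∧
      ∀ z, Δ z ^ 2 - 1 = (z - s) ^ 2 * d z := by
  obtain ⟨α, β, hαβ, hd⟩ := exists_hasDerivAt_monodromy hq hQ hL s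
  have hdiff := fun i j => differentiable_ps hq hQ i j L
  set f : ℂ → ℂ := fun z => (ps q 0 0 L z - ps q 1 1 L z) / 2 with hf
  have hfd : Differentiable ℂ f := ((hdiff 0 0).sub (hdiff 1 1)).div_const 2
  have hreal : ps q 1 1 L s = ps q 0 0 L s := by
    rw [(ps_ofReal_conj hq L s).1, Complex.conj_eq_iff_im.2 ha]
  have hc0 : ps q 1 0 L s = 0 := by rw [(ps_ofReal_conj hq L s).2, hb, map_zero]
  have hf0 : f s = 0 := by simp [hf, hreal]
  have ha2 : ps q 0 0 L s ^ 2 = 1 := by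
    have := ps_det hq s L
    rw [hreal, hb] at this
    linear_combination this
  have hmul : ∀ g : ℂ → ℂ, g s = 0 → ∀ z, g z = (z - s) * dslope g s z := fun g hg z => by
    have := sub_smul_dslope g (s : ℂ) z
    rw [smul_eq_mul, hg, sub_zero] at this
    exact this.symm
  refine ⟨fun z => dslope f s z ^ 2 + dslope (fun z => ps q 0 1 L z) s z *
      dslope (fun z => ps q 1 0 L z) s z, ((differentiable_dslope hfd s).pow 2).add
      ((differentiable_dslope (hdiff 0 1) s).mul (differentiable_dslope (hdiff 1 0) s)),
    ⟨‖β‖ ^ 2 - α ^ 2, ?_, ?_⟩, fun z => ?_⟩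
  · nlinarith [norm_nonneg β]
  · have hfs : deriv f s = _ := (((hd 0).1.sub (hd 1).2).div_const 2).deriv
    simp only [dslope_same]
    rw [(hd 0).2.deriv, (hd 1).1.deriv, hfs, hb, hc0, hreal]
    have hn : β * conj β = (‖β‖ : ℂ) ^ 2 := Complex.mul_conj' β
    push_cast
    rw [← hn]
    linear_combination (α ^ 2 * I ^ 2 - β * conj β * I ^ 2) * ha2 + (α ^ 2 - β * conj β) * I_sq
  · rw [discriminant_sq_sub_one_ps hq]
    have h1 := hmul f hf0 z
    have h2 := hmul (fun z => ps q 0 1 L z) hb z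
    have h3 := hmul (fun z => ps q 1 0 L z) hc0 z
    have h1' : (ps q 0 0 L z - ps q 1 1 L z) / 2 = (z - s) * dslope f s z := h1
    rw [h1', h2, h3]
    ring

end RealAxis

variable {Q : ℝ}

/-! ### Asymptotics for large spectral parameter -/

theorem continuous_of_periodic (hL : 0 < L) (hper : ∀ x, q (x + L) = q x)
    (hq : ContinuousOn q (Icc 0 L)) : Continuous q := by
  have : Fact (0 < L) := ⟨hL⟩
  have hc : Continuous (AddCircle.liftIco L 0 q) :=
    AddCircle.liftIco_continuous (by simpa using (hper 0).symm) (by simpa using hq)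
  have hp : Function.Periodic q L := hper
  have he : q = fun x : ℝ => AddCircle.liftIco L 0 q (x : AddCircle L) := by
    ext x
    have h1 : ((toIcoMod hL 0 x : ℝ) : AddCircle L) = (x : AddCircle L) := by
      rw [toIcoMod, AddCircle.coe_sub, AddCircle.coe_zsmul, AddCircle.coe_period, smul_zero,
        sub_zero]
    rw [← h1, AddCircle.liftIco_coe_apply (toIcoMod_mem_Ico hL 0 x), toIcoMod, hp.sub_zsmul_eq]
  rw [he]
  exact hc.comp (AddCircle.continuous_mk' L)

theorem exists_hasDerivWithinAt (hL : 0 < L) (hq : ContDiffOn ℝ 2 q (Icc 0 L)) :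
    ∃ (q' : ℝ → ℂ) (Q' : ℝ), ∀ x ∈ Icc 0 L, HasDerivWithinAt q (q' x) (Icc 0 L) x ∧
      ‖q' x‖ ≤ Q' := by
  have hc := hq.continuousOn_derivWithin (uniqueDiffOn_Icc hL) (by norm_num)
  obtain ⟨Q', hQ'⟩ := isCompact_Icc.exists_bound_of_continuousOn hc
  exact ⟨derivWithin q (Icc 0 L), Q', fun x hx =>
    ⟨((hq.differentiableOn (by norm_num)) x hx).hasDerivWithinAt, hQ' x hx⟩⟩

theorem norm_exp_I_mul (z : ℂ) (x : ℝ) : ‖exp (I * z * x)‖ = Real.exp (-(z.im * x)) := by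
  rw [norm_exp]; simp

/-- For `Im z ≥ 0` and `0 ≤ x ≤ L` the normalized principal solution `e^{izx} Y(x,z)` differs from
`diag(1, e^{2izx})` by `O(1/z)`. -/
theorem exists_norm_exp_mul_ps_sub_le {q' : ℝ → ℂ} {Q : ℝ} (hq : Continuous q)
    (hQ : ∀ x, ‖q x‖ ≤ Q) (hL : 0 < L)
    (hd : ∀ x ∈ Icc 0 L, HasDerivWithinAt q (q' x) (Icc 0 L) x ∧ ‖q' x‖ ≤ Q) :
    ∃ K : ℝ, 0 ≤ K ∧ ∀ z : ℂ, 0 ≤ z.im → 1 ≤ ‖z‖ → ∀ x ∈ Icc 0 L, ∀ j : Fin 2,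
      ‖exp (I * z * x) * ps q 0 j x z - (1 : Mat₂) 0 j‖
        ≤ K / ‖z‖ ∧
      ‖exp (I * z * x) * ps q 1 j x z -
        exp (2 * I * z * x) * (1 : Mat₂) 1 j‖ ≤ K / ‖z‖ := by
  have hQ0 : 0 ≤ Q := (norm_nonneg _).trans (hQ 0)
  set A := Real.exp (Q * L) with hA
  have hA0 : 0 < A := Real.exp_pos _
  set C1 := (Q + Q ^ 2) * A with hC1
  set C2 := Q ^ 2 * A + Q * (A + Q * A) + Q * C1 with hC2
  have hC10 : 0 ≤ C1 := by positivity
  have hC20 : 0 ≤ C2 := by positivity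
  refine ⟨C1 * L + 2 * Q * A + C2 * L + 2 * Q * (A + Q * A), by positivity,
    fun z hz hz1 x hx j => ?_⟩
  have hz0 : 0 < ‖z‖ := by linarith
  have hzne : z ≠ 0 := norm_pos_iff.1 hz0
  set w : ℂ := 2 * I * z with hw
  have hwne : w ≠ 0 := by simp [hw, hzne]
  have hwn : ‖w‖ = 2 * ‖z‖ := by simp [hw]
  have hwz : ∀ u : ℂ, ‖u / w‖ ≤ ‖u‖ / ‖z‖ := fun u => by
    rw [norm_div, hwn]
    gcongr
    linarith
  have hw1 : ∀ u : ℂ, ‖u / w‖ ≤ ‖u‖ := fun u => (hwz u).trans (div_le_self (norm_nonneg _) hz1)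
  set a : ℝ → ℂ := fun t => exp (I * z * t) * ps q 0 j t z with ha
  set b : ℝ → ℂ := fun t => exp (I * z * t) * ps q 1 j t z with hb
  have hbd : ∀ i, ∀ t ∈ Icc 0 L, ‖exp (I * z * t) * ps q i j t z‖ ≤ A :=
    fun i t ht => by
      rw [norm_mul, norm_exp_I_mul]
      calc _ ≤ Real.exp (-(z.im * t)) * Real.exp ((|z.im| + Q) * |t|) := by
            gcongr; exact norm_ps_le hq hQ i j t z
        _ = Real.exp (Q * t) := by
            rw [← Real.exp_add, abs_of_nonneg hz, abs_of_nonneg ht.1]; ring_nf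
        _ ≤ A := by rw [hA]; gcongr; exact ht.2
  have haA : ∀ t ∈ Icc 0 L, ‖a t‖ ≤ A := hbd 0
  have hbA : ∀ t ∈ Icc 0 L, ‖b t‖ ≤ A := hbd 1
  have hexp : ∀ (v : ℂ) (t : ℝ), HasDerivAt (fun t : ℝ => exp (v * t))
      (v * exp (v * t)) t := fun v t => by
    have := (((hasDerivAt_id (t : ℂ)).const_mul v).cexp).comp_ofReal
    simp only [id, mul_one] at this
    exact this.congr_deriv (mul_comm _ _)
  have hda : ∀ t, HasDerivAt a (q t * b t) t := fun t =>
    ((hexp (I * z) t).mul (hasDerivAt_ps_zero hq z j t)).congr_deriv (by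
      simp only [hb]; ring)
  have hdb : ∀ t, HasDerivAt b (conj (q t) * a t + w * b t) t := fun t =>
    ((hexp (I * z) t).mul (hasDerivAt_ps_one hq z j t)).congr_deriv (by
      simp only [ha, hb, hw]; ring)
  -- one integration by parts: `g' = wg + O(1/z)`, while `b' = wb + O(1)`
  set g : ℝ → ℂ := fun t => b t + conj (q t) * a t / w with hg
  set r : ℝ → ℂ := fun t => (conj (q' t) * a t + conj (q t) * (q t * b t)) / w
    with hr
  have hconj : ∀ t ∈ Icc 0 L, HasDerivWithinAt (fun t => conj (q t))
      (conj (q' t)) (Icc 0 L) t := fun t ht => (hd t ht).1.star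
  have hdg : ∀ t ∈ Icc 0 L, HasDerivWithinAt g (w * g t + r t) (Icc 0 L) t := fun t ht =>
    ((hdb t).hasDerivWithinAt.add
      (((hconj t ht).mul (hda t).hasDerivWithinAt).div_const w)).congr_deriv (by
        simp only [hg, hr]; field_simp; ring)
  have hnr : ∀ t ∈ Icc 0 L, ‖conj (q' t) * a t + conj (q t) * (q t * b t)‖
      ≤ C1 := fun t ht => by
    refine (norm_add_le _ _).trans ?_
    rw [norm_mul, norm_mul (conj (q t)), norm_mul (q t), norm_conj, norm_conj]
    calc _ ≤ Q * A + Q * (Q * A) := by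
          gcongr
          exacts [(hd t ht).2, haA t ht, hQ t, hQ t, hbA t ht]
      _ = C1 := by rw [hC1]; ring
  have hrn : ∀ t ∈ Icc 0 L, ‖r t‖ ≤ C1 / ‖z‖ := fun t ht =>
    (hwz _).trans (by gcongr; exact hnr t ht)
  have hqa : ∀ t ∈ Icc 0 L, ‖conj (q t) * a t‖ ≤ Q * A := fun t ht => by
    rw [norm_mul, norm_conj]
    gcongr
    exacts [hQ t, haA t ht]
  have hgn : ∀ t ∈ Icc 0 L, ‖g t‖ ≤ A + Q * A := fun t ht =>
    (norm_add_le _ _).trans (add_le_add (hbA t ht) ((hw1 _).trans (hqa t ht)))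
  have hqg : ∀ t ∈ Icc 0 L, ‖q t * g t / w‖ ≤ Q * (A + Q * A) / ‖z‖ := fun t ht => by
    refine (hwz _).trans ?_
    rw [norm_mul]
    gcongr
    exacts [hQ t, hgn t ht]
  have h0 : (0 : ℝ) ∈ Icc 0 L := ⟨le_rfl, hL.le⟩
  have hsub : Icc 0 x ⊆ Icc 0 L := Icc_subset_Icc le_rfl hx.2
  -- the remainder of `g` after removing the oscillating factor has a small derivative
  have key1 : ‖g x - exp (w * x) * g 0‖ ≤ C1 / ‖z‖ * L := by
    set G : ℝ → ℂ := fun t => exp (w * x) * (exp (-w * t) * g t) with hG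
    have hdG : ∀ t ∈ Icc 0 x, HasDerivWithinAt G
        (exp (w * x) * (exp (-w * t) * r t)) (Icc 0 x) t := fun t ht =>
      ((((hexp (-w) t).hasDerivWithinAt.mul ((hdg t (hsub ht)).mono hsub)).const_mul
        (exp (w * x)))).congr_deriv (by ring)
    have hGn : ∀ t ∈ Icc 0 x, ‖exp (w * x) * (exp (-w * t) * r t)‖ ≤ C1 / ‖z‖ :=
      fun t ht => by
        rw [← mul_assoc, ← exp_add, norm_mul, norm_exp]
        refine (mul_le_of_le_one_left (norm_nonneg _) ?_).trans (hrn t (hsub ht))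
        rw [Real.exp_le_one_iff]
        simp [hw]
        nlinarith [mul_nonneg hz (sub_nonneg.2 ht.2)]
    have := (convex_Icc (0 : ℝ) x).norm_image_sub_le_of_norm_hasDerivWithin_le hdG hGn
      (left_mem_Icc.2 hx.1) (right_mem_Icc.2 hx.1)
    simp only [hG, ofReal_zero, mul_zero, exp_zero, one_mul, sub_zero] at this
    rw [← mul_assoc, ← exp_add, neg_mul, add_neg_cancel, exp_zero, one_mul] at this
    refine this.trans ?_
    rw [Real.norm_eq_abs, abs_of_nonneg hx.1]
    gcongr
    exact hx.2
  have key2 : ‖(a x - q x * g x / w) - (a 0 - q 0 * g 0 / w)‖ ≤ C2 / ‖z‖ * L := by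
    have hdc : ∀ t ∈ Icc 0 L, HasDerivWithinAt (fun t => a t - q t * g t / w)
        (-(q t * (conj (q t) * a t) + q' t * g t + q t * r t) / w) (Icc 0 L) t :=
      fun t ht => ((hda t).hasDerivWithinAt.sub
        (((hd t ht).1.mul (hdg t ht)).div_const w)).congr_deriv (by
          simp only [hg]; field_simp; ring)
    have hcn : ∀ t ∈ Icc 0 L, ‖-(q t * (conj (q t) * a t) + q' t * g t + q t * r t) / w‖
        ≤ C2 / ‖z‖ := fun t ht => by
      refine (hwz _).trans ?_
      gcongr
      rw [norm_neg]
      refine (norm_add₃_le).trans ?_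
      rw [norm_mul, norm_mul (q' t), norm_mul (q t) (r t)]
      calc _ ≤ Q * (Q * A) + Q * (A + Q * A) + Q * C1 := by
            gcongr
            exacts [hQ t, hqa t ht, (hd t ht).2, hgn t ht, hQ t,
              (hrn t ht).trans (div_le_self hC10 hz1)]
        _ = C2 := by rw [hC2]; ring
    have := (convex_Icc (0 : ℝ) L).norm_image_sub_le_of_norm_hasDerivWithin_le hdc hcn h0 hx
    refine this.trans ?_
    rw [Real.norm_eq_abs, sub_zero, abs_of_nonneg hx.1]
    gcongr
    exact hx.2
  have hps0 : ∀ i, ps q i j 0 z = (1 : Mat₂) i j := fun i => by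
    simp only [ps, principalSolution_zero hq]
  have ha0 : a 0 = (1 : Mat₂) 0 j := by simp [ha, hps0]
  have hb0 : b 0 = (1 : Mat₂) 1 j := by simp [hb, hps0]
  have hew : ‖exp (w * x)‖ ≤ 1 := by
    rw [norm_exp, Real.exp_le_one_iff]
    simp only [hw, mul_re, mul_im, I_re, I_im, Complex.re_ofNat,
      Complex.im_ofNat, ofReal_re, ofReal_im]
    nlinarith [mul_nonneg hz hx.1]
  constructor
  · rw [← ha0]
    have e : a x - a 0 = ((a x - q x * g x / w) - (a 0 - q 0 * g 0 / w)) + q x * g x / w -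
      q 0 * g 0 / w := by ring
    change ‖a x - a 0‖ ≤ _
    rw [e]
    refine (norm_sub_le _ _).trans ((add_le_add ((norm_add_le _ _).trans
      (add_le_add key2 (hqg x hx))) (hqg 0 h0)).trans ?_)
    rw [div_mul_eq_mul_div, ← add_div, ← add_div]
    refine div_le_div_of_nonneg_right ?_ hz0.le
    nlinarith [mul_nonneg hC10 hL.le, mul_nonneg hQ0 hA0.le]
  · rw [← hb0]
    have e : b x - exp (w * x) * b 0 = (g x - exp (w * x) * g 0) -
      conj (q x) * a x / w + exp (w * x) * (conj (q 0) * a 0 / w) := by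
      simp only [hg]; ring
    change ‖b x - exp (w * x) * b 0‖ ≤ _
    rw [e]
    have k1 : ‖conj (q x) * a x / w‖ ≤ Q * A / ‖z‖ :=
      (hwz _).trans (by gcongr; exact hqa x hx)
    have k2 : ‖exp (w * x) * (conj (q 0) * a 0 / w)‖ ≤ Q * A / ‖z‖ := by
      rw [norm_mul]
      exact (mul_le_of_le_one_left (norm_nonneg _) hew).trans
        ((hwz _).trans (by gcongr; exact hqa 0 h0))
    refine (norm_add_le _ _).trans ((add_le_add ((norm_sub_le _ _).trans
      (add_le_add key1 k1)) k2).trans ?_)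
    rw [div_mul_eq_mul_div, ← add_div, ← add_div]
    refine div_le_div_of_nonneg_right ?_ hz0.le
    nlinarith [mul_nonneg hC20 hL.le, mul_nonneg hQ0 (add_nonneg hA0.le (mul_nonneg hQ0 hA0.le))]

/-! ### Bounds for trigonometric functions -/

theorem norm_sin_sq (w : ℂ) : ‖sin w‖ ^ 2 = Real.sin w.re ^ 2 + Real.sinh w.im ^ 2 := by
  rw [← normSq_eq_norm_sq, Complex.sin_eq, normSq_apply]
  simp only [← Complex.ofReal_sin, ← Complex.ofReal_cos, ← Complex.ofReal_sinh,
    ← Complex.ofReal_cosh, add_re, add_im, mul_re, mul_im,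
    ofReal_re, ofReal_im, I_re, I_im]
  have h1 := Real.sin_sq_add_cos_sq w.re
  have h2 := Real.cosh_sq w.im
  linear_combination Real.sin w.re ^ 2 * h2 + Real.sinh w.im ^ 2 * h1

theorem norm_exp_mul_I_le (w : ℂ) : ‖exp (w * I)‖ ≤ Real.exp |w.im| ∧
    ‖exp (-w * I)‖ ≤ Real.exp |w.im| := by
  simp only [norm_exp]
  constructor <;> gcongr <;> simp [neg_le_abs, le_abs_self]

theorem norm_cos_le (w : ℂ) : ‖cos w‖ ≤ Real.exp |w.im| := by
  rw [cos, norm_div, norm_ofNat, div_le_iff₀ two_pos]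
  have := norm_exp_mul_I_le w
  linarith [norm_add_le (exp (w * I)) (exp (-w * I))]

/-- `|sin w| ≥ c e^{|Im w|}` outside discs around the zeros of the sine. -/
theorem exists_le_norm_sin {δ : ℝ} (hδ : 0 < δ) : ∃ c : ℝ, 0 < c ∧ ∀ w : ℂ,
    (∀ n : ℤ, δ ≤ ‖w - n * π‖) → c * Real.exp |w.im| ≤ ‖sin w‖ := by
  have hpi := Real.pi_pos
  have he := Real.exp_pos 1
  refine ⟨min (1 / 4) (2 / π * min δ 1 / Real.exp 1), by positivity, fun w hw => ?_⟩
  have hsq := norm_sin_sq w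
  rcases le_or_gt |w.im| 1 with h | h
  · set n := round (w.re / π) with hn
    set x := w.re - n * π with hx
    have hxn : |x| ≤ π / 2 := by
      have := abs_sub_round (w.re / π)
      have e : x = (w.re / π - n) * π := by rw [hx]; field_simp
      rw [e, abs_mul, abs_of_pos hpi]
      nlinarith
    have hs1 : Real.sin w.re ^ 2 = Real.sin x ^ 2 := by
      rw [hx, Real.sin_sub_int_mul_pi, mul_pow]
      rcases Int.even_or_odd n with h | h <;> simp [h.neg_one_zpow]
    have hs2 := Real.mul_abs_le_abs_sin hxn
    have hs3 : |w.im| ≤ |Real.sinh w.im| := by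
      rw [Real.abs_sinh]; exact Real.self_le_sinh_iff.2 (abs_nonneg _)
    have hwn : δ ^ 2 ≤ x ^ 2 + w.im ^ 2 := by
      have h1 := hw n
      have h2 : ‖w - n * π‖ ^ 2 = x ^ 2 + w.im ^ 2 := by
        rw [← normSq_eq_norm_sq, normSq_apply]
        simp [hx]; ring
      rw [← h2]; gcongr
    have h2p : 2 / π ≤ 1 := by rw [div_le_one hpi]; linarith [Real.pi_gt_three]
    have h2p0 : 0 < 2 / π := by positivity
    have k : (2 / π * δ) ^ 2 ≤ ‖sin w‖ ^ 2 := by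
      rw [hsq, hs1, ← sq_abs (Real.sin x), ← sq_abs (Real.sinh w.im)]
      have k1 : (2 / π * |x|) ^ 2 ≤ |Real.sin x| ^ 2 := by gcongr
      have k2 : (2 / π * |w.im|) ^ 2 ≤ |Real.sinh w.im| ^ 2 := by
        gcongr
        exact (mul_le_of_le_one_left (abs_nonneg _) h2p).trans hs3
      rw [mul_pow, sq_abs] at k1 k2
      rw [mul_pow]
      nlinarith [pow_pos h2p0 2]
    have k' : 2 / π * δ ≤ ‖sin w‖ := by
      exact (sq_le_sq₀ (by positivity) (norm_nonneg _)).1 k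
    calc _ ≤ (2 / π * min δ 1 / Real.exp 1) * Real.exp 1 := by
          gcongr
          exact min_le_right _ _
      _ = 2 / π * min δ 1 := by field_simp
      _ ≤ 2 / π * δ := by gcongr; exact min_le_left _ _
      _ ≤ _ := k'
  · have k : |Real.sinh w.im| ≤ ‖sin w‖ := by
      refine (sq_le_sq₀ (abs_nonneg _) (norm_nonneg _)).1 ?_
      rw [hsq, sq_abs]; nlinarith [sq_nonneg (Real.sin w.re)]
    refine le_trans ?_ k
    rw [Real.abs_sinh, Real.sinh_eq]
    have h1 : Real.exp (-|w.im|) ≤ 1 := by simp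
    have h2 : 2 ≤ Real.exp |w.im| := by linarith [Real.add_one_le_exp |w.im|]
    have h3 : min (1 / 4) (2 / π * min δ 1 / Real.exp 1) ≤ 1 / 4 := min_le_left _ _
    nlinarith

/-- The standing assumptions on the potential: continuous, `L`-periodic and, on one period, of
class `C¹`, with a common bound `Q` for `q` and `q'`. -/
structure Admissible (q : ℝ → ℂ) (L Q : ℝ) : Prop where
  pos : 0 < L
  cont : Continuous q
  bound : ∀ x, ‖q x‖ ≤ Q
  per : ∀ x, q (x + L) = q x
  hasDeriv : ∃ q' : ℝ → ℂ, ∀ x ∈ Icc 0 L, HasDerivWithinAt q (q' x) (Icc 0 L) x ∧ ‖q' x‖ ≤ Q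

theorem exists_admissible (hL : 0 < L) (hper : ∀ x, q (x + L) = q x)
    (hq : ContDiffOn ℝ 2 q (Icc 0 L)) : ∃ Q, Admissible q L Q := by
  have hc := continuous_of_periodic hL hper hq.continuousOn
  obtain ⟨Q, hQ⟩ := exists_norm_le_of_periodic hL hc hper
  obtain ⟨q', Q', hd⟩ := exists_hasDerivWithinAt hL hq
  exact ⟨max Q Q', hL, hc, fun x => (hQ.2 x).trans (le_max_left _ _), hper, q', fun x hx =>
    ⟨(hd x hx).1, (hd x hx).2.trans (le_max_right _ _)⟩⟩

/-- The reflected potential `-q̄(L - x)`, which exchanges the two components of a solution. -/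
theorem Admissible.reflect (h : Admissible q L Q) :
    Admissible (fun t => -conj (q (L - t))) L Q := by
  obtain ⟨q', hd⟩ := h.hasDeriv
  refine ⟨h.pos, ?_, fun x => ?_, fun x => ?_, fun t => conj (q' (L - t)), fun x hx => ⟨?_, ?_⟩⟩
  · exact (continuous_conj.comp (h.cont.comp (by fun_prop))).neg
  · rw [norm_neg, norm_conj]; exact h.bound _
  · have := h.per (L - (x + L))
    rw [← this]; congr 3; ring
  · have hx' : L - x ∈ Icc 0 L := ⟨by linarith [hx.2], by linarith [hx.1]⟩
    have h1 : HasDerivWithinAt (fun t : ℝ => L - t) (-1) (Icc 0 L) x :=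
      ((hasDerivAt_id x).const_sub L).hasDerivWithinAt
    have h2 : MapsTo (fun t : ℝ => L - t) (Icc 0 L) (Icc 0 L) := fun t ht =>
      ⟨by linarith [ht.2], by linarith [ht.1]⟩
    have h3 := HasDerivWithinAt.scomp x (hd (L - x) hx').1 h1 h2
    exact (h3.star.neg).congr_deriv (by simp)
  · rw [norm_conj]
    exact (hd _ ⟨by linarith [hx.2], by linarith [hx.1]⟩).2

/-- The leading terms of the monodromy matrix; the lower half-plane follows by conjugation. -/
theorem Admissible.exists_asymptotics (h : Admissible q L Q) :
    ∃ K : ℝ, 0 ≤ K ∧ ∀ z : ℂ, 1 ≤ ‖z‖ →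
      ‖ms q 0 1 L z - sin (z * L)‖ ≤ K * Real.exp (|z.im| * L) / ‖z‖ ∧
      ‖Δ z - cos (z * L)‖ ≤ K * Real.exp (|z.im| * L) / ‖z‖ ∧
      ‖(ms q 1 1 L z - ms q 0 0 L z) / 2‖ ≤ K * Real.exp (|z.im| * L) / ‖z‖ := by
  obtain ⟨q', hd⟩ := h.hasDeriv
  obtain ⟨K, hK, hb⟩ := exists_norm_exp_mul_ps_sub_le h.cont h.bound h.pos hd
  have up : ∀ z : ℂ, 0 ≤ z.im → 1 ≤ ‖z‖ →
      ‖ms q 0 1 L z - sin (z * L)‖ ≤ 2 * K * Real.exp (|z.im| * L) / ‖z‖ ∧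
      ‖Δ z - cos (z * L)‖ ≤ 2 * K * Real.exp (|z.im| * L) / ‖z‖ ∧
      ‖(ms q 1 1 L z - ms q 0 0 L z) / 2‖ ≤ 2 * K * Real.exp (|z.im| * L) / ‖z‖ := by
    intro z hz hz1
    have hI : I * I = -1 := I_mul_I
    obtain ⟨h0, h1⟩ := hb z hz hz1 L ⟨h.pos.le, le_rfl⟩ 0
    obtain ⟨h2, h3⟩ := hb z hz hz1 L ⟨h.pos.le, le_rfl⟩ 1
    simp only [Matrix.one_apply_eq, ne_eq, one_ne_zero, zero_ne_one, not_false_eq_true,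
      Matrix.one_apply_ne, sub_zero, mul_one, mul_zero] at h0 h1 h2 h3
    set e := exp (I * z * L) with he
    set B := K / ‖z‖ with hB
    have he2 : exp (2 * I * z * L) = e ^ 2 := by
      rw [he, ← exp_nat_mul]; congr 1; push_cast; ring
    have hen : Real.exp (|z.im| * L) * ‖e‖ = 1 := by
      rw [he, norm_exp_I_mul, ← Real.exp_add, abs_of_nonneg hz]; simp
    have hene : e ≠ 0 := exp_ne_zero _
    rw [he2] at h3
    have red : ∀ u : ℂ, ‖e * u‖ ≤ 2 * B → ‖u‖ ≤ 2 * K * Real.exp (|z.im| * L) / ‖z‖ := fun u hu => by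
      rw [norm_mul] at hu
      have : ‖u‖ = Real.exp (|z.im| * L) * (‖e‖ * ‖u‖) := by
        rw [← mul_assoc, hen, one_mul]
      rw [this]
      calc _ ≤ Real.exp (|z.im| * L) * (2 * B) := by gcongr
        _ = _ := by rw [hB]; ring
    have hinv : exp (-(z * L) * I) = e⁻¹ := by
      rw [he, ← exp_neg]; congr 1; ring
    have hinv' : exp (z * L * I) = e := by
      rw [he]; congr 1; ring
    obtain ⟨f1, f2, f3, f4⟩ := ms_formulas q L z
    have four : ∀ a b c d : ℂ, ‖a‖ ≤ B → ‖b‖ ≤ B → ‖c‖ ≤ B → ‖d‖ ≤ B →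
        ‖(a - b + c - d) / 2‖ ≤ 2 * B := fun a b c d ha hb hc hd => by
      rw [norm_div, norm_ofNat, div_le_iff₀ two_pos]
      linarith [norm_sub_le (a - b + c) d, norm_add_le (a - b) c, norm_sub_le a b]
    refine ⟨red _ ?_, red _ ?_, red _ ?_⟩
    · rw [f2, sin, hinv, hinv']
      have := four _ _ _ _ h0 h2 h1 h3
      have e1 : e * (I * (ps q 0 0 L z - ps q 0 1 L z + ps q 1 0 L z - ps q 1 1 L z) / 2 -
        (e⁻¹ - e) * I / 2) = I * ((e * ps q 0 0 L z - 1 - e * ps q 0 1 L z +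
          e * ps q 1 0 L z - (e * ps q 1 1 L z - e ^ 2)) / 2) := by
        field_simp; ring
      rw [e1, norm_mul, norm_I, one_mul]
      exact this
    · rw [discriminant_eq_ps, cos, hinv, hinv']
      have e1 : e * ((ps q 0 0 L z + ps q 1 1 L z) / 2 - (e + e⁻¹) / 2) =
          (e * ps q 0 0 L z - 1 + (e * ps q 1 1 L z - e ^ 2)) / 2 := by
        field_simp; ring
      rw [e1, norm_div, norm_ofNat, div_le_iff₀ two_pos]
      have hB0 : 0 ≤ B := (norm_nonneg _).trans h0
      linarith [norm_add_le (e * ps q 0 0 L z - 1) (e * ps q 1 1 L z - e ^ 2)]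
    · rw [f1, f4]
      have e1 : e * (((ps q 0 0 L z - ps q 0 1 L z - ps q 1 0 L z + ps q 1 1 L z) / 2 -
          (ps q 0 0 L z + ps q 0 1 L z + ps q 1 0 L z + ps q 1 1 L z) / 2) / 2) =
          -(e * ps q 0 1 L z + e * ps q 1 0 L z) / 2 := by ring
      rw [e1, norm_div, norm_neg, norm_ofNat, div_le_iff₀ two_pos]
      have hB0 : 0 ≤ B := (norm_nonneg _).trans h0
      linarith [norm_add_le (e * ps q 0 1 L z) (e * ps q 1 0 L z)]
  refine ⟨2 * K, by positivity, fun z hz1 => ?_⟩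
  rcases le_total 0 z.im with hz | hz
  · exact up z hz hz1
  · have hu := up (conj z) (by simpa using hz) (by simpa using hz1)
    have hcL : conj z * (L : ℂ) = conj (z * L) := by simp
    rw [ms_conj h.cont, ms_conj h.cont, ms_conj h.cont, discriminant_conj h.cont, hcL,
      Complex.sin_conj, Complex.cos_conj, ← map_sub, ← map_sub, ← map_sub, norm_conj,
      norm_conj, norm_conj, conj_im, abs_neg, norm_div, norm_conj,
      ← norm_div] at hu
    exact hu

theorem im_mul_ofReal_abs (hL : 0 < L) (z : ℂ) : |(z * L).im| = |z.im| * L := by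
  rw [Complex.im_mul_ofReal, abs_mul, abs_of_pos hL]

/-- `Δ² - 1 = -sin²(zL) + O(e^{2L|Im z|}/z)`. -/
theorem Admissible.exists_asymptotics_sq (h : Admissible q L Q) :
    ∃ K : ℝ, 0 ≤ K ∧ ∀ z : ℂ, 1 ≤ ‖z‖ → ‖Δ z ^ 2 - 1 + sin (z * L) ^ 2‖ ≤
        K * Real.exp (|z.im| * L) ^ 2 / ‖z‖ := by
  obtain ⟨K, hK, hb⟩ := h.exists_asymptotics
  refine ⟨K * (K + 2), by positivity, fun z hz => ?_⟩
  have h1 := (hb z hz).2.1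
  set E := Real.exp (|z.im| * L)
  have hE : 0 < E := Real.exp_pos _
  have hc : ‖cos (z * L)‖ ≤ E := by
    have := norm_cos_le (z * L)
    rwa [im_mul_ofReal_abs h.pos] at this
  set d := Δ z - cos (z * L) with hd
  have e : Δ z ^ 2 - 1 + sin (z * L) ^ 2 = d * (d + 2 * cos (z * L)) := by
    rw [hd]; linear_combination Complex.sin_sq_add_cos_sq (z * L)
  have hd1 : ‖d‖ ≤ K * E := h1.trans (div_le_self (by positivity) hz)
  have hd2 : ‖d + 2 * cos (z * L)‖ ≤ (K + 2) * E := by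
    refine (norm_add_le _ _).trans ?_
    rw [norm_mul, norm_ofNat]
    linarith
  rw [e, norm_mul]
  calc _ ≤ K * E / ‖z‖ * ((K + 2) * E) := by gcongr
    _ = _ := by ring

/-- Away from the points `nπ/L` the functions `ỹ₁₂(L,·)` and `Δ² - 1` are as large as the leading
terms of their asymptotics. -/
theorem Admissible.exists_lower_bound (h : Admissible q L Q) {δ : ℝ} (hδ : 0 < δ) :
    ∃ c K : ℝ, 0 < c ∧ 1 ≤ K ∧ ∀ z : ℂ, K ≤ ‖z‖ → (∀ n : ℤ, δ ≤ ‖z * L - n * π‖) →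
      c * Real.exp (|z.im| * L) ≤ ‖sin (z * L)‖ ∧
      c * Real.exp (|z.im| * L) ≤ ‖ms q 0 1 L z‖ ∧
      c * Real.exp (|z.im| * L) ^ 2 ≤ ‖Δ z ^ 2 - 1‖ := by
  obtain ⟨K, hK, hb⟩ := h.exists_asymptotics
  obtain ⟨K', hK', hb'⟩ := h.exists_asymptotics_sq
  obtain ⟨c, hc, hs⟩ := exists_le_norm_sin hδ
  refine ⟨min (c / 2) (c ^ 2 / 2), max 1 (max (2 * K / c) (2 * K' / c ^ 2)), by positivity,
    le_max_left _ _, fun z hz hn => ?_⟩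
  have hz1 : 1 ≤ ‖z‖ := (le_max_left _ _).trans hz
  have hz2 : 2 * K / c ≤ ‖z‖ := (le_max_left _ _).trans ((le_max_right _ _).trans hz)
  have hz3 : 2 * K' / c ^ 2 ≤ ‖z‖ := (le_max_right _ _).trans ((le_max_right _ _).trans hz)
  have hz0 : 0 < ‖z‖ := by linarith
  have h1 := (hb z hz1).1
  have h2 := hb' z hz1
  have h3 := hs (z * L) hn
  rw [im_mul_ofReal_abs h.pos] at h3
  set E := Real.exp (|z.im| * L)
  have hE : 0 < E := Real.exp_pos _
  have k1 : min (c / 2) (c ^ 2 / 2) * E ≤ c / 2 * E := by gcongr; exact min_le_left _ _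
  have k2 : min (c / 2) (c ^ 2 / 2) * E ^ 2 ≤ c ^ 2 / 2 * E ^ 2 := by gcongr; exact min_le_right _ _
  have k3 : K * E / ‖z‖ ≤ c / 2 * E := by
    rw [div_le_iff₀ hz0]
    rw [div_le_iff₀ hc] at hz2
    nlinarith
  have k4 : K' * E ^ 2 / ‖z‖ ≤ c ^ 2 / 2 * E ^ 2 := by
    rw [div_le_iff₀ hz0]
    rw [div_le_iff₀ (by positivity)] at hz3
    nlinarith [sq_nonneg E]
  refine ⟨by nlinarith, ?_, ?_⟩
  · have := norm_sub_norm_le (sin (z * L)) (sin (z * L) - ms q 0 1 L z)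
    rw [sub_sub_cancel, norm_sub_rev] at this
    nlinarith
  · have := norm_sub_norm_le (sin (z * L) ^ 2)
      (Δ z ^ 2 - 1 + sin (z * L) ^ 2)
    rw [← norm_neg (_ - _), neg_sub, add_sub_cancel_right, norm_pow] at this
    have h4 : (c * E) ^ 2 ≤ ‖sin (z * L)‖ ^ 2 := by gcongr
    nlinarith

/-- `ỹ₁₂(L,·)` is of exponential type. -/
theorem Admissible.exists_norm_le (h : Admissible q L Q) :
    ∃ K : ℝ, 0 < K ∧ ∀ z : ℂ, ‖ms q 0 1 L z‖ ≤ K * Real.exp (|z.im| * L) ∧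
      ‖Δ z‖ ≤ K * Real.exp (|z.im| * L) := by
  have hb : ∀ i j z, ‖ps q i j L z‖ ≤ Real.exp (Q * L) * Real.exp (|z.im| * L) := fun i j z => by
    refine (norm_ps_le h.cont h.bound i j L z).trans (le_of_eq ?_)
    rw [← Real.exp_add, abs_of_pos h.pos]; ring_nf
  refine ⟨2 * Real.exp (Q * L), by positivity, fun z => ⟨?_, ?_⟩⟩
  · rw [(ms_formulas q L z).2.1, norm_div, norm_mul, norm_I, one_mul, norm_ofNat,
      div_le_iff₀ two_pos]
    linarith [hb 0 0 z, hb 0 1 z, hb 1 0 z, hb 1 1 z,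
      norm_sub_le (ps q 0 0 L z - ps q 0 1 L z + ps q 1 0 L z) (ps q 1 1 L z),
      norm_add_le (ps q 0 0 L z - ps q 0 1 L z) (ps q 1 0 L z),
      norm_sub_le (ps q 0 0 L z) (ps q 0 1 L z)]
  · rw [discriminant_eq_ps, norm_div, norm_ofNat, div_le_iff₀ two_pos]
    have : 0 ≤ Real.exp (Q * L) * Real.exp (|z.im| * L) := by positivity
    linarith [hb 0 0 z, hb 1 1 z, norm_add_le (ps q 0 0 L z) (ps q 1 1 L z)]

/-- The discriminant is Lipschitz continuous on the real line. -/
theorem Admissible.exists_lipschitz (h : Admissible q L Q) :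
    ∃ K : ℝ, 0 < K ∧ ∀ s t : ℝ, ‖Δ s - Δ t‖ ≤ K * |s - t| := by
  obtain ⟨K, hK, hb⟩ := h.exists_norm_le
  have hdiff := differentiable_discriminant (L := L) h.cont h.bound
  refine ⟨K * Real.exp L, by positivity, fun s t => ?_⟩
  have hder : ∀ x : ℝ, ‖deriv Δ x‖ ≤ K * Real.exp L := fun x => by
    have := norm_deriv_le_of_forall_mem_sphere_norm_le (c := (x : ℂ)) (R := 1)
      (C := K * Real.exp L) one_pos (hdiff.diffContOnCl) (fun z hz => ?_)
    · simpa using this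
    · refine (hb z).2.trans ?_
      gcongr
      have h1 : ‖z - x‖ = 1 := by simpa using hz
      have h2 := abs_im_le_norm (z - x)
      rw [h1] at h2
      simp only [sub_im, ofReal_im, sub_zero] at h2
      nlinarith [h.pos]
  have := (convex_univ (𝕜 := ℝ) (E := ℝ)).norm_image_sub_le_of_norm_hasDerivWithin_le
    (f := fun x : ℝ => Δ x) (f' := fun x : ℝ => deriv Δ x)
    (fun x _ => ((hdiff x).hasDerivAt.comp_ofReal).hasDerivWithinAt) (fun x _ => hder x)
    (mem_univ t) (mem_univ s)
  simpa using this

/-! ### Real restrictions of the discriminant and of `ỹ₁₂` -/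

/-- The discriminant as a real function on the real line. -/
def dR (q : ℝ → ℂ) (L s : ℝ) : ℝ := (discriminant q L s).re

/-- The function `ỹ₁₂(L,·)` as a real function on the real line. -/
def mR (q : ℝ → ℂ) (L s : ℝ) : ℝ := (ms q 0 1 L s).re

namespace Admissible

variable (h : Admissible q L Q)
include h

theorem discriminant_eq (s : ℝ) :
    Δ s = (dR q L s : ℂ) := by
  rw [dR, discriminant_ofReal h.cont, ofReal_re]

theorem ms_eq (s : ℝ) : ms q 0 1 L s = (mR q L s : ℂ) := by
  rw [mR, ms_zero_one_ofReal h.cont, ofReal_re]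

theorem ms_eq_zero_iff {s : ℝ} :
    ms q 0 1 L s = 0 ↔ mR q L s = 0 := by
  rw [h.ms_eq, Complex.ofReal_eq_zero]

theorem discriminant_sq_eq_one_iff {s : ℝ} :
    Δ s ^ 2 = 1 ↔ dR q L s ^ 2 = 1 := by
  rw [h.discriminant_eq]; norm_cast

theorem hasDerivAt_dR (s : ℝ) :
    HasDerivAt (dR q L) (deriv Δ s).re s :=
  ((differentiable_discriminant h.cont h.bound) s).hasDerivAt.real_of_complex

theorem hasDerivAt_mR (s : ℝ) :
    HasDerivAt (mR q L) (deriv (fun z => ms q 0 1 L z) s).re s :=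
  ((differentiable_ms h.cont h.bound 0 1 L) s).hasDerivAt.real_of_complex

theorem differentiable_dR : Differentiable ℝ (dR q L) :=
  fun s => (h.hasDerivAt_dR s).differentiableAt

theorem continuous_mR : Continuous (mR q L) :=
  continuous_iff_continuousAt.2 fun s => (h.hasDerivAt_mR s).continuousAt

theorem deriv_dR_mul_neg {s : ℝ} (h1 : dR q L s ^ 2 ≤ 1)
    (h0 : mR q L s ≠ 0) : deriv (dR q L) s * mR q L s < 0 := by
  obtain ⟨δ, hd, hδ⟩ := deriv_discriminant_mul_neg h.cont h.bound h.pos (s := s) h1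
    (mt h.ms_eq_zero_iff.1 h0)
  rw [(h.hasDerivAt_dR s).deriv, hd.deriv]
  exact hδ

theorem of_mR_eq_zero {s : ℝ} (h0 : mR q L s = 0) :
    1 ≤ dR q L s ^ 2 ∧ 0 < deriv (mR q L) s * dR q L s := by
  have hz := h.ms_eq_zero_iff.2 h0
  obtain ⟨κ, hκ, hd⟩ := hasDerivAt_ms_of_eq_zero h.cont h.bound h.pos hz
  have h00 := ms_zero_zero_ofReal (L := L) h.cont s
  set x := (ps q 0 0 L s).re + (ps q 0 1 L s).re
  have hdet := ms_det h.cont L (s : ℂ)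
  rw [hz, h00, zero_mul, sub_zero] at hdet
  have hx : x ≠ 0 := by rintro hx; rw [hx] at hdet; simp at hdet
  have h11 : ms q 1 1 L s = ((x⁻¹ : ℝ) : ℂ) := by
    rw [Complex.ofReal_inv]; exact eq_inv_of_mul_eq_one_right hdet
  have hdR : dR q L s = (x + x⁻¹) / 2 := by
    have := h.discriminant_eq s
    rw [discriminant_eq_ms, h00, h11] at this
    exact_mod_cast this.symm
  have hx2 : 0 < x ^ 2 := by positivity
  rw [(h.hasDerivAt_mR s).deriv, hd.deriv, h00, hdR]
  constructor
  · have : ((x + x⁻¹) / 2) ^ 2 - 1 = ((x - x⁻¹) / 2) ^ 2 := by field_simp; ring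
    nlinarith [sq_nonneg ((x - x⁻¹) / 2)]
  · rw [← ofReal_mul, ofReal_re]
    have : κ * x * ((x + x⁻¹) / 2) = κ * (x ^ 2 + 1) / 2 := by field_simp
    rw [this]; positivity

/-- At a point where the monodromy matrix is `±I` the discriminant has a strict local extremum
`±1`. -/
theorem sq_lt_one_of_deriv_eq_zero {s : ℝ}
    (h1 : dR q L s ^ 2 = 1) (h0 : deriv (dR q L) s = 0) :
    mR q L s = 0 ∧ (∃ d : ℂ → ℂ, Differentiable ℂ d ∧ d s ≠ 0 ∧
      ∀ z, Δ z ^ 2 - 1 = (z - s) ^ 2 * d z) ∧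
      ∀ᶠ t in 𝓝[≠] s, dR q L t ^ 2 < 1 := by
  obtain ⟨α, β, -, hd⟩ := hasDerivAt_discriminant h.cont h.bound h.pos s
  have hd0 : deriv Δ s = 0 := by
    have := (h.hasDerivAt_dR s).deriv
    rw [h0, hd.deriv, ofReal_re] at this
    rw [hd.deriv, ← this, ofReal_zero]
  obtain ⟨hb, ha⟩ := ps_eq_zero_of_deriv_eq_zero h.cont h.bound h.pos
    (h.discriminant_sq_eq_one_iff.2 h1) hd0
  obtain ⟨d, hdd, ⟨c, hc, hdc⟩, hD⟩ := discriminant_double_zero h.cont h.bound h.pos hb ha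
  refine ⟨?_, ⟨d, hdd, ?_, hD⟩, ?_⟩
  · rw [mR, ms_zero_one_ofReal h.cont, ofReal_re, ha, hb]; simp
  · rw [hdc]; exact_mod_cast hc.ne
  · have hcont : ContinuousAt (fun t : ℝ => (d t).re) s :=
      (Complex.continuous_re.comp (hdd.continuous.comp continuous_ofReal)).continuousAt
    have hev : ∀ᶠ t : ℝ in 𝓝 s, (d t).re < 0 :=
      hcont.eventually_lt continuousAt_const (by simpa [hdc] using hc)
    filter_upwards [hev.filter_mono nhdsWithin_le_nhds, self_mem_nhdsWithin] with t ht hts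
    have e := congrArg Complex.re (hD t)
    rw [h.discriminant_eq, ← ofReal_sub, ← ofReal_pow, ← ofReal_pow,
      ← Complex.ofReal_one, ← ofReal_sub, ofReal_re, Complex.re_ofReal_mul] at e
    have : 0 < (t - s) ^ 2 := by
      have : t - s ≠ 0 := sub_ne_zero.2 hts
      positivity
    nlinarith

/-! ### Enumeration of the spectra -/

end Admissible

theorem exists_strictMono_int {Z : Set ℝ} (hd : ∀ x, ∀ᶠ y in 𝓝[≠] x, y ∉ Z)
    (hu : ∀ B, ∃ z ∈ Z, B < z) (hl : ∀ B, ∃ z ∈ Z, z < B) :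
    ∃ μ : ℤ → ℝ, StrictMono μ ∧ range μ = Z := by
  have hfin : ∀ a b : ℝ, (Z ∩ Icc a b).Finite := fun a b => by
    by_contra hinf
    obtain ⟨x, -, hx⟩ := Set.Infinite.exists_accPt_of_subset_isCompact hinf isCompact_Icc
      inter_subset_right
    rw [accPt_iff_frequently_nhdsNE] at hx
    exact hx ((hd x).mono fun y hy h => hy h.1)
  have : LocallyFiniteOrder Z := LocallyFiniteOrder.ofFiniteIcc fun a b => by
    refine Set.Finite.of_finite_image ((hfin a b).subset ?_)
      (Subtype.coe_injective.injOn (s := Icc a b))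
    rintro _ ⟨x, hx, rfl⟩
    exact ⟨x.2, hx.1, hx.2⟩
  have : NoMaxOrder Z := ⟨fun a => (hu a).elim fun z hz => ⟨⟨z, hz.1⟩, hz.2⟩⟩
  have : NoMinOrder Z := ⟨fun a => (hl a).elim fun z hz => ⟨⟨z, hz.1⟩, hz.2⟩⟩
  have : Nonempty Z := (hu 0).elim fun z hz => ⟨⟨z, hz.1⟩⟩
  let _ := LinearLocallyFiniteOrder.succOrder Z
  let _ := LinearLocallyFiniteOrder.predOrder Z
  let e : Z ≃o ℤ := orderIsoIntOfLinearSuccPredArch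
  refine ⟨fun j => e.symm j, fun i j hij => e.symm.strictMono hij, ?_⟩
  rw [show (fun j => (e.symm j : ℝ)) = Subtype.val ∘ e.symm from rfl, range_comp,
    e.symm.surjective.range_eq, image_univ, Subtype.range_coe]

theorem exists_mem_Ico_of_strictMono {μ : ℤ → ℝ} (hμ : StrictMono μ) (hu : ∀ B, ∃ j, B < μ j)
    (hl : ∀ B, ∃ j, μ j < B) (s : ℝ) : ∃ j, μ j ≤ s ∧ s < μ (j + 1) := by
  obtain ⟨i, hi⟩ := hl s
  obtain ⟨k, hk⟩ := hu s
  obtain ⟨j, hj, hmax⟩ := Int.exists_greatest_of_bdd (P := fun j => μ j ≤ s)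
    ⟨k, fun j hj => (hμ.lt_iff_lt.1 (hj.trans_lt hk)).le⟩ ⟨i, hi.le⟩
  refine ⟨j, hj, lt_of_not_ge fun h => ?_⟩
  have := hmax _ h
  omega

/-- If `f` decreases wherever `|f| ≤ 1`, it crosses the strip `[-1,1]` exactly once. -/
theorem exists_band {f : ℝ → ℝ} {a b : ℝ} (hab : a < b) (hf : Differentiable ℝ f)
    (hd : ∀ s ∈ Ioo a b, f s ^ 2 ≤ 1 → deriv f s < 0) (ha : 1 ≤ f a) (hb : f b ≤ -1) :
    ∃ α β, a ≤ α ∧ α < β ∧ β ≤ b ∧ f α = 1 ∧ f β = -1 ∧ (∀ s ∈ Ioo a α, 1 < f s) ∧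
      (∀ s ∈ Ioo α β, -1 < f s ∧ f s < 1) ∧ ∀ s ∈ Ioo β b, f s < -1 := by
  have stay : ∀ c : ℝ, c ^ 2 = 1 → ∀ x y, a < x → x < y → y < b → f x ≤ c → f y < c := by
    intro c hc x y hax hxy hyb hfx
    have hle : ∀ t ∈ Icc x y, f t ≤ c := fun t ht =>
      image_le_of_deriv_right_lt_deriv_boundary' (f := f) (f' := deriv f) (B := fun _ => c)
        (B' := fun _ => 0) hf.continuous.continuousOn
        (fun u _ => (hf u).hasDerivAt.hasDerivWithinAt) hfx continuousOn_const
        (fun u _ => hasDerivWithinAt_const _ _ _)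
        (fun u hu he => hd u ⟨hax.trans_le hu.1, hu.2.trans hyb⟩ (by rw [he, hc])) ht
    refine lt_of_le_of_ne (hle y ⟨hxy.le, le_rfl⟩) fun he => ?_
    have hneg := hd y ⟨hax.trans hxy, hyb⟩ (by rw [he, hc])
    have hs := ((hasDerivAt_iff_tendsto_slope.1 (hf y).hasDerivAt).mono_left
      (nhdsWithin_mono y (fun t (ht : t < y) => ne_of_lt ht) : 𝓝[<] y ≤ 𝓝[≠] y))
    refine hneg.not_ge (ge_of_tendsto hs ?_)
    filter_upwards [Ioo_mem_nhdsLT hxy] with t ht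
    rw [slope_def_field]
    exact div_nonneg_of_nonpos (by linarith [hle t ⟨ht.1.le, ht.2.le⟩]) (by linarith [ht.2])
  have hA : IsCompact (Icc a b ∩ f ⁻¹' Ici 1) :=
    isCompact_Icc.inter_right (isClosed_Ici.preimage hf.continuous)
  have hB : IsCompact (Icc a b ∩ f ⁻¹' Iic (-1)) :=
    isCompact_Icc.inter_right (isClosed_Iic.preimage hf.continuous)
  obtain ⟨α, ⟨hα, hfα⟩, hαmax⟩ := hA.exists_isGreatest ⟨a, ⟨le_rfl, hab.le⟩, ha⟩
  obtain ⟨β, ⟨hβ, hfβ⟩, hβmin⟩ := hB.exists_isLeast ⟨b, ⟨hab.le, le_rfl⟩, hb⟩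
  simp only [mem_preimage, mem_Ici, mem_Iic] at hfα hfβ
  have hαb : α < b := lt_of_le_of_ne hα.2 (by rintro rfl; linarith)
  have haβ : a < β := lt_of_le_of_ne hβ.1 (by rintro rfl; linarith)
  have hαβ : α < β := by
    by_contra! hle
    have hlt : β < α := lt_of_le_of_ne hle (by rintro rfl; linarith)
    have := stay 1 (by norm_num) β α haβ hlt hαb (by linarith)
    linarith
  have h1 : ∀ s, α < s → s ≤ b → f s < 1 := fun s hs hsb => by
    by_contra! h
    exact (hαmax ⟨⟨hα.1.trans hs.le, hsb⟩, h⟩).not_gt hs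
  have h2 : ∀ s, a ≤ s → s < β → -1 < f s := fun s has hs => by
    by_contra! h
    exact (hβmin ⟨⟨has, hs.le.trans hβ.2⟩, h⟩).not_gt hs
  have e1 : f α = 1 := le_antisymm (le_of_tendsto
    (hf.continuous.continuousAt.mono_left nhdsWithin_le_nhds : Tendsto f (𝓝[>] α) (𝓝 (f α)))
    (by filter_upwards [Ioo_mem_nhdsGT hαb] with t ht using (h1 t ht.1 ht.2.le).le)) hfα
  have e2 : f β = -1 := le_antisymm hfβ (ge_of_tendsto
    (hf.continuous.continuousAt.mono_left nhdsWithin_le_nhds : Tendsto f (𝓝[<] β) (𝓝 (f β)))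
    (by filter_upwards [Ioo_mem_nhdsLT haβ] with t ht using (h2 t ht.1.le ht.2).le))
  refine ⟨α, β, hα.1, hαβ, hβ.2, e1, e2, fun s hs => ?_, fun s hs => ⟨h2 s (hα.1.trans hs.1.le) hs.2,
    h1 s hs.1 (hs.2.le.trans hβ.2)⟩, fun s hs => ?_⟩
  · by_contra! h
    have := stay 1 (by norm_num) s α hs.1 hs.2 hαb h
    linarith
  · obtain ⟨u, hu1, hu2⟩ : ∃ u, β < u ∧ u < s := exists_between hs.1
    exact stay (-1) (by norm_num) β s haβ hs.1 hs.2 e2.le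

/-- Between two consecutive zeros of `ỹ₁₂` there is exactly one band. -/
theorem Admissible.exists_band (h : Admissible q L Q) {a b : ℝ} (hab : a < b) (ha : mR q L a = 0)
    (hb : mR q L b = 0) (hne : ∀ s ∈ Ioo a b, mR q L s ≠ 0) :
    ∃ α β, a ≤ α ∧ α < β ∧ β ≤ b ∧ dR q L α ^ 2 = 1 ∧ dR q L β ^ 2 = 1 ∧
      (∀ s ∈ Ioo a α, 1 < dR q L s ^ 2) ∧ (∀ s ∈ Ioo α β, dR q L s ^ 2 < 1) ∧
      ∀ s ∈ Ioo β b, 1 < dR q L s ^ 2 := by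
  obtain ⟨a1, a2⟩ := h.of_mR_eq_zero ha
  obtain ⟨b1, b2⟩ := h.of_mR_eq_zero hb
  -- `ε` is the sign of the discriminant at the left end
  have main : ∀ ε : ℝ, ε ^ 2 = 1 → 0 < ε * dR q L a → ∃ α β, a ≤ α ∧ α < β ∧ β ≤ b ∧
      dR q L α ^ 2 = 1 ∧ dR q L β ^ 2 = 1 ∧
      (∀ s ∈ Ioo a α, 1 < dR q L s ^ 2) ∧ (∀ s ∈ Ioo α β, dR q L s ^ 2 < 1) ∧
      ∀ s ∈ Ioo β b, 1 < dR q L s ^ 2 := by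
    intro ε hε hpos
    have hsq : ∀ s, (ε * dR q L s) ^ 2 = dR q L s ^ 2 := fun s => by rw [mul_pow, hε, one_mul]
    have hεne : ε ≠ 0 := by rintro rfl; norm_num at hε
    have hdm : ∀ s, HasDerivAt (fun t => ε * mR q L t) (ε * deriv (mR q L) s) s := fun s =>
      ((h.hasDerivAt_mR s).differentiableAt.hasDerivAt.const_mul ε)
    have hcm : Continuous fun t => ε * mR q L t := continuous_const.mul h.continuous_mR
    have hda : 0 < ε * deriv (mR q L) a := by
      have : 0 < (ε * deriv (mR q L) a) * (ε * dR q L a) := by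
        have e : (ε * deriv (mR q L) a) * (ε * dR q L a) =
          ε ^ 2 * (deriv (mR q L) a * dR q L a) := by ring
        rw [e, hε, one_mul]; exact a2
      exact pos_of_mul_pos_left this hpos.le
    have hmpos : ∀ s ∈ Ioo a b, 0 < ε * mR q L s := by
      have hev := eventually_nhdsWithin_sign_eq_of_deriv_pos
        (f := fun t => ε * mR q L t) (x₀ := a) (by rw [(hdm a).deriv]; exact hda) (by simp [ha])
      have hev' : ∀ᶠ t in 𝓝[>] a, t ∈ Ioo a b ∧ 0 < ε * mR q L t := by
        filter_upwards [hev.filter_mono nhdsWithin_le_nhds, Ioo_mem_nhdsGT hab] with t ht ht'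
        refine ⟨ht', ?_⟩
        rw [sign_pos (sub_pos.2 ht'.1), sign_eq_one_iff] at ht
        exact ht
      obtain ⟨t, ht, htp⟩ := hev'.exists
      intro s hs
      by_contra! hle
      obtain ⟨u, hu, hu0⟩ := isPreconnected_Ioo.intermediate_value hs ht hcm.continuousOn ⟨hle, htp.le⟩
      exact hne u hu ((mul_eq_zero.1 hu0).resolve_left hεne)
    have hdb : ε * dR q L b ≤ -1 := by
      have hneg : ε * dR q L b < 0 := by
        by_contra! hle
        have hdbne : dR q L b ≠ 0 := by intro h0; rw [h0] at b1; norm_num at b1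
        have hp : 0 < ε * dR q L b := lt_of_le_of_ne hle (mul_ne_zero hεne hdbne).symm
        have hdp : 0 < ε * deriv (mR q L) b := by
          have : 0 < (ε * deriv (mR q L) b) * (ε * dR q L b) := by
            have e : (ε * deriv (mR q L) b) * (ε * dR q L b) =
              ε ^ 2 * (deriv (mR q L) b * dR q L b) := by ring
            rw [e, hε, one_mul]; exact b2
          exact pos_of_mul_pos_left this hp.le
        have hev := eventually_nhdsWithin_sign_eq_of_deriv_pos
          (f := fun t => ε * mR q L t) (x₀ := b) (by rw [(hdm b).deriv]; exact hdp) (by simp [hb])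
        have hev' : ∀ᶠ t in 𝓝[<] b, t ∈ Ioo a b ∧ ε * mR q L t < 0 := by
          filter_upwards [hev.filter_mono nhdsWithin_le_nhds, Ioo_mem_nhdsLT hab] with t ht ht'
          refine ⟨ht', ?_⟩
          rw [sign_neg (sub_neg.2 ht'.2), sign_eq_neg_one_iff] at ht
          exact ht
        obtain ⟨t, ht, htn⟩ := hev'.exists
        linarith [hmpos t ht]
      have := hsq b
      nlinarith
    have hda1 : 1 ≤ ε * dR q L a := by
      have := hsq a
      nlinarith
    have hfd : Differentiable ℝ fun s => ε * dR q L s := h.differentiable_dR.const_mul ε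
    obtain ⟨α, β, h1, h2, h3, h4, h5, h6, h7, h8⟩ := ZSP.exists_band hab hfd (fun s hs hs1 => by
      have hs1' : dR q L s ^ 2 ≤ 1 := by rw [← hsq]; exact hs1
      have k := h.deriv_dR_mul_neg hs1' (hne s hs)
      have e : deriv (fun s => ε * dR q L s) s = ε * deriv (dR q L) s :=
        ((h.differentiable_dR s).hasDerivAt.const_mul ε).deriv
      rw [e]
      have k2 : (ε * deriv (dR q L) s) * (ε * mR q L s) < 0 := by
        have e : (ε * deriv (dR q L) s) * (ε * mR q L s) =
          ε ^ 2 * (deriv (dR q L) s * mR q L s) := by ring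
        rw [e, hε, one_mul]; exact k
      exact neg_of_mul_neg_left k2 (hmpos s hs).le) hda1 hdb
    refine ⟨α, β, h1, h2, h3, by rw [← hsq, h4]; norm_num, by rw [← hsq, h5]; norm_num,
      fun s hs => ?_, fun s hs => ?_, fun s hs => ?_⟩
    · rw [← hsq]; nlinarith [h6 s hs]
    · rw [← hsq]; nlinarith [h7 s hs]
    · rw [← hsq]; nlinarith [h8 s hs]
  have hdane : dR q L a ≠ 0 := by intro h0; rw [h0] at a1; norm_num at a1
  rcases lt_or_gt_of_ne hdane with hlt | hgt
  · exact main (-1) (by norm_num) (by linarith)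
  · exact main 1 (by norm_num) (by linarith)

theorem Admissible.exists_sign_alternation (h : Admissible q L Q) :
    ∃ K : ℝ, ∀ n : ℤ, K < |(n + 1 / 2) * π / L| →
      0 < (-1 : ℝ) ^ n * mR q L ((n + 1 / 2) * π / L) := by
  obtain ⟨K, hK, hb⟩ := h.exists_asymptotics
  refine ⟨max K 1, fun n hn => ?_⟩
  set s := (n + 1 / 2) * π / L with hs
  have h1 : 1 < |s| := (le_max_right _ _).trans_lt hn
  have h2 : K < |s| := (le_max_left _ _).trans_lt hn
  have hns : ‖(s : ℂ)‖ = |s| := by rw [norm_real, Real.norm_eq_abs]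
  have hb1 := (hb s (by rw [hns]; exact h1.le)).1
  have hsL : s * L = n * π + π / 2 := by
    rw [hs]; field_simp [h.pos.ne']
  have hsin : Real.sin (s * L) = (-1 : ℝ) ^ n := by
    rw [hsL, Real.sin_add_pi_div_two, Real.cos_int_mul_pi]
  rw [h.ms_eq, ← ofReal_mul, ← Complex.ofReal_sin, ← ofReal_sub, hsin,
    norm_real, hns, ofReal_im, abs_zero, zero_mul, Real.exp_zero, mul_one,
    Real.norm_eq_abs] at hb1
  have hlt : K / |s| < 1 := by rw [div_lt_one (by linarith)]; exact h2
  have := abs_lt.1 (hb1.trans_lt hlt)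
  rcases Int.even_or_odd n with e | e <;> rw [e.neg_one_zpow] at this ⊢ <;>
    linarith [this.1, this.2]

theorem Admissible.exists_zero_between (h : Admissible q L Q) : ∃ K : ℝ, ∀ n : ℤ,
    K < |(n + 1 / 2) * π / L| → K < |(n + 1 + 1 / 2) * π / L| →
    ∃ s, mR q L s = 0 ∧ (n + 1 / 2) * π / L < s ∧ s < (n + 1 + 1 / 2) * π / L := by
  obtain ⟨K, hK⟩ := h.exists_sign_alternation
  refine ⟨K, fun n h1 h2 => ?_⟩
  have k1 := hK n h1
  have k2 := hK (n + 1) (by push_cast; exact h2)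
  push_cast at k2
  rw [zpow_add_one₀ (by norm_num)] at k2
  set a := (n + 1 / 2) * π / L
  set b := (n + 1 + 1 / 2) * π / L
  have hab : a ≤ b := by
    have := h.pos
    have := Real.pi_pos
    simp only [a, b]; gcongr; linarith
  obtain ⟨s, hs, hs0⟩ := intermediate_value_Icc' hab
    ((continuous_const.mul h.continuous_mR).continuousOn (f := fun s => (-1 : ℝ) ^ n * mR q L s))
    (show (0 : ℝ) ∈ Icc _ _ from ⟨by linarith, k1.le⟩)
  have hs0' : mR q L s = 0 := (mul_eq_zero.1 hs0).resolve_left (zpow_ne_zero _ (by norm_num))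
  refine ⟨s, hs0', lt_of_le_of_ne hs.1 ?_, lt_of_le_of_ne hs.2 ?_⟩
  · rintro rfl; rw [hs0'] at k1; simp at k1
  · rintro rfl; rw [hs0'] at k2; simp at k2

theorem Admissible.exists_zero_gt_and_lt (h : Admissible q L Q) (B : ℝ) :
    (∃ s, mR q L s = 0 ∧ B < s) ∧ ∃ s, mR q L s = 0 ∧ s < B := by
  obtain ⟨K, hK⟩ := h.exists_zero_between
  have hpi := Real.pi_pos
  have hL := h.pos
  have mono : ∀ x y : ℝ, x < y → x * π / L < y * π / L := fun x y hxy =>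
    div_lt_div_of_pos_right (mul_lt_mul_of_pos_right hxy hpi) hL
  constructor
  · obtain ⟨n, hn⟩ := exists_int_gt (max |K| |B| * L / π)
    have hle : max |K| |B| < n * π / L := by
      rw [lt_div_iff₀ hL]; rwa [div_lt_iff₀ hpi] at hn
    have e1 := mono n (n + 1 / 2) (by linarith)
    have e2 := mono n (n + 1 + 1 / 2) (by linarith)
    have hKn := (le_abs_self K).trans (le_max_left |K| |B|)
    have hBn := (le_abs_self B).trans (le_max_right |K| |B|)
    obtain ⟨s, hs, hs1, -⟩ := hK n ((by linarith : K < _).trans_le (le_abs_self _))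
      ((by linarith : K < _).trans_le (le_abs_self _))
    exact ⟨s, hs, by linarith⟩
  · obtain ⟨n, hn⟩ := exists_int_lt (-(max |K| |B| * L / π) - 2)
    have hle : (n + 2) * π / L < - max |K| |B| := by
      rw [div_lt_iff₀ hL]
      have : (n + 2 : ℝ) < -(max |K| |B| * L / π) := by linarith
      calc (n + 2 : ℝ) * π < -(max |K| |B| * L / π) * π := by gcongr
        _ = _ := by field_simp
    have e1 := mono (n + 1 / 2) (n + 2) (by linarith)
    have e2 := mono (n + 1 + 1 / 2) (n + 2) (by linarith)
    have hKn := (le_abs_self K).trans (le_max_left |K| |B|)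
    have hBn := (neg_le_abs B).trans (le_max_right |K| |B|)
    obtain ⟨s, hs, -, hs1⟩ := hK n ((by linarith : K < _).trans_le (neg_le_abs _))
      ((by linarith : K < _).trans_le (neg_le_abs _))
    exact ⟨s, hs, by linarith⟩

theorem Admissible.exists_dirichlet_enumeration (h : Admissible q L Q) :
    ∃ μ : ℤ → ℝ, StrictMono μ ∧ range μ = {s | mR q L s = 0} := by
  refine exists_strictMono_int (fun x => ?_) (fun B => (h.exists_zero_gt_and_lt B).1)
    (fun B => (h.exists_zero_gt_and_lt B).2)
  rcases eq_or_ne (mR q L x) 0 with h0 | h0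
  · have hd := (h.of_mR_eq_zero h0).2
    exact (h.hasDerivAt_mR x).differentiableAt.hasDerivAt.eventually_ne
      (left_ne_zero_of_mul hd.ne')
  · exact (h.continuous_mR.continuousAt.eventually_ne h0).filter_mono nhdsWithin_le_nhds

theorem Admissible.im_eq_zero_of_mem (h : Admissible q L Q) {t : ℝ}
    (ht : t ∈ Icc (-1 : ℝ) 1) (hz : Δ z = t) :
    z = (z.re : ℂ) ∧ dR q L z.re = t := by
  have h0 := im_eq_zero_of_discriminant_mem h.cont h.pos ht hz
  have e : z = (z.re : ℂ) := Complex.ext (by simp) (by simp [h0])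
  refine ⟨e, ?_⟩
  rw [e, h.discriminant_eq] at hz
  exact_mod_cast hz

/-- The spectral data can be enumerated. The Dirichlet eigenvalues form a sequence of order type
`ℤ`, and between any two neighbours there is exactly one band. -/
theorem Admissible.exists_isSpectralEnumeration (h : Admissible q L Q) :
    ∃ ζ μ : ℤ → ℝ, IsSpectralEnumeration q L ζ μ := by
  obtain ⟨μ, hμ, hr⟩ := h.exists_dirichlet_enumeration
  have hμ0 : ∀ j, mR q L (μ j) = 0 := fun j => (hr ▸ mem_range_self j : μ j ∈ {s | mR q L s = 0})
  have hμi : ∀ s, mR q L s = 0 → ∃ j, μ j = s := fun s hs => by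
    have : s ∈ range μ := by rw [hr]; exact hs
    exact this
  have hband : ∀ j, ∃ α β, μ j ≤ α ∧ α < β ∧ β ≤ μ (j + 1) ∧ dR q L α ^ 2 = 1 ∧ dR q L β ^ 2 = 1 ∧
      (∀ s ∈ Ioo (μ j) α, 1 < dR q L s ^ 2) ∧ (∀ s ∈ Ioo α β, dR q L s ^ 2 < 1) ∧
      ∀ s ∈ Ioo β (μ (j + 1)), 1 < dR q L s ^ 2 := fun j =>
    h.exists_band (hμ (lt_add_one j)) (hμ0 j) (hμ0 (j + 1)) fun s hs h0 => by
      obtain ⟨i, rfl⟩ := hμi s h0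
      have h1 := hμ.lt_iff_lt.1 hs.1
      have h2 := hμ.lt_iff_lt.1 hs.2
      omega
  choose a b h1 h2 h3 h4 h5 h6 h7 h8 using hband
  have ham : StrictMono a := strictMono_int_of_lt_succ fun j =>
    (h2 j).trans_le ((h3 j).trans (h1 (j + 1)))
  have hu : ∀ B, ∃ j, B < μ j := fun B => by
    obtain ⟨s, hs, hB⟩ := (h.exists_zero_gt_and_lt B).1
    obtain ⟨j, rfl⟩ := hμi s hs
    exact ⟨j, hB⟩
  have hl : ∀ B, ∃ j, μ j < B := fun B => by
    obtain ⟨s, hs, hB⟩ := (h.exists_zero_gt_and_lt B).2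
    obtain ⟨j, rfl⟩ := hμi s hs
    exact ⟨j, hB⟩
  -- at a Dirichlet eigenvalue in the main spectrum one of the two neighbouring bands is adjacent
  have hedge : ∀ j, dR q L (μ j) ^ 2 = 1 → a j = μ j ∨ b (j - 1) = μ j := by
    intro j hj
    by_contra! hne
    have k1 : μ j < a j := lt_of_le_of_ne (h1 j) hne.1.symm
    have k2 : b (j - 1) < μ j := lt_of_le_of_ne (by simpa using h3 (j - 1)) hne.2
    have hev : ∀ᶠ t in 𝓝[≠] (μ j), 1 < dR q L t ^ 2 := by
      filter_upwards [(Ioo_mem_nhds k2 k1 : Ioo (b (j - 1)) (a j) ∈ 𝓝 (μ j)) |>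
        (fun hm => mem_nhdsWithin_of_mem_nhds hm), self_mem_nhdsWithin] with t ht hne
      rcases lt_or_gt_of_ne hne with hlt | hgt
      · exact h8 (j - 1) t ⟨ht.1, by simpa using hlt⟩
      · exact h6 j t ⟨hgt, ht.2⟩
    have hmin : IsLocalMin (fun t => dR q L t ^ 2) (μ j) := by
      have : ∀ᶠ t in 𝓝 (μ j), t ≠ μ j → 1 < dR q L t ^ 2 := eventually_nhdsWithin_iff.1 hev
      filter_upwards [this] with t ht
      rcases eq_or_ne t (μ j) with rfl | hne
      · exact le_rfl
      · simp only [hj]; exact (ht hne).le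
    have hd := hmin.hasDerivAt_eq_zero ((h.differentiable_dR (μ j)).hasDerivAt.pow 2)
    have hd0 : deriv (dR q L) (μ j) = 0 := by
      have hne : dR q L (μ j) ≠ 0 := by intro h0; rw [h0] at hj; norm_num at hj
      simpa [hne] using hd
    obtain ⟨t, ht1, ht2⟩ := (hev.and (h.sq_lt_one_of_deriv_eq_zero hj hd0).2.2).exists
    linarith
  have hcov : ∀ s, dR q L s ^ 2 ≤ 1 → (∃ j, s ∈ Icc (a j) (b j)) := by
    intro s hs
    obtain ⟨j, hj1, hj2⟩ := exists_mem_Ico_of_strictMono hμ hu hl s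
    rcases eq_or_lt_of_le hj1 with rfl | hlt
    · have hj := le_antisymm hs (h.of_mR_eq_zero (hμ0 j)).1
      rcases hedge j hj with e | e
      · exact ⟨j, e.le, e ▸ (h2 j).le⟩
      · exact ⟨j - 1, e ▸ (h2 (j - 1)).le, e.ge⟩
    · refine ⟨j, ?_, ?_⟩
      · by_contra! hc; linarith [h6 j s ⟨hlt, hc⟩]
      · by_contra! hc; linarith [h8 j s ⟨hc, hj2⟩]
  have hsq : ∀ j, ∀ s ∈ Icc (a j) (b j), dR q L s ^ 2 ≤ 1 := fun j s hs => by
    rcases eq_or_lt_of_le hs.1 with rfl | k1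
    · exact (h4 j).le
    rcases eq_or_lt_of_le hs.2 with rfl | k2
    · exact (h5 j).le
    exact (h7 j s ⟨k1, k2⟩).le
  have hmain : ∀ s, dR q L s ^ 2 = 1 → ∃ j, s = a j ∨ s = b j := fun s hs => by
    obtain ⟨j, hj⟩ := hcov s hs.le
    refine ⟨j, ?_⟩
    by_contra! hne
    linarith [h7 j s ⟨lt_of_le_of_ne hj.1 hne.1.symm, lt_of_le_of_ne hj.2 hne.2⟩]
  obtain ⟨k, hk, hkmin⟩ := Int.exists_least_of_bdd (P := fun j => 0 ≤ a j) (by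
    obtain ⟨i, hi⟩ := hl 0
    refine ⟨i - 1, fun j hj => ?_⟩
    have : a (i - 1) < a j := by
      have := (h2 (i - 1)).trans_le (h3 (i - 1))
      rw [sub_add_cancel] at this
      linarith
    exact (ham.lt_iff_lt.1 this).le) (by
    obtain ⟨i, hi⟩ := hu 0
    exact ⟨i, hi.le.trans (h1 i)⟩)
  set ζ : ℤ → ℝ := fun n => if Even n then a (n / 2 + k) else b (n / 2 + k) with hζ
  have ζe : ∀ j, ζ (2 * j) = a (j + k) := fun j => by simp [hζ]
  have ζo : ∀ j, ζ (2 * j + 1) = b (j + k) := fun j => by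
    have h1 : ¬ Even (2 * j + 1) := by simp
    have h2 : (2 * j + 1) / 2 = j := by omega
    simp only [hζ, if_neg h1, h2]
  have ζo' : ∀ j, ζ (2 * j - 1) = b (j + k - 1) := fun j => by
    rw [show 2 * j - 1 = 2 * (j - 1) + 1 by ring, ζo]; congr 1; ring
  have h3' : ∀ j, b (j - 1) ≤ μ j := fun j => by simpa using h3 (j - 1)
  refine ⟨ζ, fun j => μ (j + k), fun z => ⟨fun hz => ?_, ?_⟩, fun j => ?_, fun j => ?_,
    fun z => ⟨?_, ?_⟩, ?_, ?_, fun z => ?_, fun j => ?_⟩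
  · obtain ⟨t, ht, hzt⟩ : ∃ t ∈ Icc (-1 : ℝ) 1, Δ z = t := by
      rcases (sq_eq_sq_iff_eq_or_eq_neg.1 (hz.trans (one_pow 2).symm)) with e | e
      · exact ⟨1, by norm_num, by simpa using e⟩
      · exact ⟨-1, by norm_num, by simpa using e⟩
    obtain ⟨e, hd⟩ := h.im_eq_zero_of_mem ht hzt
    rw [e, h.discriminant_sq_eq_one_iff] at hz
    obtain ⟨j, hj | hj⟩ := hmain _ hz
    · exact ⟨2 * (j - k), by rw [ζe, sub_add_cancel, ← hj, ← e]⟩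
    · exact ⟨2 * (j - k) + 1, by rw [ζo, sub_add_cancel, ← hj, ← e]⟩
  · rintro ⟨n, rfl⟩
    rw [h.discriminant_sq_eq_one_iff]
    simp only [hζ]
    split_ifs
    exacts [h4 _, h5 _]
  · rw [ζo', ζe]; exact (h3' _).trans (h1 _)
  · rw [ζe, ζo]; exact h2 _
  · rintro ⟨t, ht, hzt⟩
    obtain ⟨e, hd⟩ := h.im_eq_zero_of_mem ht hzt
    obtain ⟨j, hj⟩ := hcov z.re (by rw [hd]; nlinarith [ht.1, ht.2])
    exact ⟨j - k, z.re, by rwa [ζe, ζo, sub_add_cancel], e⟩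
  · rintro ⟨j, s, hs, rfl⟩
    rw [ζe, ζo] at hs
    have := hsq _ s hs
    exact ⟨dR q L s, abs_le.1 ((sq_le_one_iff_abs_le_one _).1 this), h.discriminant_eq s⟩
  · rw [show (-2 : ℤ) = 2 * (-1) by norm_num, ζe]
    by_contra! hc
    have := hkmin _ hc
    omega
  · rw [show (0 : ℤ) = 2 * 0 by norm_num, ζe, zero_add]
    exact hk
  · rw [mem_dirichletSpectrum_iff h.cont h.pos]
    constructor
    · intro hz
      have h0 := im_eq_zero_of_ms_eq_zero h.cont h.pos hz
      have e : z = (z.re : ℂ) := Complex.ext (by simp) (by simp [h0])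
      rw [e, h.ms_eq_zero_iff] at hz
      obtain ⟨j, hj⟩ := hμi _ hz
      exact ⟨j - k, by rw [sub_add_cancel, hj, ← e]⟩
    · rintro ⟨j, rfl⟩
      exact h.ms_eq_zero_iff.2 (hμ0 _)
  · rw [ζo', ζe]
    exact ⟨h3' _, h1 _⟩

variable {ζ μ : ℤ → ℝ}

/-! ### Bands, gaps and Dirichlet eigenvalues of an enumeration -/

namespace IsSpectralEnumeration

variable (e : IsSpectralEnumeration q L ζ μ) (h : Admissible q L Q)
include e h

omit h in
theorem lt_succ (j : ℤ) : ζ (2 * j) < ζ (2 * (j + 1) - 1) := by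
  have := e.band_lt j
  rwa [show 2 * (j + 1) - 1 = 2 * j + 1 by ring]

omit h in
theorem monotone : Monotone ζ :=
  monotone_int_of_le_succ fun n => by
    obtain ⟨j, rfl | rfl⟩ := Int.even_or_odd' n
    · exact (e.band_lt j).le
    · have := e.gap_le (j + 1)
      rwa [show 2 * (j + 1) - 1 = 2 * j + 1 by ring,
        show 2 * (j + 1) = 2 * j + 1 + 1 by ring] at this

omit h in
theorem mu_lt_succ (j : ℤ) : μ j < μ (j + 1) :=
  (e.dirichlet_mem j).2.trans_lt ((e.lt_succ j).trans_le (e.dirichlet_mem (j + 1)).1)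

omit h in
theorem mu_strictMono : StrictMono μ :=
  strictMono_int_of_lt_succ e.mu_lt_succ

theorem ms_eq_zero_iff :
    ms q 0 1 L z = 0 ↔ ∃ j, z = μ j := by
  rw [← mem_dirichletSpectrum_iff h.cont h.pos, e.dirichlet_iff]

theorem mR_eq_zero_iff {s : ℝ} :
    mR q L s = 0 ↔ ∃ j, s = μ j := by
  rw [← h.ms_eq_zero_iff, e.ms_eq_zero_iff h]
  simp

theorem mR_mu (j : ℤ) :
    mR q L (μ j) = 0 := (e.mR_eq_zero_iff h).2 ⟨j, rfl⟩

theorem dR_sq_eq_one_iff {s : ℝ} :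
    dR q L s ^ 2 = 1 ↔ ∃ k, s = ζ k := by
  rw [← h.discriminant_sq_eq_one_iff, e.main_iff]
  simp

theorem dR_sq_le_one_iff {s : ℝ} :
    dR q L s ^ 2 ≤ 1 ↔ ∃ j, s ∈ Icc (ζ (2 * j)) (ζ (2 * j + 1)) := by
  have := e.band_iff (s : ℂ)
  simp only [Complex.ofReal_inj] at this
  constructor
  · intro hs
    obtain ⟨j, s', hs', rfl⟩ := this.1 ⟨dR q L s,
      abs_le.1 ((sq_le_one_iff_abs_le_one _).1 hs), h.discriminant_eq s⟩
    exact ⟨j, hs'⟩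
  · rintro ⟨j, hj⟩
    obtain ⟨t, ht, hst⟩ := this.2 ⟨j, s, hj, rfl⟩
    rw [h.discriminant_eq, Complex.ofReal_inj] at hst
    rw [hst]
    nlinarith [ht.1, ht.2]

theorem dR_sq_lt_one {j : ℤ} {s : ℝ}
    (hs : s ∈ Ioo (ζ (2 * j)) (ζ (2 * j + 1))) : dR q L s ^ 2 < 1 := by
  refine lt_of_le_of_ne ((e.dR_sq_le_one_iff h).2 ⟨j, hs.1.le, hs.2.le⟩) fun h1 => ?_
  obtain ⟨k, rfl⟩ := (e.dR_sq_eq_one_iff h).1 h1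
  have k1 : 2 * j < k := by
    by_contra! hc; exact (e.monotone hc).not_gt hs.1
  have k2 : k < 2 * j + 1 := by
    by_contra! hc; exact (e.monotone hc).not_gt hs.2
  omega

theorem one_lt_dR_sq {j : ℤ} {s : ℝ}
    (hs : s ∈ Ioo (ζ (2 * j - 1)) (ζ (2 * j))) : 1 < dR q L s ^ 2 := by
  by_contra! hle
  obtain ⟨i, hi⟩ := (e.dR_sq_le_one_iff h).1 hle
  have k1 : 2 * i < 2 * j := by
    by_contra! hc; exact ((e.monotone hc).trans hi.1).not_gt hs.2
  have k2 : 2 * j - 1 < 2 * i + 1 := by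
    by_contra! hc; exact (hi.2.trans (e.monotone hc)).not_gt hs.1
  omega

theorem one_le_dR_sq {j : ℤ} {s : ℝ}
    (hs : s ∈ Icc (ζ (2 * j - 1)) (ζ (2 * j))) : 1 ≤ dR q L s ^ 2 := by
  rcases eq_or_lt_of_le hs.1 with h1 | h1
  · exact ((e.dR_sq_eq_one_iff h).2 ⟨_, h1.symm⟩).ge
  rcases eq_or_lt_of_le hs.2 with h2 | h2
  · exact ((e.dR_sq_eq_one_iff h).2 ⟨_, h2⟩).ge
  exact (e.one_lt_dR_sq h ⟨h1, h2⟩).le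

omit e in
theorem mR_ne_zero_of_sq_lt {s : ℝ} (hs : dR q L s ^ 2 < 1) :
    mR q L s ≠ 0 := fun h0 => hs.not_ge (h.of_mR_eq_zero h0).1

/-- The band lengths are bounded below, because the discriminant is Lipschitz continuous and runs
from `±1` to `∓1` in each band. -/
theorem exists_le_band :
    ∃ c : ℝ, 0 < c ∧ ∀ j, ζ (2 * j) + c ≤ ζ (2 * j + 1) := by
  obtain ⟨K, hK, hb⟩ := h.exists_lipschitz
  refine ⟨2 / K, by positivity, fun j => ?_⟩
  have h1 := (e.dR_sq_eq_one_iff h).2 ⟨2 * j, rfl⟩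
  have h2 := (e.dR_sq_eq_one_iff h).2 ⟨2 * j + 1, rfl⟩
  have hne : dR q L (ζ (2 * j)) ≠ dR q L (ζ (2 * j + 1)) := fun heq => by
    obtain ⟨s, hs, hd⟩ := exists_deriv_eq_zero (e.band_lt j)
      h.differentiable_dR.continuous.continuousOn heq
    have hlt := e.dR_sq_lt_one h hs
    have := h.deriv_dR_mul_neg hlt.le (mR_ne_zero_of_sq_lt h hlt)
    rw [hd] at this
    simp at this
  have hl := hb (ζ (2 * j)) (ζ (2 * j + 1))
  rw [h.discriminant_eq, h.discriminant_eq, ← ofReal_sub, norm_real,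
    Real.norm_eq_abs, abs_sub_comm (ζ (2 * j)), abs_of_pos (sub_pos.2 (e.band_lt j))] at hl
  have h2' : (2 : ℝ) ≤ |dR q L (ζ (2 * j)) - dR q L (ζ (2 * j + 1))| := by
    have hsub : dR q L (ζ (2 * j)) + dR q L (ζ (2 * j + 1)) = 0 := by
      have : (dR q L (ζ (2 * j)) - dR q L (ζ (2 * j + 1))) *
        (dR q L (ζ (2 * j)) + dR q L (ζ (2 * j + 1))) = 0 := by linear_combination h1 - h2
      exact (mul_eq_zero.1 this).resolve_left (sub_ne_zero.2 hne)
    rw [eq_neg_of_add_eq_zero_right hsub, sub_neg_eq_add, ← two_mul, abs_mul, abs_two]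
    have := sq_abs (dR q L (ζ (2 * j)))
    nlinarith [abs_nonneg (dR q L (ζ (2 * j)))]
  have := h2'.trans hl
  rw [← sub_nonneg]
  have : 2 / K ≤ ζ (2 * j + 1) - ζ (2 * j) := by rw [div_le_iff₀ hK]; linarith
  linarith

theorem exists_mu_add_le :
    ∃ c : ℝ, 0 < c ∧ ∀ j k : ℤ, c * |(j - k : ℝ)| ≤ |μ j - μ k| := by
  obtain ⟨c, hc, hb⟩ := e.exists_le_band h
  have hs : ∀ (k : ℤ) (n : ℕ), μ k + c * n ≤ μ (k + n) := by
    intro k n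
    induction n with
    | zero => simp
    | succ n ih =>
      have h1 := hb (k + n)
      have h2 := (e.dirichlet_mem (k + n)).2
      have h3 := (e.dirichlet_mem (k + n + 1)).1
      rw [show 2 * (k + (n : ℤ) + 1) - 1 = 2 * (k + n) + 1 by ring] at h3
      push_cast
      rw [← add_assoc]
      linarith
  refine ⟨c, hc, fun j k => ?_⟩
  rcases le_total k j with hkj | hkj
  · obtain ⟨n, rfl⟩ := Int.le.dest hkj
    have := hs k n
    push_cast
    rw [add_sub_cancel_left, Nat.abs_cast]
    exact (by linarith : c * n ≤ μ (k + n) - μ k).trans (le_abs_self _)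
  · obtain ⟨n, rfl⟩ := Int.le.dest hkj
    have := hs j n
    push_cast
    rw [abs_sub_comm, add_sub_cancel_left, Nat.abs_cast, abs_sub_comm]
    exact (by linarith : c * n ≤ μ (j + n) - μ j).trans (le_abs_self _)

theorem exists_cover (s : ℝ) :
    (∃ j, s ∈ Icc (ζ (2 * j)) (ζ (2 * j + 1))) ∨ ∃ j, s ∈ Ioo (ζ (2 * j - 1)) (ζ (2 * j)) := by
  obtain ⟨c, hc, hb⟩ := e.exists_mu_add_le h
  have hu : ∀ B, ∃ j, B < μ j := fun B => by
    obtain ⟨n, hn⟩ := exists_nat_gt ((|B| + |μ 0|) / c)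
    rw [div_lt_iff₀ hc] at hn
    refine ⟨n, ?_⟩
    have h1 := hb n 0
    have h2 : μ 0 ≤ μ n := e.mu_strictMono.monotone (by positivity)
    rw [abs_of_nonneg (sub_nonneg.2 h2)] at h1
    simp only [Int.cast_natCast, Int.cast_zero, sub_zero, Nat.abs_cast] at h1
    linarith [le_abs_self B, neg_abs_le (μ 0)]
  have hl : ∀ B, ∃ j, μ j < B := fun B => by
    obtain ⟨n, hn⟩ := exists_nat_gt ((|B| + |μ 0|) / c)
    rw [div_lt_iff₀ hc] at hn
    refine ⟨-n, ?_⟩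
    have h1 := hb 0 (-n)
    have h2 : μ (-n) ≤ μ 0 := e.mu_strictMono.monotone (by simp)
    rw [abs_of_nonneg (sub_nonneg.2 h2)] at h1
    simp only [Int.cast_neg, Int.cast_natCast, Int.cast_zero, zero_sub, neg_neg, Nat.abs_cast] at h1
    linarith [neg_abs_le B, le_abs_self (μ 0)]
  obtain ⟨j, h1, h2⟩ := exists_mem_Ico_of_strictMono (μ := fun j => ζ (2 * j))
    (strictMono_int_of_lt_succ fun j => (e.lt_succ j).trans_le (e.gap_le _))
    (fun B => (hu B).imp fun j hj => hj.trans_le (e.dirichlet_mem j).2)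
    (fun B => by
      obtain ⟨j, hj⟩ := hl B
      refine ⟨j - 1, ((e.lt_succ (j - 1)).trans_le ?_).trans hj⟩
      rw [sub_add_cancel]
      exact (e.dirichlet_mem j).1) s
  rcases le_or_gt s (ζ (2 * j + 1)) with hle | hgt
  · exact Or.inl ⟨j, h1, hle⟩
  · exact Or.inr ⟨j + 1, by rwa [show 2 * (j + 1) - 1 = 2 * j + 1 by ring], h2⟩

theorem eq_mu_of_mem_gap {j : ℤ} {s : ℝ}
    (hs : s ∈ Icc (ζ (2 * j - 1)) (ζ (2 * j))) (h0 : mR q L s = 0) : s = μ j := by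
  obtain ⟨i, rfl⟩ := (e.mR_eq_zero_iff h).1 h0
  have hi := e.dirichlet_mem i
  have k1 : ¬ i < j := fun hij => by
    have := e.band_lt i
    have h3 := e.monotone (show 2 * i + 1 ≤ 2 * j - 1 by omega)
    linarith [hs.1, hi.2]
  have k2 : ¬ j < i := fun hij => by
    have := e.band_lt j
    have h3 := e.monotone (show 2 * j + 1 ≤ 2 * i - 1 by omega)
    linarith [hs.2, hi.1]
  rw [show i = j by omega]

/-- In a gap the product `ỹ₁₂ Δ` changes sign exactly at the Dirichlet eigenvalue, from negative to
positive. -/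
theorem sign_mR_mul_dR {j : ℤ} {s : ℝ}
    (hs : s ∈ Icc (ζ (2 * j - 1)) (ζ (2 * j))) :
    sign (mR q L s * dR q L s) = sign (s - μ j) := by
  set u : ℝ → ℝ := fun t => mR q L t * dR q L t with hu
  have hcont : Continuous u := h.continuous_mR.mul h.differentiable_dR.continuous
  have hne : ∀ t ∈ Icc (ζ (2 * j - 1)) (ζ (2 * j)), t ≠ μ j → u t ≠ 0 := fun t ht htj => by
    refine mul_ne_zero (fun h0 => htj (e.eq_mu_of_mem_gap h ht h0)) fun h0 => ?_
    have := e.one_le_dR_sq h ht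
    rw [h0] at this
    norm_num at this
  have hd : HasDerivAt u (deriv (mR q L) (μ j) * dR q L (μ j)) (μ j) :=
    ((h.hasDerivAt_mR (μ j)).differentiableAt.hasDerivAt.mul
      (h.differentiable_dR (μ j)).hasDerivAt).congr_deriv (by rw [e.mR_mu h]; ring)
  have hev := eventually_nhdsWithin_sign_eq_of_deriv_pos (f := u) (x₀ := μ j)
    (by rw [hd.deriv]; exact (h.of_mR_eq_zero (e.mR_mu h j)).2) (by simp [hu, e.mR_mu h])
  have hμ := e.dirichlet_mem j
  rcases lt_trichotomy s (μ j) with hlt | rfl | hgt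
  · rw [sign_neg (sub_neg.2 hlt), sign_eq_neg_one_iff]
    obtain ⟨t, ⟨ht1, ht2⟩, ht3⟩ : ∃ t, (t ∈ Ioo s (μ j) ∧ sign (u t) =
        sign (t - μ j)) := (Filter.Eventually.and (Ioo_mem_nhdsLT hlt)
        (hev.filter_mono nhdsWithin_le_nhds) : ∀ᶠ t in 𝓝[<] (μ j), _).exists
    rw [sign_neg (sub_neg.2 ht2), sign_eq_neg_one_iff] at ht3
    by_contra! hge
    obtain ⟨v, hv, hv0⟩ := intermediate_value_Icc' ht1.le hcont.continuousOn
      (show (0 : ℝ) ∈ Icc (u t) (u s) from ⟨ht3.le, hge⟩)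
    exact hne v ⟨hs.1.trans hv.1, (hv.2.trans ht2.le).trans hμ.2⟩ (hv.2.trans_lt ht2).ne hv0
  · simp [e.mR_mu h]
  · rw [sign_pos (sub_pos.2 hgt), sign_eq_one_iff]
    obtain ⟨t, ⟨ht1, ht2⟩, ht3⟩ : ∃ t, (t ∈ Ioo (μ j) s ∧ sign (u t) =
        sign (t - μ j)) := (Filter.Eventually.and (Ioo_mem_nhdsGT hgt)
        (hev.filter_mono nhdsWithin_le_nhds) : ∀ᶠ t in 𝓝[>] (μ j), _).exists
    rw [sign_pos (sub_pos.2 ht1), sign_eq_one_iff] at ht3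
    by_contra! hge
    obtain ⟨v, hv, hv0⟩ := intermediate_value_Icc' ht2.le hcont.continuousOn
      (show (0 : ℝ) ∈ Icc (u s) (u t) from ⟨hge, ht3.le⟩)
    exact hne v ⟨(hμ.1.trans ht1.le).trans hv.1, hv.2.trans hs.2⟩ (ht1.trans_le hv.1).ne' hv0

/-- At an edge of an open gap `Δ² - 1` has a simple zero. -/
theorem deriv_ne_zero_of_mem_bandEdges
    {s : ℝ} (hs : s ∈ bandEdges ζ) : dR q L s ^ 2 = 1 ∧ deriv (dR q L) s ≠ 0 := by
  obtain ⟨j, hj, hs⟩ := hs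
  have h1 : dR q L s ^ 2 = 1 := by
    rcases hs with rfl | rfl
    exacts [(e.dR_sq_eq_one_iff h).2 ⟨_, rfl⟩, (e.dR_sq_eq_one_iff h).2 ⟨_, rfl⟩]
  refine ⟨h1, fun h0 => ?_⟩
  have hev := (h.sq_lt_one_of_deriv_eq_zero h1 h0).2.2
  rcases hs with rfl | rfl
  · have h3 : ∀ᶠ t in 𝓝[>] ζ (2 * j - 1), t ∈ Ioo (ζ (2 * j - 1)) (ζ (2 * j)) ∧
        dR q L t ^ 2 < 1 := Filter.Eventually.and (Ioo_mem_nhdsGT hj)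
      (hev.filter_mono (nhdsWithin_mono _ fun t (ht : _ < t) => ne_of_gt ht))
    obtain ⟨t, ht, ht'⟩ := h3.exists
    exact ht'.not_gt (e.one_lt_dR_sq h ht)
  · have h3 : ∀ᶠ t in 𝓝[<] ζ (2 * j), t ∈ Ioo (ζ (2 * j - 1)) (ζ (2 * j)) ∧
        dR q L t ^ 2 < 1 := Filter.Eventually.and (Ioo_mem_nhdsLT hj)
      (hev.filter_mono (nhdsWithin_mono _ fun t (ht : t < _) => ne_of_lt ht))
    obtain ⟨t, ht, ht'⟩ := h3.exists
    exact ht'.not_gt (e.one_lt_dR_sq h ht)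

omit h in
theorem eq_mu_of_not_isOpenGap {j : ℤ}
    (hj : ¬ IsOpenGap ζ j) : ζ (2 * j - 1) = μ j ∧ ζ (2 * j) = μ j := by
  have h1 := e.dirichlet_mem j
  have h2 : ζ (2 * j) ≤ ζ (2 * j - 1) := not_lt.1 hj
  exact ⟨le_antisymm h1.1 (h1.2.trans h2), le_antisymm (h2.trans h1.1) h1.2⟩

theorem deriv_eq_zero_of_not_isOpenGap {j : ℤ} (hj : ¬ IsOpenGap ζ j) :
    dR q L (μ j) ^ 2 = 1 ∧ deriv (dR q L) (μ j) = 0 := by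
  obtain ⟨h1, h2⟩ := e.eq_mu_of_not_isOpenGap hj
  have hsq : dR q L (μ j) ^ 2 = 1 := (e.dR_sq_eq_one_iff h).2 ⟨_, h1.symm⟩
  refine ⟨hsq, ?_⟩
  have hmax : IsLocalMax (fun t => dR q L t ^ 2) (μ j) := by
    have k1 := e.band_lt j
    have k2 := e.band_lt (j - 1)
    rw [h2] at k1
    rw [show 2 * (j - 1) + 1 = 2 * j - 1 by ring, h1] at k2
    filter_upwards [Ioo_mem_nhds k2 k1] with t ht
    rw [hsq]
    rcases lt_or_ge t (μ j) with hlt | hge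
    · refine (e.dR_sq_le_one_iff h).2 ⟨j - 1, ht.1.le, ?_⟩
      rw [show 2 * (j - 1) + 1 = 2 * j - 1 by ring, h1]
      exact hlt.le
    · exact (e.dR_sq_le_one_iff h).2 ⟨j, h2 ▸ hge, ht.2.le⟩
  have hd := hmax.hasDerivAt_eq_zero ((h.differentiable_dR (μ j)).hasDerivAt.pow 2)
  have hne : dR q L (μ j) ≠ 0 := by intro h0; rw [h0] at hsq; norm_num at hsq
  simpa [hne] using hd

/-- A real point which is not an edge of an open gap is interior to a band or to an open gap, or is
a degenerate gap. -/
theorem trichotomy {s : ℝ}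
    (hs : s ∉ bandEdges ζ) :
    (∃ j, s ∈ Ioo (ζ (2 * j)) (ζ (2 * j + 1))) ∨
      (∃ j, s ∈ Ioo (ζ (2 * j - 1)) (ζ (2 * j))) ∨ ∃ j, ¬ IsOpenGap ζ j ∧ s = μ j := by
  rcases e.exists_cover h s with ⟨j, hj⟩ | hj
  · rcases eq_or_lt_of_le hj.1 with h1 | h1
    · have hn : ¬ IsOpenGap ζ j := fun ho => hs ⟨j, ho, Or.inr h1.symm⟩
      exact Or.inr (Or.inr ⟨j, hn, by rw [← h1, (e.eq_mu_of_not_isOpenGap hn).2]⟩)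
    rcases eq_or_lt_of_le hj.2 with h2 | h2
    · have h2' : s = ζ (2 * (j + 1) - 1) := by
        rw [h2, show 2 * (j + 1) - 1 = 2 * j + 1 by ring]
      have hn : ¬ IsOpenGap ζ (j + 1) := fun ho => hs ⟨j + 1, ho, Or.inl h2'⟩
      exact Or.inr (Or.inr ⟨j + 1, hn, by rw [h2', (e.eq_mu_of_not_isOpenGap hn).1]⟩)
    exact Or.inl ⟨j, h1, h2⟩
  · exact Or.inr (Or.inl hj)

theorem mem_bands_iff {s : ℝ} :
    s ∈ bands ζ ↔ dR q L s ^ 2 ≤ 1 := (e.dR_sq_le_one_iff h).symm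

end IsSpectralEnumeration

/-! ### Genus-one products with real zeros -/

/-- The weight of a zero `a` in the convergence condition `∑ a⁻² < ∞`; it is `1` for `a = 0`, so that
summability of the weights also says that only finitely many zeros vanish. -/
def hadamardWeight (a : ℝ) : ℝ := if a = 0 then 1 else (a ^ 2)⁻¹

theorem hadamardWeight_nonneg (a : ℝ) : 0 ≤ hadamardWeight a := by
  rw [hadamardWeight]; split_ifs <;> positivity

theorem differentiable_hadamardFactor (a : ℝ) : Differentiable ℂ (hadamardFactor a) := by
  by_cases h : a = 0
  · have : hadamardFactor a = fun z => z := by ext z; simp [hadamardFactor, h]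
    rw [this]; fun_prop
  · have : hadamardFactor a = fun z => (1 - z / a) * exp (z / a) := by
      ext z; simp [hadamardFactor, h]
    rw [this]; fun_prop

theorem hadamardFactor_eq_zero_iff {a : ℝ} : hadamardFactor a z = 0 ↔ z = a := by
  by_cases h : a = 0
  · simp [hadamardFactor, h]
  · have h' : (a : ℂ) ≠ 0 := by exact_mod_cast h
    simp only [hadamardFactor, if_neg h, mul_eq_zero, exp_ne_zero, or_false, sub_eq_zero]
    rw [eq_div_iff h', one_mul, eq_comm]

theorem hadamardFactor_conj (a : ℝ) (z : ℂ) :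
    hadamardFactor a (conj z) = conj (hadamardFactor a z) := by
  by_cases h : a = 0
  · simp [hadamardFactor, h]
  · simp [hadamardFactor, h, ← exp_conj]

theorem norm_hadamardFactor_le (a : ℝ) (z : ℂ) :
    ‖hadamardFactor a z‖ ≤ Real.exp (hadamardWeight a * ‖z‖ ^ 2) := by
  by_cases h : a = 0
  · simp only [hadamardFactor, hadamardWeight, if_pos h, one_mul]
    have := Real.add_one_le_exp (‖z‖ ^ 2)
    nlinarith [sq_nonneg (‖z‖ - 1 / 2)]
  · simp only [hadamardFactor, hadamardWeight, if_neg h]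
    set w := z / a with hw
    have e : (a ^ 2)⁻¹ * ‖z‖ ^ 2 = ‖w‖ ^ 2 := by
      rw [hw, norm_div, norm_real, Real.norm_eq_abs, div_pow, sq_abs]; field_simp
    rw [e, norm_mul, norm_exp]
    have h1 : ‖1 - w‖ ^ 2 = 1 - 2 * w.re + ‖w‖ ^ 2 := by
      rw [← normSq_eq_norm_sq, ← normSq_eq_norm_sq, normSq_apply, normSq_apply]
      simp; ring
    have h2 : ‖1 - w‖ ^ 2 ≤ Real.exp (-2 * w.re + ‖w‖ ^ 2) := by
      rw [h1]; linarith [Real.add_one_le_exp (-2 * w.re + ‖w‖ ^ 2)]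
    refine (sq_le_sq₀ (by positivity) (by positivity)).1 ?_
    rw [mul_pow, ← Real.exp_nat_mul, ← Real.exp_nat_mul]
    calc _ ≤ Real.exp (-2 * w.re + ‖w‖ ^ 2) * Real.exp ((2 : ℕ) * w.re) := by gcongr
      _ = Real.exp (‖w‖ ^ 2) := by rw [← Real.exp_add]; congr 1; push_cast; ring
      _ ≤ _ := by
        gcongr; push_cast; nlinarith [sq_nonneg ‖w‖]

theorem norm_hadamardFactor_sub_one_le {a : ℝ} (ha : a ≠ 0) (hz : ‖z‖ ≤ |a|) :
    ‖hadamardFactor a z - 1‖ ≤ 3 * ‖z‖ ^ 2 * hadamardWeight a := by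
  simp only [hadamardFactor, hadamardWeight, if_neg ha]
  set w := z / a with hw
  have hwn : ‖w‖ = ‖z‖ / |a| := by rw [hw, norm_div, norm_real, Real.norm_eq_abs]
  have hw1 : ‖w‖ ≤ 1 := by rw [hwn]; exact div_le_one_of_le₀ hz (abs_nonneg a)
  have e : 3 * ‖z‖ ^ 2 * (a ^ 2)⁻¹ = 3 * ‖w‖ ^ 2 := by
    rw [hwn, div_pow, sq_abs]; field_simp
  rw [e]
  have h1 := Complex.norm_exp_sub_one_sub_id_le hw1
  have h2 := Complex.norm_exp_sub_one_le hw1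
  have e2 : (1 - w) * exp w - 1 = (exp w - 1 - w) - w * (exp w - 1) := by
    ring
  rw [e2]
  refine (norm_sub_le _ _).trans ?_
  rw [norm_mul]
  nlinarith [norm_nonneg w]

/-- The product `∏_j (1 - z/a_j) e^{z/a_j}`, with the factor `z` for `a_j = 0`. -/
def hadamardProduct {ι : Type*} (a : ι → ℝ) (z : ℂ) : ℂ := ∏' j, hadamardFactor (a j) z

section Product

variable {ι : Type*} {a : ι → ℝ} (ha : Summable fun j => hadamardWeight (a j))
include ha

theorem eventually_lt_abs (r : ℝ) : ∀ᶠ j in cofinite, a j ≠ 0 ∧ r < |a j| := by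
  have h1 : ∀ᶠ j in cofinite, hadamardWeight (a j) < 1 / (r ^ 2 + 1) :=
    ha.tendsto_cofinite_zero.eventually_lt_const (by positivity)
  filter_upwards [h1] with j hj
  have hr : 1 / (r ^ 2 + 1) ≤ 1 := by
    rw [div_le_one (by positivity)]; nlinarith [sq_nonneg r]
  have h0 : a j ≠ 0 := fun h0 => by
    rw [hadamardWeight, if_pos h0] at hj; linarith
  refine ⟨h0, ?_⟩
  rw [hadamardWeight, if_neg h0, ← one_div, one_div_lt_one_div (by positivity) (by positivity)]
    at hj
  by_contra! hle
  have : |a j| ^ 2 ≤ r ^ 2 := pow_le_pow_left₀ (abs_nonneg _) hle 2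
  rw [sq_abs] at this
  linarith

theorem eventually_norm_hadamardFactor_sub_one_le (r : ℝ) : ∀ᶠ j in cofinite,
    ∀ z ∈ ball (0 : ℂ) r, ‖hadamardFactor (a j) z - 1‖ ≤ 3 * r ^ 2 * hadamardWeight (a j) := by
  filter_upwards [eventually_lt_abs ha r] with j hj z hz
  rw [mem_ball_zero_iff] at hz
  refine (norm_hadamardFactor_sub_one_le hj.1 (hz.le.trans hj.2.le)).trans ?_
  have := hadamardWeight_nonneg (a j)
  gcongr

theorem hasProdLocallyUniformlyOn_hadamardFactor (r : ℝ) : HasProdLocallyUniformlyOn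
    (fun j z => hadamardFactor (a j) z) (hadamardProduct a) (ball (0 : ℂ) r) := by
  have := Summable.hasProdLocallyUniformlyOn_one_add (f := fun j z => hadamardFactor (a j) z - 1)
    (isOpen_ball (x := (0 : ℂ)) (ε := r)) (ha.mul_left (3 * r ^ 2))
    (eventually_norm_hadamardFactor_sub_one_le ha r)
    (fun j => ((differentiable_hadamardFactor _).continuous.sub continuous_const).continuousOn)
  simp only [add_sub_cancel] at this
  exact this

theorem summable_norm_hadamardFactor_sub_one (z : ℂ) :
    Summable fun j => ‖hadamardFactor (a j) z - 1‖ := by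
  refine Summable.of_norm_bounded_eventually (ha.mul_left (3 * (‖z‖ + 1) ^ 2)) ?_
  filter_upwards [eventually_norm_hadamardFactor_sub_one_le ha (‖z‖ + 1)] with j hj
  rw [norm_norm]
  exact hj z (by simp)

theorem multipliable_hadamardFactor (z : ℂ) : Multipliable fun j => hadamardFactor (a j) z := by
  have := multipliable_one_add_of_summable (summable_norm_hadamardFactor_sub_one ha z)
  simpa only [add_sub_cancel] using this

theorem hadamardProduct_ne_zero (hz : ∀ j, z ≠ a j) : hadamardProduct a z ≠ 0 := by
  have := tprod_one_add_ne_zero_of_summable (f := fun j => hadamardFactor (a j) z - 1)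
    (fun j => by rw [add_sub_cancel]; exact mt hadamardFactor_eq_zero_iff.1 (hz j))
    (summable_norm_hadamardFactor_sub_one ha z)
  simp only [add_sub_cancel] at this
  exact this

theorem differentiable_hadamardProduct : Differentiable ℂ (hadamardProduct a) := fun z => by
  have h1 : DifferentiableOn ℂ (hadamardProduct a) (ball (0 : ℂ) (‖z‖ + 1)) :=
    TendstoLocallyUniformlyOn.differentiableOn
      (hasProdLocallyUniformlyOn_hadamardFactor ha (‖z‖ + 1))
      (Eventually.of_forall fun s => DifferentiableOn.fun_finsetProd fun j _ =>
        (differentiable_hadamardFactor (a j)).differentiableOn) isOpen_ball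
  exact h1.differentiableAt (isOpen_ball.mem_nhds (by simp))

omit ha in
theorem hadamardProduct_eq_zero (j : ι) : hadamardProduct a (a j) = 0 :=
  tprod_of_exists_eq_zero ⟨j, hadamardFactor_eq_zero_iff.2 rfl⟩

theorem hadamardProduct_conj (z : ℂ) :
    hadamardProduct a (conj z) = conj (hadamardProduct a z) := by
  have h := ((multipliable_hadamardFactor ha z).hasProd.map conj
    continuous_conj).tprod_eq
  rw [hadamardProduct, hadamardProduct, ← h]
  congr 1
  ext j
  exact hadamardFactor_conj _ _

theorem norm_hadamardProduct_le (z : ℂ) :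
    ‖hadamardProduct a z‖ ≤ Real.exp ((∑' j, hadamardWeight (a j)) * ‖z‖ ^ 2) := by
  have h := (multipliable_hadamardFactor ha z).hasProd
  refine le_of_tendsto (h.norm : Tendsto _ _ _) (Eventually.of_forall fun s => ?_)
  have hs : ∏ j ∈ s, ‖hadamardFactor (a j) z‖ ≤
      Real.exp ((∑ j ∈ s, hadamardWeight (a j)) * ‖z‖ ^ 2) := by
    rw [Finset.sum_mul, Real.exp_sum]
    exact Finset.prod_le_prod (fun _ _ => norm_nonneg _) fun j _ => norm_hadamardFactor_le _ _
  refine hs.trans ?_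
  gcongr
  exact ha.sum_le_tsum s fun j _ => hadamardWeight_nonneg _

theorem hadamardProduct_ofReal (s : ℝ) :
    hadamardProduct a s = ((hadamardProduct a s).re : ℂ) := by
  have := hadamardProduct_conj ha s
  rw [conj_ofReal] at this
  exact (conj_eq_iff_re.1 this.symm).symm

/-- The sign of a genus-one product on the real line, relative to a base point: it changes at each
zero. -/
theorem sign_hadamardProduct_mul {s t : ℝ} (hs : hadamardProduct a s ≠ 0)
    (ht : hadamardProduct a t ≠ 0) {K : Finset ι} (hK : ∀ j ∉ K, 0 < (s - a j) * (t - a j)) :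
    sign ((hadamardProduct a s).re * (hadamardProduct a t).re) =
      ∏ j ∈ K, sign ((s - a j) * (t - a j)) := by
  have hre : ∀ (b u : ℝ), hadamardFactor b u = ((hadamardFactor b u).re : ℂ) := fun b u => by
    have := hadamardFactor_conj b u
    rw [conj_ofReal] at this
    exact (conj_eq_iff_re.1 this.symm).symm
  have hsg : ∀ b u : ℝ, sign (hadamardFactor b u).re =
      if b = 0 then sign (u - b) else -(sign b * sign (u - b)) := by
    intro b u
    by_cases hb : b = 0
    · simp [hadamardFactor, hb]
    · have e : (hadamardFactor b u).re = b⁻¹ * (-(u - b)) * Real.exp (u / b) := by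
        have : hadamardFactor b u = ((b⁻¹ * (-(u - b)) * Real.exp (u / b) : ℝ) : ℂ) := by
          rw [hadamardFactor, if_neg hb]
          push_cast
          have hb' : (b : ℂ) ≠ 0 := by exact_mod_cast hb
          congr 1
          field_simp; ring
        rw [this, ofReal_re]
      have hinv : sign b⁻¹ = sign b := by
        rcases lt_or_gt_of_ne hb with h | h
        · rw [sign_neg h, sign_neg (inv_lt_zero.2 h)]
        · rw [sign_pos h, sign_pos (inv_pos.2 h)]
      rw [e, sign_mul, sign_mul, sign_pos (Real.exp_pos _), mul_one, Left.sign_neg, if_neg hb, hinv,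
        mul_neg]
  set p : ι → ℝ := fun j => (hadamardFactor (a j) s).re * (hadamardFactor (a j) t).re with hp
  have hps : ∀ j, sign (p j) = sign ((s - a j) * (t - a j)) := fun j => by
    simp only [hp, sign_mul, hsg]
    by_cases hb : a j = 0
    · simp [hb]
    · rw [if_neg hb, if_neg hb]
      have : sign (a j) * sign (a j) = 1 := by
        rw [← sign_mul]; exact sign_pos (mul_self_pos.2 hb)
      calc _ = (sign (a j) * sign (a j)) * (sign (s - a j) * sign (t - a j)) := by
            rw [neg_mul_neg, mul_mul_mul_comm]
        _ = _ := by rw [this, one_mul]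
  have hprod : Tendsto (fun J : Finset ι => ∏ j ∈ J, p j) atTop
      (𝓝 ((hadamardProduct a s).re * (hadamardProduct a t).re)) := by
    have h1 := ((multipliable_hadamardFactor ha (s : ℂ)).hasProd.mul
      (multipliable_hadamardFactor ha (t : ℂ)).hasProd : Tendsto _ _ _)
    have h2 := (Complex.continuous_re.tendsto _).comp h1
    change Tendsto _ _ (𝓝 (hadamardProduct a s * hadamardProduct a t).re) at h2
    rw [hadamardProduct_ofReal ha s, hadamardProduct_ofReal ha t, ← ofReal_mul, ofReal_re] at h2
    refine h2.congr fun J => ?_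
    simp only [Function.comp_apply]
    rw [show (fun i => hadamardFactor (a i) (s : ℂ) * hadamardFactor (a i) t) =
      fun i => ((p i : ℝ) : ℂ) by
        ext i; rw [hre (a i) s, hre (a i) t, ← ofReal_mul], ← Complex.ofReal_prod,
      ofReal_re]
  have hne : (hadamardProduct a s).re * (hadamardProduct a t).re ≠ 0 := by
    rw [hadamardProduct_ofReal ha s, ofReal_ne_zero] at hs
    rw [hadamardProduct_ofReal ha t, ofReal_ne_zero] at ht
    exact mul_ne_zero hs ht
  classical
  have hsign : ∀ J : Finset ι, K ⊆ J → sign (∏ j ∈ J, p j) =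
      ∏ j ∈ K, sign ((s - a j) * (t - a j)) := fun J hJ => by
    have : sign (∏ j ∈ J, p j) = ∏ j ∈ J, sign (p j) := map_prod signHom _ _
    rw [this, ← Finset.prod_sdiff hJ, Finset.prod_eq_one, one_mul]
    · exact Finset.prod_congr rfl fun j _ => hps j
    · intro j hj
      rw [hps]
      exact sign_pos (hK j (Finset.mem_sdiff.1 hj).2)
  have hlim : ∀ᶠ J in (atTop : Filter (Finset ι)), sign (∏ j ∈ J, p j) =
      sign ((hadamardProduct a s).re * (hadamardProduct a t).re) := by
    rcases lt_or_gt_of_ne hne with h | h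
    · filter_upwards [hprod.eventually_lt_const h] with J hJ
      rw [sign_neg h, sign_neg hJ]
    · filter_upwards [hprod.eventually_const_lt h] with J hJ
      rw [sign_pos h, sign_pos hJ]
  obtain ⟨J, hJ1, hJ2⟩ := (hlim.and (eventually_ge_atTop K)).exists
  rw [← hJ1]
  exact hsign J hJ2

end Product

/-! ### Holomorphic functions with a real singular set -/

/-- The complement of the real line. -/
def offReal : Set ℂ := {z | z.im ≠ 0}

theorem isOpen_offReal : IsOpen offReal := isOpen_ne_fun continuous_im continuous_const

theorem dense_offReal : Dense offReal := by
  intro z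
  rw [mem_closure_iff_seq_limit]
  by_cases hz : z.im = 0
  · refine ⟨fun n : ℕ => z + ((1 / (n + 1 : ℝ) : ℝ) : ℂ) * I, fun n => ?_, ?_⟩
    · simp only [offReal, mem_ofPred_eq, add_im, Complex.mul_I_im, ofReal_re, hz, zero_add]
      positivity
    · have h1 : Tendsto (fun n : ℕ => ((1 / (n + 1 : ℝ) : ℝ) : ℂ)) atTop (𝓝 0) := by
        have := (continuous_ofReal.tendsto 0).comp tendsto_one_div_add_atTop_nhds_zero_nat
        rwa [ofReal_zero] at this
      simpa using tendsto_const_nhds.add (h1.mul_const I)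
  · exact ⟨fun _ => z, fun _ => hz, tendsto_const_nhds⟩

instance neBot_nhdsWithin_offReal (z : ℂ) : (𝓝[offReal] z).NeBot :=
  mem_closure_iff_nhdsWithin_neBot.1 (dense_offReal z)

/-- A function which is holomorphic off the real line and agrees near each real point of `U` with a
holomorphic function extends holomorphically to `U`. -/
theorem exists_differentiableOn_of_local {f : ℂ → ℂ} {U : Set ℂ}
    (hf : ∀ z ∈ U, z ∈ offReal → DifferentiableAt ℂ f z)
    (hloc : ∀ s : ℝ, (s : ℂ) ∈ U → ∃ W : ℂ → ℂ, AnalyticAt ℂ W s ∧ ∀ᶠ z in 𝓝[offReal] (s : ℂ),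
      f z = W z) :
    ∃ g : ℂ → ℂ, (∀ z ∈ U, DifferentiableAt ℂ g z) ∧ EqOn g f offReal ∧
      ∀ (s : ℝ) (W : ℂ → ℂ), (s : ℂ) ∈ U → AnalyticAt ℂ W s →
        (∀ᶠ z in 𝓝[offReal] (s : ℂ), f z = W z) → g =ᶠ[𝓝 (s : ℂ)] W := by
  classical
  set g : ℂ → ℂ := fun z => if z ∈ offReal then f z else limUnder (𝓝[offReal] z) f with hg
  have hgo : EqOn g f offReal := fun z hz => if_pos hz
  have hgl : ∀ (s : ℝ) (W : ℂ → ℂ), (s : ℂ) ∈ U → AnalyticAt ℂ W s →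
      (∀ᶠ z in 𝓝[offReal] (s : ℂ), f z = W z) → g =ᶠ[𝓝 (s : ℂ)] W := by
    intro s W _ hW hev
    have h1 := (eventually_nhdsWithin_iff.1 hev).eventually_nhds
    have h2 := hW.eventually_analyticAt
    filter_upwards [h1, h2] with z hz1 hz2
    by_cases hz : z ∈ offReal
    · rw [hgo hz]; exact hz1.self_of_nhds hz
    · simp only [hg, if_neg hz]
      refine Tendsto.limUnder_eq ?_
      refine (hz2.continuousAt.tendsto.mono_left nhdsWithin_le_nhds).congr' ?_
      filter_upwards [eventually_nhdsWithin_iff.2 hz1] with w hw using hw.symm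
  refine ⟨g, fun z hz => ?_, hgo, hgl⟩
  by_cases hzo : z ∈ offReal
  · refine (hf z hz hzo).congr_of_eventuallyEq ?_
    filter_upwards [isOpen_offReal.mem_nhds hzo] with w hw using hgo hw
  · have e : z = ((z.re : ℝ) : ℂ) := Complex.ext (by simp) (by simpa [offReal] using hzo)
    rw [e] at hz ⊢
    obtain ⟨W, hW, hev⟩ := hloc z.re hz
    exact hW.differentiableAt.congr_of_eventuallyEq (hgl z.re W hz hW hev)

/-- A bound off the real line on a sphere extends to the ball, for functions with removable real
singularities. -/
theorem norm_le_of_sphere {f : ℂ → ℂ} {c : ℂ} {r M : ℝ}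
    (hf : ∀ z ∈ closedBall c r, z ∈ offReal → DifferentiableAt ℂ f z)
    (hloc : ∀ s : ℝ, (s : ℂ) ∈ closedBall c r → ∃ W : ℂ → ℂ, AnalyticAt ℂ W s ∧
      ∀ᶠ z in 𝓝[offReal] (s : ℂ), f z = W z)
    (hM : ∃ V : Set ℂ, IsOpen V ∧ sphere c r ⊆ V ∧ ∀ z ∈ V, z ∈ offReal → ‖f z‖ ≤ M)
    (hz : z ∈ ball c r) (hzo : z ∈ offReal) : ‖f z‖ ≤ M := by
  obtain ⟨g, hg, hgo, -⟩ := exists_differentiableOn_of_local hf hloc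
  obtain ⟨V, hV, hsub, hb⟩ := hM
  have hr : r ≠ 0 := by rintro rfl; simp at hz
  have hd : DiffContOnCl ℂ g (ball c r) := DifferentiableOn.diffContOnCl fun w hw =>
    (hg w (closure_ball_subset_closedBall hw)).differentiableWithinAt
  rw [← hgo hzo]
  refine Complex.norm_le_of_forall_mem_frontier_norm_le isBounded_ball hd (fun w hw => ?_)
    (subset_closure hz)
  rw [frontier_ball c hr] at hw
  have hcont : Tendsto g (𝓝[offReal] w) (𝓝 (g w)) :=
    (hg w (sphere_subset_closedBall hw)).continuousAt.tendsto.mono_left nhdsWithin_le_nhds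
  refine le_of_tendsto hcont.norm ?_
  filter_upwards [mem_nhdsWithin_of_mem_nhds (hV.mem_nhds (hsub hw)), self_mem_nhdsWithin]
    with u hu huo
  rw [hgo huo]
  exact hb u hu huo

/-- Division of an entire function by `z - s` at a zero. -/
theorem exists_eq_sub_mul {f : ℂ → ℂ} (hf : Differentiable ℂ f) {s : ℂ} (hs : f s = 0) :
    ∃ g : ℂ → ℂ, Differentiable ℂ g ∧ g s = deriv f s ∧ ∀ z, f z = (z - s) * g z := by
  refine ⟨dslope f s, differentiable_dslope hf _, dslope_same _ _, fun z => ?_⟩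
  · have := sub_smul_dslope f s z
    rw [smul_eq_mul, hs, sub_zero] at this
    exact this.symm

/-! ### Second logarithmic derivatives -/

theorem norm_deriv_logDeriv_le {f : ℂ → ℂ} (hf : Differentiable ℂ f) {z A : ℂ} {r M m : ℝ}
    (hr : 0 < r) (hm : 0 < m) (hM : ∀ w ∈ closedBall z (2 * r), ‖f w - A‖ ≤ M)
    (hlo : ∀ w ∈ closedBall z r, m ≤ ‖f w‖) :
    ‖deriv (logDeriv f) z‖ ≤ M / (m * r ^ 2) := by
  have h1 : ∀ w ∈ closedBall z r, ‖deriv f w‖ ≤ M / r := fun w hw => by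
    have := norm_deriv_le_of_forall_mem_sphere_norm_le (f := fun u => f u - A) (c := w) hr
      (hf.sub_const A).diffContOnCl (C := M) fun u hu => hM u ?_
    · rwa [deriv_sub_const] at this
    · rw [mem_closedBall] at hw ⊢
      rw [mem_sphere] at hu
      linarith [dist_triangle u w z]
  have hM0 : 0 ≤ M := (norm_nonneg _).trans (hM z (mem_closedBall_self (by positivity)))
  have hne : ∀ w ∈ closedBall z r, f w ≠ 0 := fun w hw => norm_pos_iff.1 (hm.trans_le (hlo w hw))
  have hdd := differentiable_deriv hf
  have hd : DiffContOnCl ℂ (logDeriv f) (ball z r) :=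
    DifferentiableOn.diffContOnCl fun w hw => by
      have := hne w (closure_ball_subset_closedBall hw)
      exact ((hdd w).div (hf w) this).differentiableWithinAt
  have := norm_deriv_le_of_forall_mem_sphere_norm_le hr hd (C := M / (m * r))
    fun w hw => by
      have hw' := sphere_subset_closedBall hw
      rw [logDeriv_apply, norm_div, mul_comm m r, ← div_div]
      exact div_le_div₀ (by positivity) (h1 w hw') hm (hlo w hw')
  refine this.trans (le_of_eq ?_)
  field_simp

theorem deriv_logDeriv {f : ℂ → ℂ} (hf : Differentiable ℂ f) (hz : f z ≠ 0) :
    deriv (logDeriv f) z = (deriv (deriv f) z * f z - deriv f z * deriv f z) / f z ^ 2 := by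
  have hdd := differentiable_deriv hf
  exact ((hdd z).hasDerivAt.div (hf z).hasDerivAt hz).deriv

theorem logDeriv_hadamardFactor {a : ℝ} (hz : z ≠ a) :
    logDeriv (hadamardFactor a) z = (z - a)⁻¹ + (a : ℂ)⁻¹ := by
  by_cases h : a = 0
  · have : hadamardFactor a = fun z => z := by ext z; simp [hadamardFactor, h]
    rw [this, logDeriv_apply, h]
    simp
  · have h' : (a : ℂ) ≠ 0 := by exact_mod_cast h
    have e : hadamardFactor a = fun z => (1 - z / a) * exp (z / a) := by
      ext z; simp [hadamardFactor, h]
    have hd : HasDerivAt (hadamardFactor a)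
        (-(1 / a) * exp (z / a) + (1 - z / a) * (exp (z / a) * (1 / a))) z := by
      rw [e]
      exact ((((hasDerivAt_id z).div_const (a : ℂ)).const_sub 1).mul
        (((hasDerivAt_id z).div_const (a : ℂ)).cexp)).congr_deriv (by simp)
    rw [logDeriv_apply, hd.deriv, e]
    have h1 : 1 - z / a ≠ 0 := by
      rw [sub_ne_zero, ne_eq, eq_div_iff h', one_mul]
      exact fun h => hz h.symm
    have h2 : z - a ≠ 0 := sub_ne_zero.2 hz
    have h3 := exp_ne_zero (z / a)
    have h4 : (a : ℂ) - z ≠ 0 := fun h => h2 (by linear_combination -h)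
    simp only
    rw [show (1 - z / (a : ℂ)) = (a - z) / a by field_simp]
    field_simp
    ring

theorem deriv_logDeriv_prod_hadamardFactor {ι : Type*} {a : ι → ℝ} (K : Finset ι)
    (hz : z ∈ offReal) :
    deriv (logDeriv fun w => ∏ j ∈ K, hadamardFactor (a j) w) z = -∑ j ∈ K, ((z - a j) ^ 2)⁻¹ := by
  have hne : ∀ w ∈ offReal, ∀ j, w ≠ a j := fun w hw j h => hw (by rw [h]; simp)
  have h1 : logDeriv (fun w => ∏ j ∈ K, hadamardFactor (a j) w) =ᶠ[𝓝 z]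
      fun w => ∑ j ∈ K, ((w - a j)⁻¹ + (a j : ℂ)⁻¹) := by
    filter_upwards [isOpen_offReal.mem_nhds hz] with w hw
    rw [logDeriv_prod (fun j _ => mt hadamardFactor_eq_zero_iff.1 (hne w hw j))
      (fun j _ => (differentiable_hadamardFactor (a j)) w)]
    exact Finset.sum_congr rfl fun j _ => logDeriv_hadamardFactor (hne w hw j)
  rw [h1.deriv_eq, ← Finset.sum_neg_distrib]
  refine (HasDerivAt.fun_sum fun j _ => ?_).deriv
  have := (((hasDerivAt_id z).sub_const (a j : ℂ)).inv
    (sub_ne_zero.2 (hne z hz j))).add_const ((a j : ℂ)⁻¹)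
  refine this.congr_deriv ?_
  simp [neg_div]

/-- A bound for the second logarithmic derivative of a genus-one product off the real line. -/
theorem norm_deriv_logDeriv_hadamardProduct_le {ι : Type*} {a : ι → ℝ}
    (ha : Summable fun j => hadamardWeight (a j)) (hz : z ∈ offReal) {B : ℝ}
    (hB : ∀ K : Finset ι, ∑ j ∈ K, (‖z - a j‖ ^ 2)⁻¹ ≤ B) :
    ‖deriv (logDeriv (hadamardProduct a)) z‖ ≤ B := by
  have hne : ∀ j, z ≠ a j := fun j h => hz (by rw [h]; simp)
  have hP := differentiable_hadamardProduct ha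
  set F : Finset ι → ℂ → ℂ := fun K w => ∏ j ∈ K, hadamardFactor (a j) w with hF
  have hFd : ∀ K, Differentiable ℂ (F K) := fun K =>
    Differentiable.fun_finsetProd fun j _ => differentiable_hadamardFactor (a j)
  have hball : IsOpen (ball (0 : ℂ) (‖z‖ + 1)) := isOpen_ball
  have hzb : z ∈ ball (0 : ℂ) (‖z‖ + 1) := by simp
  have t0 : TendstoLocallyUniformlyOn F (hadamardProduct a) atTop (ball (0 : ℂ) (‖z‖ + 1)) :=
    hasProdLocallyUniformlyOn_hadamardFactor ha (‖z‖ + 1)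
  have t1 := t0.deriv (Eventually.of_forall fun K => (hFd K).differentiableOn) hball
  have t2 := t1.deriv (Eventually.of_forall fun K => (differentiable_deriv (hFd K)).differentiableOn) hball
  have hPz : hadamardProduct a z ≠ 0 := hadamardProduct_ne_zero ha hne
  have hlim : Tendsto (fun K => deriv (logDeriv (F K)) z) atTop
      (𝓝 (deriv (logDeriv (hadamardProduct a)) z)) := by
    rw [deriv_logDeriv hP hPz]
    have hFz : ∀ K, F K z ≠ 0 := fun K => Finset.prod_ne_zero_iff.2 fun j _ =>
      mt hadamardFactor_eq_zero_iff.1 (hne j)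
    simp only [fun K => deriv_logDeriv (hFd K) (hFz K)]
    exact (((t2.tendsto_at hzb).mul (t0.tendsto_at hzb)).sub
      ((t1.tendsto_at hzb).mul (t1.tendsto_at hzb))).div ((t0.tendsto_at hzb).pow 2)
      (pow_ne_zero 2 hPz)
  refine le_of_tendsto hlim.norm (Eventually.of_forall fun K => ?_)
  rw [deriv_logDeriv_prod_hadamardFactor K hz, norm_neg]
  refine (norm_sum_le _ _).trans ?_
  simp only [norm_inv, norm_pow]
  exact hB K

/-- If `|a_i - a_j| ≥ c |i - j|` then `∑ |z - a_j|⁻²` is bounded in terms of the distance of `z` to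
the `a_j`. -/
theorem sum_inv_sq_le {a : ℤ → ℝ} {c δ : ℝ} (hc : 0 < c) (hδ : 0 < δ)
    (ha : ∀ j k : ℤ, c * |(j - k : ℝ)| ≤ |a j - a k|) (hz : ∀ j, δ ≤ ‖z - a j‖)
    (K : Finset ℤ) :
    ∑ j ∈ K, (‖z - a j‖ ^ 2)⁻¹ ≤ (δ ^ 2)⁻¹ + 4 / c ^ 2 * ∑' n : ℤ, 1 / (n : ℝ) ^ 2 := by
  classical
  have hs : Summable fun n : ℤ => 1 / (n : ℝ) ^ 2 := Real.summable_one_div_int_pow.2 one_lt_two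
  have hT : 0 ≤ ∑' n : ℤ, 1 / (n : ℝ) ^ 2 := tsum_nonneg fun n => by positivity
  rcases K.eq_empty_or_nonempty with rfl | hK
  · simp only [Finset.sum_empty]; positivity
  obtain ⟨i, hi, hmin⟩ := K.exists_min_image (fun j => ‖z - a j‖) hK
  rw [← Finset.add_sum_erase K _ hi]
  refine add_le_add ?_ ?_
  · have := hz i
    gcongr
  · have h1 : ∀ j ∈ K.erase i, (‖z - a j‖ ^ 2)⁻¹ ≤ 4 / c ^ 2 * (1 / ((j - i : ℤ) : ℝ) ^ 2) := by
      intro j hj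
      have hji : j ≠ i := (Finset.mem_erase.1 hj).1
      have k1 := hmin j (Finset.mem_erase.1 hj).2
      have k2 := ha j i
      have k3 : |a j - a i| ≤ ‖z - a i‖ + ‖z - a j‖ := by
        rw [← Real.norm_eq_abs, ← norm_real]
        push_cast
        rw [show (a j - a i : ℂ) = (z - a i) - (z - a j) by ring]
        exact norm_sub_le _ _
      have h0 : 0 < |((j : ℝ) - i)| := abs_pos.2 (sub_ne_zero.2 (by exact_mod_cast hji))
      have k4 : c / 2 * |((j : ℝ) - i)| ≤ ‖z - a j‖ := by linarith
      calc (‖z - a j‖ ^ 2)⁻¹ ≤ ((c / 2 * |((j : ℝ) - i)|) ^ 2)⁻¹ := by gcongr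
        _ = _ := by
          rw [mul_pow, sq_abs]; push_cast
          have : ((j : ℝ) - i) ≠ 0 := abs_pos.1 h0
          field_simp; norm_num
    refine (Finset.sum_le_sum h1).trans ?_
    rw [← Finset.mul_sum]
    gcongr
    have := (Equiv.subRight i).summable_iff.2 hs
    calc ∑ j ∈ K.erase i, 1 / ((j - i : ℤ) : ℝ) ^ 2
        ≤ ∑' j : ℤ, 1 / ((j - i : ℤ) : ℝ) ^ 2 :=
          Summable.sum_le_tsum _ (fun j _ => by positivity) this
      _ = _ := (Equiv.subRight i).tsum_eq fun n : ℤ => 1 / (n : ℝ) ^ 2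

/-! ### The Hadamard factorization of `ỹ₁₂(L,·)` -/

namespace IsSpectralEnumeration

variable (e : IsSpectralEnumeration q L ζ μ) (h : Admissible q L Q)
include e h

theorem summable_hadamardWeight :
    Summable fun j => hadamardWeight (μ j) := by
  obtain ⟨c, hc, hb⟩ := e.exists_mu_add_le h
  have hs : Summable fun n : ℤ => 1 / (n : ℝ) ^ 2 := Real.summable_one_div_int_pow.2 one_lt_two
  refine Summable.of_norm_bounded_eventually (hs.mul_left (4 / c ^ 2)) ?_
  obtain ⟨N, hN⟩ := exists_nat_gt (2 * |μ 0| / c)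
  rw [div_lt_iff₀ hc] at hN
  have hfin : (Icc (-(N : ℤ)) N).Finite := finite_Icc _ _
  filter_upwards [hfin.compl_mem_cofinite] with j hj
  have hjN : (N : ℝ) < |(j : ℝ)| := by
    rw [mem_compl_iff, mem_Icc, not_and_or, not_le, not_le] at hj
    rw [lt_abs]
    rcases hj with hj | hj
    · right; exact_mod_cast (by omega : (N : ℤ) < -j)
    · left; exact_mod_cast hj
  have h1 := hb j 0
  simp only [Int.cast_zero, sub_zero] at h1
  have h2 : |μ j - μ 0| ≤ |μ j| + |μ 0| := abs_sub _ _
  have hN0 : (0 : ℝ) ≤ N := Nat.cast_nonneg N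
  have h3 : c / 2 * |(j : ℝ)| ≤ |μ j| := by nlinarith
  have hj0 : 0 < |(j : ℝ)| := by linarith
  have h4 : 0 < |μ j| := lt_of_lt_of_le (by positivity) h3
  rw [Real.norm_of_nonneg (hadamardWeight_nonneg _), hadamardWeight, if_neg (abs_pos.1 h4)]
  calc (μ j ^ 2)⁻¹ = (|μ j| ^ 2)⁻¹ := by rw [sq_abs]
    _ ≤ ((c / 2 * |(j : ℝ)|) ^ 2)⁻¹ := by gcongr
    _ = _ := by
      rw [mul_pow, sq_abs]
      have : (j : ℝ) ≠ 0 := abs_pos.1 hj0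
      field_simp; norm_num

theorem ms_deriv_ne_zero (j : ℤ) :
    deriv (fun z => ms q 0 1 L z) (μ j) ≠ 0 := fun h0 => by
  have := (h.of_mR_eq_zero (e.mR_mu h j)).2
  rw [(h.hasDerivAt_mR _).deriv, h0] at this
  simp at this

/-- At each real point the quotient of `ỹ₁₂(L,·)` by the product over its zeros has a
removable singularity and a nonzero value. -/
theorem exists_quotient :
    ∃ G : ℂ → ℂ, Differentiable ℂ G ∧ (∀ z, G z ≠ 0) ∧
      ∀ z, ms q 0 1 L z = G z * hadamardProduct μ z := by
  have hw := e.summable_hadamardWeight h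
  have hm := differentiable_ms h.cont h.bound 0 1 L
  have hP := differentiable_hadamardProduct hw
  have hoff : ∀ z ∈ offReal, ∀ j, z ≠ μ j := fun z hz j hj => hz (by rw [hj]; simp)
  have hPoff : ∀ z ∈ offReal, hadamardProduct μ z ≠ 0 := fun z hz =>
    hadamardProduct_ne_zero hw (hoff z hz)
  have hloc : ∀ s : ℝ, ∃ W : ℂ → ℂ, AnalyticAt ℂ W s ∧ W s ≠ 0 ∧ ∀ᶠ z in 𝓝[offReal] (s : ℂ),
      ms q 0 1 L z / hadamardProduct μ z = W z := by
    intro s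
    by_cases hs : ∃ j, s = μ j
    · obtain ⟨j, rfl⟩ := hs
      have hm0 : ms q 0 1 L (μ j) = 0 := (e.ms_eq_zero_iff h).2 ⟨j, rfl⟩
      obtain ⟨u, hu, hus, hmu⟩ := exists_eq_sub_mul hm hm0
      -- split off the factor which vanishes at `μ j`
      have hw' : Summable fun i : ({j}ᶜ : Set ℤ) => hadamardWeight (μ i) :=
        hw.comp_injective Subtype.val_injective
      obtain ⟨v, hv, hvs, hfv⟩ := exists_eq_sub_mul (differentiable_hadamardFactor (μ j))
        (hadamardFactor_eq_zero_iff.2 rfl)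
      have hv0 : v (μ j) ≠ 0 := by
        rw [hvs]
        by_cases h0 : μ j = 0
        · have : hadamardFactor (μ j) = fun z => z := by ext z; simp [hadamardFactor, h0]
          rw [this]; simp
        · have h' : (μ j : ℂ) ≠ 0 := by exact_mod_cast h0
          have e : hadamardFactor (μ j) = fun z => (1 - z / μ j) * exp (z / μ j) := by
            ext z; simp [hadamardFactor, h0]
          have hd : HasDerivAt (hadamardFactor (μ j)) (-(1 / μ j) * exp 1) (μ j) := by
            rw [e]
            exact ((((hasDerivAt_id (μ j : ℂ)).div_const (μ j : ℂ)).const_sub 1).mul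
              (((hasDerivAt_id (μ j : ℂ)).div_const (μ j : ℂ)).cexp)).congr_deriv (by simp [h'])
          rw [hd.deriv]
          simp [h']
      have hsplit : ∀ z, hadamardProduct μ z = hadamardFactor (μ j) z *
          hadamardProduct (fun i : ({j}ᶜ : Set ℤ) => μ i) z := fun z => by
        have h1 : HasProd ((fun i => hadamardFactor (μ i) z) ∘ ((↑) : ({j} : Set ℤ) → ℤ))
            (hadamardFactor (μ j) z) := by
          have := hasProd_unique ((fun i => hadamardFactor (μ i) z) ∘ ((↑) : ({j} : Set ℤ) → ℤ))
          simpa using this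
        exact (h1.mul_compl (multipliable_hadamardFactor hw' z).hasProd).tprod_eq
      set P' := hadamardProduct (fun i : ({j}ᶜ : Set ℤ) => μ i) with hP'
      have hP'd : Differentiable ℂ P' := differentiable_hadamardProduct hw'
      have hP'0 : P' (μ j) ≠ 0 := hadamardProduct_ne_zero hw' fun i hi =>
        i.2 (e.mu_strictMono.injective (Complex.ofReal_injective hi)).symm
      have hne : v (μ j) * P' (μ j) ≠ 0 := mul_ne_zero hv0 hP'0
      refine ⟨fun z => u z / (v z * P' z), (hu.analyticAt _).div
        ((hv.analyticAt _).mul (hP'd.analyticAt _)) hne, div_ne_zero ?_ hne, ?_⟩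
      · rw [hus]; exact e.ms_deriv_ne_zero h j
      · filter_upwards [self_mem_nhdsWithin] with z hz
        have : z - μ j ≠ 0 := sub_ne_zero.2 (hoff z hz j)
        have hmu' : ms q 0 1 L z = (z - μ j) * u z := hmu z
        rw [hmu', hsplit, hfv, mul_assoc, mul_div_mul_left _ _ this]
    · have hs' : ∀ j, (s : ℂ) ≠ μ j := fun j hj => hs ⟨j, Complex.ofReal_injective hj⟩
      have hPs := hadamardProduct_ne_zero hw hs'
      refine ⟨fun z => ms q 0 1 L z / hadamardProduct μ z,
        (hm.analyticAt _).div (hP.analyticAt _) hPs, div_ne_zero (fun h0 => ?_) hPs,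
        Eventually.of_forall fun z => rfl⟩
      obtain ⟨j, hj⟩ := (e.ms_eq_zero_iff h).1 h0
      exact hs' j hj
  obtain ⟨G, hG, hGo, hGl⟩ := exists_differentiableOn_of_local
    (f := fun z => ms q 0 1 L z / hadamardProduct μ z) (U := univ)
    (fun z _ hz => (hm z).div (hP z) (hPoff z hz))
    (fun s _ => by
      obtain ⟨W, h1, -, h2⟩ := hloc s
      exact ⟨W, h1, h2⟩)
  have hGd : Differentiable ℂ G := fun z => hG z trivial
  refine ⟨G, hGd, fun z => ?_, fun z => ?_⟩
  · by_cases hz : z ∈ offReal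
    · rw [hGo hz]
      refine div_ne_zero (fun h0 => ?_) (hPoff z hz)
      obtain ⟨j, hj⟩ := (e.ms_eq_zero_iff h).1 h0
      exact hoff z hz j hj
    · have ez : z = ((z.re : ℝ) : ℂ) := Complex.ext (by simp) (by simpa [offReal] using hz)
      obtain ⟨W, h1, h2, h3⟩ := hloc z.re
      rw [ez, (hGl z.re W trivial h1 h3).self_of_nhds]
      exact h2
  · have hc : Continuous fun z => G z * hadamardProduct μ z := hGd.continuous.mul hP.continuous
    refine congrFun (Continuous.ext_on dense_offReal hm.continuous hc fun z hz => ?_) z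
    simp only [hGo hz]
    rw [div_mul_cancel₀ _ (hPoff z hz)]

end IsSpectralEnumeration

theorem exp_abs_im_le {L : ℝ} (hL : 0 < L) {z w : ℂ} {r : ℝ} (hw : w ∈ closedBall z r) :
    Real.exp (|w.im| * L) ≤ Real.exp (|z.im| * L) * Real.exp (r * L) := by
  rw [← Real.exp_add, ← add_mul]
  gcongr
  have h1 := abs_im_le_norm (w - z)
  rw [mem_closedBall, dist_eq_norm] at hw
  have h2 := abs_sub_abs_le_abs_sub w.im z.im
  rw [← sub_im] at h2
  linarith

/-- The second logarithmic derivative of `ỹ₁₂(L,·)` is bounded away from the zeros of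
`sin(zL)`. -/
theorem Admissible.exists_deriv_logDeriv_le (h : Admissible q L Q) :
    ∃ C K : ℝ, ∀ z : ℂ, K ≤ ‖z‖ → (∀ n : ℤ, 1 ≤ ‖z * L - n * π‖) →
      ‖deriv (logDeriv fun w => ms q 0 1 L w) z‖ ≤ C ∧
      ∀ s : ℝ, mR q L s = 0 → 1 / (2 * L) ≤ ‖z - s‖ := by
  obtain ⟨c, K, hc, -, hlow⟩ := h.exists_lower_bound (δ := 1 / 2) (by norm_num)
  obtain ⟨M, hM, hup⟩ := h.exists_norm_le
  have hL := h.pos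
  have hm := differentiable_ms h.cont h.bound 0 1 L
  set r := 1 / (4 * L) with hr
  have hr0 : 0 < r := by positivity
  have hrL : r * L = 1 / 4 := by rw [hr]; field_simp
  have hrL2 : 2 * r * L = 1 / 2 := by rw [mul_assoc, hrL]; norm_num
  refine ⟨M * Real.exp (1 / 2) * Real.exp (1 / 2) / (c * r ^ 2), K + 1 / L, fun z hz hn =>
    ⟨?_, fun s hs => ?_⟩⟩
  · have hE := Real.exp_pos (|z.im| * L)
    have := norm_deriv_logDeriv_le hm (z := z) (A := 0) (r := r)
      (M := M * (Real.exp (|z.im| * L) * Real.exp (1 / 2)))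
      (m := c * (Real.exp (|z.im| * L) * (Real.exp (1 / 2))⁻¹)) hr0 (by positivity)
      (fun w hw => ?_) (fun w hw => ?_)
    · refine this.trans (le_of_eq ?_)
      field_simp
    · rw [sub_zero]
      have := exp_abs_im_le hL hw
      rw [hrL2] at this
      exact (hup w).1.trans (by gcongr)
    · have hwz : ‖z - w‖ ≤ r := by rwa [mem_closedBall, dist_comm, dist_eq_norm] at hw
      have hw' : z ∈ closedBall w r := by rwa [mem_closedBall, dist_eq_norm]
      have h1 := exp_abs_im_le hL hw'
      rw [hrL] at h1
      have h2 : Real.exp (1 / 4) ≤ Real.exp (1 / 2) := by gcongr; norm_num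
      have h3 : K ≤ ‖w‖ := by
        have := norm_sub_norm_le z w
        have : r ≤ 1 / L := by
          rw [hr]; gcongr; linarith
        linarith
      have h4 := (hlow w h3 fun n => ?_).2.1
      · refine le_trans ?_ h4
        have hw0 := Real.exp_pos (|w.im| * L)
        have : Real.exp (|z.im| * L) * (Real.exp (1 / 2))⁻¹ ≤ Real.exp (|w.im| * L) := by
          rw [← div_eq_mul_inv, div_le_iff₀ (Real.exp_pos _)]
          exact h1.trans (by gcongr)
        gcongr
      · have h5 := norm_sub_norm_le (z * L - n * π) (w * L - n * π)
        rw [sub_sub_sub_cancel_right, ← sub_mul, norm_mul, norm_real, Real.norm_eq_abs,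
          abs_of_pos hL] at h5
        nlinarith [hn n]
  · by_contra! hlt
    have hlt' : ‖z - s‖ * L < 1 / 2 := by
      calc ‖z - s‖ * L < 1 / (2 * L) * L := by gcongr
        _ = 1 / 2 := by field_simp
    have h3 : K ≤ ‖(s : ℂ)‖ := by
      have := norm_sub_norm_le z s
      have : 1 / (2 * L) ≤ 1 / L := by gcongr; linarith
      linarith
    have h4 := (hlow s h3 fun n => ?_).2.1
    · rw [h.ms_eq, hs, ofReal_zero, norm_zero] at h4
      have := Real.exp_pos (|(s : ℂ).im| * L)
      nlinarith
    · have h5 := norm_sub_norm_le (z * L - n * π) (s * L - n * π)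
      rw [sub_sub_sub_cancel_right, ← sub_mul, norm_mul, norm_real L, Real.norm_eq_abs,
        abs_of_pos hL] at h5
      linarith [hn n]

/-- Along the imaginary axis the second logarithmic derivative of `ỹ₁₂(L,·)` tends to zero. -/
theorem Admissible.tendsto_deriv_logDeriv (h : Admissible q L Q) :
    Tendsto (fun y : ℝ => deriv (logDeriv fun w => ms q 0 1 L w) (y * I)) atTop (𝓝 0) := by
  obtain ⟨K, hK, hb⟩ := h.exists_asymptotics
  have hL := h.pos
  have hm := differentiable_ms h.cont h.bound 0 1 L
  set φ : ℂ → ℂ := fun w => -2 * I * exp (I * w * L) * ms q 0 1 L w with hφ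
  have hφd : Differentiable ℂ φ := by
    have : Differentiable ℂ fun w : ℂ => -2 * I * exp (I * w * L) := by
      fun_prop
    exact this.mul hm
  have hφ1 : ∀ w : ℂ, 0 ≤ w.im → 1 ≤ ‖w‖ →
      ‖φ w - 1‖ ≤ 2 * K / ‖w‖ + Real.exp (-(2 * (w.im * L))) := by
    intro w hw hw1
    have h1 := (hb w hw1).1
    set e := exp (I * w * L) with he
    have hen : Real.exp (|w.im| * L) * ‖e‖ = 1 := by
      rw [he, norm_exp_I_mul, ← Real.exp_add, abs_of_nonneg hw]; simp
    have hene : e ≠ 0 := exp_ne_zero _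
    have hinv : exp (-(w * L) * I) = e⁻¹ := by
      rw [he, ← exp_neg]; congr 1; ring
    have hinv' : exp (w * L * I) = e := by
      rw [he]; congr 1; ring
    have e1 : φ w - 1 = -2 * I * (e * (ms q 0 1 L w - sin (w * L))) - e ^ 2 := by
      have hs : e * sin (w * L) = (1 - e ^ 2) * I / 2 := by
        rw [sin, hinv, hinv']; field_simp
      have hI : I * I = -1 := I_mul_I
      simp only [hφ]
      linear_combination -(2 * I) * hs - (1 - e ^ 2) * hI
    have e2 : ‖e ^ 2‖ = Real.exp (-(2 * (w.im * L))) := by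
      rw [norm_pow, he, norm_exp_I_mul, ← Real.exp_nat_mul]; congr 1; push_cast; ring
    rw [e1, ← e2]
    refine (norm_sub_le _ _).trans ?_
    gcongr
    rw [norm_mul, norm_mul, norm_neg, norm_I, norm_ofNat, norm_mul, mul_one]
    calc 2 * (‖e‖ * ‖ms q 0 1 L w - sin (w * L)‖)
        ≤ 2 * (‖e‖ * (K * Real.exp (|w.im| * L) / ‖w‖)) := by gcongr
      _ = 2 * K * (Real.exp (|w.im| * L) * ‖e‖) / ‖w‖ := by ring
      _ = _ := by rw [hen, mul_one]
  set ε : ℝ → ℝ := fun y => 2 * K / (y - 2) + Real.exp (-(2 * ((y - 2) * L))) with hε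
  have hε0 : Tendsto ε atTop (𝓝 0) := by
    have h1 : Tendsto (fun y : ℝ => y - 2) atTop atTop := tendsto_atTop_add_const_right _ _ tendsto_id
    have h2 : Tendsto (fun y : ℝ => 2 * K / (y - 2)) atTop (𝓝 0) := h1.const_div_atTop _
    have h3 : Tendsto (fun y : ℝ => 2 * ((y - 2) * L)) atTop atTop :=
      (h1.atTop_mul_const hL).const_mul_atTop two_pos
    simpa using h2.add (Real.tendsto_exp_neg_atTop_nhds_zero.comp h3)
  have hbd : ∀ᶠ y : ℝ in atTop, ‖deriv (logDeriv fun w => ms q 0 1 L w) (y * I)‖ ≤ 2 * ε y := by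
    filter_upwards [eventually_ge_atTop (3 : ℝ), hε0.eventually_le_const
      (show (0 : ℝ) < 1 / 2 by norm_num)] with y hy hεy
    have him : ((y : ℂ) * I).im = y := by simp
    have hball : ∀ w ∈ closedBall ((y : ℂ) * I) (2 * 1), ‖φ w - 1‖ ≤ ε y := by
      intro w hw
      rw [mem_closedBall, dist_eq_norm, mul_one] at hw
      have h1 := (abs_im_le_norm _).trans hw
      rw [sub_im, him] at h1
      have h2 : y - 2 ≤ w.im := by linarith [(abs_le.1 h1).1]
      have h3 : y - 2 ≤ ‖w‖ := h2.trans ((le_abs_self _).trans (abs_im_le_norm w))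
      refine (hφ1 w (by linarith) (by linarith)).trans ?_
      simp only [hε]
      have : 0 < y - 2 := by linarith
      gcongr
    have h1 := norm_deriv_logDeriv_le hφd (z := (y : ℂ) * I) (A := 1) (r := 1) (M := ε y)
      (m := 1 / 2) one_pos (by norm_num) hball fun w hw => by
        have := hball w (closedBall_subset_closedBall (by norm_num) hw)
        have h2 := norm_sub_norm_le (1 : ℂ) (1 - φ w)
        rw [sub_sub_cancel, norm_sub_rev, norm_one] at h2
        linarith
    have hmne : ms q 0 1 L ((y : ℂ) * I) ≠ 0 := fun h0 => by
      have := im_eq_zero_of_ms_eq_zero h.cont h.pos h0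
      rw [him] at this; linarith
    have heq : logDeriv φ =ᶠ[𝓝 ((y : ℂ) * I)]
        fun w => logDeriv (fun w => ms q 0 1 L w) w + I * L := by
      filter_upwards [hm.continuous.continuousAt.eventually_ne hmne] with w hw
      have hexp : HasDerivAt (fun w : ℂ => -2 * I * exp (I * w * L))
          (-2 * I * (exp (I * w * L) * (I * L))) w :=
        ((((hasDerivAt_id w).const_mul I).mul_const (L : ℂ)).cexp.const_mul _).congr_deriv
          (by simp)
      have hd := hexp.mul (hm w).hasDerivAt
      have hd' : deriv φ w = _ := hd.deriv
      rw [logDeriv_apply, logDeriv_apply, hd']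
      simp only [hφ]
      have hene : exp (I * w * L) ≠ 0 := exp_ne_zero _
      have hI := I_ne_zero
      field_simp
      ring
    rw [heq.deriv_eq, deriv_add_const] at h1
    refine h1.trans (le_of_eq ?_)
    ring
  exact squeeze_zero_norm' hbd (by simpa using hε0.const_mul 2)

namespace IsSpectralEnumeration

variable (e : IsSpectralEnumeration q L ζ μ) (h : Admissible q L Q)
include e h

/-- Hadamard's factorization: the quotient of `ỹ₁₂(L,·)` by the product over its zeros has a
bounded second logarithmic derivative, which tends to zero along the imaginary axis. -/
theorem exists_isHadamardConstants :
    ∃ A B : ℂ, IsHadamardConstants q L μ A B := by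
  obtain ⟨G, hG, hG0, hGm⟩ := e.exists_quotient h
  have hw := e.summable_hadamardWeight h
  have hm := differentiable_ms h.cont h.bound 0 1 L
  have hP := differentiable_hadamardProduct hw
  have hlG : Differentiable ℂ (logDeriv G) := fun z => (differentiable_deriv hG z).div (hG z) (hG0 z)
  set κ := deriv (logDeriv G) with hκ
  have hκd : Differentiable ℂ κ := differentiable_deriv hlG
  have hoff : ∀ z ∈ offReal, ∀ j, z ≠ μ j := fun z hz j hj => hz (by rw [hj]; simp)
  have hPoff : ∀ z ∈ offReal, hadamardProduct μ z ≠ 0 := fun z hz =>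
    hadamardProduct_ne_zero hw (hoff z hz)
  have hκe : ∀ z ∈ offReal, κ z = deriv (logDeriv fun w => ms q 0 1 L w) z -
      deriv (logDeriv (hadamardProduct μ)) z := by
    intro z hz
    have hev : (logDeriv fun w => ms q 0 1 L w) =ᶠ[𝓝 z]
        fun w => logDeriv G w + logDeriv (hadamardProduct μ) w := by
      filter_upwards [isOpen_offReal.mem_nhds hz] with w hw'
      rw [show (fun w => ms q 0 1 L w) = fun w => G w * hadamardProduct μ w from funext hGm]
      exact logDeriv_mul w (hG0 w) (hPoff w hw') (hG w) (hP w)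
    have hd2 : DifferentiableAt ℂ (logDeriv (hadamardProduct μ)) z :=
      (differentiable_deriv hP z).div (hP z) (hPoff z hz)
    rw [hev.deriv_eq]
    have : deriv (fun w => logDeriv G w + logDeriv (hadamardProduct μ) w) z = _ :=
      ((hlG z).hasDerivAt.add hd2.hasDerivAt).deriv
    rw [this]
    ring
  obtain ⟨C, K, hCK⟩ := h.exists_deriv_logDeriv_le
  obtain ⟨c, hc, hsep⟩ := e.exists_mu_add_le h
  have hL := h.pos
  have hpi := Real.pi_gt_three
  set C' := C + (((1 / (2 * L)) ^ 2)⁻¹ + 4 / c ^ 2 * ∑' n : ℤ, 1 / (n : ℝ) ^ 2) with hC'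
  have hgood : ∀ z ∈ offReal, K ≤ ‖z‖ → (∀ n : ℤ, 1 ≤ ‖z * L - n * π‖) → ‖κ z‖ ≤ C' := by
    intro z hz hzK hn
    obtain ⟨h1, h2⟩ := hCK z hzK hn
    rw [hκe z hz]
    refine (norm_sub_le _ _).trans (add_le_add h1 ?_)
    exact norm_deriv_logDeriv_hadamardProduct_le hw hz fun J =>
      sum_inv_sq_le hc (by positivity) hsep (fun j => h2 _ (e.mR_mu h j)) J
  have hbd : ∀ z, ‖κ z‖ ≤ C' := by
    have hoffb : ∀ z ∈ offReal, ‖κ z‖ ≤ C' := by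
      intro z hz
      obtain ⟨n, hn⟩ := exists_nat_gt ((max ‖z‖ K + 1 / L) * L)
      -- on the circle of radius `R` the zeros `kπ/L` are at distance at least `π/(2L)`
      set R := (n + 1 / 2) * π / L with hR
      have hRn : max ‖z‖ K + 1 / L < R := by
        rw [hR, lt_div_iff₀ hL]
        have : (0 : ℝ) ≤ n := Nat.cast_nonneg n
        nlinarith
      refine norm_le_of_sphere (c := 0) (r := R) (fun w _ _ => hκd w)
        (fun s _ => ⟨κ, hκd.analyticAt _, Eventually.of_forall fun _ => rfl⟩)
        ⟨{w : ℂ | |‖w‖ * L - (n + 1 / 2) * π| < 1 / 2}, ?_, ?_, ?_⟩ ?_ hz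
      · exact isOpen_lt (by fun_prop) continuous_const
      · intro w hw
        rw [mem_sphere_zero_iff_norm] at hw
        rw [mem_ofPred_eq, hw, hR, div_mul_cancel₀ _ hL.ne', sub_self, abs_zero]
        norm_num
      · intro w hw hwo
        rw [mem_ofPred_eq] at hw
        refine hgood w hwo ?_ fun k => ?_
        · have h1 : (R - ‖w‖) * L < 1 / 2 := by
            have := (abs_lt.1 hw).1
            rw [sub_mul, hR, div_mul_cancel₀ _ hL.ne']; linarith
          have h2 : R - ‖w‖ < 1 / L := by
            rw [lt_div_iff₀ hL]; linarith
          linarith [le_max_right ‖z‖ K]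
        · have h1 := abs_norm_sub_norm_le (w * L) (k * π)
          rw [norm_mul, norm_mul, norm_real, norm_real, Real.norm_of_nonneg hL.le,
            Real.norm_of_nonneg Real.pi_pos.le, Complex.norm_intCast] at h1
          refine le_trans ?_ h1
          have h3 : π / 2 ≤ |(n + 1 / 2) * π - |(k : ℝ)| * π| := by
            rw [← sub_mul, abs_mul, abs_of_pos Real.pi_pos]
            have : (1 : ℝ) / 2 ≤ abs ((n + 1 / 2 : ℝ) - abs (k : ℝ)) := by
              rw [← Int.cast_abs, le_abs]
              rcases le_or_gt |k| (n : ℤ) with hk | hk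
              · left
                have : ((|k| : ℤ) : ℝ) ≤ n := by exact_mod_cast hk
                linarith
              · right
                have : (n : ℝ) + 1 ≤ ((|k| : ℤ) : ℝ) := by exact_mod_cast hk
                linarith
            nlinarith [Real.pi_pos]
          have h4 := abs_sub_abs_le_abs_sub ((n + 1 / 2) * π - |(k : ℝ)| * π)
            (‖w‖ * L - |(k : ℝ)| * π)
          rw [sub_sub_sub_cancel_right] at h4
          rw [abs_sub_comm] at hw
          linarith
      · rw [mem_ball_zero_iff]
        have : 0 < 1 / L := by positivity
        linarith [le_max_left ‖z‖ K]
    -- the bound extends to the real line by density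
    have hcl : IsClosed {z | ‖κ z‖ ≤ C'} := isClosed_le hκd.continuous.norm continuous_const
    intro z
    have := hcl.closure_subset_iff.2 hoffb
    rw [dense_offReal.closure_eq] at this
    exact this trivial
  have hκ0 : ∀ z, κ z = 0 := by
    intro z
    have hconst : ∀ y : ℝ, κ (y * I) = κ z := fun y =>
      hκd.apply_eq_apply_of_bounded (isBounded_iff_forall_norm_le.2
        ⟨C', by rintro _ ⟨w, rfl⟩; exact hbd w⟩) _ _
    have ht1 := h.tendsto_deriv_logDeriv
    have hwt : ∀ y : ℝ, 1 ≤ y → ∀ j, (y ^ 2 + μ j ^ 2)⁻¹ ≤ hadamardWeight (μ j) := fun y hy j => by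
      have hy2 : 1 ≤ y ^ 2 := by nlinarith
      rw [hadamardWeight]
      split_ifs with h0
      · exact inv_le_one_of_one_le₀ (by nlinarith [sq_nonneg (μ j)])
      · have : 0 < μ j ^ 2 := by positivity
        gcongr
        linarith
    have ht2 : Tendsto (fun y : ℝ => ∑' j, (y ^ 2 + μ j ^ 2)⁻¹) atTop (𝓝 0) := by
      have := tendsto_tsum_of_dominated_convergence (𝓕 := atTop)
        (f := fun (y : ℝ) j => (y ^ 2 + μ j ^ 2)⁻¹) (g := fun _ => (0 : ℝ)) hw
        (fun j => (tendsto_atTop_add_const_right _ _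
          (tendsto_pow_atTop two_ne_zero)).inv_tendsto_atTop) (by
          filter_upwards [eventually_ge_atTop (1 : ℝ)] with y hy j
          rw [Real.norm_of_nonneg (by positivity)]; exact hwt y hy j)
      simpa using this
    have hle : ∀ᶠ y : ℝ in atTop, ‖κ z‖ ≤
        ‖deriv (logDeriv fun w => ms q 0 1 L w) (y * I)‖ + ∑' j, (y ^ 2 + μ j ^ 2)⁻¹ := by
      filter_upwards [eventually_ge_atTop (1 : ℝ)] with y hy
      have hyo : (y : ℂ) * I ∈ offReal := by
        simp only [offReal, mem_ofPred_eq, Complex.mul_I_im, ofReal_re]; linarith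
      rw [← hconst y, hκe _ hyo]
      refine (norm_sub_le _ _).trans (add_le_add_right ?_ _)
      refine norm_deriv_logDeriv_hadamardProduct_le hw hyo fun J => ?_
      have hn : ∀ j, ‖(y : ℂ) * I - μ j‖ ^ 2 = y ^ 2 + μ j ^ 2 := fun j => by
        rw [← normSq_eq_norm_sq, normSq_apply]; simp; ring
      simp only [hn]
      refine Summable.sum_le_tsum J (fun j _ => by positivity) ?_
      exact Summable.of_nonneg_of_le (fun j => by positivity) (hwt y hy) hw
    have hlim := ge_of_tendsto (ht1.norm.add ht2) hle
    rw [norm_zero, add_zero] at hlim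
    exact norm_le_zero_iff.1 hlim
  have hA : ∀ z, logDeriv G z = logDeriv G 0 := fun z =>
    is_const_of_deriv_eq_zero hlG hκ0 z 0
  set A := logDeriv G 0 with hAdef
  have hG' : ∀ z, HasDerivAt G (A * G z) z := fun z => by
    have h1 := hA z
    rw [logDeriv_apply, div_eq_iff (hG0 z)] at h1
    rw [← h1]
    exact (hG z).hasDerivAt
  have hH : ∀ z, HasDerivAt (fun z => G z * exp (-A * z)) 0 z := fun z =>
    ((hG' z).mul (((hasDerivAt_id z).const_mul (-A)).cexp)).congr_deriv (by simp; ring)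
  have hconst : ∀ z, G z * exp (-A * z) = G 0 := fun z => by
    have := is_const_of_deriv_eq_zero (fun z => (hH z).differentiableAt)
      (fun z => (hH z).deriv) z 0
    simpa using this
  refine ⟨A, Complex.log (G 0), fun z => ⟨multipliable_hadamardFactor hw z, ?_⟩⟩
  rw [exp_add, Complex.exp_log (hG0 0), ← hconst z]
  have : exp (A * z) * (G z * exp (-A * z)) = G z := by
    rw [mul_left_comm, ← exp_add]; simp
  rw [this]
  exact hGm z

end IsSpectralEnumeration

variable {A B : ℂ}

local notation "𝔣" => signProduct q L μ
local notation "f⁰" => fZero q L μ A B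
local notation "Γ" => zeroSignMovable q L ζ μ

/-! ### The three partial products and the signs -/

/-- Half the difference of the diagonal entries of the monodromy matrix. -/
def halfDiff (q : ℝ → ℂ) (L : ℝ) (z : ℂ) : ℂ := (ms q 1 1 L z - ms q 0 0 L z) / 2

namespace Admissible

variable (h : Admissible q L Q)
include h

theorem differentiable_halfDiff :
    Differentiable ℂ (halfDiff q L) :=
  ((differentiable_ms h.cont h.bound 1 1 L).sub (differentiable_ms h.cont h.bound 0 0 L)).div_const 2

theorem halfDiff_conj (z : ℂ) :
    halfDiff q L (conj z) = conj (halfDiff q L z) := by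
  simp only [halfDiff, ms_conj h.cont, map_div₀, map_sub, map_ofNat]

theorem halfDiff_sq (h0 : ms q 0 1 L z = 0) :
    halfDiff q L z ^ 2 = Δ z ^ 2 - 1 := by
  rw [discriminant_sq_sub_one_ms h.cont, h0, halfDiff]; ring

theorem halfDiff_ofReal (s : ℝ) :
    halfDiff q L s = ((halfDiff q L s).re : ℂ) := by
  have := h.halfDiff_conj s
  rw [conj_ofReal] at this
  exact (conj_eq_iff_re.1 this.symm).symm

theorem ms_ofReal (i j : Fin 2) (x s : ℝ) :
    ms q i j x s = ((ms q i j x s).re : ℂ) := by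
  have := ms_conj h.cont i j x s
  rw [conj_ofReal] at this
  exact (conj_eq_iff_re.1 this.symm).symm

end Admissible

/-- At a Dirichlet eigenvalue `ỹ₁₁ỹ₂₂ = 1`, so that the sign `σ_j` compares the two diagonal entries
of the monodromy matrix. -/
theorem IsSpectralEnumeration.dirSign_eq (e : IsSpectralEnumeration q L ζ μ) (h : Admissible q L Q)
    (j : ℤ) : dirSign q L μ j = -sign ((halfDiff q L (μ j)).re * dR q L (μ j)) := by
  have h0 : ms q 0 1 L (μ j) = 0 := (e.ms_eq_zero_iff h).2 ⟨j, rfl⟩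
  have hdet := ms_det h.cont L (μ j : ℂ)
  have h1 : dR q L (μ j) = ((ms q 0 0 L (μ j)).re + (ms q 1 1 L (μ j)).re) / 2 := by
    rw [dR, discriminant_eq_ms, h.ms_ofReal 0 0, h.ms_ofReal 1 1]; norm_cast
  have h2 : (halfDiff q L (μ j)).re = ((ms q 1 1 L (μ j)).re - (ms q 0 0 L (μ j)).re) / 2 := by
    rw [halfDiff, h.ms_ofReal 0 0, h.ms_ofReal 1 1]; norm_cast
  rw [h0, zero_mul, sub_zero, h.ms_ofReal 0 0, h.ms_ofReal 1 1] at hdet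
  rw [dirSign, h1, h2]
  change -sign (Real.log ‖ms q 1 1 L (μ j)‖) = _
  rw [h.ms_ofReal 1 1, norm_real, ofReal_re, Real.norm_eq_abs, Real.log_abs]
  generalize (ms q 0 0 L (μ j)).re = a at hdet ⊢
  generalize (ms q 1 1 L (μ j)).re = d at hdet ⊢
  have had : a * d = 1 := by exact_mod_cast hdet
  have hd : d ≠ 0 := by rintro rfl; simp at had
  have hap : 0 < |d| := abs_pos.2 hd
  have hsq : a ^ 2 * d ^ 2 = 1 := by rw [← mul_pow, had, one_pow]
  congr 1
  rw [← Real.log_abs]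
  rcases lt_trichotomy |d| 1 with hlt | heq | hgt
  · rw [sign_neg (Real.log_neg hap hlt), sign_neg]
    have : d ^ 2 < 1 := by rw [← sq_abs]; nlinarith
    nlinarith [sq_nonneg a]
  · rw [heq, Real.log_one, sign_zero]
    have hd2 : d ^ 2 = 1 := by rw [← sq_abs, heq, one_pow]
    rw [hd2, mul_one] at hsq
    rw [show (d - a) / 2 * ((a + d) / 2) = (d ^ 2 - a ^ 2) / 4 by ring, hd2, hsq]
    simp
  · rw [sign_pos (Real.log_pos hgt), sign_pos]
    have : 1 < d ^ 2 := by rw [← sq_abs]; nlinarith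
    nlinarith [sq_nonneg a]

namespace IsSpectralEnumeration

variable (e : IsSpectralEnumeration q L ζ μ) (h : Admissible q L Q)
include e h

theorem halfDiff_re_sq (j : ℤ) :
    (halfDiff q L (μ j)).re ^ 2 = dR q L (μ j) ^ 2 - 1 := by
  have := h.halfDiff_sq ((e.ms_eq_zero_iff h).2 ⟨j, rfl⟩)
  rw [h.halfDiff_ofReal, h.discriminant_eq] at this
  exact_mod_cast this

theorem dirSign_eq_zero_iff (j : ℤ) :
    dirSign q L μ j = 0 ↔ dR q L (μ j) ^ 2 = 1 := by
  have h1 := e.halfDiff_re_sq h j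
  have h2 := (h.of_mR_eq_zero (e.mR_mu h j)).1
  have h3 : dR q L (μ j) ≠ 0 := by rintro h0; rw [h0] at h2; norm_num at h2
  rw [e.dirSign_eq h]
  constructor
  · intro h4
    have h5 : sign ((halfDiff q L (μ j)).re * dR q L (μ j)) = 0 := by
      generalize sign ((halfDiff q L (μ j)).re * dR q L (μ j)) = t at h4
      revert h4; cases t <;> decide
    rw [sign_eq_zero_iff, mul_eq_zero, or_iff_left h3] at h5
    rw [h5] at h1; linarith
  · intro h4
    rw [h4, sub_self] at h1
    rw [pow_eq_zero_iff two_ne_zero |>.1 h1, zero_mul, sign_zero]; rfl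

theorem isOpenGap_of_dirSign_ne_zero
    {j : ℤ} (hj : dirSign q L μ j ≠ 0) : IsOpenGap ζ j := by
  by_contra hc
  exact hj ((e.dirSign_eq_zero_iff h j).2 (e.deriv_eq_zero_of_not_isOpenGap h hc).1)

theorem summable_sign (τ : SignType) :
    Summable fun j : {j : ℤ // dirSign q L μ j = τ} => hadamardWeight (μ j) :=
  (e.summable_hadamardWeight h).comp_injective Subtype.val_injective

theorem differentiable_signProduct
    (τ : SignType) : Differentiable ℂ (𝔣 τ) :=
  differentiable_hadamardProduct (e.summable_sign h τ)

theorem signProduct_conj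
    (τ : SignType) (z : ℂ) :
    𝔣 τ (conj z) = conj (𝔣 τ z) :=
  hadamardProduct_conj (e.summable_sign h τ) z

theorem signProduct_ofReal
    (τ : SignType) (s : ℝ) :
    𝔣 τ s = ((𝔣 τ s).re : ℂ) :=
  hadamardProduct_ofReal (e.summable_sign h τ) s

theorem signProduct_eq_zero_iff
    {τ : SignType} :
    𝔣 τ z = 0 ↔ ∃ j, dirSign q L μ j = τ ∧ z = μ j := by
  constructor
  · intro h0
    by_contra! hc
    exact hadamardProduct_ne_zero (e.summable_sign h τ) (fun j => hc j j.2) h0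
  · rintro ⟨j, hj, rfl⟩
    exact hadamardProduct_eq_zero (ι := {j // dirSign q L μ j = τ}) ⟨j, hj⟩

theorem norm_signProduct_le
    (τ : SignType) : ∃ c : ℝ, 0 ≤ c ∧ ∀ z, ‖𝔣 τ z‖ ≤ Real.exp (c * ‖z‖ ^ 2) :=
  ⟨_, tsum_nonneg fun _ => hadamardWeight_nonneg _, norm_hadamardProduct_le (e.summable_sign h τ)⟩

/-- The product over all Dirichlet eigenvalues splits according to the signs. -/
theorem ms_eq_mul
    (hAB : IsHadamardConstants q L μ A B) (z : ℂ) :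
    ms q 0 1 L z = 2 * f⁰ z * 𝔣 1 z * 𝔣 (-1) z := by
  have key : ∀ τ, HasProd ({j : ℤ | dirSign q L μ j = τ}.mulIndicator
      fun j => hadamardFactor (μ j) z) (𝔣 τ z) := fun τ =>
    hasProd_subtype_iff_mulIndicator.1
      (multipliable_hadamardFactor (e.summable_sign h τ) z).hasProd
  have h3 := ((key 0).mul (key 1)).mul (key (-1))
  have hfun : (fun j => {j : ℤ | dirSign q L μ j = 0}.mulIndicator
      (fun j => hadamardFactor (μ j) z) j * {j : ℤ | dirSign q L μ j = 1}.mulIndicator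
      (fun j => hadamardFactor (μ j) z) j * {j : ℤ | dirSign q L μ j = -1}.mulIndicator
      (fun j => hadamardFactor (μ j) z) j) = fun j => hadamardFactor (μ j) z := by
    ext j
    simp only [mulIndicator, mem_ofPred_eq]
    rcases h : dirSign q L μ j <;> simp
  rw [hfun] at h3
  have h4 := (hAB z).2
  rw [h3.tprod_eq] at h4
  rw [ms, h4, fZero]
  ring

theorem differentiable_fZero (A B : ℂ) : Differentiable ℂ (fZero q L μ A B) := by
  have := e.differentiable_signProduct h 0
  unfold fZero
  fun_prop

theorem fZero_eq_zero_iff :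
    f⁰ z = 0 ↔ ∃ j, dirSign q L μ j = 0 ∧ z = μ j := by
  rw [← e.signProduct_eq_zero_iff h, fZero]
  simp [exp_ne_zero]

theorem norm_fZero_le (A B : ℂ) :
    ∃ c : ℝ, 0 ≤ c ∧ ∀ z, 1 ≤ ‖z‖ → ‖fZero q L μ A B z‖ ≤ Real.exp (c * ‖z‖ ^ 2) := by
  obtain ⟨c, hc, hb⟩ := e.norm_signProduct_le h 0
  refine ⟨‖A‖ + ‖B‖ + c, by positivity, fun z hz => ?_⟩
  have h1 : ‖exp (A * z + B)‖ ≤ Real.exp ((‖A‖ + ‖B‖) * ‖z‖ ^ 2) := by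
    refine (Complex.norm_exp_le_exp_norm _).trans (Real.exp_le_exp.2 ?_)
    have h2 : ‖z‖ ≤ ‖z‖ ^ 2 := by nlinarith
    have h3 : 1 ≤ ‖z‖ ^ 2 := by nlinarith
    calc ‖A * z + B‖ ≤ ‖A‖ * ‖z‖ + ‖B‖ := (norm_add_le _ _).trans (by rw [norm_mul])
      _ ≤ ‖A‖ * ‖z‖ ^ 2 + ‖B‖ * ‖z‖ ^ 2 := by
        have := norm_nonneg A; have := norm_nonneg B
        gcongr
        nlinarith
      _ = _ := by ring
  rw [fZero, norm_mul, norm_mul, add_mul, Real.exp_add]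
  refine mul_le_mul ?_ (hb z) (norm_nonneg _) (Real.exp_pos _).le
  refine le_trans ?_ h1
  have : ‖(1 / 2 : ℂ)‖ = 1 / 2 := by norm_num
  rw [this]
  linarith [norm_nonneg (exp (A * z + B))]

omit e in
theorem ms_ne_zero_of_im (hz : z ∈ offReal) :
    ms q 0 1 L z ≠ 0 := fun h0 => hz (im_eq_zero_of_ms_eq_zero h.cont h.pos h0)

theorem factors_ne_zero
    (hAB : IsHadamardConstants q L μ A B) (hz : ms q 0 1 L z ≠ 0) :
    f⁰ z ≠ 0 ∧ 𝔣 1 z ≠ 0 ∧ 𝔣 (-1) z ≠ 0 := by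
  rw [e.ms_eq_mul h hAB] at hz
  refine ⟨fun h0 => hz ?_, fun h0 => hz ?_, fun h0 => hz ?_⟩ <;> rw [h0] <;> ring

theorem fZero_conj
    (hAB : IsHadamardConstants q L μ A B) (z : ℂ) :
    f⁰ (conj z) = conj (f⁰ z) := by
  have hc := (e.differentiable_fZero h A B).continuous
  have key : (fun z => f⁰ (conj z)) = fun z => conj (f⁰ z) := by
    refine Continuous.ext_on dense_offReal (hc.comp continuous_conj)
      (continuous_conj.comp hc) fun z hz => ?_
    obtain ⟨-, h1, h2⟩ := e.factors_ne_zero h hAB (ms_ne_zero_of_im h hz)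
    have h3 := ms_conj h.cont 0 1 L z
    rw [e.ms_eq_mul h hAB, e.ms_eq_mul h hAB, e.signProduct_conj h, e.signProduct_conj h, map_mul,
      map_mul, map_mul, map_ofNat] at h3
    have h1' := (map_ne_zero conj).2 h1
    have h2' := (map_ne_zero conj).2 h2
    exact mul_left_cancel₀ two_ne_zero (mul_right_cancel₀ h1' (mul_right_cancel₀ h2' h3))
  exact congrFun key z

theorem fZero_ofReal
    (hAB : IsHadamardConstants q L μ A B) (s : ℝ) :
    f⁰ s = ((f⁰ s).re : ℂ) := by
  have := e.fZero_conj h hAB s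
  rw [conj_ofReal] at this
  exact (conj_eq_iff_re.1 this.symm).symm

/-- The real form of the factorization of `ỹ₁₂(L,·)`. -/
theorem mR_eq_mul
    (hAB : IsHadamardConstants q L μ A B) (s : ℝ) :
    mR q L s = 2 * (f⁰ s).re * ((𝔣 1 s).re * (𝔣 (-1) s).re) := by
  have := e.ms_eq_mul h hAB s
  rw [h.ms_eq, e.fZero_ofReal h hAB, e.signProduct_ofReal h 1, e.signProduct_ofReal h (-1)] at this
  rw [← mul_assoc]
  exact_mod_cast this

end IsSpectralEnumeration

/-! ### Branches of roots -/

/-- Two continuous `n`-th roots of the same nonvanishing function on a preconnected set differ by a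
constant factor. -/
theorem exists_eq_const_mul_of_pow_eq {X : Type*} [TopologicalSpace X] {U : Set X}
    (hU : IsPreconnected U) {f g : X → ℂ} {n : ℕ} (hn : n ≠ 0) (hf : ContinuousOn f U)
    (hg : ContinuousOn g U) (h0 : ∀ z ∈ U, g z ≠ 0) (h : ∀ z ∈ U, f z ^ n = g z ^ n) :
    ∃ c : ℂ, c ^ n = 1 ∧ ∀ z ∈ U, f z = c * g z := by
  have hT : ({c : ℂ | c ^ n = 1}).Finite := by
    have : {c : ℂ | c ^ n = 1} ⊆ ((Polynomial.nthRoots n (1 : ℂ)).toFinset : Set ℂ) := fun c hc => by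
      rw [Finset.mem_coe, Multiset.mem_toFinset, Polynomial.mem_nthRoots (Nat.pos_of_ne_zero hn)]
      exact hc
    exact (Finset.finite_toSet _).subset this
  obtain ⟨c, hc, hcU⟩ := hU.eqOn_const_of_mapsTo hT.isDiscrete (f := fun z => f z / g z)
    (hf.div hg h0) (fun z hz => by
      rw [mem_ofPred_eq, div_pow, h z hz, div_self (pow_ne_zero _ (h0 z hz))]) ⟨1, one_pow n⟩
  refine ⟨c, hc, fun z hz => ?_⟩
  rw [← div_eq_iff (h0 z hz)]
  exact hcU hz

theorem exists_analyticAt_pow_eq {g : ℂ → ℂ} {s : ℂ} {n : ℕ} (hn : n ≠ 0) (hg : AnalyticAt ℂ g s)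
    (h0 : g s ≠ 0) :
    ∃ W : ℂ → ℂ, AnalyticAt ℂ W s ∧ W s ≠ 0 ∧ ∀ z, W z ^ n = g z := by
  obtain ⟨r, hr⟩ := IsAlgClosed.exists_pow_nat_eq (g s) (Nat.pos_of_ne_zero hn)
  have hW : ∀ z, (r * (g z / g s) ^ (1 / n : ℂ)) ^ n = g z := fun z => by
    rw [mul_pow, hr, one_div, Complex.cpow_nat_inv_pow _ hn, mul_div_cancel₀ _ h0]
  refine ⟨fun z => r * (g z / g s) ^ (1 / n : ℂ), ?_, fun h => h0 ?_, hW⟩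
  · refine analyticAt_const.mul ((hg.div analyticAt_const h0).cpow analyticAt_const ?_)
    change g s / g s ∈ _
    rw [div_self h0]; exact Complex.one_mem_slitPlane
  · have h' : r * (g s / g s) ^ (1 / n : ℂ) = 0 := h
    rw [← hW s, h', zero_pow hn]

/-- A continuous root of a nonvanishing holomorphic function on one side of a boundary point
extends holomorphically across it. -/
theorem exists_analyticAt_of_pow_eq {f g : ℂ → ℂ} {U : Set ℂ} {s : ℂ} {n : ℕ} (hU : Convex ℝ U)
    (hn : n ≠ 0) (hf : ∀ᶠ z in 𝓝[U] s, ContinuousWithinAt f U z ∧ f z ^ n = g z)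
    (hg : AnalyticAt ℂ g s) (h0 : g s ≠ 0) :
    ∃ W : ℂ → ℂ, AnalyticAt ℂ W s ∧ W s ≠ 0 ∧ (∀ z, W z ^ n = g z) ∧ ∀ᶠ z in 𝓝[U] s, f z = W z := by
  obtain ⟨W, hW, hW0, hWn⟩ := exists_analyticAt_pow_eq hn hg h0
  have h1 : ∀ᶠ z in 𝓝[U] s, (ContinuousWithinAt f U z ∧ f z ^ n = g z) ∧ AnalyticAt ℂ W z ∧
      W z ≠ 0 :=
    hf.and (((hW.eventually_analyticAt).and (hW.continuousAt.eventually_ne hW0)).filter_mono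
      nhdsWithin_le_nhds)
  obtain ⟨r, hr, hball⟩ := mem_nhdsWithin_iff.1 h1
  obtain ⟨c, hc, hcW⟩ := exists_eq_const_mul_of_pow_eq
    (((convex_ball s r).inter hU).isPreconnected) hn (f := f) (g := W)
    (fun z hz => ((hball hz).1.1).mono inter_subset_right)
    (fun z hz => (hball hz).2.1.continuousAt.continuousWithinAt) (fun z hz => (hball hz).2.2)
    (fun z hz => by rw [hWn]; exact (hball hz).1.2)
  have hc0 : c ≠ 0 := by rintro rfl; rw [zero_pow hn] at hc; exact zero_ne_one hc
  refine ⟨fun z => c * W z, analyticAt_const.mul hW, mul_ne_zero hc0 hW0, fun z => by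
    rw [mul_pow, hc, one_mul, hWn], ?_⟩
  filter_upwards [inter_mem_nhdsWithin U (ball_mem_nhds s hr)] with z hz
  exact hcW z ⟨hz.2, hz.1⟩

theorem differentiableAt_of_pow_eq {f g : ℂ → ℂ} {s : ℂ} {n : ℕ} (hn : n ≠ 0)
    (hf : ∀ᶠ z in 𝓝 s, ContinuousAt f z ∧ f z ^ n = g z) (hg : AnalyticAt ℂ g s) (h0 : g s ≠ 0) :
    DifferentiableAt ℂ f s := by
  obtain ⟨W, hW, -, -, hev⟩ := exists_analyticAt_of_pow_eq (f := f) convex_univ hn (by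
    rw [nhdsWithin_univ]
    simpa only [continuousWithinAt_univ] using hf) hg h0
  rw [nhdsWithin_univ] at hev
  exact hW.differentiableAt.congr_of_eventuallyEq hev

theorem convex_upper : Convex ℝ upper := convex_halfSpace_im_gt 0

theorem isOpen_upper : IsOpen upper := isOpen_lt continuous_const continuous_im

theorem isOpen_lower : IsOpen lower := isOpen_lt continuous_im continuous_const

theorem upper_union_lower : upper ∪ lower = offReal := by
  ext z
  simp only [upper, lower, offReal, mem_union, mem_ofPred_eq]
  rw [or_comm]; exact lt_or_lt_iff_ne

instance neBot_nhdsWithin_upper (s : ℝ) : (𝓝[upper] (s : ℂ)).NeBot := by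
  rw [← mem_closure_iff_nhdsWithin_neBot, upper, Complex.closure_setOfPred_lt_im]
  simp

instance neBot_nhdsWithin_lower (s : ℝ) : (𝓝[lower] (s : ℂ)).NeBot := by
  rw [← mem_closure_iff_nhdsWithin_neBot, lower, Complex.closure_setOfPred_im_lt]
  simp

/-- The plane cut along the real axis outside of an interval. -/
def slitDomain (a b : ℝ) : Set ℂ := {z | z.im ≠ 0 ∨ z.re ∈ Ioo a b}

theorem isOpen_slitDomain (a b : ℝ) : IsOpen (slitDomain a b) :=
  isOpen_offReal.union (isOpen_Ioo.preimage Complex.continuous_re)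

theorem isSimplyConnected_slitDomain {a b : ℝ} (hab : a < b) :
    IsSimplyConnected (slitDomain a b) := by
  set s : ℝ := (a + b) / 2 with hs
  have hsI : s ∈ Ioo a b := ⟨by linarith, by linarith⟩
  have hstar : StarConvex ℝ (s : ℂ) (slitDomain a b) := by
    intro z hz α β hα hβ hαβ
    rcases hβ.eq_or_lt with rfl | hβ
    · rw [add_zero] at hαβ
      right; simpa [hαβ] using hsI
    rcases hz with hz | hz
    · left
      simp [hβ.ne', hz]
    · right
      have := (convex_Ioo a b) hsI hz hα hβ.le hαβ
      simpa using this
  have := hstar.contractibleSpace ⟨s, Or.inr (by simpa using hsI)⟩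
  exact (inferInstance : SimplyConnectedSpace (slitDomain a b))

/-- Roots of functions which vanish at most on the cuts. -/
theorem exists_root_slitDomain {a b : ℝ} (hab : a < b) {f : ℂ → ℂ} (hf : Differentiable ℂ f)
    (h0 : ∀ z ∈ slitDomain a b, f z ≠ 0) {n : ℕ} (hn : n ≠ 0) :
    ∃ G : ℂ → ℂ, DifferentiableOn ℂ G (slitDomain a b) ∧ ∀ z, G z ^ n = f z := by
  obtain ⟨G, hG, hGn⟩ := Complex.exists_continuousOn_pow_eq (isSimplyConnected_slitDomain hab)
    (isOpen_slitDomain a b) (g := f) hf.continuous.continuousOn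
    (by rintro ⟨z, hz, hz0⟩; exact h0 z hz hz0) hn
  refine ⟨G, fun z hz => (differentiableAt_of_pow_eq hn ?_ (hf.analyticAt z)
    (h0 z hz)).differentiableWithinAt, hGn⟩
  filter_upwards [(isOpen_slitDomain a b).mem_nhds hz] with w hw
  exact ⟨hG.continuousAt ((isOpen_slitDomain a b).mem_nhds hw), hGn w⟩

open Classical in
/-- The function which equals `f` in the upper half-plane and `g` elsewhere. -/
def pieceUpper (f g : ℂ → ℂ) (z : ℂ) : ℂ := if z ∈ upper then f z else g z

theorem pieceUpper_of_mem {f g : ℂ → ℂ} (hz : z ∈ upper) : pieceUpper f g z = f z :=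
  if_pos hz

theorem pieceUpper_of_lower {f g : ℂ → ℂ} (hz : z ∈ lower) : pieceUpper f g z = g z :=
  if_neg fun h => lt_asymm (h : 0 < z.im) hz

theorem differentiableOn_pieceUpper {f g : ℂ → ℂ} (hf : DifferentiableOn ℂ f offReal)
    (hg : DifferentiableOn ℂ g offReal) :
    DifferentiableOn ℂ (pieceUpper f g) offReal := by
  intro z hz
  rw [← upper_union_lower] at hz
  have hz' := hz
  rw [upper_union_lower] at hz'
  rcases hz with hz | hz
  · refine ((hf.differentiableAt (isOpen_offReal.mem_nhds hz')).congr_of_eventuallyEq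
      ?_).differentiableWithinAt
    filter_upwards [isOpen_upper.mem_nhds hz] with w hw using pieceUpper_of_mem hw
  · refine ((hg.differentiableAt (isOpen_offReal.mem_nhds hz')).congr_of_eventuallyEq
      ?_).differentiableWithinAt
    filter_upwards [isOpen_lower.mem_nhds hz] with w hw using pieceUpper_of_lower hw

theorem tendsto_pieceUpper {f g : ℂ → ℂ} {s : ℂ} {a b : ℂ} (hf : Tendsto f (𝓝 s) (𝓝 a))
    (hg : Tendsto g (𝓝 s) (𝓝 b)) :
    Tendsto (pieceUpper f g) (𝓝[upper] s) (𝓝 a) ∧ Tendsto (pieceUpper f g) (𝓝[lower] s) (𝓝 b) := by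
  constructor
  · refine (hf.mono_left nhdsWithin_le_nhds).congr' ?_
    filter_upwards [self_mem_nhdsWithin] with w hw using (pieceUpper_of_mem hw).symm
  · refine (hg.mono_left nhdsWithin_le_nhds).congr' ?_
    filter_upwards [self_mem_nhdsWithin] with w hw using (pieceUpper_of_lower hw).symm

theorem exists_isSqrtBranch {ζ : ℤ → ℝ} {m : ℝ → ℕ} {f : ℂ → ℂ} (hab : ζ (-2) < ζ (-1))
    (hf : Differentiable ℂ f) (h0 : ∀ z ∈ slitDomain (ζ (-2)) (ζ (-1)), f z ≠ 0) {k : ℕ}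
    (hm : ∀ s ∈ Ioo (ζ (-2)) (ζ (-1)), m s = k) : ∃ S, IsSqrtBranch ζ m f S := by
  obtain ⟨G, hG, hGn⟩ := exists_root_slitDomain hab hf h0 two_ne_zero
  have hGo : DifferentiableOn ℂ G offReal := hG.mono fun z hz => Or.inl hz
  refine ⟨pieceUpper G fun z => (-1) ^ k * G z, ?_, fun z _ => ?_, fun s hs => ⟨G s, ?_⟩⟩
  · rw [upper_union_lower]
    exact differentiableOn_pieceUpper hGo (hGo.const_mul _)
  · rw [pieceUpper]
    split_ifs
    · exact hGn z
    · rw [mul_pow, hGn, ← pow_mul, mul_comm k, pow_mul]; simp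
  · have hc : Tendsto G (𝓝 (s : ℂ)) (𝓝 (G s)) := (hG.differentiableAt
      ((isOpen_slitDomain _ _).mem_nhds (Or.inr (by simpa using hs)))).continuousAt
    rw [hm s hs]
    exact tendsto_pieceUpper hc (hc.const_mul _)

theorem exp_neg_I_pi_div_four : exp (-(I * π / 4)) = -I * exp (I * π / 4) := by
  rw [← Complex.exp_neg_pi_div_two_mul_I, ← exp_add]
  congr 1; ring

theorem exp_I_pi_div_four_sq : exp (I * π / 4) ^ 2 = I := by
  conv_rhs => rw [← Complex.exp_pi_div_two_mul_I]
  rw [← exp_nat_mul]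
  congr 1; push_cast; ring

theorem ofReal_rpow_quarter_pow (x : ℝ) (hx : 0 ≤ x) :
    ((x ^ (1 / 4 : ℝ) : ℝ) : ℂ) ^ 4 = (x : ℂ) := by
  rw [← ofReal_pow, ← Real.rpow_natCast, ← Real.rpow_mul hx]; norm_num

theorem exists_isFourthRootBranch {ζ : ℤ → ℝ} {D : ℂ → ℂ} (hab : ζ (-2) < ζ (-1))
    (hD : Differentiable ℂ D) (h0 : ∀ z ∈ slitDomain (ζ (-2)) (ζ (-1)), D z ≠ 0)
    (hneg : ∀ s ∈ Ioo (ζ (-2)) (ζ (-1)), D s = -(‖D s‖ : ℂ)) :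
    ∃ F, IsFourthRootBranch ζ D F := by
  obtain ⟨G, hG, hGn⟩ := exists_root_slitDomain hab hD h0 (n := 4) (by norm_num)
  have hGo : DifferentiableOn ℂ G offReal := hG.mono fun z hz => Or.inl hz
  set κ := exp (I * π / 4) with hκ
  have hκ4 : κ ^ 4 = -1 := by
    rw [show κ ^ 4 = (κ ^ 2) ^ 2 by ring, exp_I_pi_div_four_sq, I_sq]
  have hmem : ∀ s ∈ Ioo (ζ (-2)) (ζ (-1)), (s : ℂ) ∈ slitDomain (ζ (-2)) (ζ (-1)) :=
    fun s hs => Or.inr (by simpa using hs)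
  have hcG : ∀ s ∈ Ioo (ζ (-2)) (ζ (-1)), ContinuousAt G s := fun s hs =>
    (hG.differentiableAt ((isOpen_slitDomain _ _).mem_nhds (hmem s hs))).continuousAt
  obtain ⟨c, hc, hcs⟩ := exists_eq_const_mul_of_pow_eq (U := Ioo (ζ (-2)) (ζ (-1)))
    isPreconnected_Ioo (n := 4) (by norm_num)
    (f := fun s : ℝ => (((‖D s‖ ^ (1 / 4 : ℝ) : ℝ) : ℂ) * κ)) (g := fun s : ℝ => G s)
    (by
      have : Continuous fun s : ℝ => ‖D s‖ := (hD.continuous.comp continuous_ofReal).norm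
      exact ((continuous_ofReal.comp (this.rpow_const fun _ => Or.inr
        (by norm_num))).mul continuous_const).continuousOn)
    (fun s hs => ((hcG s hs).comp continuous_ofReal.continuousAt).continuousWithinAt)
    (fun s hs h => h0 _ (hmem s hs) (by rw [← hGn, h]; norm_num))
    (fun s hs => by
      rw [mul_pow, ofReal_rpow_quarter_pow _ (norm_nonneg _), hκ4, hGn, hneg s hs]
      simp)
  refine ⟨pieceUpper (fun z => c * G z) fun z => -I * (c * G z), ?_, fun z _ => ?_, fun s hs => ?_⟩
  · rw [upper_union_lower]
    exact differentiableOn_pieceUpper (hGo.const_mul _) ((hGo.const_mul _).const_mul _)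
  · rw [pieceUpper]
    split_ifs
    · rw [mul_pow, hc, one_mul, hGn]
    · rw [mul_pow, mul_pow, hc, one_mul, hGn, neg_pow, Complex.I_pow_four]; norm_num
  · have hcs' : (((‖D s‖ ^ (1 / 4 : ℝ) : ℝ) : ℂ) * κ) = c * G s := hcs s hs
    have h1 : Tendsto (fun z => c * G z) (𝓝 (s : ℂ)) (𝓝 (c * G s)) := (hcG s hs).const_mul c
    have := tendsto_pieceUpper h1 (h1.const_mul (-I))
    rw [exp_neg_I_pi_div_four, ← mul_assoc, mul_comm _ (-I), mul_assoc, ← hκ, hcs']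
    exact this

/-! ### The counting functions and the signs of the partial products -/

namespace IsSpectralEnumeration

variable (e : IsSpectralEnumeration q L ζ μ) (h : Admissible q L Q)
include e h

theorem exists_forall_lt (x : ℝ) :
    ∃ N : ℕ, ∀ j : ℤ, ((N : ℤ) < j → x < ζ (2 * j - 1)) ∧ (j < -(N : ℤ) → ζ (2 * j) < -x) := by
  obtain ⟨c, hc, hsep⟩ := e.exists_mu_add_le h
  obtain ⟨N, hN⟩ := exists_nat_gt ((|x| + |μ 0|) / c + 1)
  have hN' : |x| + |μ 0| < c * (N - 1) := by
    rw [← div_lt_iff₀' hc]; linarith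
  have h0 := neg_abs_le (μ 0)
  have h0' := le_abs_self (μ 0)
  refine ⟨N, fun j => ⟨fun hj => ?_, fun hj => ?_⟩⟩
  · have h1 := hsep (j - 1) 0
    have hjR : (N : ℝ) + 1 ≤ j := by exact_mod_cast hj
    have hj1 : (0 : ℤ) ≤ j - 1 := by omega
    have h2 : μ 0 ≤ μ (j - 1) := e.mu_strictMono.monotone hj1
    rw [abs_of_nonneg (sub_nonneg.2 h2)] at h1
    have h3 : (j : ℝ) - 1 ≤ |(((j - 1 : ℤ) : ℝ) - ((0 : ℤ) : ℝ))| := by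
      push_cast; rw [sub_zero]; exact le_abs_self _
    have h4 : c * (N - 1) ≤ c * ((j : ℝ) - 1) := by gcongr; linarith
    have h5 := mul_le_mul_of_nonneg_left h3 hc.le
    have h6 := (e.dirichlet_mem (j - 1)).2
    have h7 := e.lt_succ (j - 1)
    rw [sub_add_cancel] at h7
    linarith [le_abs_self x]
  · have h1 := hsep (j + 1) 0
    have hjR : (j : ℝ) + 1 ≤ -N := by exact_mod_cast hj
    have hj1 : j + 1 ≤ (0 : ℤ) := by omega
    have h2 : μ (j + 1) ≤ μ 0 := e.mu_strictMono.monotone hj1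
    rw [abs_of_nonpos (sub_nonpos.2 h2)] at h1
    have h3 : -((j : ℝ) + 1) ≤ |(((j + 1 : ℤ) : ℝ) - ((0 : ℤ) : ℝ))| := by
      push_cast; rw [sub_zero]; exact neg_le_abs _
    have h4 : c * (N - 1) ≤ c * (-((j : ℝ) + 1)) := by gcongr; linarith
    have h5 := mul_le_mul_of_nonneg_left h3 hc.le
    have h6 := (e.dirichlet_mem (j + 1)).1
    have h7 := e.lt_succ j
    linarith [le_abs_self x]

theorem zeroSignMovable_subset :
    Γ ⊆ bandEdges ζ := by
  rintro _ ⟨j, hj, hσ, rfl⟩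
  refine ⟨j, hj, ?_⟩
  have h1 := (e.dirSign_eq_zero_iff h j).1 hσ
  obtain ⟨h2, h3⟩ := e.dirichlet_mem j
  by_contra! hc
  have := e.one_lt_dR_sq h ⟨h2.lt_of_ne' hc.1, h3.lt_of_ne hc.2⟩
  linarith

theorem exists_isClosestToZero :
    ∃ g, IsClosestToZero Γ g := by
  rcases (Γ).eq_empty_or_nonempty with h0 | ⟨g₀, hg₀⟩
  · exact ⟨0, fun hne => absurd h0 hne.ne_empty⟩
  obtain ⟨N, hN⟩ := e.exists_forall_lt h |g₀|
  have hfin : (Γ ∩ {x | |x| ≤ |g₀|}).Finite := by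
    refine ((Finset.Icc (-(N : ℤ)) N).finite_toSet.image μ).subset ?_
    rintro _ ⟨⟨j, -, -, rfl⟩, hj⟩
    refine ⟨j, ?_, rfl⟩
    rw [mem_ofPred_eq, abs_le] at hj
    obtain ⟨h1, h2⟩ := e.dirichlet_mem j
    rw [Finset.coe_Icc, mem_Icc]
    constructor
    · by_contra! hc
      linarith [(hN j).2 hc]
    · by_contra! hc
      linarith [(hN j).1 hc]
  obtain ⟨g, hg, hmin⟩ := hfin.exists_minimalFor (fun x => |x|) _ ⟨g₀, hg₀, le_refl |g₀|⟩
  refine ⟨g, fun _ => ⟨hg.1, fun g' hg' => ?_⟩⟩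
  rcases le_total |g'| |g₀| with h1 | h1
  · rcases le_total |g| |g'| with h2 | h2
    · exact h2
    · exact hmin ⟨hg', h1⟩ h2
  · exact (hg.2 : |g| ≤ |g₀|).trans h1

omit h in
theorem notMem_Ioo (k m : ℤ) :
    ζ k ∉ Ioo (ζ m) (ζ (m + 1)) := by
  rintro ⟨h1, h2⟩
  have h3 := e.monotone.reflect_lt h1
  have h4 := e.monotone.reflect_lt h2
  omega

theorem exists_Ioo_disjoint {s : ℝ}
    (hs : s ∉ bandEdges ζ) : ∃ a b, s ∈ Ioo a b ∧ ∀ t ∈ bandEdges ζ, t ∉ Ioo a b := by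
  rcases e.trichotomy h hs with ⟨j, hj⟩ | ⟨j, hj⟩ | ⟨j, hj, rfl⟩
  · refine ⟨_, _, hj, ?_⟩
    rintro _ ⟨k, -, rfl | rfl⟩ <;> exact e.notMem_Ioo _ _
  · refine ⟨_, _, hj, ?_⟩
    have h2 := fun k => e.notMem_Ioo k (2 * j - 1)
    rw [sub_add_cancel] at h2
    rintro _ ⟨k, -, rfl | rfl⟩ <;> exact h2 _
  · obtain ⟨h1, h2⟩ := e.eq_mu_of_not_isOpenGap hj
    refine ⟨ζ (2 * j - 1 - 1), ζ (2 * j + 1), ⟨?_, h2 ▸ e.band_lt j⟩, ?_⟩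
    · have := e.band_lt (j - 1)
      rwa [show 2 * (j - 1) = 2 * j - 1 - 1 by ring, sub_add_cancel, h1] at this
    · rintro _ ⟨k, hk, hk'⟩ ⟨h3, h4⟩
      have hkj : k ≠ j := by rintro rfl; exact hj hk
      rcases hk' with rfl | rfl
      · have h5 := e.monotone.reflect_lt h3
        have h6 := e.monotone.reflect_lt h4
        omega
      · have h5 := e.monotone.reflect_lt h3
        have h6 := e.monotone.reflect_lt h4
        omega

omit e h in
theorem edgeIndex_congr {s t : ℝ} (hst : ∀ x ∈ bandEdges ζ, (x < s ↔ x < t) ∧ (x ≤ s ↔ x ≤ t)) :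
    edgeIndex ζ s = edgeIndex ζ t := by
  have h1 : ∀ j, IsOpenGap ζ j → (ζ (2 * j) < s ↔ ζ (2 * j) < t) := fun j hj =>
    (hst _ ⟨j, hj, Or.inr rfl⟩).1
  have h2 : ∀ j, IsOpenGap ζ j → (s ≤ ζ (2 * j) ↔ t ≤ ζ (2 * j)) := fun j hj => by
    rw [← not_lt, ← not_lt, h1 j hj]
  have e1 : {j : ℤ | 0 ≤ j ∧ IsOpenGap ζ j ∧ ζ (2 * j) < s} =
      {j : ℤ | 0 ≤ j ∧ IsOpenGap ζ j ∧ ζ (2 * j) < t} := by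
    ext j
    exact and_congr_right fun _ => and_congr_right fun hj => h1 j hj
  have e2 : {j : ℤ | j < 0 ∧ IsOpenGap ζ j ∧ s ≤ ζ (2 * j)} =
      {j : ℤ | j < 0 ∧ IsOpenGap ζ j ∧ t ≤ ζ (2 * j)} := by
    ext j
    exact and_congr_right fun _ => and_congr_right fun hj => h2 j hj
  rw [edgeIndex, edgeIndex, e1, e2]

omit e h in
theorem countM_congr {G : Set ℝ} {g s t : ℝ} (hg : G.Nonempty → g ∈ G)
    (hst : ∀ x ∈ G, x ≤ s ↔ x ≤ t) : countM G g s = countM G g t := by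
  rcases G.eq_empty_or_nonempty with rfl | hne
  · simp [countM]
  have h1 := hst g (hg hne)
  have e1 : {g' ∈ G | g ≤ g' ∧ g' ≤ s} = {g' ∈ G | g ≤ g' ∧ g' ≤ t} := by
    ext x
    exact and_congr_right fun hx => and_congr_right fun _ => hst x hx
  have e2 : {g' ∈ G | s < g' ∧ g' < g} = {g' ∈ G | t < g' ∧ g' < g} := by
    ext x
    refine and_congr_right fun hx => and_congr_left fun _ => ?_
    rw [← not_le, ← not_le, hst x hx]
  rw [countM, countM, e1, e2]
  simp only [h1]

/-- Both counting functions are locally constant off the band edges. -/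
theorem eventually_index_eq {g s : ℝ}
    (hg : IsClosestToZero Γ g) (hs : s ∉ bandEdges ζ) :
    ∀ᶠ t in 𝓝 s, t ∉ bandEdges ζ ∧ edgeIndex ζ t = edgeIndex ζ s ∧ countM Γ g t = countM Γ g s := by
  obtain ⟨a, b, hab, hE⟩ := e.exists_Ioo_disjoint h hs
  filter_upwards [Ioo_mem_nhds hab.1 hab.2] with t ht
  have key : ∀ x ∈ bandEdges ζ, (x < t ↔ x < s) ∧ (x ≤ t ↔ x ≤ s) := fun x hx => by
    have hx' := hE x hx
    rw [mem_Ioo, not_and_or, not_lt, not_lt] at hx'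
    obtain ⟨h1, h2⟩ := hab
    obtain ⟨h3, h4⟩ := ht
    rcases hx' with hx' | hx'
    · exact ⟨iff_of_true (by linarith) (by linarith), iff_of_true (by linarith) (by linarith)⟩
    · exact ⟨iff_of_false (by linarith) (by linarith), iff_of_false (by linarith) (by linarith)⟩
  refine ⟨fun hx => hE t hx ht, edgeIndex_congr key, countM_congr (fun hne => (hg hne).1) fun x hx =>
    (key x (e.zeroSignMovable_subset h hx)).2⟩

theorem countM_base {g s t : ℝ}
    (hg : IsClosestToZero Γ g) (hs : s ∈ Ioo (ζ (-2)) (ζ (-1)))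
    (ht : t ∈ Ioo (ζ (-2)) (ζ (-1))) :
    countM Γ g s = countM Γ g t := by
  refine countM_congr (fun hne => (hg hne).1) fun x hx => ?_
  obtain ⟨j, -, hj⟩ := e.zeroSignMovable_subset h hx
  have hk : ∃ k, x = ζ k := by rcases hj with rfl | rfl <;> exact ⟨_, rfl⟩
  obtain ⟨k, rfl⟩ := hk
  have := e.notMem_Ioo k (-2)
  rw [show (-2 + 1 : ℤ) = -1 by norm_num, mem_Ioo, not_and_or, not_lt, not_lt] at this
  rcases this with h1 | h1
  · exact iff_of_true (by linarith [hs.1]) (by linarith [ht.1])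
  · exact iff_of_false (by linarith [hs.2]) (by linarith [ht.2])

omit h in
theorem edgeIndex_base {s : ℝ}
    (hs : s ∈ Ioo (ζ (-2)) (ζ (-1))) : edgeIndex ζ s = 0 := by
  have e1 : {j : ℤ | 0 ≤ j ∧ IsOpenGap ζ j ∧ ζ (2 * j) < s} = ∅ := by
    refine eq_empty_of_forall_notMem fun j hj => ?_
    have : ζ (-1) ≤ ζ (2 * j) := e.monotone (by have := hj.1; omega)
    linarith [hj.2.2, hs.2]
  have e2 : {j : ℤ | j < 0 ∧ IsOpenGap ζ j ∧ s ≤ ζ (2 * j)} = ∅ := by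
    refine eq_empty_of_forall_notMem fun j hj => ?_
    have : ζ (2 * j) ≤ ζ (-2) := e.monotone (by have := hj.1; omega)
    linarith [hj.2.2, hs.1]
  rw [edgeIndex, e1, e2]; simp

end IsSpectralEnumeration

open Classical in
theorem sign_neg_one_pow_ncard {ι : Type*} {s : Set ι} {K : Finset ι} (hs : s ⊆ K) :
    sign ((-1 : ℝ) ^ s.ncard) = ∏ j ∈ K, if j ∈ s then (-1 : SignType) else 1 := by
  have h1 : s = ((K.filter (· ∈ s) : Finset ι) : Set ι) := by
    ext j
    simp only [Finset.coe_filter, mem_ofPred_eq]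
    exact ⟨fun hj => ⟨hs hj, hj⟩, fun hj => hj.2⟩
  rw [Finset.prod_ite, Finset.prod_const, Finset.prod_const_one, mul_one]
  nth_rewrite 1 [h1]
  rw [ncard_coe_finset, sign_pow, Left.sign_neg, sign_one]

/-- The sign `(-1)^{n+m}` of the jump matrix. -/
def jumpSign (ζ : ℤ → ℝ) (m : ℝ → ℕ) (s : ℝ) : ℝ := (-1) ^ (edgeIndex ζ s + (m s : ℤ))

theorem jumpSign_mul_self (ζ : ℤ → ℝ) (m : ℝ → ℕ) (s : ℝ) :
    jumpSign ζ m s * jumpSign ζ m s = 1 := by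
  rw [jumpSign, ← mul_zpow]; norm_num

theorem sign_mul_ite_neg_one {x y : ℝ} (h : x ≠ y) (p : Prop) [Decidable p] :
    sign (x - y) * (if p then (-1 : SignType) else 1) = if (p ↔ y < x) then -1 else 1 := by
  rcases h.lt_or_gt with hxy | hxy
  · rw [sign_neg (by linarith)]
    have : ¬ y < x := by linarith
    by_cases hp : p <;> simp [hp, this]
  · rw [sign_pos (by linarith)]
    by_cases hp : p <;> simp [hp, hxy]

open Classical in
theorem sign_edgeIndex {s : ℝ} {K : Finset ℤ} (hne : ∀ j, IsOpenGap ζ j → s ≠ ζ (2 * j))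
    (hK : ∀ j ∉ K, (0 ≤ j → s < ζ (2 * j)) ∧ (j < 0 → ζ (2 * j) < s)) :
    sign ((-1 : ℝ) ^ edgeIndex ζ s) = ∏ j ∈ K, if IsOpenGap ζ j then
      sign (s - ζ (2 * j)) * (if 0 ≤ j then (-1 : SignType) else 1) else 1 := by
  have h1 : {j : ℤ | 0 ≤ j ∧ IsOpenGap ζ j ∧ ζ (2 * j) < s} ⊆ K := fun j hj => by
    by_contra hjK
    exact lt_asymm hj.2.2 ((hK j hjK).1 hj.1)
  have h2 : {j : ℤ | j < 0 ∧ IsOpenGap ζ j ∧ s ≤ ζ (2 * j)} ⊆ K := fun j hj => by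
    by_contra hjK
    exact not_lt.2 hj.2.2 ((hK j hjK).2 hj.1)
  rw [edgeIndex, zpow_sub₀ (by norm_num), zpow_natCast, zpow_natCast, div_eq_mul_inv, ← inv_pow,
    inv_neg_one, sign_mul, sign_neg_one_pow_ncard h1, sign_neg_one_pow_ncard h2,
    ← Finset.prod_mul_distrib]
  refine Finset.prod_congr rfl fun j _ => ?_
  simp only [mem_ofPred_eq]
  by_cases hj : IsOpenGap ζ j
  · rw [if_pos hj, sign_mul_ite_neg_one (hne j hj)]
    rcases lt_or_ge j 0 with h0 | h0
    · have h0' : ¬ 0 ≤ j := not_le.2 h0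
      simp only [h0, h0', hj, true_and, false_and, if_false, one_mul, false_iff, not_lt]
    · have h0' : ¬ j < 0 := not_lt.2 h0
      simp only [h0, h0', hj, true_and, false_and, if_false, mul_one, true_iff]
  · simp [hj]

open Classical in
theorem sign_countM (hμ : StrictMono μ) {g s : ℝ} {K : Finset ℤ}
    (hne : s ∉ Γ)
    (hK : ∀ j ∉ K, (g ≤ μ j → s < μ j) ∧ (μ j < g → μ j < s)) :
    sign ((-1 : ℝ) ^ countM Γ g s) = ∏ j ∈ K, if IsOpenGap ζ j ∧ dirSign q L μ j = 0 then
        sign (s - μ j) * (if g ≤ μ j then (-1 : SignType) else 1) else 1 := by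
  have himg : ∀ p : ℝ → Prop, {x ∈ Γ | p x} =
      μ '' {j | (IsOpenGap ζ j ∧ dirSign q L μ j = 0) ∧ p (μ j)} := fun p => by
    ext x
    constructor
    · rintro ⟨⟨j, hj, hσ, rfl⟩, hx⟩
      exact ⟨j, ⟨⟨hj, hσ⟩, hx⟩, rfl⟩
    · rintro ⟨j, ⟨⟨hj, hσ⟩, hx⟩, rfl⟩
      exact ⟨⟨j, hj, hσ, rfl⟩, hx⟩
  have hsj : ∀ j, IsOpenGap ζ j ∧ dirSign q L μ j = 0 → s ≠ μ j := fun j hj hs =>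
    hne ⟨j, hj.1, hj.2, hs⟩
  rw [countM]
  split_ifs with hgs
  · rw [himg, ncard_image_of_injective _ hμ.injective, sign_neg_one_pow_ncard (K := K)]
    · refine Finset.prod_congr rfl fun j _ => ?_
      simp only [mem_setOf_eq]
      by_cases hj : IsOpenGap ζ j ∧ dirSign q L μ j = 0
      · rw [if_pos hj, sign_mul_ite_neg_one (hsj j hj)]
        refine if_congr ?_ rfl rfl
        have := hsj j hj
        constructor
        · rintro ⟨-, h1, h2⟩
          exact iff_of_true h1 (h2.lt_of_ne this.symm)
        · intro h1
          by_cases h2 : μ j < s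
          · exact ⟨hj, h1.2 h2, h2.le⟩
          · exact absurd (h1.1 (hgs.trans (not_lt.1 h2))) h2
      · rw [if_neg hj, if_neg fun h1 => hj h1.1]
    · intro j hj
      by_contra hjK
      exact not_lt.2 hj.2.2 ((hK j hjK).1 hj.2.1)
  · rw [himg, ncard_image_of_injective _ hμ.injective, sign_neg_one_pow_ncard (K := K)]
    · refine Finset.prod_congr rfl fun j _ => ?_
      simp only [mem_setOf_eq]
      by_cases hj : IsOpenGap ζ j ∧ dirSign q L μ j = 0
      · rw [if_pos hj, sign_mul_ite_neg_one (hsj j hj)]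
        refine if_congr ?_ rfl rfl
        have := hsj j hj
        constructor
        · rintro ⟨-, h1, h2⟩
          exact iff_of_false (not_le.2 h2) h1.not_gt
        · intro h1
          by_cases h2 : μ j < s
          · exact absurd (h1.2 h2) (not_le.2 (h2.trans (not_le.1 hgs)))
          · exact ⟨hj, (not_lt.1 h2).lt_of_ne this, not_le.1 fun h3 => h2 (h1.1 h3)⟩
      · rw [if_neg hj, if_neg fun h1 => hj h1.1]
    · intro j hj
      by_contra hjK
      exact lt_asymm hj.2.1 ((hK j hjK).2 hj.2.2)

namespace IsSpectralEnumeration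

variable (e : IsSpectralEnumeration q L ζ μ) (h : Admissible q L Q)
include e h

open Classical in
theorem sign_signProduct_mul
    {τ : SignType} {s t : ℝ} (hs : 𝔣 τ s ≠ 0) (ht : 𝔣 τ t ≠ 0)
    {K : Finset ℤ} (hK : ∀ j ∉ K, 0 < (s - μ j) * (t - μ j)) :
    sign ((𝔣 τ s).re * (𝔣 τ t).re) =
      ∏ j ∈ K, if dirSign q L μ j = τ then sign ((s - μ j) * (t - μ j)) else 1 := by
  have := sign_hadamardProduct_mul (e.summable_sign h τ) hs ht
    (K := K.subtype fun j => dirSign q L μ j = τ) fun j hj =>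
      hK j fun hjK => hj (Finset.mem_subtype.2 hjK)
  refine this.trans ?_
  rw [Finset.prod_subtype_eq_prod_filter (fun j => sign ((s - μ j) * (t - μ j))),
    Finset.prod_filter]

/-- `f⁺f⁻` on the real line. -/
def _root_.ZSP.prodPM (q : ℝ → ℂ) (L : ℝ) (μ : ℤ → ℝ) (s : ℝ) : ℝ :=
  (signProduct q L μ 1 s).re * (signProduct q L μ (-1) s).re

open Classical in
theorem sign_prodPM_mul
    {s t : ℝ} (hs : mR q L s ≠ 0) (ht : mR q L t ≠ 0)
    {K : Finset ℤ} (hK : ∀ j ∉ K, 0 < (s - μ j) * (t - μ j)) :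
    sign (prodPM q L μ s * prodPM q L μ t) =
      ∏ j ∈ K, if dirSign q L μ j = 0 then 1 else sign ((s - μ j) * (t - μ j)) := by
  have hne : ∀ {u : ℝ} {τ : SignType}, mR q L u ≠ 0 → 𝔣 τ u ≠ 0 := by
    intro u τ hu h0
    obtain ⟨j, -, hj⟩ := (e.signProduct_eq_zero_iff h).1 h0
    exact hu ((e.mR_eq_zero_iff h).2 ⟨j, by exact_mod_cast hj⟩)
  rw [prodPM, prodPM, mul_mul_mul_comm, sign_mul, e.sign_signProduct_mul h (hne hs) (hne ht) hK,
    e.sign_signProduct_mul h (hne hs) (hne ht) hK, ← Finset.prod_mul_distrib]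
  refine Finset.prod_congr rfl fun j _ => ?_
  rcases dirSign q L μ j <;> simp

omit h in
theorem lt_or_gt_of_band {i : ℤ} {s : ℝ}
    (hs : s ∈ Ioo (ζ (2 * i)) (ζ (2 * i + 1))) (j : ℤ) : s < ζ (2 * j - 1) ∨ ζ (2 * j) < s := by
  rcases le_or_gt j i with hj | hj
  · exact Or.inr ((e.monotone (by omega)).trans_lt hs.1)
  · exact Or.inl (hs.2.trans_le (e.monotone (by omega)))

omit h in
theorem lt_or_gt_of_gap {i : ℤ} {s : ℝ}
    (hs : s ∈ Ioo (ζ (2 * i - 1)) (ζ (2 * i))) {j : ℤ} (hj : j ≠ i) :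
    s < ζ (2 * j - 1) ∨ ζ (2 * j) < s := by
  rcases hj.lt_or_gt with hj | hj
  · exact Or.inr ((e.monotone (by omega)).trans_lt hs.1)
  · exact Or.inl (hs.2.trans_le (e.monotone (by omega)))

omit h in
theorem sign_sub_eq {j : ℤ} {s : ℝ}
    (hs : s < ζ (2 * j - 1) ∨ ζ (2 * j) < s) :
    sign (s - ζ (2 * j)) = sign (s - μ j) ∧ sign (s - μ j) ≠ 0 := by
  obtain ⟨h1, h2⟩ := e.dirichlet_mem j
  rcases hs with hs | hs
  · rw [sign_neg (by linarith), sign_neg (by linarith)]; exact ⟨rfl, by decide⟩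
  · rw [sign_pos (by linarith), sign_pos (by linarith)]; exact ⟨rfl, by decide⟩

open Classical in
/-- The sign `(-1)^{n+m} f⁺f⁻` at `s`, relative to `t`, as a product over finitely many gaps: each
open gap and each Dirichlet eigenvalue between the two points contributes a factor. -/
theorem sign_total {g s t : ℝ}
    (hs : mR q L s ≠ 0) (ht : mR q L t ≠ 0) (hsE : s ∉ bandEdges ζ) (htE : t ∉ bandEdges ζ) :
    ∃ K : Finset ℤ, (∀ j ∉ K, s < ζ (2 * j - 1) ∨ ζ (2 * j) < s) ∧ ∃ κ κ' : ℤ → SignType,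
      (∀ j, κ j * κ j = 1) ∧ (∀ j, κ' j * κ' j = 1) ∧
      sign (jumpSign ζ (countM Γ g) s * jumpSign ζ (countM Γ g) t *
          (prodPM q L μ s * prodPM q L μ t)) =
        ∏ j ∈ K, ((if IsOpenGap ζ j then sign (s - ζ (2 * j)) * κ j else 1) *
          (if IsOpenGap ζ j ∧ dirSign q L μ j = 0 then sign (s - μ j) * κ' j else 1) *
          ((if IsOpenGap ζ j then sign (t - ζ (2 * j)) * κ j else 1) *
          (if IsOpenGap ζ j ∧ dirSign q L μ j = 0 then sign (t - μ j) * κ' j else 1)) *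
          (if dirSign q L μ j = 0 then 1 else
            sign (s - μ j) * sign (t - μ j))) := by
  obtain ⟨N, hN⟩ := e.exists_forall_lt h (max (max |s| |t|) |g|)
  set K := Finset.Icc (-(N : ℤ)) N
  have hKlt : ∀ j ∉ K, (max (max |s| |t|) |g| < ζ (2 * j - 1) ∧ 0 ≤ j) ∨
      (ζ (2 * j) < -max (max |s| |t|) |g| ∧ j < 0) := fun j hj => by
    rw [Finset.mem_Icc, not_and_or, not_le, not_le] at hj
    rcases hj with hj | hj
    · exact Or.inr ⟨(hN j).2 hj, by omega⟩
    · exact Or.inl ⟨(hN j).1 hj, by omega⟩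
  have hb : ∀ x, x = s ∨ x = t ∨ x = g → |x| ≤ max (max |s| |t|) |g| := by
    rintro x (rfl | rfl | rfl)
    · exact (le_max_left _ _).trans (le_max_left _ _)
    · exact (le_max_right _ _).trans (le_max_left _ _)
    · exact le_max_right _ _
  have hsep : ∀ x, x = s ∨ x = t ∨ x = g → ∀ j ∉ K,
      (x < ζ (2 * j - 1) ∧ g < ζ (2 * j - 1) ∧ 0 ≤ j) ∨ (ζ (2 * j) < x ∧ ζ (2 * j) < g ∧ j < 0) := by
    intro x hx j hj
    have h1 := abs_le.1 (hb x hx)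
    have h2 := abs_le.1 (hb g (Or.inr (Or.inr rfl)))
    rcases hKlt j hj with ⟨h3, h4⟩ | ⟨h3, h4⟩
    · exact Or.inl ⟨by linarith, by linarith, h4⟩
    · exact Or.inr ⟨by linarith, by linarith, h4⟩
  refine ⟨K, fun j hj => (hsep s (Or.inl rfl) j hj).imp And.left And.left,
    fun j => if 0 ≤ j then -1 else 1, fun j => if g ≤ μ j then -1 else 1,
    fun j => by dsimp only; split_ifs <;> rfl, fun j => by dsimp only; split_ifs <;> rfl, ?_⟩
  have hone : ∀ x, x = s ∨ x = t ∨ x = g → x ∉ bandEdges ζ → sign (jumpSign ζ (countM Γ g) x) =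
      ∏ j ∈ K, ((if IsOpenGap ζ j then sign (x - ζ (2 * j)) *
        (if 0 ≤ j then (-1 : SignType) else 1) else 1) *
        (if IsOpenGap ζ j ∧ dirSign q L μ j = 0 then
          sign (x - μ j) * (if g ≤ μ j then (-1 : SignType) else 1) else 1)) := by
    intro x hx hxE
    rw [jumpSign, zpow_add₀ (by norm_num), zpow_natCast, sign_mul,
      sign_edgeIndex (K := K), sign_countM e.mu_strictMono (K := K), Finset.prod_mul_distrib]
    · exact fun hxΓ => hxE (e.zeroSignMovable_subset h hxΓ)
    · intro j hj
      obtain ⟨h1, h2⟩ := e.dirichlet_mem j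
      rcases hsep x hx j hj with ⟨h3, h4, h5⟩ | ⟨h3, h4, h5⟩
      · exact ⟨fun _ => by linarith, fun _ => by linarith⟩
      · exact ⟨fun _ => by linarith, fun _ => by linarith⟩
    · exact fun j hj hxj => hxE ⟨j, hj, Or.inr hxj⟩
    · intro j hj
      have h1 := e.gap_le j
      rcases hsep x hx j hj with ⟨h3, h4, h5⟩ | ⟨h3, h4, h5⟩
      · exact ⟨fun _ => by linarith, fun _ => by omega⟩
      · exact ⟨fun _ => by omega, fun _ => by linarith⟩
  rw [sign_mul, sign_mul, hone s (Or.inl rfl) hsE, hone t (Or.inr (Or.inl rfl)) htE,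
    e.sign_prodPM_mul h hs ht (K := K), ← Finset.prod_mul_distrib, ← Finset.prod_mul_distrib]
  · simp only [sign_mul]
  · intro j hj
    obtain ⟨h1, h2⟩ := e.dirichlet_mem j
    rcases hsep s (Or.inl rfl) j hj with ⟨h3, h4, h5⟩ | ⟨h3, h4, h5⟩ <;>
      rcases hsep t (Or.inr (Or.inl rfl)) j hj with ⟨h6, h7, h8⟩ | ⟨h6, h7, h8⟩
    · exact mul_pos_of_neg_of_neg (by linarith) (by linarith)
    · omega
    · omega
    · exact mul_pos (by linarith) (by linarith)

theorem jump_band {g s t : ℝ} {i k : ℤ}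
    (hs : s ∈ Ioo (ζ (2 * i)) (ζ (2 * i + 1))) (ht : t ∈ Ioo (ζ (2 * k)) (ζ (2 * k + 1)))
    (hsE : s ∉ bandEdges ζ) (htE : t ∉ bandEdges ζ) :
    0 < jumpSign ζ (countM Γ g) s * jumpSign ζ (countM Γ g) t *
      (prodPM q L μ s * prodPM q L μ t) := by
  obtain ⟨K, -, κ, κ', hκ, hκ', hsg⟩ := e.sign_total h (g := g)
    (mR_ne_zero_of_sq_lt h (e.dR_sq_lt_one h hs)) (mR_ne_zero_of_sq_lt h (e.dR_sq_lt_one h ht))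
    hsE htE
  rw [← sign_eq_one_iff, hsg]
  refine Finset.prod_eq_one fun j _ => ?_
  obtain ⟨h1, h2⟩ := e.sign_sub_eq (e.lt_or_gt_of_band hs j)
  obtain ⟨h3, h4⟩ := e.sign_sub_eq (e.lt_or_gt_of_band ht j)
  have hop := fun hc => e.isOpenGap_of_dirSign_ne_zero h (j := j) hc
  rw [h1, h3]
  have hk := hκ j
  have hk' := hκ' j
  generalize sign (s - μ j) = u at h2 ⊢
  generalize sign (t - μ j) = v at h4 ⊢
  generalize κ j = a at hk ⊢
  generalize κ' j = b at hk' ⊢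
  by_cases hσ : dirSign q L μ j = 0
  · by_cases ho : IsOpenGap ζ j
    · simp only [hσ, ho, if_true, and_self]
      revert u v a b; decide
    · simp [hσ, ho]
  · simp only [hσ, hop hσ, if_true, and_false, if_false]
    revert u v a b; decide

theorem jump_gap {g s t : ℝ} {i k : ℤ}
    (hs : s ∈ Ioo (ζ (2 * i - 1)) (ζ (2 * i))) (ht : t ∈ Ioo (ζ (2 * k)) (ζ (2 * k + 1)))
    (hs0 : mR q L s ≠ 0) (hsE : s ∉ bandEdges ζ) (htE : t ∉ bandEdges ζ) :
    jumpSign ζ (countM Γ g) s * jumpSign ζ (countM Γ g) t *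
      (prodPM q L μ s * prodPM q L μ t) * (mR q L s * dR q L s) < 0 := by
  obtain ⟨K, hK, κ, κ', hκ, hκ', hsg⟩ := e.sign_total h (g := g) hs0
    (mR_ne_zero_of_sq_lt h (e.dR_sq_lt_one h ht)) hsE htE
  have hiK : i ∈ K := by
    by_contra hi
    rcases hK i hi with h1 | h1
    · linarith [hs.1]
    · linarith [hs.2]
  rw [← sign_eq_neg_one_iff, sign_mul, hsg, e.sign_mR_mul_dR h (Ioo_subset_Icc_self hs),
    ← Finset.mul_prod_erase K _ hiK, Finset.prod_eq_one, mul_one]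
  · have hop : IsOpenGap ζ i := hs.1.trans hs.2
    obtain ⟨h3, h4⟩ := e.sign_sub_eq (e.lt_or_gt_of_band ht i)
    have h1 : sign (s - ζ (2 * i)) = -1 := sign_neg (by linarith [hs.2])
    have h2 : sign (s - μ i) ≠ 0 := by
      rw [Ne, sign_eq_zero_iff, sub_eq_zero]
      rintro rfl
      exact hs0 (e.mR_mu h i)
    rw [h1, h3]
    have hk := hκ i
    have hk' := hκ' i
    generalize sign (s - μ i) = u at h2 ⊢
    generalize sign (t - μ i) = v at h4 ⊢
    generalize κ i = a at hk ⊢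
    generalize κ' i = b at hk' ⊢
    by_cases hσ : dirSign q L μ i = 0
    · simp only [hσ, hop, if_true, and_self]
      revert u v a b; decide
    · simp only [hσ, hop, if_true, and_false, if_false]
      revert u v a b; decide
  · intro j hj
    obtain ⟨h1, h2⟩ := e.sign_sub_eq (e.lt_or_gt_of_gap hs (Finset.ne_of_mem_erase hj))
    obtain ⟨h3, h4⟩ := e.sign_sub_eq (e.lt_or_gt_of_band ht j)
    have hop := fun hc => e.isOpenGap_of_dirSign_ne_zero h (j := j) hc
    rw [h1, h3]
    have hk := hκ j
    have hk' := hκ' j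
    generalize sign (s - μ j) = u at h2 ⊢
    generalize sign (t - μ j) = v at h4 ⊢
    generalize κ j = a at hk ⊢
    generalize κ' j = b at hk' ⊢
    by_cases hσ : dirSign q L μ j = 0
    · by_cases ho : IsOpenGap ζ j
      · simp only [hσ, ho, if_true, and_self]
        revert u v a b; decide
      · simp [hσ, ho]
    · simp only [hσ, hop hσ, if_true, and_false, if_false]
      revert u v a b; decide

end IsSpectralEnumeration

variable {g : ℝ} {S F : ℂ → ℂ}

local notation "Φ" => matPhi q L μ S F

/-! ### The square root of `Δ² - 1` near the real line -/

theorem upper_subset : upper ⊆ offReal := fun _ hz => ne_of_gt hz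

theorem lower_subset : lower ⊆ offReal := fun _ hz => ne_of_lt hz

theorem nhdsWithin_le_of_subset_offReal {V : Set ℂ} (hV : V ⊆ offReal) (s : ℝ) :
    𝓝[V] (s : ℂ) ≤ 𝓝[≠] (s : ℂ) :=
  nhdsWithin_mono _ fun z hz h0 => hV hz (by rw [mem_singleton_iff.1 h0]; simp)

namespace Admissible

variable (h : Admissible q L Q)
include h

theorem discriminant_sq_sub_one_ne_zero (hz : z ∈ offReal) :
    Δ z ^ 2 - 1 ≠ 0 := fun h0 => by
  have h1 : (Δ z - 1) * (Δ z + 1) = 0 := by linear_combination h0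
  rcases mul_eq_zero.1 h1 with h2 | h2
  · exact ne_of_im_ne_zero h.cont h.pos hz 1 ⟨by norm_num, le_rfl⟩ (by
      push_cast; linear_combination h2)
  · exact ne_of_im_ne_zero h.cont h.pos hz (-1) ⟨le_rfl, by norm_num⟩ (by
      push_cast; linear_combination h2)

theorem differentiable_sq_sub_one :
    Differentiable ℂ fun z => Δ z ^ 2 - 1 :=
  ((differentiable_discriminant h.cont h.bound).pow 2).sub_const 1

theorem differentiableAt_rootR (hz : z ∈ offReal) :
    DifferentiableAt ℂ (rootR q L) z :=
  (differentiableAt_joukowskiRoot (ne_of_im_ne_zero h.cont h.pos hz)).comp z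
    (differentiable_discriminant h.cont h.bound z)

theorem rootR_sq (hz : z ∈ offReal) :
    rootR q L z ^ 2 = Δ z ^ 2 - 1 :=
  joukowskiRoot_sq (ne_of_im_ne_zero h.cont h.pos hz)

theorem rootR_ne_zero (hz : z ∈ offReal) : rootR q L z ≠ 0 :=
  fun h0 => h.discriminant_sq_sub_one_ne_zero hz (by rw [← h.rootR_sq hz, h0]; ring)

theorem rootR_conj (hz : z ∈ offReal) :
    rootR q L (conj z) = conj (rootR q L z) := by
  rw [rootR, discriminant_conj h.cont, joukowskiRoot_conj (ne_of_im_ne_zero h.cont h.pos hz)]; rfl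

theorem weylPlus_conj (hz : z ∈ offReal) :
    weylPlus q L (conj z) = conj (weylPlus q L z) := by
  simp only [weylPlus, h.rootR_conj hz, ms_conj h.cont, map_sub, map_div₀, map_ofNat]

theorem weylMinus_conj (hz : z ∈ offReal) :
    weylMinus q L (conj z) = conj (weylMinus q L z) := by
  simp only [weylMinus, h.rootR_conj hz, ms_conj h.cont, map_sub, map_add, map_div₀, map_ofNat]

omit h in
theorem weylPlus_eq (q : ℝ → ℂ) (L : ℝ) (z : ℂ) :
    weylPlus q L z = (halfDiff q L z - rootR q L z) / ms q 0 1 L z := rfl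

omit h in
theorem weylMinus_eq (q : ℝ → ℂ) (L : ℝ) (z : ℂ) :
    weylMinus q L z = (halfDiff q L z + rootR q L z) / ms q 0 1 L z := rfl

theorem differentiableAt_weylPlus (hz : z ∈ offReal) :
    DifferentiableAt ℂ (weylPlus q L) z :=
  ((h.differentiable_halfDiff z).sub (h.differentiableAt_rootR hz)).div
    (differentiable_ms h.cont h.bound 0 1 L z) (IsSpectralEnumeration.ms_ne_zero_of_im h hz)

theorem differentiableAt_weylMinus (hz : z ∈ offReal) :
    DifferentiableAt ℂ (weylMinus q L) z :=
  ((h.differentiable_halfDiff z).add (h.differentiableAt_rootR hz)).div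
    (differentiable_ms h.cont h.bound 0 1 L z) (IsSpectralEnumeration.ms_ne_zero_of_im h hz)

/-- Real points at which `Δ² - 1` does not vanish: the upper boundary values of `R`. -/
theorem exists_rootR_of_ne {s : ℝ} (hs : dR q L s ^ 2 ≠ 1) :
    ∃ W : ℂ → ℂ, AnalyticAt ℂ W s ∧ (∀ z, W z ^ 2 = Δ z ^ 2 - 1) ∧
      ∀ᶠ z in 𝓝[upper] (s : ℂ), rootR q L z = W z := by
  obtain ⟨W, h1, -, h2, h3⟩ := exists_analyticAt_of_pow_eq (f := rootR q L) (s := s)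
    (g := fun z => Δ z ^ 2 - 1) convex_upper two_ne_zero (by
      filter_upwards [self_mem_nhdsWithin] with z hz
      have hz' := upper_subset hz
      exact ⟨(h.differentiableAt_rootR hz').continuousAt.continuousWithinAt, h.rootR_sq hz'⟩)
    (h.differentiable_sq_sub_one.analyticAt _) (by
      rw [h.discriminant_eq, sub_ne_zero]; exact_mod_cast hs)
  exact ⟨W, h1, h2, h3⟩

/-- In a band the upper boundary value of `R` is imaginary; its sign comes from the positivity of
the imaginary part of the Weyl function. -/
theorem rootR_band {s : ℝ} (hs : dR q L s ^ 2 < 1) {W : ℂ → ℂ}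
    (hW : ContinuousAt W s) (hWsq : W s ^ 2 = Δ s ^ 2 - 1)
    (hev : ∀ᶠ z in 𝓝[upper] (s : ℂ), rootR q L z = W z) :
    (W s).re = 0 ∧ (W s).im * mR q L s < 0 := by
  rw [h.discriminant_eq] at hWsq
  have hre : (W s).re ^ 2 - (W s).im ^ 2 = dR q L s ^ 2 - 1 := by
    have := congrArg Complex.re hWsq
    rw [sq, mul_re] at this
    rw [sq, sq, this]
    norm_cast
  have him : (W s).re * (W s).im = 0 := by
    have := congrArg Complex.im hWsq
    rw [sq, mul_im] at this
    have h2 : ((dR q L s : ℂ) ^ 2 - 1).im = 0 := by norm_cast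
    rw [h2] at this
    linarith
  have him0 : (W s).im ≠ 0 := fun h0 => by
    rw [h0] at hre; nlinarith [sq_nonneg (W s).re]
  have hre0 : (W s).re = 0 := (mul_eq_zero.1 him).resolve_right him0
  refine ⟨hre0, ?_⟩
  have hm0 := IsSpectralEnumeration.mR_ne_zero_of_sq_lt h hs
  have hlim : Tendsto (weylPlus q L) (𝓝[upper] (s : ℂ))
      (𝓝 ((halfDiff q L s - W s) / ms q 0 1 L s)) := by
    have h1 : Tendsto (fun z => (halfDiff q L z - W z) / ms q 0 1 L z) (𝓝 (s : ℂ))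
        (𝓝 ((halfDiff q L s - W s) / ms q 0 1 L s)) :=
      ((h.differentiable_halfDiff.continuous.tendsto _).sub hW).div
        ((differentiable_ms h.cont h.bound 0 1 L).continuous.tendsto _)
        (mt h.ms_eq_zero_iff.1 hm0)
    refine (h1.mono_left nhdsWithin_le_nhds).congr' ?_
    filter_upwards [hev] with z hz
    rw [weylPlus_eq, hz]
  have hge := ge_of_tendsto ((continuous_im.tendsto _).comp hlim) (b := 0) (by
    filter_upwards [self_mem_nhdsWithin] with z hz
    exact (weylPlus_im_pos h.cont h.pos h.per hz).le)
  rw [h.ms_eq, Complex.div_ofReal_im, sub_im, h.halfDiff_ofReal, ofReal_im, zero_sub] at hge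
  have h3 : (W s).im * mR q L s ≤ 0 := by
    have := mul_nonneg hge (sq_nonneg (mR q L s))
    rw [sq, ← mul_assoc, div_mul_cancel₀ _ hm0] at this
    linarith
  exact lt_of_le_of_ne h3 (mul_ne_zero him0 hm0)

theorem rootR_gap {s : ℝ} (hs : 1 < dR q L s ^ 2) {W : ℂ → ℂ}
    (hW : ContinuousAt W s) (hev : ∀ᶠ z in 𝓝[upper] (s : ℂ), rootR q L z = W z) :
    W s = ((W s).re : ℂ) ∧ 0 < (W s).re * dR q L s := by
  have hne : ∀ t ∈ Icc (-1 : ℝ) 1, Δ s ≠ t := fun t ht h0 => by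
    rw [h.discriminant_eq] at h0
    have h1 : dR q L s = t := by exact_mod_cast h0
    rw [h1] at hs
    nlinarith [ht.1, ht.2]
  have hc : ContinuousAt (rootR q L) s :=
    ((differentiableAt_joukowskiRoot hne).comp (s : ℂ)
      (differentiable_discriminant h.cont h.bound s)).continuousAt
  have h1 : W s = rootR q L s := tendsto_nhds_unique
    ((hW.tendsto.mono_left nhdsWithin_le_nhds).congr' (by
      filter_upwards [hev] with z hz using hz.symm)) (hc.tendsto.mono_left nhdsWithin_le_nhds)
  rw [rootR, h.discriminant_eq, joukowskiRoot_ofReal hs] at h1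
  rw [h1, ofReal_re]
  refine ⟨rfl, ?_⟩
  have h2 : 0 < √(1 - (dR q L s ^ 2)⁻¹) := by
    apply Real.sqrt_pos.2
    have := inv_lt_one_of_one_lt₀ hs
    linarith
  have h3 : dR q L s * √(1 - (dR q L s ^ 2)⁻¹) * dR q L s =
    dR q L s ^ 2 * √(1 - (dR q L s ^ 2)⁻¹) := by ring
  rw [h3]
  exact mul_pos (by linarith) h2

end Admissible

/-- Upper boundary values of `R` off the band edges. -/
theorem IsSpectralEnumeration.exists_rootR (e : IsSpectralEnumeration q L ζ μ)
    (h : Admissible q L Q) {s : ℝ} (hs : s ∉ bandEdges ζ) :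
    ∃ W : ℂ → ℂ, AnalyticAt ℂ W s ∧ (∀ z, W z ^ 2 = Δ z ^ 2 - 1) ∧
      ∀ᶠ z in 𝓝[upper] (s : ℂ), rootR q L z = W z := by
  by_cases hd : dR q L s ^ 2 = 1
  swap
  · exact h.exists_rootR_of_ne hd
  have hj : ∃ j, ¬ IsOpenGap ζ j ∧ s = μ j := by
    rcases e.trichotomy h hs with ⟨j, hj⟩ | ⟨j, hj⟩ | hj
    · linarith [e.dR_sq_lt_one h hj]
    · linarith [e.one_lt_dR_sq h hj]
    · exact hj
  obtain ⟨j, hj, rfl⟩ := hj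
  obtain ⟨-, ⟨d, hd1, hd2, hd3⟩, -⟩ :=
    h.sq_lt_one_of_deriv_eq_zero hd (e.deriv_eq_zero_of_not_isOpenGap h hj).2
  have hne : ∀ z ∈ upper, z - (μ j : ℂ) ≠ 0 := fun z hz h0 =>
    upper_subset hz (by rw [sub_eq_zero.1 h0]; simp)
  obtain ⟨W, h1, -, h2, h3⟩ := exists_analyticAt_of_pow_eq
    (f := fun z => rootR q L z / (z - μ j)) (s := (μ j : ℂ))
    (g := d) convex_upper two_ne_zero (by
      filter_upwards [self_mem_nhdsWithin] with z hz
      have hz' := upper_subset hz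
      refine ⟨((h.differentiableAt_rootR hz').div (by fun_prop)
        (hne z hz)).continuousAt.continuousWithinAt, ?_⟩
      rw [div_pow, h.rootR_sq hz', hd3, mul_div_cancel_left₀ _ (pow_ne_zero 2 (hne z hz))])
    (hd1.analyticAt _) hd2
  refine ⟨fun z => (z - μ j) * W z, by fun_prop, fun z => by rw [mul_pow, h2, hd3], ?_⟩
  filter_upwards [h3, self_mem_nhdsWithin] with z hz hzu
  rw [← hz, mul_div_cancel₀ _ (hne z hzu)]

/-! ### The branches `S` and `F` and their symmetry -/

/-- The data entering the Riemann-Hilbert problem: `S` is the branch of `√f⁰`, `F` that of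
`(Δ² - 1)^{1/4}`, and `g` the base point `γ_*` of the counting function `m`. -/
structure BranchData (q : ℝ → ℂ) (L Q : ℝ) (ζ μ : ℤ → ℝ) (A B : ℂ) (g : ℝ) (S F : ℂ → ℂ) :
    Prop where
  adm : Admissible q L Q
  spec : IsSpectralEnumeration q L ζ μ
  had : IsHadamardConstants q L μ A B
  closest : IsClosestToZero (zeroSignMovable q L ζ μ) g
  sqrt : IsSqrtBranch ζ (countM (zeroSignMovable q L ζ μ) g) (fZero q L μ A B) S
  root : IsFourthRootBranch ζ (fun z => discriminant q L z ^ 2 - 1) F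

namespace BranchData

variable (d : BranchData q L Q ζ μ A B g S F)
include d

theorem differentiableAt_S (hz : z ∈ offReal) : DifferentiableAt ℂ S z := by
  have := d.sqrt.1
  rw [upper_union_lower] at this
  exact this.differentiableAt (isOpen_offReal.mem_nhds hz)

theorem differentiableAt_F (hz : z ∈ offReal) : DifferentiableAt ℂ F z := by
  have := d.root.1
  rw [upper_union_lower] at this
  exact this.differentiableAt (isOpen_offReal.mem_nhds hz)

theorem S_sq (hz : z ∈ offReal) : S z ^ 2 = f⁰ z :=
  d.sqrt.2.1 z (by rwa [upper_union_lower])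

theorem F_pow (hz : z ∈ offReal) : F z ^ 4 = Δ z ^ 2 - 1 :=
  d.root.2.1 z (by rwa [upper_union_lower])

theorem fZero_ne_zero (hz : z ∈ offReal) : f⁰ z ≠ 0 :=
  (d.spec.factors_ne_zero d.adm d.had (IsSpectralEnumeration.ms_ne_zero_of_im d.adm hz)).1

theorem S_ne_zero (hz : z ∈ offReal) : S z ≠ 0 := fun h0 =>
  d.fZero_ne_zero hz (by rw [← d.S_sq hz, h0]; ring)

theorem F_ne_zero (hz : z ∈ offReal) : F z ≠ 0 := fun h0 =>
  d.adm.discriminant_sq_sub_one_ne_zero hz (by rw [← d.F_pow hz, h0]; ring)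

/-- A point of the base band. -/
theorem exists_base : ∃ s, s ∈ Ioo (ζ (-2)) (ζ (-1)) := by
  have := d.spec.band_lt (-1)
  norm_num at this
  exact exists_between this

theorem base_sq_lt {s : ℝ} (hs : s ∈ Ioo (ζ (-2)) (ζ (-1))) : dR q L s ^ 2 < 1 :=
  d.spec.dR_sq_lt_one d.adm (j := -1) (by norm_num; exact hs)

omit d in
theorem conj_mem_lower (hz : z ∈ upper) : conj z ∈ lower := by
  simpa [upper, lower] using hz

omit d in
theorem conj_mem_upper (hz : z ∈ lower) : conj z ∈ upper := by
  simpa [upper, lower] using hz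

omit d in
theorem tendsto_conj_upper (s : ℝ) :
    Tendsto conj (𝓝[upper] (s : ℂ)) (𝓝[lower] (s : ℂ)) := by
  have h1 : Tendsto conj (𝓝 (s : ℂ)) (𝓝 (s : ℂ)) := by
    simpa using continuous_conj.tendsto (s : ℂ)
  exact tendsto_nhdsWithin_iff.2 ⟨h1.mono_left nhdsWithin_le_nhds, by
    filter_upwards [self_mem_nhdsWithin] with z hz using conj_mem_lower hz⟩

omit d in
theorem tendsto_conj_lower (s : ℝ) :
    Tendsto conj (𝓝[lower] (s : ℂ)) (𝓝[upper] (s : ℂ)) := by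
  have h1 : Tendsto conj (𝓝 (s : ℂ)) (𝓝 (s : ℂ)) := by
    simpa using continuous_conj.tendsto (s : ℂ)
  exact tendsto_nhdsWithin_iff.2 ⟨h1.mono_left nhdsWithin_le_nhds, by
    filter_upwards [self_mem_nhdsWithin] with z hz using conj_mem_upper hz⟩

omit d in
theorem continuousOn_conj_comp {f : ℂ → ℂ} (hf : ContinuousOn f offReal) :
    ContinuousOn (fun z => conj (f (conj z))) upper :=
  continuous_conj.comp_continuousOn (hf.comp continuous_conj.continuousOn
    fun _ hz => lower_subset (conj_mem_lower hz))

theorem continuousOn_S : ContinuousOn S offReal := fun _ hz =>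
  (d.differentiableAt_S hz).continuousAt.continuousWithinAt

theorem continuousOn_F : ContinuousOn F offReal := fun _ hz =>
  (d.differentiableAt_F hz).continuousAt.continuousWithinAt

theorem F_conj (hz : z ∈ upper) : F (conj z) = conj (F z) := by
  obtain ⟨c, hc, hcU⟩ := exists_eq_const_mul_of_pow_eq convex_upper.isPreconnected (n := 4)
    (by norm_num) (continuousOn_conj_comp d.continuousOn_F)
    (d.continuousOn_F.mono upper_subset)
    (fun z hz => d.F_ne_zero (upper_subset hz)) (fun z hz => by
      rw [← map_pow, d.F_pow (lower_subset (conj_mem_lower hz)),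
        d.F_pow (upper_subset hz), discriminant_conj d.adm.cont, map_sub, map_pow,
        conj_conj, map_one])
  obtain ⟨s, hs⟩ := d.exists_base
  obtain ⟨h1, h2⟩ := d.root.2.2 s hs
  have h3 := (continuous_conj.tendsto _).comp (h2.comp (tendsto_conj_upper s))
  have h4 := (h1.const_mul c).congr' (f₂ := fun z => conj (F (conj z))) (by
    filter_upwards [self_mem_nhdsWithin] with z hz using (hcU z hz).symm)
  have h5 := tendsto_nhds_unique h3 h4
  have hne : ((‖Δ s ^ 2 - 1‖ ^ (1 / 4 : ℝ) : ℝ) : ℂ) * exp (I * π / 4) ≠ 0 := by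
    refine mul_ne_zero ?_ (exp_ne_zero _)
    have h6 : Δ s ^ 2 - 1 ≠ 0 := by
      rw [d.adm.discriminant_eq, sub_ne_zero]
      exact_mod_cast (d.base_sq_lt hs).ne
    exact_mod_cast (Real.rpow_pos_of_pos (norm_pos_iff.2 h6) _).ne'
  have hc1 : c = 1 := by
    rw [map_mul, conj_ofReal, ← exp_conj] at h5
    simp only [map_neg, map_mul, map_div₀, conj_I, conj_ofReal, map_ofNat,
      neg_mul, neg_div, neg_neg] at h5
    exact mul_right_cancel₀ hne (by rw [one_mul]; exact h5.symm)
  have := hcU z hz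
  rw [hc1, one_mul] at this
  rw [← this, conj_conj]

/-- The sign in the symmetry relation for `S`. -/
theorem exists_S_conj : ∃ c : ℝ, c ^ 2 = 1 ∧ (∀ z ∈ upper, S (conj z) = c * conj (S z)) ∧
    ∀ s ∈ Ioo (ζ (-2)) (ζ (-1)), 0 < c * (-1) ^ countM Γ g s * (f⁰ s).re := by
  obtain ⟨c, hc, hcU⟩ := exists_eq_const_mul_of_pow_eq convex_upper.isPreconnected (n := 2)
    (by norm_num) (continuousOn_conj_comp d.continuousOn_S)
    (d.continuousOn_S.mono upper_subset)
    (fun z hz => d.S_ne_zero (upper_subset hz)) (fun z hz => by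
      rw [← map_pow, d.S_sq (lower_subset (conj_mem_lower hz)),
        d.S_sq (upper_subset hz), d.spec.fZero_conj d.adm d.had, conj_conj])
  have hcr : ∃ r : ℝ, c = r ∧ r ^ 2 = 1 := by
    rcases sq_eq_one_iff.1 hc with h | h
    · exact ⟨1, by rw [h]; simp, by norm_num⟩
    · exact ⟨-1, by rw [h]; simp, by norm_num⟩
  obtain ⟨r, rfl, hr⟩ := hcr
  have hsym : ∀ z ∈ upper, S (conj z) = r * conj (S z) := fun z hz => by
    have := congrArg conj (hcU z hz)
    rwa [conj_conj, map_mul, conj_ofReal] at this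
  refine ⟨r, hr, hsym, fun s hs => ?_⟩
  obtain ⟨w, h1, h2⟩ := d.sqrt.2.2 s hs
  set k := countM Γ g s
  have h3 := h2.comp (tendsto_conj_upper s)
  have h4 := (((continuous_conj.tendsto _).comp h1).const_mul (r : ℂ)).congr'
    (f₂ := S ∘ conj) (by
      filter_upwards [self_mem_nhdsWithin] with z hz using (hsym z hz).symm)
  have h5 := tendsto_nhds_unique h3 h4
  have h6 : w ^ 2 = f⁰ s := tendsto_nhds_unique ((h1.pow 2).congr' (by
      filter_upwards [self_mem_nhdsWithin] with z hz using d.S_sq (upper_subset hz)))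
    (((d.spec.differentiable_fZero d.adm A B).continuous.tendsto _).mono_left nhdsWithin_le_nhds)
  have hf0 : f⁰ s ≠ 0 := (d.spec.factors_ne_zero d.adm d.had (mt d.adm.ms_eq_zero_iff.1
    (IsSpectralEnumeration.mR_ne_zero_of_sq_lt d.adm (d.base_sq_lt hs)))).1
  have hw : w ≠ 0 := by rintro rfl; rw [← h6] at hf0; simp at hf0
  have hk2 : ((-1 : ℝ) ^ k) ^ 2 = 1 := by rw [← pow_mul, mul_comm, pow_mul]; simp
  have h7 : ((-1 : ℂ) ^ k) * w ^ 2 = r * (normSq w : ℂ) := by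
    rw [← mul_conj, sq, ← mul_assoc, h5]; ring
  rw [h6, d.spec.fZero_ofReal d.adm d.had] at h7
  have h8 : (-1 : ℝ) ^ k * (f⁰ s).re = r * normSq w := by exact_mod_cast h7
  rw [mul_assoc, h8, ← mul_assoc, ← sq, hr, one_mul]
  exact Complex.normSq_pos.2 hw

/-- In the upper half-plane `√(Δ²-1) = ±R`; the sign is read off in the base band. -/
theorem exists_F_sq : ∃ ε : ℝ, ε ^ 2 = 1 ∧ (∀ z ∈ upper, F z ^ 2 = ε * rootR q L z) ∧
    ∀ s ∈ Ioo (ζ (-2)) (ζ (-1)), ε * mR q L s < 0 := by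
  obtain ⟨c, hc, hcU⟩ := exists_eq_const_mul_of_pow_eq convex_upper.isPreconnected (n := 2)
    (by norm_num) (f := fun z => F z ^ 2) ((d.continuousOn_F.mono upper_subset).pow 2)
    (g := rootR q L) (fun z hz => (d.adm.differentiableAt_rootR
      (upper_subset hz)).continuousAt.continuousWithinAt)
    (fun z hz => d.adm.rootR_ne_zero (upper_subset hz)) (fun z hz => by
      have hz' := upper_subset hz
      rw [d.adm.rootR_sq hz', ← d.F_pow hz']; ring)
  have hcr : ∃ r : ℝ, c = r ∧ r ^ 2 = 1 := by
    rcases sq_eq_one_iff.1 hc with h | h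
    · exact ⟨1, by rw [h]; simp, by norm_num⟩
    · exact ⟨-1, by rw [h]; simp, by norm_num⟩
  obtain ⟨r, rfl, hr⟩ := hcr
  refine ⟨r, hr, hcU, fun s hs => ?_⟩
  obtain ⟨W, hW, hWsq, hev⟩ := d.adm.exists_rootR_of_ne (d.base_sq_lt hs).ne
  obtain ⟨h1, h2⟩ := d.adm.rootR_band (d.base_sq_lt hs) hW.continuousAt (hWsq s) hev
  have h3 := (d.root.2.2 s hs).1.pow 2
  have h4 : Tendsto (fun z => F z ^ 2) (𝓝[upper] (s : ℂ)) (𝓝 (r * W s)) :=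
    ((hW.continuousAt.tendsto.mono_left nhdsWithin_le_nhds).const_mul (r : ℂ)).congr' (by
      filter_upwards [hev, self_mem_nhdsWithin] with z hz hzu
      rw [hcU z hzu, hz])
  have h5 := congrArg Complex.im (tendsto_nhds_unique h3 h4)
  rw [mul_pow, exp_I_pi_div_four_sq, Complex.im_ofReal_mul, ← ofReal_pow,
    Complex.im_ofReal_mul, I_im, mul_one] at h5
  have h6 : Δ s ^ 2 - 1 ≠ 0 := by
    rw [d.adm.discriminant_eq, sub_ne_zero]
    exact_mod_cast (d.base_sq_lt hs).ne
  have h7 : 0 < r * (W s).im := by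
    rw [← h5]; exact pow_pos (Real.rpow_pos_of_pos (norm_pos_iff.2 h6) _) 2
  have h8 : (r * mR q L s) * ((W s).im ^ 2) < 0 := by
    have := mul_neg_of_pos_of_neg h7 h2
    nlinarith
  by_contra! hcon
  nlinarith [sq_nonneg (W s).im]

end BranchData

/-! ### Holomorphic continuation to the real line -/

/-- The entries of `f⁺ψ⁺`. -/
def colPlus (q : ℝ → ℂ) (L : ℝ) (μ : ℤ → ℝ) (x : ℝ) (i : Fin 2) (z : ℂ) : ℂ :=
  signProduct q L μ 1 z * (ms q i 0 x z + ms q i 1 x z * weylPlus q L z)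

/-- The entries of `f⁻ψ⁻`. -/
def colMinus (q : ℝ → ℂ) (L : ℝ) (μ : ℤ → ℝ) (x : ℝ) (i : Fin 2) (z : ℂ) : ℂ :=
  signProduct q L μ (-1) z * (ms q i 0 x z + ms q i 1 x z * weylMinus q L z)

theorem Admissible.matPhi_upper (h : Admissible q L Q) (hz : z ∈ upper) (x : ℝ)
    (i : Fin 2) :
    Φ x z i 0 = I * (S z / F z) * colMinus q L μ x i z * exp (I * z * x) ∧
    Φ x z i 1 = I * (S z / F z) * colPlus q L μ x i z * exp (-(I * z * x)) := by
  have hz' := upper_subset hz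
  have h1 := blochPlus_eq h.cont h.pos h.per hz' x
  have h2 := blochMinus_eq h.cont h.pos h.per hz' x
  simp only [matPhi, matPsi, matB, if_pos hz, expSigmaThree, Matrix.mul_smul, Matrix.smul_apply,
    Matrix.mul_diagonal, smul_eq_mul]
  obtain rfl | rfl := fin_two i
  all_goals
    simp [ofCols, h1, h2, colPlus, colMinus]
    constructor <;> ring

theorem Admissible.matPhi_lower (h : Admissible q L Q) (hz : z ∈ lower) (x : ℝ)
    (i : Fin 2) :
    Φ x z i 0 = S z / F z * colPlus q L μ x i z * exp (I * z * x) ∧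
    Φ x z i 1 = S z / F z * colMinus q L μ x i z * exp (-(I * z * x)) := by
  have hz' := lower_subset hz
  have hzu : z ∉ upper := fun h' =>
    lt_asymm (show 0 < z.im from h') (show z.im < 0 from hz)
  have h1 := blochPlus_eq h.cont h.pos h.per hz' x
  have h2 := blochMinus_eq h.cont h.pos h.per hz' x
  simp only [matPhi, matPsi, matB, if_neg hzu, expSigmaThree, Matrix.mul_smul, Matrix.smul_apply,
    Matrix.mul_diagonal, smul_eq_mul]
  obtain rfl | rfl := fin_two i
  all_goals
    simp [ofCols, h1, h2, colPlus, colMinus]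
    constructor <;> (left; ring)

/-- The quotient of analytic functions at a common zero which is simple for the denominator. -/
theorem exists_analyticAt_div {N m : ℂ → ℂ} {s : ℂ} (hN : AnalyticAt ℂ N s)
    (hm : Differentiable ℂ m) (h0 : m s = 0 → N s = 0 ∧ deriv m s ≠ 0) :
    ∃ W : ℂ → ℂ, AnalyticAt ℂ W s ∧ ∀ᶠ z in 𝓝[≠] s, N z / m z = W z := by
  by_cases hms : m s = 0
  swap
  · exact ⟨_, hN.div (hm.analyticAt s) hms, Eventually.of_forall fun _ => rfl⟩
  obtain ⟨hNs, hd⟩ := h0 hms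
  obtain ⟨k, hk, hks, hmk⟩ := exists_eq_sub_mul hm hms
  obtain ⟨p, hp⟩ := hN
  have hN1 : AnalyticAt ℂ (dslope N s) s := ⟨_, hp.has_fpower_series_dslope_fslope⟩
  refine ⟨fun z => dslope N s z / k z, hN1.div (hk.analyticAt s) (by rwa [hks]), ?_⟩
  filter_upwards [self_mem_nhdsWithin] with z hz
  have h1 := sub_smul_dslope N s z
  rw [hNs, sub_zero, smul_eq_mul] at h1
  rw [← h1, hmk, mul_div_mul_left _ _ (sub_ne_zero.2 hz)]

theorem eventually_upper_of_ne {p : ℂ → Prop} {s : ℝ} (h : ∀ᶠ z in 𝓝[≠] (s : ℂ), p z) :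
    ∀ᶠ z in 𝓝[upper] (s : ℂ), p z := by
  refine h.filter_mono (nhdsWithin_mono _ fun z hz hzs => ?_)
  rw [mem_singleton_iff] at hzs
  exact upper_subset hz (by rw [hzs]; simp)

namespace IsSpectralEnumeration

variable (e : IsSpectralEnumeration q L ζ μ) (h : Admissible q L Q)
include e h

/-- At a Dirichlet eigenvalue off the band edges, one of `f⁺`, `h - R` vanishes, and one of `f⁻`,
`h + R`. -/
theorem numerators_eq_zero {s : ℝ}
    {W : ℂ → ℂ} (hW : ContinuousAt W s)
    (hsq : W s ^ 2 = Δ s ^ 2 - 1)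
    (hev : ∀ᶠ z in 𝓝[upper] (s : ℂ), rootR q L z = W z) (hm : ms q 0 1 L s = 0) :
    𝔣 1 s * (halfDiff q L s - W s) = 0 ∧ 𝔣 (-1) s * (halfDiff q L s + W s) = 0 := by
  obtain ⟨j, hj⟩ := (e.ms_eq_zero_iff h).1 hm
  have hj' : s = μ j := by exact_mod_cast hj
  subst hj'
  have hh := h.halfDiff_sq hm
  have hzero := fun τ => (e.signProduct_eq_zero_iff h (τ := τ) (z := μ j)).2
  have hσ := e.dirSign_eq h j
  -- `h² = Δ² - 1 = R²`, and the sign of `hΔ` is `-σ_j` while that of `RΔ` is positive in a gap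
  by_cases hcase : dirSign q L μ j = 0
  · have h1 : dR q L (μ j) ^ 2 = 1 := (e.dirSign_eq_zero_iff h j).1 hcase
    rw [h.discriminant_sq_eq_one_iff.2 h1, sub_self, sq_eq_zero_iff] at hh hsq
    rw [hh, hsq]; simp
  have hgt : 1 < dR q L (μ j) ^ 2 := (h.of_mR_eq_zero (e.mR_mu h j)).1.lt_of_ne fun h1 =>
    hcase ((e.dirSign_eq_zero_iff h j).2 h1.symm)
  obtain ⟨h1, h2⟩ := h.rootR_gap hgt hW hev
  have h4 : (halfDiff q L (μ j)).re ^ 2 = (W (μ j)).re ^ 2 := by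
    rw [← hsq, h.halfDiff_ofReal, h1] at hh
    exact_mod_cast hh
  rw [h.halfDiff_ofReal, h1]
  rcases sq_eq_sq_iff_eq_or_eq_neg.1 h4 with h5 | h5
  · rw [h5, sign_pos h2] at hσ
    exact ⟨by rw [h5]; simp, by rw [hzero (-1) ⟨j, hσ, rfl⟩, zero_mul]⟩
  · rw [h5, neg_mul, sign_neg (neg_neg_of_pos h2), neg_neg] at hσ
    exact ⟨by rw [hzero 1 ⟨j, hσ, rfl⟩, zero_mul], by rw [h5]; simp⟩

theorem exists_colPlus {s : ℝ}
    (hs : s ∉ bandEdges ζ) (x : ℝ) (i : Fin 2) :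
    ∃ W : ℂ → ℂ, AnalyticAt ℂ W s ∧ ∀ᶠ z in 𝓝[upper] (s : ℂ), colPlus q L μ x i z = W z := by
  obtain ⟨R, hR, hsq, hev⟩ := e.exists_rootR h hs
  have hf := e.differentiable_signProduct h 1
  obtain ⟨W, hW, hWe⟩ := exists_analyticAt_div
    (N := fun z => 𝔣 1 z * (halfDiff q L z - R z))
    ((hf.analyticAt _).mul ((h.differentiable_halfDiff.analyticAt _).sub hR))
    (differentiable_ms h.cont h.bound 0 1 L) fun hm => by
      refine ⟨(e.numerators_eq_zero h hR.continuousAt (hsq s) hev hm).1, ?_⟩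
      obtain ⟨j, hj⟩ := (e.ms_eq_zero_iff h).1 hm
      rw [hj]; exact e.ms_deriv_ne_zero h j
  refine ⟨fun z => 𝔣 1 z * ms q i 0 x z + ms q i 1 x z * W z,
    ((hf.analyticAt _).mul ((differentiable_ms h.cont h.bound i 0 x).analyticAt _)).add
      (((differentiable_ms h.cont h.bound i 1 x).analyticAt _).mul hW), ?_⟩
  filter_upwards [hev, eventually_upper_of_ne hWe] with z h1 h2
  rw [← h2, colPlus, Admissible.weylPlus_eq, h1]
  ring

theorem exists_colMinus {s : ℝ}
    (hs : s ∉ bandEdges ζ) (x : ℝ) (i : Fin 2) :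
    ∃ W : ℂ → ℂ, AnalyticAt ℂ W s ∧ ∀ᶠ z in 𝓝[upper] (s : ℂ), colMinus q L μ x i z = W z := by
  obtain ⟨R, hR, hsq, hev⟩ := e.exists_rootR h hs
  have hf := e.differentiable_signProduct h (-1)
  obtain ⟨W, hW, hWe⟩ := exists_analyticAt_div
    (N := fun z => 𝔣 (-1) z * (halfDiff q L z + R z))
    ((hf.analyticAt _).mul ((h.differentiable_halfDiff.analyticAt _).add hR))
    (differentiable_ms h.cont h.bound 0 1 L) fun hm => by
      refine ⟨(e.numerators_eq_zero h hR.continuousAt (hsq s) hev hm).2, ?_⟩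
      obtain ⟨j, hj⟩ := (e.ms_eq_zero_iff h).1 hm
      rw [hj]; exact e.ms_deriv_ne_zero h j
  refine ⟨fun z => 𝔣 (-1) z * ms q i 0 x z + ms q i 1 x z * W z,
    ((hf.analyticAt _).mul ((differentiable_ms h.cont h.bound i 0 x).analyticAt _)).add
      (((differentiable_ms h.cont h.bound i 1 x).analyticAt _).mul hW), ?_⟩
  filter_upwards [hev, eventually_upper_of_ne hWe] with z h1 h2
  rw [← h2, colMinus, Admissible.weylMinus_eq, h1]
  ring

/-- `f⁰` has simple zeros. -/
theorem exists_fZero_eq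
    (hAB : IsHadamardConstants q L μ A B) {j : ℤ} (hj : dirSign q L μ j = 0) :
    ∃ k : ℂ → ℂ, Differentiable ℂ k ∧ k (μ j) ≠ 0 ∧ ∀ z, f⁰ z = (z - μ j) * k z := by
  obtain ⟨k, hk, -, hfk⟩ := exists_eq_sub_mul (e.differentiable_fZero h A B)
    ((e.fZero_eq_zero_iff h (A := A) (B := B) (z := μ j)).2 ⟨j, hj, rfl⟩)
  refine ⟨k, hk, fun h0 => ?_, hfk⟩
  have hp := e.differentiable_signProduct h 1
  have hm := e.differentiable_signProduct h (-1)
  have hd : HasDerivAt (fun z => ms q 0 1 L z) 0 (μ j) := by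
    have h1 : (fun z => ms q 0 1 L z) = fun z => (z - μ j) * (k z * (2 * 𝔣 1 z * 𝔣 (-1) z)) := by
      ext z; rw [e.ms_eq_mul h hAB, hfk]; ring
    rw [h1]
    have h2 : DifferentiableAt ℂ (fun z => k z * (2 * 𝔣 1 z * 𝔣 (-1) z)) (μ j) := by fun_prop
    exact (((hasDerivAt_id (μ j : ℂ)).sub_const _).mul h2.hasDerivAt).congr_deriv (by
      simp [h0])
  exact e.ms_deriv_ne_zero h j hd.deriv

end IsSpectralEnumeration

namespace BranchData

variable (d : BranchData q L Q ζ μ A B g S F)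
include d

theorem quot_pow (hz : z ∈ offReal) :
    (S z / F z) ^ 4 = f⁰ z ^ 2 / (Δ z ^ 2 - 1) := by
  rw [div_pow, d.F_pow hz, ← d.S_sq hz]; ring

theorem exists_quot {s : ℝ} (hs : s ∉ bandEdges ζ) :
    ∃ W : ℂ → ℂ, AnalyticAt ℂ W s ∧ W s ≠ 0 ∧ ∀ᶠ z in 𝓝[upper] (s : ℂ), S z / F z = W z := by
  have hcont : ∀ z ∈ upper, ContinuousWithinAt (fun z => S z / F z) upper z := fun z hz => by
    have hz' := upper_subset hz
    exact ((d.differentiableAt_S hz').div (d.differentiableAt_F hz')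
      (d.F_ne_zero hz')).continuousAt.continuousWithinAt
  have hf0 := d.spec.differentiable_fZero d.adm A B
  by_cases hd : dR q L s ^ 2 = 1
  swap
  · have hfs : f⁰ s ≠ 0 := fun h0 => by
      obtain ⟨j, hj, hsj⟩ := (d.spec.fZero_eq_zero_iff d.adm).1 h0
      have : s = μ j := by exact_mod_cast hsj
      exact hd (this ▸ (d.spec.dirSign_eq_zero_iff d.adm j).1 hj)
    have hD : Δ s ^ 2 - 1 ≠ 0 := by
      rw [d.adm.discriminant_eq, sub_ne_zero]; exact_mod_cast hd
    obtain ⟨W, h1, h2, -, h3⟩ := exists_analyticAt_of_pow_eq (s := (s : ℂ))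
      (f := fun z => S z / F z) (n := 4)
      (g := fun z => f⁰ z ^ 2 / (Δ z ^ 2 - 1)) convex_upper
      (by norm_num) (by
        filter_upwards [self_mem_nhdsWithin] with z hz
        exact ⟨hcont z hz, d.quot_pow (upper_subset hz)⟩)
      (((hf0.pow 2).analyticAt _).div (d.adm.differentiable_sq_sub_one.analyticAt _) hD)
      (div_ne_zero (pow_ne_zero 2 hfs) hD)
    exact ⟨W, h1, h2, h3⟩
  have hj : ∃ j, ¬ IsOpenGap ζ j ∧ s = μ j := by
    rcases d.spec.trichotomy d.adm hs with ⟨j, hj⟩ | ⟨j, hj⟩ | hj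
    · linarith [d.spec.dR_sq_lt_one d.adm hj]
    · linarith [d.spec.one_lt_dR_sq d.adm hj]
    · exact hj
  obtain ⟨j, hj, rfl⟩ := hj
  obtain ⟨-, ⟨u, hu, hu0, hDu⟩, -⟩ :=
    d.adm.sq_lt_one_of_deriv_eq_zero hd (d.spec.deriv_eq_zero_of_not_isOpenGap d.adm hj).2
  obtain ⟨k, hk, hk0, hfk⟩ := d.spec.exists_fZero_eq d.adm d.had
    ((d.spec.dirSign_eq_zero_iff d.adm j).2 hd)
  obtain ⟨W, h1, h2, -, h3⟩ := exists_analyticAt_of_pow_eq (s := (μ j : ℂ))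
    (f := fun z => S z / F z) (n := 4) (g := fun z => k z ^ 2 / u z) convex_upper
    (by norm_num) (by
      filter_upwards [self_mem_nhdsWithin] with z hz
      refine ⟨hcont z hz, ?_⟩
      have hne : z - (μ j : ℂ) ≠ 0 := fun h0 =>
        upper_subset hz (by rw [sub_eq_zero.1 h0]; simp)
      rw [d.quot_pow (upper_subset hz), hfk, hDu, mul_pow,
        mul_div_mul_left _ _ (pow_ne_zero 2 hne)])
    (((hk.pow 2).analyticAt _).div (hu.analyticAt _) hu0) (div_ne_zero (pow_ne_zero 2 hk0) hu0)
  exact ⟨W, h1, h2, h3⟩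

theorem matPhi_conj {c : ℝ} (hc : ∀ z ∈ upper, S (conj z) = c * conj (S z))
    (hz : z ∈ upper) (x : ℝ) (i : Fin 2) :
    Φ x (conj z) i 0 = c * I * conj (Φ x z i 1) ∧
    Φ x (conj z) i 1 = c * I * conj (Φ x z i 0) := by
  have hz' := upper_subset hz
  obtain ⟨h1, h2⟩ := d.adm.matPhi_upper (μ := μ) (S := S) (F := F) hz x i
  obtain ⟨h3, h4⟩ := d.adm.matPhi_lower (μ := μ) (S := S) (F := F) (conj_mem_lower hz) x i
  have h5 : colPlus q L μ x i (conj z) = conj (colPlus q L μ x i z) := by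
    simp only [colPlus, d.spec.signProduct_conj d.adm, ms_conj d.adm.cont,
      d.adm.weylPlus_conj hz', map_mul, map_add]
  have h6 : colMinus q L μ x i (conj z) = conj (colMinus q L μ x i z) := by
    simp only [colMinus, d.spec.signProduct_conj d.adm, ms_conj d.adm.cont,
      d.adm.weylMinus_conj hz', map_mul, map_add]
  rw [h1, h2, h3, h4, hc z hz, d.F_conj hz, h5, h6]
  simp only [map_mul, map_div₀, conj_I, ← exp_conj, map_neg, conj_ofReal]
  constructor
  · rw [show -(-I * conj z * (x : ℂ)) = I * conj z * x by ring]
    linear_combination ((c * conj (S z) / conj (F z) *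
      conj (colPlus q L μ x i z) * exp (I * conj z * x))) * I_sq
  · rw [show -(I * conj z * (x : ℂ)) = -I * conj z * x by ring]
    linear_combination ((c * conj (S z) / conj (F z) *
      conj (colMinus q L μ x i z) * exp (-I * conj z * x))) * I_sq

/-- Each entry of `Φ` continues holomorphically across every real point which is not a band edge. -/
theorem exists_matPhi {s : ℝ} (hs : s ∉ bandEdges ζ) (x : ℝ) (i j : Fin 2) :
    ∃ W : ℂ → ℂ, AnalyticAt ℂ W s ∧ ∀ᶠ z in 𝓝[upper] (s : ℂ), Φ x z i j = W z := by
  obtain ⟨T, hT, -, hTe⟩ := d.exists_quot hs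
  obtain rfl | rfl := fin_two j
  · obtain ⟨W, hW, hWe⟩ := d.spec.exists_colMinus d.adm hs x i
    refine ⟨fun z => I * T z * W z * exp (I * z * x), by fun_prop, ?_⟩
    filter_upwards [hTe, hWe, self_mem_nhdsWithin] with z h1 h2 h3
    rw [(d.adm.matPhi_upper h3 x i).1, h1, h2]
  · obtain ⟨W, hW, hWe⟩ := d.spec.exists_colPlus d.adm hs x i
    refine ⟨fun z => I * T z * W z * exp (-(I * z * x)), by fun_prop, ?_⟩
    filter_upwards [hTe, hWe, self_mem_nhdsWithin] with z h1 h2 h3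
    rw [(d.adm.matPhi_upper h3 x i).2, h1, h2]

theorem differentiableOn_matPhi (x : ℝ) (i j : Fin 2) :
    DifferentiableOn ℂ (fun z => Φ x z i j) {z | z.im ≠ 0} := by
  intro z hz
  change z ∈ offReal at hz
  have hq : DifferentiableAt ℂ (fun z => S z / F z) z :=
    (d.differentiableAt_S hz).div (d.differentiableAt_F hz) (d.F_ne_zero hz)
  have hm := fun i j => differentiable_ms d.adm.cont d.adm.bound i j x z
  have hcp : DifferentiableAt ℂ (colPlus q L μ x i) z :=
    (d.spec.differentiable_signProduct d.adm 1 z).mul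
      ((hm i 0).add ((hm i 1).mul (d.adm.differentiableAt_weylPlus hz)))
  have hcm : DifferentiableAt ℂ (colMinus q L μ x i) z :=
    (d.spec.differentiable_signProduct d.adm (-1) z).mul
      ((hm i 0).add ((hm i 1).mul (d.adm.differentiableAt_weylMinus hz)))
  refine DifferentiableAt.differentiableWithinAt ?_
  have hzz := hz
  rw [← upper_union_lower] at hzz
  obtain rfl | rfl := fin_two j
  all_goals rcases hzz with hzu | hzl
  · refine DifferentiableAt.congr_of_eventuallyEq (f₁ := fun z => Φ x z i 0)
      (f := fun z => I * (S z / F z) * colMinus q L μ x i z * exp (I * z * x)) (by fun_prop) ?_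
    filter_upwards [isOpen_upper.mem_nhds hzu] with w hw using (d.adm.matPhi_upper hw x i).1
  · refine DifferentiableAt.congr_of_eventuallyEq (f₁ := fun z => Φ x z i 0)
      (f := fun z => S z / F z * colPlus q L μ x i z * exp (I * z * x)) (by fun_prop) ?_
    filter_upwards [isOpen_lower.mem_nhds hzl] with w hw using (d.adm.matPhi_lower hw x i).1
  · refine DifferentiableAt.congr_of_eventuallyEq (f₁ := fun z => Φ x z i 1)
      (f := fun z => I * (S z / F z) * colPlus q L μ x i z * exp (-(I * z * x))) (by fun_prop) ?_
    filter_upwards [isOpen_upper.mem_nhds hzu] with w hw using (d.adm.matPhi_upper hw x i).2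
  · refine DifferentiableAt.congr_of_eventuallyEq (f₁ := fun z => Φ x z i 1)
      (f := fun z => S z / F z * colMinus q L μ x i z * exp (-(I * z * x))) (by fun_prop) ?_
    filter_upwards [isOpen_lower.mem_nhds hzl] with w hw using (d.adm.matPhi_lower hw x i).2

end BranchData

/-! ### The jump relation -/

theorem eventually_of_eventually_ne {p : ℂ → Prop} {s : ℝ} (h : ∀ᶠ z in 𝓝[≠] (s : ℂ), p z) :
    ∀ᶠ t : ℝ in 𝓝[≠] s, p t := by
  have : Tendsto (fun t : ℝ => (t : ℂ)) (𝓝[≠] s) (𝓝[≠] (s : ℂ)) :=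
    tendsto_nhdsWithin_iff.2 ⟨(continuous_ofReal.tendsto s).mono_left nhdsWithin_le_nhds, by
      filter_upwards [self_mem_nhdsWithin] with t ht h0
      rw [mem_singleton_iff] at h0
      exact ht (by rw [mem_singleton_iff]; exact_mod_cast h0)⟩
  exact this.eventually h

theorem eventually_ne_zero_of_offReal {f : ℂ → ℂ} (hf : Differentiable ℂ f)
    (h0 : ∀ z ∈ offReal, f z ≠ 0) (s : ℝ) : ∀ᶠ t : ℝ in 𝓝[≠] s, f t ≠ 0 := by
  refine eventually_of_eventually_ne (p := fun z => f z ≠ 0) ?_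
  rcases (hf.analyticAt (s : ℂ)).eventually_eq_zero_or_eventually_ne_zero with h | h
  · have h1 : ∃ᶠ z in 𝓝 (s : ℂ), f z ≠ 0 := by
      have : ∃ᶠ z in 𝓝[offReal] (s : ℂ), f z ≠ 0 := Eventually.frequently (by
        filter_upwards [self_mem_nhdsWithin] with z hz using h0 z hz)
      exact this.filter_mono nhdsWithin_le_nhds
    exact absurd h1 (not_frequently.2 (h.mono fun z hz => not_not.2 hz))
  · exact h

/-- A complex number with real square, and its conjugate. -/
theorem eq_mul_conj_of_sq_eq {t : ℂ} {κ χ : ℝ} (ht : t ^ 2 = κ) (hχ : χ ^ 2 = 1)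
    (hpos : 0 < χ * κ) : t = χ * conj t := by
  have ht0 : t ≠ 0 := by
    rintro rfl
    have h0 : (κ : ℂ) = 0 := by rw [← ht]; norm_num
    have : κ = 0 := by exact_mod_cast h0
    rw [this] at hpos; simp at hpos
  have h1 : normSq t = |κ| := by
    rw [normSq_eq_norm_sq, ← norm_pow, ht, norm_real, Real.norm_eq_abs]
  have h2 : χ * |κ| = κ := by
    rcases sq_eq_one_iff.1 hχ with rfl | rfl
    · rw [one_mul] at hpos ⊢; exact abs_of_pos hpos
    · rw [abs_of_neg (by linarith)]; ring
  apply mul_left_cancel₀ ht0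
  rw [← sq, ht, mul_left_comm, mul_conj, h1]
  exact_mod_cast h2.symm

theorem I_mul_eq_mul_conj_of_sq_eq {t : ℂ} {κ χ : ℝ} (ht : t ^ 2 = -(I * κ))
    (hχ : χ ^ 2 = 1) (hpos : 0 < χ * κ) : I * t = χ * conj t := by
  have ht0 : t ≠ 0 := by
    rintro rfl
    have h1 : I * κ = 0 := by linear_combination ht
    have : κ = 0 := by simpa using h1
    rw [this] at hpos; simp at hpos
  have h1 : normSq t = |κ| := by
    rw [normSq_eq_norm_sq, ← norm_pow, ht, norm_neg, norm_mul, norm_I, one_mul,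
      norm_real, Real.norm_eq_abs]
  have h2 : χ * |κ| = κ := by
    rcases sq_eq_one_iff.1 hχ with rfl | rfl
    · rw [one_mul] at hpos ⊢; exact abs_of_pos hpos
    · rw [abs_of_neg (by linarith)]; ring
  apply mul_left_cancel₀ ht0
  rw [show t * (I * t) = I * t ^ 2 by ring, ht, mul_left_comm, mul_conj, h1]
  rw [← ofReal_mul, h2]
  linear_combination (-(κ : ℂ)) * I_sq

theorem matV_band {x s : ℝ} {m : ℝ → ℕ} (hs : s ∈ bands ζ) :
    matV q L ζ μ m x s = ((jumpSign ζ m s : ℝ) : ℂ) • Matrix.diagonal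
      ![𝔣 (-1) s / 𝔣 1 s, 𝔣 1 s / 𝔣 (-1) s] := by
  rw [matV, if_pos hs, jumpSign]; push_cast; rfl

theorem matV_gap {x s : ℝ} {m : ℝ → ℕ} (hs : s ∉ bands ζ) :
    matV q L ζ μ m x s = (((jumpSign ζ m s : ℝ) : ℂ) * I) •
      (expSigmaThree (-(2 * I * s * x)) * !![0, 1; 1, 0]) := by
  rw [matV, if_neg hs, jumpSign]; push_cast; rfl

theorem mul_matV_band {x s : ℝ} {m : ℝ → ℕ} (hs : s ∈ bands ζ) (M : Mat₂)
    (i : Fin 2) :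
    (M * matV q L ζ μ m x s) i 0 = jumpSign ζ m s * (M i 0 * (𝔣 (-1) s / 𝔣 1 s)) ∧
    (M * matV q L ζ μ m x s) i 1 = jumpSign ζ m s * (M i 1 * (𝔣 1 s / 𝔣 (-1) s)) := by
  rw [matV_band hs]
  simp [Matrix.smul_apply, Matrix.mul_diagonal]

theorem mul_matV_gap {x s : ℝ} {m : ℝ → ℕ} (hs : s ∉ bands ζ) (M : Mat₂)
    (i : Fin 2) :
    (M * matV q L ζ μ m x s) i 0 = jumpSign ζ m s * I * (M i 1 * exp (2 * I * s * x)) ∧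
    (M * matV q L ζ μ m x s) i 1 = jumpSign ζ m s * I * (M i 0 * exp (-(2 * I * s * x))) := by
  rw [matV_gap hs, Matrix.mul_smul, ← Matrix.mul_assoc, expSigmaThree]
  simp [Matrix.mul_apply, Matrix.smul_apply, Fin.sum_univ_two]

/-- Off the band edges, bands and gaps are neighbourhoods of their points. -/
theorem IsSpectralEnumeration.eventually_mem_bands_iff (e : IsSpectralEnumeration q L ζ μ)
    (h : Admissible q L Q) {s : ℝ} (hs : s ∉ bandEdges ζ) :
    ∀ᶠ t in 𝓝 s, (t ∈ bands ζ ↔ s ∈ bands ζ) := by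
  have hc := (h.differentiable_dR.continuous.pow 2).continuousAt (x := s)
  rcases e.trichotomy h hs with ⟨j, hj⟩ | ⟨j, hj⟩ | ⟨j, hj, rfl⟩
  · have h1 := e.dR_sq_lt_one h hj
    filter_upwards [hc.eventually_lt_const h1] with t ht
    rw [e.mem_bands_iff h, e.mem_bands_iff h]
    exact iff_of_true (le_of_lt ht) h1.le
  · have h1 := e.one_lt_dR_sq h hj
    filter_upwards [hc.eventually_const_lt h1] with t ht
    rw [e.mem_bands_iff h, e.mem_bands_iff h]
    exact iff_of_false (not_le.2 ht) (not_le.2 h1)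
  · obtain ⟨h1, h2⟩ := e.deriv_eq_zero_of_not_isOpenGap h hj
    obtain ⟨-, -, h3⟩ := h.sq_lt_one_of_deriv_eq_zero h1 h2
    filter_upwards [eventually_nhdsWithin_iff.1 h3] with t ht
    rw [e.mem_bands_iff h, e.mem_bands_iff h]
    refine iff_of_true ?_ h1.le
    by_cases htj : t = μ j
    · rw [htj]; exact h1.le
    · exact le_of_lt (ht htj)

namespace BranchData

variable (d : BranchData q L Q ζ μ A B g S F)
include d

theorem notMem_bandEdges_of_ne {s : ℝ} (hs : dR q L s ^ 2 ≠ 1) : s ∉ bandEdges ζ := fun h =>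
  hs (d.spec.deriv_ne_zero_of_mem_bandEdges d.adm h).1

/-- The jump relation away from the zeros of `Δ² - 1` and `ỹ₁₂`, where `P` are the upper boundary values
of `Φ` and the lower ones `M` are given by conjugation. -/
theorem jump_of_generic {x s : ℝ} (hs : dR q L s ^ 2 ≠ 1) (hm : mR q L s ≠ 0)
    {c : ℝ} (hc2 : c ^ 2 = 1)
    (hcb : ∀ s ∈ Ioo (ζ (-2)) (ζ (-1)), 0 < c * (-1) ^ countM Γ g s * (f⁰ s).re)
    {P M : Mat₂}
    (hP : ∀ i j, Tendsto (fun z => Φ x z i j) (𝓝[upper] (s : ℂ)) (𝓝 (P i j)))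
    (hM0 : ∀ i, M i 0 = c * I * conj (P i 1))
    (hM1 : ∀ i, M i 1 = c * I * conj (P i 0)) :
    P = M * matV q L ζ μ (countM Γ g) x s := by
  set m := countM Γ g with hmdef
  have hsE := d.notMem_bandEdges_of_ne hs
  obtain ⟨ε, hε, hεF, hεb⟩ := d.exists_F_sq
  obtain ⟨s0, hs0⟩ := d.exists_base
  obtain ⟨T, hT, hT0, hTe⟩ := d.exists_quot hsE
  obtain ⟨W, hW, hWsq, hWe⟩ := d.adm.exists_rootR_of_ne hs
  have hms : ms q 0 1 L s ≠ 0 := mt d.adm.ms_eq_zero_iff.1 hm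
  obtain ⟨hf0, hfp, hfm⟩ := d.spec.factors_ne_zero d.adm d.had hms
  have hlow : 𝓝[upper] (s : ℂ) ≤ 𝓝 (s : ℂ) := nhdsWithin_le_nhds
  have hTlim : Tendsto (fun z => S z / F z) (𝓝[upper] (s : ℂ)) (𝓝 (T s)) :=
    ((hT.continuousAt.tendsto).mono_left hlow).congr' (hTe.mono fun z hz => hz.symm)
  have hRlim : Tendsto (rootR q L) (𝓝[upper] (s : ℂ)) (𝓝 (W s)) :=
    ((hW.continuousAt.tendsto).mono_left hlow).congr' (hWe.mono fun z hz => hz.symm)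
  have hcl : ∀ f : ℂ → ℂ, Differentiable ℂ f → Tendsto f (𝓝[upper] (s : ℂ)) (𝓝 (f s)) :=
    fun f hf => (hf.continuous.tendsto _).mono_left hlow
  have hhl := hcl _ d.adm.differentiable_halfDiff
  have hml := hcl _ (differentiable_ms d.adm.cont d.adm.bound 0 1 L)
  have hmx := fun i j => hcl _ (differentiable_ms d.adm.cont d.adm.bound i j x)
  have hexp : Tendsto (fun z : ℂ => exp (I * z * x)) (𝓝[upper] (s : ℂ))
      (𝓝 (exp (I * s * x))) := hcl _ (by fun_prop)
  have hexp' : Tendsto (fun z : ℂ => exp (-(I * z * x))) (𝓝[upper] (s : ℂ))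
      (𝓝 (exp (-(I * s * x)))) := hcl _ (by fun_prop)
  have hP0 : ∀ i, P i 0 = I * T s * (𝔣 (-1) s * (ms q i 0 x s +
      ms q i 1 x s * ((halfDiff q L s + W s) / ms q 0 1 L s))) * exp (I * s * x) :=
    fun i => tendsto_nhds_unique (hP i 0) ((((hTlim.const_mul I).mul
      ((hcl _ (d.spec.differentiable_signProduct d.adm (-1))).mul ((hmx i 0).add ((hmx i 1).mul
        ((hhl.add hRlim).div hml hms))))).mul hexp).congr' (by
          filter_upwards [self_mem_nhdsWithin] with z hz
          exact (d.adm.matPhi_upper hz x i).1.symm))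
  have hP1 : ∀ i, P i 1 = I * T s * (𝔣 1 s * (ms q i 0 x s +
      ms q i 1 x s * ((halfDiff q L s - W s) / ms q 0 1 L s))) * exp (-(I * s * x)) :=
    fun i => tendsto_nhds_unique (hP i 1) ((((hTlim.const_mul I).mul
      ((hcl _ (d.spec.differentiable_signProduct d.adm 1)).mul ((hmx i 0).add ((hmx i 1).mul
        ((hhl.sub hRlim).div hml hms))))).mul hexp').congr' (by
          filter_upwards [self_mem_nhdsWithin] with z hz
          exact (d.adm.matPhi_upper hz x i).2.symm))
  have hW0 : W s ≠ 0 := fun h0 => by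
    have := hWsq s
    rw [h0, d.adm.discriminant_eq] at this
    apply hs
    have h2 : ((dR q L s ^ 2 - 1 : ℝ) : ℂ) = 0 := by push_cast; rw [← this]; ring
    have h3 : dR q L s ^ 2 - 1 = 0 := by exact_mod_cast h2
    linarith
  have hε0 : ε ≠ 0 := by rintro rfl; norm_num at hε
  have hεc : (ε : ℂ) ≠ 0 := by exact_mod_cast hε0
  -- `(S/F)² = f⁰/(εR)` passes to the boundary values `T` of `S/F` and `W` of `R`
  have hTsq : T s ^ 2 * (ε * W s) = f⁰ s := by
    refine tendsto_nhds_unique ((hTlim.pow 2).mul (hRlim.const_mul (ε : ℂ)))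
      ((hcl _ (d.spec.differentiable_fZero d.adm A B)).congr' ?_)
    filter_upwards [self_mem_nhdsWithin] with z hz
    have hz' := upper_subset hz
    have hR0 := d.adm.rootR_ne_zero hz'
    rw [div_pow, d.S_sq hz', hεF z hz, div_mul_cancel₀ _ (mul_ne_zero hεc hR0)]
  -- signs in the base band
  have hc0 : c ≠ 0 := by rintro rfl; norm_num at hc2
  have hb1 := hcb s0 hs0
  have hb2 := hεb s0 hs0
  have hj0 : jumpSign ζ m s0 = (-1) ^ m s0 := by
    rw [jumpSign, d.spec.edgeIndex_base hs0, zero_add, zpow_natCast]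
  rw [← hj0] at hb1
  have hm0 := d.spec.mR_eq_mul d.adm d.had s0
  have hms1 := d.spec.mR_eq_mul d.adm d.had s
  change mR q L s0 = 2 * (f⁰ s0).re * prodPM q L μ s0 at hm0
  change mR q L s = 2 * (f⁰ s).re * prodPM q L μ s at hms1
  have hbase : s0 ∈ Ioo (ζ (2 * (-1))) (ζ (2 * (-1) + 1)) := by norm_num; exact hs0
  have hs0E := d.notMem_bandEdges_of_ne (d.base_sq_lt hs0).ne
  have hχ := jumpSign_mul_self ζ m s
  have hcj : ∀ τ, conj (𝔣 τ s) = 𝔣 τ s := fun τ => by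
    rw [← d.spec.signProduct_conj d.adm, conj_ofReal]
  have hmj : ∀ i j x, conj (ms q i j x s) = ms q i j x s := fun i j x => by
    rw [← ms_conj d.adm.cont, conj_ofReal]
  have hhj : conj (halfDiff q L s) = halfDiff q L s := by
    rw [← d.adm.halfDiff_conj, conj_ofReal]
  set E := exp (I * s * x) with hE
  set E' := exp (-(I * s * x)) with hE'
  have hEE : E * E' = 1 := by rw [hE, hE', ← exp_add, add_neg_cancel, exp_zero]
  have hEj : conj E = E' := by
    rw [hE, hE', ← exp_conj]; simp [mul_assoc]
  have hEj' : conj E' = E := by rw [← hEj, conj_conj]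
  have hE2 : exp (2 * I * s * x) = E ^ 2 := by
    rw [hE, ← exp_nat_mul]; congr 1; push_cast; ring
  have hE2' : exp (-(2 * I * s * x)) = E' ^ 2 := by
    rw [hE', ← exp_nat_mul]; congr 1; push_cast; ring
  have hχc : (jumpSign ζ m s * c) ^ 2 = 1 := by rw [mul_pow, hc2, sq, hχ, one_mul]
  have hfr := d.spec.fZero_ofReal d.adm d.had s
  -- `χ` is the claimed sign of the jump; the signs of all other factors are known relative to `s0`
  set χ := jumpSign ζ m s
  set χ0 := jumpSign ζ m s0
  set f := (f⁰ s).re with hf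
  set f0 := (f⁰ s0).re
  have hf0' : f0 ≠ 0 := by rintro h0; rw [h0] at hb1; simp at hb1
  have hf' : f ≠ 0 := by intro h0; rw [h0] at hms1; exact hm (by rw [hms1]; ring)
  have hdiv : ∀ y ≠ 0, 0 < χ * c * f * ε * y → 0 < χ * c * (f / (ε * y)) := fun y hy h1 => by
    rw [show χ * c * (f / (ε * y)) = χ * c * f * ε * y * (ε * y)⁻¹ ^ 2 by field_simp]; positivity
  have hpp : ∀ a b : ℝ, 0 < a * b → 0 < b → 0 < a := fun a b h1 h2 =>
    (mul_pos_iff_of_pos_right h2).1 h1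
  have hI := I_sq
  rcases lt_or_gt_of_ne hs with hlt | hgt
  · obtain ⟨hre, him⟩ := d.adm.rootR_band hlt hW.continuousAt (hWsq s) hWe
    have hWI : W s = I * ((W s).im : ℂ) := by
      apply Complex.ext <;> simp [hre]
    have hbands : s ∈ bands ζ := (d.spec.mem_bands_iff d.adm).2 hlt.le
    obtain ⟨i0, hi0⟩ := (d.spec.dR_sq_le_one_iff d.adm).1 hlt.le
    have hi1 : s ∈ Ioo (ζ (2 * i0)) (ζ (2 * i0 + 1)) := by
      refine ⟨hi0.1.lt_of_ne fun h0 => hs ?_, hi0.2.lt_of_ne fun h0 => hs ?_⟩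
      · exact (d.spec.dR_sq_eq_one_iff d.adm).2 ⟨_, h0.symm⟩
      · exact (d.spec.dR_sq_eq_one_iff d.adm).2 ⟨_, h0⟩
    have hjump := d.spec.jump_band d.adm (g := g) hi1 hbase hsE hs0E
    change 0 < χ * χ0 * (prodPM q L μ s * prodPM q L μ s0) at hjump
    set y := (W s).im
    have hy0 : y ≠ 0 := fun h0 => by rw [h0] at hWI; exact hW0 (by simpa using hWI)
    have hκ : T s ^ 2 = -(I * ((f / (ε * y) : ℝ) : ℂ)) := by
      have hyc : (y : ℂ) ≠ 0 := by exact_mod_cast hy0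
      rw [hWI, hfr] at hTsq
      push_cast
      field_simp
      linear_combination (-I) * hTsq + T s ^ 2 * ε * y * hI
    have hpos : 0 < χ * c * (f / (ε * y)) := by
      refine hdiv y hy0 (hpp _ ((c * χ0 * f0) * (-(ε * mR q L s0)) * (-(y * mR q L s))) ?_
        (mul_pos (mul_pos hb1 (by linarith)) (by linarith)))
      have : χ * c * f * ε * y * (c * χ0 * f0 * -(ε * mR q L s0) * -(y * mR q L s)) =
          (χ * χ0 * (prodPM q L μ s * prodPM q L μ s0)) * (2 * c * f * f0 * ε * y) ^ 2 := by
        rw [hm0, hms1]; ring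
      rw [this]
      positivity
    have ht := I_mul_eq_mul_conj_of_sq_eq hκ hχc hpos
    push_cast at ht
    have hWj : conj (W s) = -W s := by
      rw [hWI, map_mul, conj_I, conj_ofReal]; ring
    have hk : 𝔣 1 s * (𝔣 (-1) s / 𝔣 1 s) = 𝔣 (-1) s := mul_div_cancel₀ _ hfp
    have hk' : 𝔣 (-1) s * (𝔣 1 s / 𝔣 (-1) s) = 𝔣 1 s := mul_div_cancel₀ _ hfm
    ext i j
    obtain ⟨hV0, hV1⟩ := mul_matV_band (L := L) (μ := μ) (q := q) (x := x) (m := m) hbands M i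
    obtain rfl | rfl := fin_two j
    · rw [hV0, hM0, hP0, hP1]
      simp only [map_mul, map_add, map_sub, map_div₀, conj_I, hcj, hmj, hhj, hWj, hEj',
        sub_neg_eq_add]
      generalize ms q i 0 x s + ms q i 1 x s * ((halfDiff q L s + W s) / ms q 0 1 L s) = a
      generalize 𝔣 (-1) s / 𝔣 1 s = k at hk ⊢
      generalize 𝔣 (-1) s = fm at hk ⊢
      generalize 𝔣 1 s = fp at hk ⊢
      linear_combination fm * a * E * ht - χ * c * conj (T s) * a * E * hk +
        χ * c * conj (T s) * a * E * fp * k * hI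
    · rw [hV1, hM1, hP0, hP1]
      simp only [map_mul, map_add, map_div₀, conj_I, hcj, hmj, hhj, hWj, hEj, ← sub_eq_add_neg]
      generalize ms q i 0 x s + ms q i 1 x s * ((halfDiff q L s - W s) / ms q 0 1 L s) = a
      generalize 𝔣 1 s / 𝔣 (-1) s = k at hk' ⊢
      generalize 𝔣 (-1) s = fm at hk' ⊢
      generalize 𝔣 1 s = fp at hk' ⊢
      linear_combination fp * a * E' * ht - χ * c * conj (T s) * a * E' * hk' +
        χ * c * conj (T s) * a * E' * fm * k * hI
  · obtain ⟨hWr, hWd⟩ := d.adm.rootR_gap hgt hW.continuousAt hWe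
    have hbands : s ∉ bands ζ := fun h0 => not_le.2 hgt ((d.spec.mem_bands_iff d.adm).1 h0)
    obtain ⟨i0, hi0⟩ : ∃ j, s ∈ Ioo (ζ (2 * j - 1)) (ζ (2 * j)) := by
      rcases d.spec.exists_cover d.adm s with ⟨j, hj⟩ | hj
      · exact absurd ⟨j, hj⟩ hbands
      · exact hj
    have hjump := d.spec.jump_gap d.adm (g := g) hi0 hbase hm hsE hs0E
    change χ * χ0 * (prodPM q L μ s * prodPM q L μ s0) * (mR q L s * dR q L s) < 0 at hjump
    set y := (W s).re
    have hy0 : y ≠ 0 := fun h0 => by rw [h0] at hWr; exact hW0 (by simpa using hWr)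
    have hκ : T s ^ 2 = ((f / (ε * y) : ℝ) : ℂ) := by
      have hyc : (y : ℂ) ≠ 0 := by exact_mod_cast hy0
      rw [hWr, hfr] at hTsq
      push_cast
      field_simp
      linear_combination hTsq
    have hpos : 0 < χ * c * (f / (ε * y)) := by
      refine hdiv y hy0 (hpp _ ((c * χ0 * f0) * (-(ε * mR q L s0)) * (y * dR q L s) * (prodPM q L μ s) ^ 2) ?_ ?_)
      · have : χ * c * f * ε * y * (c * χ0 * f0 * -(ε * mR q L s0) * (y * dR q L s) *
            prodPM q L μ s ^ 2) =
            -(χ * χ0 * (prodPM q L μ s * prodPM q L μ s0) * (mR q L s * dR q L s)) *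
              (c * f0 * ε * y) ^ 2 := by
          rw [hm0, hms1]; ring
        rw [this]
        have := neg_pos.2 hjump
        positivity
      · have hp0 : prodPM q L μ s ≠ 0 := fun h0 => by
          rw [h0, mul_zero] at hms1; exact hm hms1
        have := neg_pos.2 hb2
        positivity
    have ht := eq_mul_conj_of_sq_eq hκ hχc hpos
    push_cast at ht
    have hWj : conj (W s) = W s := by
      rw [hWr, conj_ofReal]
    ext i j
    obtain ⟨hV0, hV1⟩ := mul_matV_gap (L := L) (μ := μ) (q := q) (x := x) (m := m) hbands M i
    obtain rfl | rfl := fin_two j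
    · rw [hV0, hM1, hP0]
      simp only [map_mul, map_add, map_div₀, conj_I, hcj, hmj, hhj, hWj, hEj, hE2]
      generalize ms q i 0 x s + ms q i 1 x s * ((halfDiff q L s + W s) / ms q 0 1 L s) = a
      generalize 𝔣 (-1) s = fm
      generalize conj (T s) = ct at ht ⊢
      linear_combination I * fm * a * E * ht -
        I * fm * a * E * χ * c * ct * hEE + χ * c * I * ct * fm * a * E ^ 2 * E' * hI
    · rw [hV1, hM0, hP1]
      simp only [map_mul, map_add, map_sub, map_div₀, conj_I, hcj, hmj, hhj, hWj, hEj', hE2']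
      generalize ms q i 0 x s + ms q i 1 x s * ((halfDiff q L s - W s) / ms q 0 1 L s) = a
      generalize 𝔣 1 s = fp
      generalize conj (T s) = ct at ht ⊢
      linear_combination I * fp * a * E' * ht -
        I * fp * a * E' * χ * c * ct * hEE + χ * c * I * ct * fp * a * E' ^ 2 * E * hI

omit d in
theorem continuousAt_signProduct_div (e : IsSpectralEnumeration q L ζ μ) (h : Admissible q L Q)
    {τ τ' : SignType} {s : ℝ} (hs : 𝔣 τ' s ≠ 0) :
    ContinuousAt (fun t : ℝ => 𝔣 τ t / 𝔣 τ' t) s :=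
  (((e.differentiable_signProduct h τ).continuous.comp continuous_ofReal).continuousAt).div
    (((e.differentiable_signProduct h τ').continuous.comp continuous_ofReal).continuousAt) hs

theorem signProduct_ne_zero_of_bands {τ : SignType} (hτ : τ ≠ 0) {s : ℝ} (hs : s ∈ bands ζ) :
    𝔣 τ s ≠ 0 := fun h0 => by
  obtain ⟨j, hj, hsj⟩ := (d.spec.signProduct_eq_zero_iff d.adm).1 h0
  have hsj' : s = μ j := by exact_mod_cast hsj
  have h1 := (d.spec.mem_bands_iff d.adm).1 hs
  rw [hsj'] at h1
  have h2 := (d.adm.of_mR_eq_zero (d.spec.mR_mu d.adm j)).1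
  exact hτ (by rw [← hj, (d.spec.dirSign_eq_zero_iff d.adm j).2 (le_antisymm h1 h2)])

theorem tendsto_mul_matV {x s : ℝ} (hs : s ∉ bandEdges ζ) {M : ℝ → Mat₂}
    (hM : ∀ i j, ContinuousAt (fun t => M t i j) s) (i j : Fin 2) :
    ContinuousAt (fun t =>
      (M t * matV q L ζ μ (countM Γ g) x t) i j) s := by
  set m := countM Γ g with hm
  have hev := d.spec.eventually_index_eq d.adm d.closest hs
  have hχ : ∀ᶠ t in 𝓝 s, jumpSign ζ m t = jumpSign ζ m s := by
    filter_upwards [hev] with t ht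
    rw [jumpSign, jumpSign, ht.2.1, hm, ht.2.2]
  have hb := d.spec.eventually_mem_bands_iff d.adm hs
  by_cases hsb : s ∈ bands ζ
  · have hp := d.signProduct_ne_zero_of_bands (τ := 1) (by decide) hsb
    have hn := d.signProduct_ne_zero_of_bands (τ := -1) (by decide) hsb
    obtain rfl | rfl := fin_two j
    · refine ContinuousAt.congr (f := fun t => ((jumpSign ζ m s : ℝ) : ℂ) *
        (M t i 0 * (𝔣 (-1) t / 𝔣 1 t)))
        (continuousAt_const.mul ((hM i 0).mul (continuousAt_signProduct_div d.spec d.adm hp))) ?_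
      filter_upwards [hb, hχ] with t h1 h2
      rw [(mul_matV_band (h1.2 hsb) (M t) i).1, h2]
    · refine ContinuousAt.congr (f := fun t => ((jumpSign ζ m s : ℝ) : ℂ) *
        (M t i 1 * (𝔣 1 t / 𝔣 (-1) t)))
        (continuousAt_const.mul ((hM i 1).mul (continuousAt_signProduct_div d.spec d.adm hn))) ?_
      filter_upwards [hb, hχ] with t h1 h2
      rw [(mul_matV_band (h1.2 hsb) (M t) i).2, h2]
  · obtain rfl | rfl := fin_two j
    · refine ContinuousAt.congr (f := fun t : ℝ => ((jumpSign ζ m s : ℝ) : ℂ) * I *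
        (M t i 1 * exp (2 * I * t * x)))
        (continuousAt_const.mul ((hM i 1).mul (by fun_prop))) ?_
      filter_upwards [hb, hχ] with t h1 h2
      rw [(mul_matV_gap (mt h1.1 hsb) (M t) i).1, h2]
    · refine ContinuousAt.congr (f := fun t : ℝ => ((jumpSign ζ m s : ℝ) : ℂ) * I *
        (M t i 0 * exp (-(2 * I * t * x))))
        (continuousAt_const.mul ((hM i 0).mul (by fun_prop))) ?_
      filter_upwards [hb, hχ] with t h1 h2
      rw [(mul_matV_gap (mt h1.1 hsb) (M t) i).2, h2]

/-- The boundary values and the jump relation. -/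
theorem boundary (x : ℝ) : ∃ Φp Φm : ℝ → Mat₂,
    (∀ s ∉ bandEdges ζ, Tendsto (Φ x) (𝓝[upper] (s : ℂ)) (𝓝 (Φp s))) ∧
    (∀ s ∉ bandEdges ζ, Tendsto (Φ x) (𝓝[lower] (s : ℂ)) (𝓝 (Φm s))) ∧
    ContinuousOn Φp (bandEdges ζ)ᶜ ∧ ContinuousOn Φm (bandEdges ζ)ᶜ ∧
    ∀ s ∉ bandEdges ζ, Φp s = Φm s * matV q L ζ μ (countM Γ g) x s := by
  obtain ⟨c, hc2, hcS, hcb⟩ := d.exists_S_conj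
  set P : ℝ → Mat₂ := fun s => Matrix.of fun i j =>
    limUnder (𝓝[upper] (s : ℂ)) fun z => Φ x z i j with hP
  set M : ℝ → Mat₂ := fun s => Matrix.of fun i j =>
    c * I * conj (P s i (1 - j)) with hM
  have hPl : ∀ s ∉ bandEdges ζ, ∀ i j,
      Tendsto (fun z => Φ x z i j) (𝓝[upper] (s : ℂ)) (𝓝 (P s i j)) := by
    intro s hs i j
    obtain ⟨W, hW, hWe⟩ := d.exists_matPhi hs x i j
    exact tendsto_nhds_limUnder ⟨W s, (hW.continuousAt.tendsto.mono_left
      nhdsWithin_le_nhds).congr' (hWe.mono fun z hz => hz.symm)⟩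
  have hPc : ∀ s ∉ bandEdges ζ, ∀ i j, ContinuousAt (fun t => P t i j) s := by
    intro s hs i j
    obtain ⟨W, hW, hWe⟩ := d.exists_matPhi hs x i j
    have hWR : ContinuousAt (fun t : ℝ => W t) s :=
      ContinuousAt.comp (g := W) (f := fun t : ℝ => (t : ℂ)) hW.continuousAt
        continuous_ofReal.continuousAt
    refine hWR.congr ?_
    have h1 := (eventually_nhdsWithin_iff.1 hWe).eventually_nhds
    have h2 : ∀ᶠ z in 𝓝 (s : ℂ), AnalyticAt ℂ W z := hW.eventually_analyticAt
    have h3 : ∀ᶠ t : ℝ in 𝓝 s, (∀ᶠ z in 𝓝 (t : ℂ), z ∈ upper → Φ x z i j = W z) ∧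
        AnalyticAt ℂ W t := (continuous_ofReal.tendsto s).eventually (h1.and h2)
    filter_upwards [h3] with t ht
    refine (Tendsto.limUnder_eq ?_).symm
    refine (ht.2.continuousAt.tendsto.mono_left nhdsWithin_le_nhds).congr' ?_
    filter_upwards [eventually_nhdsWithin_iff.2 ht.1] with z hz using hz.symm
  have hMc : ∀ s ∉ bandEdges ζ, ∀ i j, ContinuousAt (fun t => M t i j) s := fun s hs i j =>
    continuousAt_const.mul (ContinuousAt.comp (g := conj)
      continuous_conj.continuousAt (hPc s hs i (1 - j)))
  have hMl : ∀ s ∉ bandEdges ζ, ∀ i j,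
      Tendsto (fun z => Φ x z i j) (𝓝[lower] (s : ℂ)) (𝓝 (M s i j)) := by
    intro s hs i j
    have h1 := (((continuous_conj.tendsto _).comp ((hPl s hs i (1 - j)).comp
      (tendsto_conj_lower s))).const_mul ((c : ℂ) * I))
    refine h1.congr' ?_
    filter_upwards [self_mem_nhdsWithin] with z hz
    have h2 := d.matPhi_conj hcS (conj_mem_upper hz) x i
    rw [conj_conj] at h2
    obtain rfl | rfl := fin_two j
    · exact h2.1.symm
    · exact h2.2.symm
  refine ⟨P, M, fun s hs => ?_, fun s hs => ?_, fun s hs => ?_, fun s hs => ?_, fun s hs => ?_⟩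
  · exact tendsto_pi_nhds.2 fun i => tendsto_pi_nhds.2 fun j => hPl s hs i j
  · exact tendsto_pi_nhds.2 fun i => tendsto_pi_nhds.2 fun j => hMl s hs i j
  · exact (continuousAt_pi.2 fun i => continuousAt_pi.2 fun j =>
      hPc s hs i j).continuousWithinAt
  · exact (continuousAt_pi.2 fun i => continuousAt_pi.2 fun j =>
      hMc s hs i j).continuousWithinAt
  · have hgen : ∀ᶠ t : ℝ in 𝓝[≠] s, P t = M t * matV q L ζ μ (countM Γ g) x t := by
      filter_upwards [eventually_ne_zero_of_offReal d.adm.differentiable_sq_sub_one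
        (fun z hz => d.adm.discriminant_sq_sub_one_ne_zero hz) s, eventually_ne_zero_of_offReal
        (differentiable_ms d.adm.cont d.adm.bound 0 1 L)
        (fun z hz => IsSpectralEnumeration.ms_ne_zero_of_im d.adm hz) s] with t h1 h2
      have h3 : dR q L t ^ 2 ≠ 1 := fun h0 => h1 (by
        rw [d.adm.discriminant_sq_eq_one_iff.2 h0, sub_self])
      refine d.jump_of_generic h3 (mt d.adm.ms_eq_zero_iff.2 h2) hc2 hcb
        (hPl t (d.notMem_bandEdges_of_ne h3)) (fun i => rfl) fun i => rfl
    ext i j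
    refine tendsto_nhds_unique (f := fun t => P t i j) (l := 𝓝[≠] s)
      ((hPc s hs i j).tendsto.mono_left nhdsWithin_le_nhds)
      (((d.tendsto_mul_matV (x := x) hs (hMc s hs) i j).tendsto.mono_left
        nhdsWithin_le_nhds).congr' ?_)
    filter_upwards [hgen] with t ht
    rw [ht]

end BranchData

/-! ### The behaviour at the band edges -/

theorem exists_eventually_norm_le {f W : ℂ → ℂ} {s : ℝ} (hW : ContinuousAt W s)
    (h : ∀ᶠ z in 𝓝[≠] (s : ℂ), f z = W z) : ∃ C, 0 ≤ C ∧ ∀ᶠ z in 𝓝[upper] (s : ℂ), ‖f z‖ ≤ C := by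
  refine ⟨‖W s‖ + 1, by positivity, ?_⟩
  filter_upwards [eventually_upper_of_ne h,
    (hW.norm.eventually_le_const (lt_add_one _)).filter_mono nhdsWithin_le_nhds] with z h1 h2
  rwa [h1]

theorem exists_eventually_norm_le' {f : ℂ → ℂ} {s : ℝ} (hf : ContinuousAt f s) :
    ∃ C, 0 ≤ C ∧ ∀ᶠ z in 𝓝[upper] (s : ℂ), ‖f z‖ ≤ C :=
  exists_eventually_norm_le hf (Eventually.of_forall fun _ => rfl)

theorem le_rpow_of_pow_four_mul_le {a y C : ℝ} (ha : 0 < a) (hy : 0 ≤ y) (hC : 0 ≤ C)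
    (h : y ^ 4 * a ≤ C) : y ≤ C ^ (1 / 4 : ℝ) * a ^ (-(1 / 4) : ℝ) := by
  have h1 : y ^ 4 ≤ C * a⁻¹ := by
    rw [← div_eq_mul_inv, le_div_iff₀ ha]; exact h
  have h2 : y = (y ^ 4) ^ (1 / 4 : ℝ) := by
    rw [← Real.rpow_natCast, ← Real.rpow_mul hy]; norm_num
  rw [h2, Real.rpow_neg ha.le, ← Real.inv_rpow ha.le, ← Real.mul_rpow hC (by positivity)]
  exact Real.rpow_le_rpow (by positivity) h1 (by norm_num)

theorem norm_add_pow_four_le (a b : ℂ) : ‖a + b‖ ^ 4 ≤ 8 * (‖a‖ ^ 4 + ‖b‖ ^ 4) := by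
  have := (pow_le_pow_left₀ (norm_nonneg _) (norm_add_le a b) 4).trans
    (add_pow_le (norm_nonneg a) (norm_nonneg b) 4)
  norm_num at this
  exact this

namespace IsSpectralEnumeration

variable (e : IsSpectralEnumeration q L ζ μ) (h : Admissible q L Q)
include e h

/-- Band edges are simple zeros of `Δ² - 1`. -/
theorem exists_edge_factor {s : ℝ}
    (hs : s ∈ bandEdges ζ) : ∃ u : ℂ → ℂ, Differentiable ℂ u ∧ u s ≠ 0 ∧
      ∀ z, Δ z ^ 2 - 1 = (z - s) * u z := by
  obtain ⟨h1, h2⟩ := e.deriv_ne_zero_of_mem_bandEdges h hs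
  obtain ⟨u, hu, hus, hDu⟩ := exists_eq_sub_mul h.differentiable_sq_sub_one (s := (s : ℂ))
    (by rw [h.discriminant_sq_eq_one_iff.2 h1, sub_self])
  refine ⟨u, hu, ?_, hDu⟩
  have hd : deriv (fun z => Δ z ^ 2 - 1) s = 2 * Δ s * deriv Δ s := by
    have h3 := (((differentiable_discriminant (L := L) h.cont h.bound (s : ℂ)).hasDerivAt.pow 2).sub_const
      1).deriv
    refine Eq.trans h3 ?_
    simp
  rw [hus, hd]
  refine mul_ne_zero (mul_ne_zero two_ne_zero fun h0 => ?_) fun h0 => ?_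
  · rw [h.discriminant_eq] at h0
    have h0' : dR q L s = 0 := by exact_mod_cast h0
    rw [h0'] at h1; norm_num at h1
  · exact h2 (by rw [(h.hasDerivAt_dR s).deriv, h0, Complex.zero_re])

end IsSpectralEnumeration

namespace BranchData

variable (d : BranchData q L Q ζ μ A B g S F)
include d

/-- At a band edge which is a Dirichlet eigenvalue `f⁰` vanishes, which compensates for the pole of
`ỹ₁₂⁻¹`. -/
theorem exists_edge_bounds {s : ℝ} (hs : s ∈ bandEdges ζ) :
    ∃ C, 0 ≤ C ∧ ∀ᶠ z in 𝓝[upper] (s : ℂ), ‖S z / F z‖ ^ 4 * ‖z - s‖ ≤ C ∧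
      ∀ w, w ^ 2 = Δ z ^ 2 - 1 →
        ‖S z / F z‖ ^ 4 * ‖z - s‖ * ‖(halfDiff q L z + w) / ms q 0 1 L z‖ ^ 4 ≤ C := by
  obtain ⟨u, hu, hu0, hDu⟩ := d.spec.exists_edge_factor d.adm hs
  have hf := d.spec.differentiable_fZero d.adm A B
  have hm := differentiable_ms d.adm.cont d.adm.bound 0 1 L
  have hh := d.adm.differentiable_halfDiff
  obtain ⟨C1, hC1, hev1⟩ := exists_eventually_norm_le' (s := s)
    (f := fun z => f⁰ z ^ 2 / u z)
    (((hf.pow 2).continuous.continuousAt).div hu.continuous.continuousAt hu0)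
  have hJ : ∃ W1 W2 : ℂ → ℂ, ContinuousAt W1 s ∧ ContinuousAt W2 s ∧ (∀ᶠ z in 𝓝[≠] (s : ℂ),
      f⁰ z ^ 2 / u z * halfDiff q L z ^ 4 / ms q 0 1 L z ^ 4 = W1 z) ∧
      ∀ᶠ z in 𝓝[≠] (s : ℂ),
      f⁰ z ^ 2 / u z * ((z - s) * u z) ^ 2 / ms q 0 1 L z ^ 4 = W2 z := by
    by_cases hms : ms q 0 1 L s = 0
    · obtain ⟨j, hj⟩ := (d.spec.ms_eq_zero_iff d.adm).1 hms
      have hj' : s = μ j := by exact_mod_cast hj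
      have hD1 := (d.spec.deriv_ne_zero_of_mem_bandEdges d.adm hs).1
      have hσ : dirSign q L μ j = 0 := (d.spec.dirSign_eq_zero_iff d.adm j).2 (hj' ▸ hD1)
      obtain ⟨k, hk, -, hfk⟩ := d.spec.exists_fZero_eq d.adm d.had hσ
      obtain ⟨p, hp, hps, hmp⟩ := exists_eq_sub_mul hm hms
      have hp0 : p s ≠ 0 := by rw [hps, hj]; exact d.spec.ms_deriv_ne_zero d.adm j
      obtain ⟨v, hv, -, hhv⟩ := exists_eq_sub_mul hh (s := (s : ℂ)) (by
        have := d.adm.halfDiff_sq hms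
        rw [d.adm.discriminant_sq_eq_one_iff.2 hD1, sub_self] at this
        exact sq_eq_zero_iff.1 this)
      rw [← hj] at hfk
      refine ⟨fun z => (z - s) ^ 2 * (k z ^ 2 / u z * v z ^ 4 / p z ^ 4),
        fun z => k z ^ 2 / u z * u z ^ 2 / p z ^ 4, ?_, ?_, ?_, ?_⟩
      · exact ((continuous_id.sub continuous_const).pow 2).continuousAt.mul
          (((((hk.continuous.pow 2).continuousAt).div hu.continuous.continuousAt hu0).mul
          (hv.continuous.pow 4).continuousAt).div (hp.continuous.pow 4).continuousAt
            (pow_ne_zero 4 hp0))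
      · exact (((((hk.continuous.pow 2).continuousAt).div hu.continuous.continuousAt hu0).mul
          (hu.continuous.pow 2).continuousAt).div (hp.continuous.pow 4).continuousAt
            (pow_ne_zero 4 hp0))
      · filter_upwards [self_mem_nhdsWithin,
          (hp.continuous.continuousAt.eventually_ne hp0).filter_mono nhdsWithin_le_nhds] with z hz hz'
        have hzs : z - (s : ℂ) ≠ 0 := sub_ne_zero.2 hz
        rw [hfk, hhv, hmp]
        field_simp
      · filter_upwards [self_mem_nhdsWithin,
          (hp.continuous.continuousAt.eventually_ne hp0).filter_mono nhdsWithin_le_nhds] with z hz hz'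
        have hzs : z - (s : ℂ) ≠ 0 := sub_ne_zero.2 hz
        rw [hfk, hmp]
        field_simp
    · refine ⟨_, _, ?_, ?_, Eventually.of_forall fun _ => rfl, Eventually.of_forall fun _ => rfl⟩
      · exact (((((hf.continuous.pow 2).continuousAt).div hu.continuous.continuousAt hu0).mul
          (hh.continuous.pow 4).continuousAt).div (hm.continuous.pow 4).continuousAt
            (pow_ne_zero 4 hms))
      · exact (((((hf.continuous.pow 2).continuousAt).div hu.continuous.continuousAt hu0).mul
          (((continuous_id.sub continuous_const).mul hu.continuous).pow 2).continuousAt).div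
            (hm.continuous.pow 4).continuousAt (pow_ne_zero 4 hms))
  obtain ⟨W1, W2, hW1, hW2, he1, he2⟩ := hJ
  obtain ⟨C2, hC2, hev2⟩ := exists_eventually_norm_le hW1 he1
  obtain ⟨C3, hC3, hev3⟩ := exists_eventually_norm_le hW2 he2
  refine ⟨C1 + 8 * (C2 + C3), by positivity, ?_⟩
  filter_upwards [hev1, hev2, hev3, self_mem_nhdsWithin] with z h1 h2 h3 hz
  have hz' := upper_subset hz
  have hzs : z - (s : ℂ) ≠ 0 := fun h0 => hz' (by rw [sub_eq_zero.1 h0]; simp)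
  have hms := IsSpectralEnumeration.ms_ne_zero_of_im d.adm hz'
  have hT : ‖S z / F z‖ ^ 4 * ‖z - s‖ = ‖f⁰ z ^ 2 / u z‖ := by
    rw [← norm_pow, ← norm_mul, d.quot_pow hz', hDu]
    congr 1
    field_simp
  refine ⟨by rw [hT]; linarith, fun w hw => ?_⟩
  have hw4 : ‖w‖ ^ 4 = ‖((z - s) * u z) ^ 2‖ := by
    rw [← hDu, ← hw, ← norm_pow]; congr 1; ring
  have hfin : ‖S z / F z‖ ^ 4 * ‖z - s‖ * ‖(halfDiff q L z + w) / ms q 0 1 L z‖ ^ 4 ≤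
      8 * (‖f⁰ z ^ 2 / u z * halfDiff q L z ^ 4 / ms q 0 1 L z ^ 4‖ +
        ‖f⁰ z ^ 2 / u z * ((z - s) * u z) ^ 2 / ms q 0 1 L z ^ 4‖) := by
    rw [hT, norm_div _ (ms q 0 1 L z), div_pow, norm_div _ (ms q 0 1 L z ^ 4),
      norm_div _ (ms q 0 1 L z ^ 4), norm_mul _ (halfDiff q L z ^ 4), norm_mul _ (_ ^ 2), ← hw4,
      norm_pow (halfDiff q L z), norm_pow (ms q 0 1 L z)]
    have h4 := norm_add_pow_four_le (halfDiff q L z) w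
    calc ‖f⁰ z ^ 2 / u z‖ * (‖halfDiff q L z + w‖ ^ 4 / ‖ms q 0 1 L z‖ ^ 4)
        ≤ ‖f⁰ z ^ 2 / u z‖ *
          (8 * (‖halfDiff q L z‖ ^ 4 + ‖w‖ ^ 4) / ‖ms q 0 1 L z‖ ^ 4) := by gcongr
      _ = _ := by ring
  linarith

theorem exists_coeff_bound (x s : ℝ) : ∃ M, 0 ≤ M ∧
    ∀ᶠ z in 𝓝[upper] (s : ℂ), ∀ (τ : SignType) (i k : Fin 2),
      ‖𝔣 τ z * ms q i k x z * exp (I * z * x)‖ ≤ M ∧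
      ‖𝔣 τ z * ms q i k x z * exp (-(I * z * x))‖ ≤ M := by
  have hb : ∀ f : ℂ → ℂ, Differentiable ℂ f → ∃ C, 0 ≤ C ∧ ∀ᶠ z in 𝓝[upper] (s : ℂ), ‖f z‖ ≤ C :=
    fun f hf => exists_eventually_norm_le' hf.continuous.continuousAt
  have hm := fun i j => differentiable_ms d.adm.cont d.adm.bound i j x
  have hs1 := fun τ => d.spec.differentiable_signProduct d.adm τ
  have hcol : ∀ p : SignType × Fin 2 × Fin 2, ∃ C, 0 ≤ C ∧ ∀ᶠ z in 𝓝[upper] (s : ℂ),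
      ‖𝔣 p.1 z * ms q p.2.1 p.2.2 x z * exp (I * z * x)‖ ≤ C ∧
      ‖𝔣 p.1 z * ms q p.2.1 p.2.2 x z * exp (-(I * z * x))‖ ≤ C := by
    rintro ⟨τ, i, k⟩
    obtain ⟨C1, h1, h1'⟩ := hb (fun z => 𝔣 τ z * ms q i k x z *
      exp (I * z * x)) (((hs1 τ).mul (hm i k)).mul (by fun_prop))
    obtain ⟨C2, h2, h2'⟩ := hb (fun z => 𝔣 τ z * ms q i k x z *
      exp (-(I * z * x))) (((hs1 τ).mul (hm i k)).mul (by fun_prop))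
    refine ⟨C1 + C2, by positivity, ?_⟩
    filter_upwards [h1', h2'] with z h3 h4
    exact ⟨by linarith, by linarith⟩
  choose K hK hKev using hcol
  refine ⟨∑ p, K p, Finset.sum_nonneg fun p _ => hK p, ?_⟩
  have hKM : ∀ p, K p ≤ ∑ p, K p := fun p =>
    Finset.single_le_sum (fun p _ => hK p) (Finset.mem_univ p)
  filter_upwards [eventually_all.2 hKev] with z hz τ i k
  exact ⟨(hz (τ, i, k)).1.trans (hKM _), (hz (τ, i, k)).2.trans (hKM _)⟩

omit d in
theorem norm_mul_pow_four_le {t a b w : ℂ} {ρ M C : ℝ} (hρ : 0 ≤ ρ) (h1 : ‖t‖ ^ 4 * ρ ≤ C)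
    (h2 : ‖t‖ ^ 4 * ρ * ‖w‖ ^ 4 ≤ C) (ha : ‖a‖ ≤ M) (hb : ‖b‖ ≤ M) :
    ‖t * (a + b * w)‖ ^ 4 * ρ ≤ 16 * M ^ 4 * C := by
  have h3 := norm_add_pow_four_le a (b * w)
  rw [norm_mul b, mul_pow] at h3
  rw [norm_mul, mul_pow]
  calc ‖t‖ ^ 4 * ‖a + b * w‖ ^ 4 * ρ
      ≤ ‖t‖ ^ 4 * (8 * (‖a‖ ^ 4 + ‖b‖ ^ 4 * ‖w‖ ^ 4)) * ρ := by gcongr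
    _ = 8 * (‖a‖ ^ 4 * (‖t‖ ^ 4 * ρ) + ‖b‖ ^ 4 * (‖t‖ ^ 4 * ρ * ‖w‖ ^ 4)) := by ring
    _ ≤ 8 * (M ^ 4 * C + M ^ 4 * C) := by gcongr
    _ = _ := by ring

theorem quartic_upper (x : ℝ) {s : ℝ} (hs : s ∈ bandEdges ζ) :
    ∃ C, 0 ≤ C ∧ ∀ᶠ z in 𝓝[upper] (s : ℂ), ∀ i j, ‖Φ x z i j‖ ^ 4 * ‖z - s‖ ≤ C := by
  obtain ⟨C, hC, hev⟩ := d.exists_edge_bounds hs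
  obtain ⟨M, hM0, hKall⟩ := d.exists_coeff_bound x s
  refine ⟨16 * M ^ 4 * C, by positivity, ?_⟩
  filter_upwards [hev, hKall, self_mem_nhdsWithin] with z h1 h2 hz i j
  have hz' := upper_subset hz
  obtain ⟨h3, h4⟩ := d.adm.matPhi_upper (μ := μ) (S := S) (F := F) hz x i
  have hIn : ‖I * (S z / F z)‖ = ‖S z / F z‖ := by rw [norm_mul, norm_I, one_mul]
  have h5 : ‖I * (S z / F z)‖ ^ 4 * ‖z - s‖ ≤ C := by rw [hIn]; exact h1.1
  obtain rfl | rfl := fin_two j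
  · have h6 : ‖I * (S z / F z)‖ ^ 4 * ‖z - s‖ * ‖weylMinus q L z‖ ^ 4 ≤ C := by
      rw [hIn]; exact h1.2 _ (d.adm.rootR_sq hz')
    have h7 := (h2 (-1) i 0).1
    have h8 := (h2 (-1) i 1).1
    have h9 := norm_mul_pow_four_le (norm_nonneg _) h5 h6 h7 h8
    have h10 : Φ x z i 0 = _ := h3.trans (by rw [colMinus]; ring :
      _ = I * (S z / F z) * (𝔣 (-1) z * ms q i 0 x z * exp (I * z * x) + 𝔣 (-1) z * ms q i 1 x z *
        exp (I * z * x) * weylMinus q L z))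
    exact le_of_eq_of_le (congrArg (fun t : ℂ => ‖t‖ ^ 4 * ‖z - s‖) h10) h9
  · have h6 : ‖I * (S z / F z)‖ ^ 4 * ‖z - s‖ * ‖weylPlus q L z‖ ^ 4 ≤ C := by
      have h6 := h1.2 (-rootR q L z) (by rw [neg_sq, d.adm.rootR_sq hz'])
      rw [← sub_eq_add_neg] at h6
      rw [hIn]; exact h6
    have h7 := (h2 1 i 0).2
    have h8 := (h2 1 i 1).2
    have h9 := norm_mul_pow_four_le (norm_nonneg _) h5 h6 h7 h8
    have h10 : Φ x z i 1 = _ := h4.trans (by rw [colPlus]; ring :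
      _ = I * (S z / F z) * (𝔣 1 z * ms q i 0 x z * exp (-(I * z * x)) + 𝔣 1 z * ms q i 1 x z *
        exp (-(I * z * x)) * weylPlus q L z))
    exact le_of_eq_of_le (congrArg (fun t : ℂ => ‖t‖ ^ 4 * ‖z - s‖) h10) h9

theorem quartic (x : ℝ) : ∀ s ∈ bandEdges ζ, ∃ C r : ℝ, 0 < r ∧ ∀ z : ℂ, z.im ≠ 0 → ‖z - s‖ < r →
    ∀ i j, ‖Φ x z i j‖ ≤ C * ‖z - s‖ ^ (-(1 / 4) : ℝ) := by
  intro s hs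
  obtain ⟨C, hC, hev⟩ := d.quartic_upper x hs
  obtain ⟨r, hr, hball⟩ := mem_nhdsWithin_iff.1 hev
  have hup : ∀ z ∈ upper, ‖z - s‖ < r → ∀ i j,
      ‖Φ x z i j‖ ≤ C ^ (1 / 4 : ℝ) * ‖z - s‖ ^ (-(1 / 4) : ℝ) := by
    intro z hz hzr i j
    have hzs : z - (s : ℂ) ≠ 0 := fun h0 =>
      upper_subset hz (by rw [sub_eq_zero.1 h0]; simp)
    exact le_rpow_of_pow_four_mul_le (norm_pos_iff.2 hzs) (norm_nonneg _) hC
      (hball ⟨by rwa [mem_ball, dist_eq_norm], hz⟩ i j)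
  obtain ⟨c, hc2, hcS, -⟩ := d.exists_S_conj
  refine ⟨C ^ (1 / 4 : ℝ), r, hr, fun z hz hzr i j => ?_⟩
  have hz' : z ∈ upper ∪ lower := by rw [upper_union_lower]; exact hz
  rcases hz' with hzu | hzl
  · exact hup z hzu hzr i j
  · have hcn : ‖(c : ℂ) * I‖ = 1 := by
      rw [norm_mul, norm_I, mul_one, norm_real, Real.norm_eq_abs]
      exact (sq_eq_one_iff.1 hc2).elim (by rintro rfl; simp) (by rintro rfl; simp)
    have hn : ‖conj z - s‖ = ‖z - s‖ := by
      rw [← norm_conj (z - s), map_sub, conj_ofReal]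
    have hu := conj_mem_upper hzl
    obtain ⟨h1, h2⟩ := d.matPhi_conj hcS hu x i
    rw [conj_conj] at h1 h2
    have h3 := hup _ hu (by rwa [hn])
    rw [hn] at h3
    obtain rfl | rfl := fin_two j
    · rw [h1, norm_mul, hcn, one_mul, norm_conj]; exact h3 i 1
    · rw [h2, norm_mul, hcn, one_mul, norm_conj]; exact h3 i 0

end BranchData

/-! ### Asymptotics of growing Floquet solutions -/

theorem apply_add_int_mul {a : ℝ → ℂ} {r : ℂ} (hr : r ≠ 0) (h : ∀ x, a (x + L) = r * a x) (k : ℤ)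
    (x : ℝ) : a (x + k * L) = r ^ k * a x := by
  induction k using Int.induction_on with
  | zero => simp
  | succ n ih =>
    rw [zpow_add_one₀ hr, mul_comm _ r, mul_assoc, ← ih, ← h]; congr 1; push_cast; ring
  | pred n ih =>
    apply mul_left_cancel₀ hr
    rw [← h, ← mul_assoc, zpow_sub_one₀ hr, mul_left_comm, mul_inv_cancel₀ hr, mul_one, ← ih]
    congr 1; push_cast; ring

/-- Along a growing Floquet solution in the upper half-plane the first component dominates. -/
theorem IsFloquetPair.norm_le {z r : ℂ} {a b : ℝ → ℂ} (hf : IsFloquetPair q L z r a b)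
    (hq : Continuous q) (hL : 0 < L) (hz : z ∈ upper) (hr : 1 < ‖r‖) : ‖b 0‖ ≤ ‖a 0‖ := by
  by_contra! hlt
  have h1 := hf.normSq_sub_lt hq hL hz (Or.inr fun h0 => by
    rw [h0, norm_zero] at hlt; exact absurd hlt (norm_nonneg _).not_gt)
  simp only [normSq_eq_norm_sq] at h1
  have h5 : ‖a 0‖ ^ 2 < ‖b 0‖ ^ 2 := by gcongr
  nlinarith [mul_pos (sub_pos.2 h5) (show 0 < ‖r‖ ^ 2 - 1 by nlinarith)]

theorem exists_le_norm_one_sub_exp {δ : ℝ} (hδ : 0 < δ) : ∃ c : ℝ, 0 < c ∧ ∀ w ∈ upper,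
    (∀ n : ℤ, δ ≤ ‖w - n * π‖) → c ≤ ‖1 - exp (2 * I * w)‖ := by
  obtain ⟨c, hc, h⟩ := exists_le_norm_sin hδ
  refine ⟨2 * c, by positivity, fun w hw hd => ?_⟩
  have h1 : 1 - exp (2 * I * w) = -2 * I * (exp (I * w) * sin w) := by
    rw [sin, show 2 * I * w = I * w + I * w by ring,
      exp_add, show -w * I = -(I * w) by ring, exp_neg,
      mul_comm w]
    field_simp [exp_ne_zero]
    linear_combination (1 - exp (I * w) ^ 2) * I_sq
  have h2 := h w hd
  rw [abs_of_pos (show 0 < w.im from hw)] at h2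
  rw [h1, norm_mul, norm_mul, norm_mul (exp _), norm_exp]
  simp only [norm_neg, norm_I, norm_ofNat, mul_re, I_re, I_im, zero_mul, one_mul, zero_sub, mul_one]
  calc 2 * c = 2 * (Real.exp (-w.im) * (c * Real.exp w.im)) := by
        rw [Real.exp_neg]; field_simp
    _ ≤ _ := by gcongr

/-- A growing Floquet solution `(a, b)` satisfies `e^{izx}(a, b) = a(0)((1, 0) + O(1/z))` away from
the zeros of `sin zL` in the upper half-plane. -/
theorem Admissible.exists_floquet_bound (h : Admissible q L Q) {δ : ℝ} (hδ : 0 < δ) (x : ℝ) :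
    ∃ C K : ℝ, 0 ≤ C ∧ ∀ z ∈ upper, K ≤ ‖z‖ → (∀ n : ℤ, δ ≤ ‖z * L - n * π‖) →
      ∀ (a b : ℝ → ℂ) (r : ℂ), IsFloquetPair q L z r a b → 1 < ‖r‖ →
        ‖exp (I * z * x) * a x - a 0‖ ≤ C / ‖z‖ * ‖a 0‖ ∧
          ‖exp (I * z * x) * b x‖ ≤ C / ‖z‖ * ‖a 0‖ := by
  have hL := h.pos
  obtain ⟨q', hq'⟩ := h.hasDeriv
  obtain ⟨K₀, hK₀, hps⟩ := exists_norm_exp_mul_ps_sub_le h.cont h.bound hL hq'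
  obtain ⟨c, hc, hsin⟩ := exists_le_norm_one_sub_exp hδ
  -- the estimate is transported to one period: `x = x₀ + kL`
  set k := ⌊x / L⌋ with hk
  set x₀ := x - k * L with hx₀
  have hx₀m : x₀ ∈ Icc 0 L := by
    have h1 := Int.floor_le (x / L)
    have h2 := (Int.lt_floor_add_one (x / L)).le
    rw [le_div_iff₀ hL] at h1
    rw [div_le_iff₀ hL] at h2
    exact ⟨by linarith, by linarith⟩
  -- powers of a number near `1`
  obtain ⟨C₁, hC₁, ρ, hρ, hpow⟩ : ∃ C₁ : ℝ, 0 ≤ C₁ ∧ ∃ ρ > 0, ∀ κ : ℂ, ‖κ - 1‖ ≤ ρ →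
      ‖κ ^ k - 1‖ ≤ C₁ * ‖κ - 1‖ := by
    have h1 : DifferentiableAt ℂ (fun κ : ℂ => κ ^ k) 1 :=
      differentiableAt_zpow.2 (Or.inl one_ne_zero)
    obtain ⟨C₁, hC₁, hO⟩ := h1.isBigO_sub.exists_nonneg
    obtain ⟨ρ, hρ, hb⟩ := nhds_basis_closedBall.mem_iff.1 hO.bound
    refine ⟨C₁, hC₁, ρ, hρ, fun κ hκ => ?_⟩
    have : ‖κ ^ k - 1 ^ k‖ ≤ _ := hb (mem_closedBall_iff_norm.2 hκ)
    rwa [one_zpow] at this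
  set C₂ := 1 + 8 / c with hC₂
  set C := 6 * C₁ * K₀ + 2 * K₀ + (1 + 2 * C₁ * K₀) * (K₀ * C₂) with hC
  refine ⟨C, max 1 (max K₀ (max (4 * K₀ / c) (2 * K₀ / ρ))), by positivity,
    fun z hz hzK hd a b r hf hr => ?_⟩
  simp only [max_le_iff] at hzK
  obtain ⟨hz1, hzK0, hzc, hzρ⟩ := hzK
  have hz0 : 0 < ‖z‖ := by linarith
  set ε := K₀ / ‖z‖ with hε
  have hε0 : 0 ≤ ε := by positivity
  have hε1 : ε ≤ 1 := (div_le_one hz0).2 hzK0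
  have hεc : 4 * ε ≤ c := by
    rw [hε, ← mul_div_assoc, div_le_iff₀ hz0]; rwa [div_le_iff₀ hc, mul_comm ‖z‖] at hzc
  have hερ : 2 * ε ≤ ρ := by
    rw [hε, ← mul_div_assoc, div_le_iff₀ hz0]; rwa [div_le_iff₀ hρ, mul_comm ‖z‖] at hzρ
  have hba := hf.norm_le h.cont hL hz hr
  have hexp : ∀ t ∈ Icc 0 L, ‖exp (I * z * t) * a t - a 0‖ ≤ 2 * ε * ‖a 0‖ ∧
      ‖exp (I * z * t) * b t - exp (2 * I * z * t) * b 0‖ ≤ ε * (‖a 0‖ + ‖b 0‖) := fun t ht => by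
    have h0 := eq_ps_mul_of_hasDerivAt h.cont hf.pair.fst hf.pair.snd t
    have h1 := hps z (show 0 < z.im from hz).le hz1 t ht
    obtain ⟨h2, h3⟩ := h1 0
    obtain ⟨h4, h5⟩ := h1 1
    simp only [Matrix.one_apply_eq, ne_eq, zero_ne_one, one_ne_zero, not_false_eq_true,
      Matrix.one_apply_ne, mul_one, mul_zero, sub_zero] at h2 h3 h4 h5
    constructor
    · rw [h0.1, show exp (I * z * t) * (ps q 0 0 t z * a 0 + ps q 0 1 t z * b 0) -
        a 0 = (exp (I * z * t) * ps q 0 0 t z - 1) * a 0 +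
          exp (I * z * t) * ps q 0 1 t z * b 0 by ring]
      refine (norm_add_le _ _).trans ?_
      rw [norm_mul, norm_mul _ (b 0)]
      calc _ ≤ ε * ‖a 0‖ + ε * ‖a 0‖ := by gcongr
        _ = _ := by ring
    · rw [h0.2, show exp (I * z * t) * (ps q 1 0 t z * a 0 + ps q 1 1 t z * b 0) -
        exp (2 * I * z * t) * b 0 = exp (I * z * t) * ps q 1 0 t z * a 0 +
          (exp (I * z * t) * ps q 1 1 t z - exp (2 * I * z * t)) * b 0 by ring]
      refine (norm_add_le _ _).trans ?_
      rw [norm_mul, norm_mul _ (b 0), mul_add]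
      gcongr
  set κ := exp (I * z * L) * r with hκ
  obtain ⟨hκa, hκb⟩ := hexp L (right_mem_Icc.2 hL.le)
  have haL := hf.fst_add 0
  have hbL := hf.snd_add 0
  rw [zero_add] at haL hbL
  rw [haL, ← mul_assoc, ← hκ, show κ * a 0 - a 0 = (κ - 1) * a 0 by ring, norm_mul] at hκa
  rw [hbL, ← mul_assoc, ← hκ, ← sub_mul, norm_mul] at hκb
  rcases (norm_nonneg (a 0)).eq_or_lt with ha0 | ha0
  · have hA : a 0 = 0 := norm_eq_zero.1 ha0.symm
    have hB : b 0 = 0 := norm_eq_zero.1 (le_antisymm (by rwa [← ha0] at hba) (norm_nonneg _))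
    have h0 := eq_ps_mul_of_hasDerivAt h.cont hf.pair.fst hf.pair.snd x
    rw [h0.1, h0.2, hA, hB]; simp
  have hκ1 : ‖κ - 1‖ ≤ 2 * ε := le_of_mul_le_mul_right hκa ha0
  -- the second component at `L` is both `κ b(0)` and `e^{2izL} b(0)` up to `O(ε)`
  have hb0 : ‖b 0‖ ≤ 4 * ε / c * ‖a 0‖ := by
    have h1 := hsin (z * L) (by simpa [upper] using mul_pos (show 0 < z.im from hz) hL) hd
    rw [← mul_assoc] at h1
    have h2 : c / 2 ≤ ‖κ - exp (2 * I * z * L)‖ := by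
      have h3 := norm_sub_norm_le (1 - exp (2 * I * z * L)) (1 - κ)
      rw [sub_sub_sub_cancel_left, norm_sub_rev 1 κ] at h3
      linarith
    have h3 : c / 2 * ‖b 0‖ ≤ 2 * ε * ‖a 0‖ :=
      (mul_le_mul_of_nonneg_right h2 (norm_nonneg _)).trans (hκb.trans (by
        rw [mul_comm 2, mul_assoc]; gcongr; linarith))
    rw [div_mul_eq_mul_div, le_div_iff₀ hc]; linarith
  have hk1 : ‖κ ^ k - 1‖ ≤ 2 * C₁ * ε :=
    (hpow κ (hκ1.trans hερ)).trans (by rw [mul_comm 2, mul_assoc]; gcongr)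
  have hr0 : r ≠ 0 := norm_pos_iff.1 (by linarith)
  have hshift : ∀ f : ℝ → ℂ, (∀ t, f (t + L) = r * f t) → exp (I * z * x) * f x =
      κ ^ k * (exp (I * z * x₀) * f x₀) := fun f hfl => by
    have h1 := apply_add_int_mul hr0 hfl k x₀
    have hx : x = x₀ + k * L := by rw [hx₀]; ring
    rw [← hx] at h1
    rw [h1, hκ, mul_zpow, ← Complex.exp_int_mul]
    nth_rw 1 [hx]
    push_cast
    rw [show I * z * (x₀ + k * L) = I * z * x₀ + k * (I * z * L) by ring, exp_add]
    ring
  obtain ⟨h1, h2⟩ := hexp x₀ hx₀m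
  set u := exp (I * z * x₀) * a x₀
  set v := exp (I * z * x₀) * b x₀
  have hu : ‖u‖ ≤ 3 * ‖a 0‖ := by
    have := norm_le_norm_add_norm_sub' u (a 0)
    nlinarith
  have hv : ‖v‖ ≤ C₂ * ε * ‖a 0‖ := by
    have h3 : ‖exp (2 * I * z * x₀) * b 0‖ ≤ ‖b 0‖ := by
      rw [norm_mul]
      refine mul_le_of_le_one_left (norm_nonneg _) ?_
      have : (2 * I * z * x₀).re = -(2 * (z.im * x₀)) := by simp; ring
      rw [norm_exp, this, Real.exp_le_one_iff]
      linarith [mul_nonneg (show 0 < z.im from hz).le hx₀m.1]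
    have h4 := norm_le_norm_add_norm_sub' v (exp (2 * I * z * x₀) * b 0)
    calc ‖v‖ ≤ ε * ‖a 0‖ + (1 + ε) * ‖b 0‖ := by linarith
      _ ≤ ε * ‖a 0‖ + (1 + 1) * (4 * ε / c * ‖a 0‖) := by gcongr
      _ = _ := by rw [hC₂]; ring
  have hCε : C / ‖z‖ = 6 * C₁ * ε + 2 * ε + (1 + 2 * C₁ * K₀) * (ε * C₂) := by
    rw [hC, hε]; ring
  have hεK : ε ≤ K₀ := div_le_self hK₀ hz1
  have hC₂0 : 0 ≤ C₂ := by positivity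
  rw [hshift a hf.fst_add, hshift b hf.snd_add, hCε]
  constructor
  · rw [show κ ^ k * u - a 0 = (κ ^ k - 1) * u + (u - a 0) by ring]
    refine (norm_add_le _ _).trans ?_
    rw [norm_mul]
    calc _ ≤ 2 * C₁ * ε * (3 * ‖a 0‖) + 2 * ε * ‖a 0‖ := by gcongr
      _ = (6 * C₁ * ε + 2 * ε + 0) * ‖a 0‖ := by ring
      _ ≤ _ := by gcongr; positivity
  · have h5 : ‖κ ^ k‖ ≤ 1 + 2 * C₁ * K₀ := by
      have := norm_le_norm_add_norm_sub' (κ ^ k) 1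
      rw [norm_one] at this
      exact this.trans (by gcongr; exact hk1.trans (by gcongr))
    rw [norm_mul]
    calc _ ≤ (1 + 2 * C₁ * K₀) * (C₂ * ε * ‖a 0‖) := by gcongr
      _ = (0 + (1 + 2 * C₁ * K₀) * (ε * C₂)) * ‖a 0‖ := by ring
      _ ≤ _ := by gcongr; positivity

/-! ### The Bloch-Floquet solutions away from the spectrum -/

/-- `U⁻¹Ψe^{izxσ₃} - I`. -/
def remainder (q : ℝ → ℂ) (L x : ℝ) (z : ℂ) : Mat₂ :=
  matU⁻¹ * matPsi q L x z * expSigmaThree (I * z * x) - 1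

/-- The second components of the columns of `Ψ(0,z)`. -/
def weylCol (q : ℝ → ℂ) (L : ℝ) (j : Fin 2) : ℂ → ℂ :=
  if j = 0 then pieceUpper (weylMinus q L) (weylPlus q L)
  else pieceUpper (weylPlus q L) (weylMinus q L)

theorem Admissible.remainder_eq (h : Admissible q L Q) (hz : z ∈ offReal) (x : ℝ)
    (i : Fin 2) :
    remainder q L x z i 0 = blochZS q (weylCol q L 0 z) i x z * exp (I * z * x) -
        (1 : Mat₂) i 0 ∧
      remainder q L x z i 1 = blochZS q (weylCol q L 1 z) i x z * exp (-(I * z * x)) -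
        (1 : Mat₂) i 1 := by
  have h1 := blochPlus_eq h.cont h.pos h.per hz x
  have h2 := blochMinus_eq h.cont h.pos h.per hz x
  have h3 := matU_inv_mul_ms q (weylPlus q L z) x z
  have h4 := matU_inv_mul_ms q (weylMinus q L z) x z
  simp only [remainder, expSigmaThree, Matrix.sub_apply, Matrix.mul_diagonal, matPsi, weylCol,
    pieceUpper, matU_inv, if_pos, one_ne_zero, if_false]
  obtain rfl | rfl := fin_two i
  all_goals
    split_ifs <;> simp only [← h3.1, ← h3.2, ← h4.1, ← h4.2, ofCols, h1, h2, Matrix.mul_apply,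
      Fin.sum_univ_two, Matrix.of_apply, Matrix.cons_val', Matrix.cons_val_zero,
      Matrix.cons_val_one, Matrix.cons_val_fin_one, and_self]

/-- Reflection exchanges decaying and growing Floquet solutions. -/
theorem IsFloquetPair.reflect {z r : ℂ} {a b : ℝ → ℂ} (hf : IsFloquetPair q L z r a b)
    (hr : r ≠ 0) : IsFloquetPair (fun t => -conj (q (L - t))) L z r⁻¹
      (fun t => b (L - t)) (fun t => a (L - t)) where
  pair := ⟨fun x => ((hf.pair.snd (L - x)).comp_const_sub L x).congr_deriv (by ring),
    fun x => ((hf.pair.fst (L - x)).comp_const_sub L x).congr_deriv (by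
      rw [map_neg, conj_conj]; ring)⟩
  fst_add x := by
    rw [eq_inv_mul_iff_mul_eq₀ hr, ← hf.snd_add]; congr 1; ring
  snd_add x := by
    rw [eq_inv_mul_iff_mul_eq₀ hr, ← hf.fst_add]; congr 1; ring

theorem norm_sub_one_le_of_add_eq_one {a a₀ b b₀ c : ℂ} {ε : ℝ} (hε : ε ≤ 1 / 4)
    (h1 : ‖a - c‖ ≤ ε * ‖c‖) (h2 : ‖b‖ ≤ ε * ‖c‖) (h3 : ‖a₀ - c‖ ≤ ε * ‖c‖) (h4 : ‖b₀‖ ≤ ε * ‖c‖)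
    (h : a₀ + b₀ = 1) : ‖a - 1‖ ≤ 6 * ε ∧ ‖b‖ ≤ 6 * ε := by
  have h5 : ‖c - 1‖ ≤ 2 * ε * ‖c‖ := by
    rw [← h, show c - (a₀ + b₀) = -((a₀ - c) + b₀) by ring, norm_neg]
    linarith [norm_add_le (a₀ - c) b₀]
  have h6 := norm_le_norm_add_norm_sub' c 1
  rw [norm_one] at h6
  have h7 : ‖c‖ ≤ 2 := by nlinarith [norm_nonneg c]
  have h8 : 0 ≤ ε := by
    by_contra! h9
    have h10 : 0 ≤ ε * ‖c‖ := (norm_nonneg _).trans h2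
    have : c = 0 := norm_eq_zero.1 (by nlinarith [norm_nonneg c])
    rw [this, zero_sub, norm_neg, norm_one, norm_zero] at h5
    linarith
  have h9 := norm_sub_le_norm_sub_add_norm_sub a c 1
  constructor <;> nlinarith

/-- `U⁻¹Ψe^{izxσ₃} = I + O(1/z)` away from the zeros of `sin zL` in the upper half-plane. -/
theorem Admissible.exists_remainder_upper (h : Admissible q L Q) {δ : ℝ} (hδ : 0 < δ) (x : ℝ) :
    ∃ C K : ℝ, 0 ≤ C ∧ ∀ z ∈ upper, K ≤ ‖z‖ → (∀ n : ℤ, δ ≤ ‖z * L - n * π‖) →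
      ∀ i j, ‖remainder q L x z i j‖ ≤ C / ‖z‖ := by
  obtain ⟨C₁, K₁, hC₁, b₁⟩ := h.exists_floquet_bound hδ x
  obtain ⟨C₂, K₂, hC₂, b₂⟩ := h.exists_floquet_bound hδ 0
  obtain ⟨C₃, K₃, hC₃, b₃⟩ := h.reflect.exists_floquet_bound hδ (L - x)
  obtain ⟨C₄, K₄, hC₄, b₄⟩ := h.reflect.exists_floquet_bound hδ L
  set C := max (max C₁ C₂) (max C₃ C₄) with hC
  have hC0 : 0 ≤ C := hC₁.trans ((le_max_left _ _).trans (le_max_left _ _))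
  refine ⟨6 * C, max (max (max K₁ K₂) (max K₃ K₄)) (max 1 (4 * C)), by positivity,
    fun z hz hzK hd => ?_⟩
  simp only [max_le_iff] at hzK
  obtain ⟨⟨⟨k₁, k₂⟩, k₃, k₄⟩, hz1, hzC⟩ := hzK
  have hz' := upper_subset hz
  have hz0 : 0 < ‖z‖ := by linarith
  have hε : C / ‖z‖ ≤ 1 / 4 := by rw [div_le_iff₀ hz0]; linarith
  have hle : ∀ {C' : ℝ} {u c : ℂ}, C' ≤ C → ‖u‖ ≤ C' / ‖z‖ * ‖c‖ → ‖u‖ ≤ C / ‖z‖ * ‖c‖ :=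
    fun hC' hu => hu.trans (by gcongr)
  have hdis := ne_of_im_ne_zero h.cont h.pos hz'
  have h12 := IsSpectralEnumeration.ms_ne_zero_of_im h hz'
  have hsq := h.rootR_sq hz'
  have hm := multiplier_eq hdis
  have hlt : ‖Δ z - rootR q L z‖ < 1 := norm_sub_joukowskiRoot_lt hdis
  have hinv : (Δ z - rootR q L z)⁻¹ = Δ z + rootR q L z := by
    rw [← hm, multiplier_inv_eq hdis]
  have hr0 : Δ z - rootR q L z ≠ 0 := fun h0 => by
    rw [h0, inv_zero] at hinv
    have h1 : (1 : ℂ) = 0 := by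
      linear_combination (Δ z + rootR q L z) * h0 + hsq
    exact one_ne_zero h1
  have hgt : 1 < ‖(Δ z - rootR q L z)⁻¹‖ := by
    rw [norm_inv]; exact (one_lt_inv₀ (norm_pos_iff.2 hr0)).2 hlt
  obtain ⟨f₂, f₁⟩ := isFloquetPair_weyl h.cont h.pos h.per hz'
  replace f₂ := f₂.reflect hr0
  rw [← hinv] at f₁
  have hsum : ∀ w, blochZS q w 0 0 z + blochZS q w 1 0 z = 1 := fun w => by
    rw [(blochZS_zero h.cont w z).1, (blochZS_zero h.cont w z).2]; ring
  have e₁ := b₁ z hz k₁ hd _ _ _ f₁ hgt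
  have e₂ := b₂ z hz k₂ hd _ _ _ f₁ hgt
  have e₃ := b₃ z hz k₃ hd _ _ _ f₂ hgt
  have e₄ := b₄ z hz k₄ hd _ _ _ f₂ hgt
  simp only [ofReal_zero, mul_zero, exp_zero, one_mul] at e₂
  simp only [sub_sub_cancel, sub_self, sub_zero] at e₃ e₄
  have c₁ : C₁ ≤ C := (le_max_left _ _).trans (le_max_left _ _)
  have c₂ : C₂ ≤ C := (le_max_right _ _).trans (le_max_left _ _)
  have c₃ : C₃ ≤ C := (le_max_left _ _).trans (le_max_right _ _)
  have c₄ : C₄ ≤ C := (le_max_right _ _).trans (le_max_right _ _)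
  have key₁ := norm_sub_one_le_of_add_eq_one hε (hle c₁ e₁.1) (hle c₁ e₁.2) (hle c₂ e₂.1)
    (hle c₂ e₂.2) (hsum _)
  -- the estimates for the reflected solution, multiplied by `e^{-izL}`
  set E := exp (-(I * z * L)) with hE
  have hexp : ∀ {y : ℝ} {u : ℂ}, E * (exp (I * z * y) * u) = exp (-(I * z * (L - y : ℝ))) * u :=
    fun {y u} => by
      rw [← mul_assoc, hE, ← exp_add]; congr 2; push_cast; ring
  have hmul : ∀ {u c : ℂ}, ‖u‖ ≤ C / ‖z‖ * ‖c‖ → ‖E * u‖ ≤ C / ‖z‖ * ‖E * c‖ := fun hu => by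
    rw [norm_mul, norm_mul, mul_left_comm]; gcongr
  have m₃ := hmul (hle c₃ e₃.1)
  have m₃' := hmul (hle c₃ e₃.2)
  have m₄ := hmul (hle c₄ e₄.1)
  have m₄' := hmul (hle c₄ e₄.2)
  rw [mul_sub, hexp] at m₃ m₄
  rw [hexp] at m₃' m₄'
  simp only [sub_sub_cancel, sub_self, ofReal_zero, mul_zero, neg_zero, exp_zero,
    one_mul] at m₃ m₃' m₄ m₄'
  have key₂ := norm_sub_one_le_of_add_eq_one hε m₃ m₃' m₄ m₄' ((add_comm _ _).trans (hsum _))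
  have w₀ : weylCol q L 0 z = weylMinus q L z := by simp [weylCol, pieceUpper_of_mem hz]
  have w₁ : weylCol q L 1 z = weylPlus q L z := by simp [weylCol, pieceUpper_of_mem hz]
  intro i j
  rw [mul_div_assoc]
  have r₀ := h.remainder_eq hz' x 0
  have r₁ := h.remainder_eq hz' x 1
  rw [w₀, w₁] at r₀ r₁
  obtain rfl | rfl := fin_two i
  all_goals obtain rfl | rfl := fin_two j
  · rw [r₀.1, mul_comm (blochZS _ _ _ _ _), Matrix.one_apply_eq]; exact key₁.1
  · rw [r₀.2, mul_comm (blochZS _ _ _ _ _), Matrix.one_apply_ne (by decide), sub_zero]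
    exact key₂.2
  · rw [r₁.1, mul_comm (blochZS _ _ _ _ _), Matrix.one_apply_ne (by decide), sub_zero]
    exact key₁.2
  · rw [r₁.2, mul_comm (blochZS _ _ _ _ _), Matrix.one_apply_eq]; exact key₂.1

theorem Admissible.norm_remainder_conj (h : Admissible q L Q) (hz : z ∈ lower) (x : ℝ)
    (i j : Fin 2) : ∃ i' j', ‖remainder q L x z i j‖ = ‖remainder q L x (conj z) i' j'‖ := by
  have hz' := lower_subset hz
  have hc := BranchData.conj_mem_upper hz
  have hc' := upper_subset hc
  have w₀ : weylCol q L 1 (conj z) = conj (weylCol q L 0 z) := by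
    simp only [weylCol, if_pos, one_ne_zero, if_false, pieceUpper_of_mem hc, pieceUpper_of_lower hz,
      h.weylPlus_conj hz']
  have w₁ : weylCol q L 0 (conj z) = conj (weylCol q L 1 z) := by
    simp only [weylCol, if_pos, one_ne_zero, if_false, pieceUpper_of_mem hc, pieceUpper_of_lower hz,
      h.weylMinus_conj hz']
  obtain ⟨p1, p2, p3, p4⟩ := ps_conj h.cont z x
  have hb : ∀ w, blochZS q (conj w) 0 x (conj z) =
      conj (blochZS q w 1 x z) ∧ blochZS q (conj w) 1 x (conj z) =
      conj (blochZS q w 0 x z) := fun w => by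
    simp only [blochZS, p1, p2, p3, p4, map_add, map_mul, map_sub, map_div₀, map_one, map_ofNat,
      conj_I]
    constructor <;> ring
  have r₀ := h.remainder_eq hz' x 0
  have r₁ := h.remainder_eq hz' x 1
  have s₀ := h.remainder_eq hc' x 0
  have s₁ := h.remainder_eq hc' x 1
  rw [w₀, w₁, (hb _).1, (hb _).1] at s₀
  rw [w₀, w₁, (hb _).2, (hb _).2] at s₁
  have e₁ : exp (I * conj z * x) = conj (exp (-(I * z * x))) := by simp [← exp_conj]
  have e₂ : exp (-(I * conj z * x)) = conj (exp (I * z * x)) := by simp [← exp_conj]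
  rw [e₁, e₂] at s₀ s₁
  have key : ∀ {u v : ℂ}, u = conj v → ‖v‖ = ‖u‖ := fun h => by
    rw [h, norm_conj]
  obtain rfl | rfl := fin_two i
  all_goals obtain rfl | rfl := fin_two j
  · exact ⟨1, 1, key (by rw [r₀.1, s₁.2]; simp)⟩
  · exact ⟨1, 0, key (by rw [r₀.2, s₁.1]; simp)⟩
  · exact ⟨0, 1, key (by rw [r₁.1, s₀.2]; simp)⟩
  · exact ⟨0, 0, key (by rw [r₁.2, s₀.1]; simp)⟩

theorem Admissible.exists_remainder (h : Admissible q L Q) {δ : ℝ} (hδ : 0 < δ) (x : ℝ) :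
    ∃ C K : ℝ, 0 ≤ C ∧ ∀ z ∈ offReal, K ≤ ‖z‖ → (∀ n : ℤ, δ ≤ ‖z * L - n * π‖) →
      ∀ i j, ‖remainder q L x z i j‖ ≤ C / ‖z‖ := by
  obtain ⟨C, K, hC, hb⟩ := h.exists_remainder_upper hδ x
  refine ⟨C, K, hC, fun z hz hzK hd i j => ?_⟩
  rw [← upper_union_lower] at hz
  rcases hz with hz | hz
  · exact hb z hz hzK hd i j
  · obtain ⟨i', j', hij⟩ := h.norm_remainder_conj hz x i j
    rw [hij, ← norm_conj z]
    refine hb _ (BranchData.conj_mem_upper hz) (by rwa [norm_conj]) (fun n => ?_) _ _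
    rw [← norm_conj]
    simpa using hd n

/-! ### Analytic continuation through the bands -/

/-- Through a band `R` continues from the upper half-plane to `-R` in the lower half-plane. -/
theorem IsSpectralEnumeration.exists_rootR_bands (e : IsSpectralEnumeration q L ζ μ)
    (h : Admissible q L Q) {s : ℝ} (hs : s ∉ bandEdges ζ) (hb : s ∈ bands ζ) :
    ∃ W : ℂ → ℂ, AnalyticAt ℂ W s ∧ (∀ z, W z ^ 2 = Δ z ^ 2 - 1) ∧
      (∀ᶠ z in 𝓝[upper] (s : ℂ), rootR q L z = W z) ∧
      ∀ᶠ z in 𝓝[lower] (s : ℂ), rootR q L z = -W z := by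
  obtain ⟨W, hW, hsq, hev⟩ := e.exists_rootR h hs
  refine ⟨W, hW, hsq, hev, ?_⟩
  set V : ℂ → ℂ := fun z => conj (W (conj z)) with hVdef
  have hconj : Tendsto conj (𝓝 (s : ℂ)) (𝓝 (s : ℂ)) := by
    simpa using continuous_conj.tendsto (s : ℂ)
  have hV : AnalyticAt ℂ V s := by
    rw [Complex.analyticAt_iff_eventually_differentiableAt] at hW ⊢
    filter_upwards [hconj.eventually hW] with z hz
    have := hz.conj_conj
    rwa [conj_conj] at this
  have hVsq : ∀ z, V z ^ 2 = Δ z ^ 2 - 1 := fun z => by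
    rw [hVdef, ← map_pow, hsq, discriminant_conj h.cont]; simp
  have hlow : ∀ᶠ z in 𝓝[lower] (s : ℂ), rootR q L z = V z := by
    filter_upwards [(BranchData.tendsto_conj_lower s).eventually hev, self_mem_nhdsWithin]
      with z hz hzl
    rw [hVdef]
    simp only [← hz]
    rw [h.rootR_conj (lower_subset hzl), conj_conj]
  have hlow' := nhdsWithin_le_of_subset_offReal lower_subset s
  rcases (hV.sub hW).eventually_eq_zero_or_eventually_ne_zero with h0 | h0
  · exfalso
    -- `W` would be real near `s` on the real axis, where `Δ² - 1 < 0`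
    have hne := eventually_ne_zero_of_offReal h.differentiable_sq_sub_one
      (fun z hz => h.discriminant_sq_sub_one_ne_zero hz) s
    have h1 : ∀ᶠ t : ℝ in 𝓝 s, V t - W t = 0 :=
      (continuous_ofReal.tendsto s).eventually h0
    obtain ⟨t, ht1, ht2, ht3⟩ := (hne.and ((h1.filter_mono nhdsWithin_le_nhds).and
      ((e.eventually_mem_bands_iff h hs).filter_mono nhdsWithin_le_nhds))).exists
    have h2 := (e.mem_bands_iff h).1 (ht3.2 hb)
    have h3 : conj (W t) = W t := by
      simpa [hVdef] using sub_eq_zero.1 ht2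
    have h4 := hsq t
    rw [← conj_eq_iff_re.1 h3, h.discriminant_eq] at h4
    rw [h.discriminant_eq] at ht1
    have h5 : (W t).re ^ 2 = dR q L t ^ 2 - 1 := by exact_mod_cast h4
    exact ht1 (by exact_mod_cast (le_antisymm (by linarith) (h5 ▸ sq_nonneg _) :
      dR q L t ^ 2 - 1 = 0))
  · filter_upwards [hlow, hlow' h0] with z hz hz0
    rw [hz]
    exact eq_neg_of_add_eq_zero_left ((mul_eq_zero.1 (show (V z - W z) * (V z + W z) = 0 by
      linear_combination hVsq z - hsq z)).resolve_left hz0)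

theorem IsSpectralEnumeration.exists_weylCol (e : IsSpectralEnumeration q L ζ μ)
    (h : Admissible q L Q) {s : ℝ} (hs : s ∉ bandEdges ζ) (hb : s ∈ bands ζ) (j : Fin 2) :
    ∃ W : ℂ → ℂ, AnalyticAt ℂ W s ∧ ∀ᶠ z in 𝓝[offReal] (s : ℂ), weylCol q L j z = W z := by
  obtain ⟨W, hW, hsq, hu, hl⟩ := e.exists_rootR_bands h hs hb
  have hdiv : ∀ c : ℂ, c ^ 2 = 1 → ∃ W' : ℂ → ℂ, AnalyticAt ℂ W' s ∧
      ∀ᶠ z in 𝓝[offReal] (s : ℂ), (halfDiff q L z + c * W z) / ms q 0 1 L z = W' z := fun c hc => by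
    obtain ⟨W', h1, h2⟩ := exists_analyticAt_div (N := fun z => halfDiff q L z + c * W z)
      ((h.differentiable_halfDiff.analyticAt _).add (analyticAt_const.mul hW))
      (differentiable_ms h.cont h.bound 0 1 L) (fun h0 => by
        have hm := h.ms_eq_zero_iff.1 h0
        have h1 : dR q L s ^ 2 = 1 :=
          le_antisymm ((e.mem_bands_iff h).1 hb) (h.of_mR_eq_zero hm).1
        have h2 := h.halfDiff_sq h0
        have h3 := hsq s
        rw [h.discriminant_sq_eq_one_iff.2 h1, sub_self, sq_eq_zero_iff] at h2 h3
        refine ⟨by rw [h2, h3]; simp, ?_⟩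
        obtain ⟨k, hk⟩ := (e.ms_eq_zero_iff h).1 h0
        rw [hk]
        exact e.ms_deriv_ne_zero h k)
    exact ⟨W', h1, h2.filter_mono (nhdsWithin_le_of_subset_offReal subset_rfl s)⟩
  have hsup : 𝓝[offReal] (s : ℂ) = 𝓝[upper] (s : ℂ) ⊔ 𝓝[lower] (s : ℂ) := by
    rw [← upper_union_lower, nhdsWithin_union]
  obtain rfl | rfl := fin_two j
  · obtain ⟨W', h1, h2⟩ := hdiv 1 (by norm_num)
    refine ⟨W', h1, ?_⟩
    rw [hsup, eventually_sup] at h2 ⊢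
    constructor
    · filter_upwards [hu, h2.1, self_mem_nhdsWithin] with z hz hz2 hzu
      rw [← hz2, weylCol, if_pos rfl, pieceUpper_of_mem hzu, Admissible.weylMinus_eq, hz, one_mul]
    · filter_upwards [hl, h2.2, self_mem_nhdsWithin] with z hz hz2 hzu
      rw [← hz2, weylCol, if_pos rfl, pieceUpper_of_lower hzu, Admissible.weylPlus_eq, hz, one_mul,
        sub_neg_eq_add]
  · obtain ⟨W', h1, h2⟩ := hdiv (-1) (by norm_num)
    refine ⟨W', h1, ?_⟩
    rw [hsup, eventually_sup] at h2 ⊢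
    constructor
    · filter_upwards [hu, h2.1, self_mem_nhdsWithin] with z hz hz2 hzu
      rw [← hz2, weylCol, if_neg one_ne_zero, pieceUpper_of_mem hzu, Admissible.weylPlus_eq, hz, neg_one_mul,
        ← sub_eq_add_neg]
    · filter_upwards [hl, h2.2, self_mem_nhdsWithin] with z hz hz2 hzu
      rw [← hz2, weylCol, if_neg one_ne_zero, pieceUpper_of_lower hzu, Admissible.weylMinus_eq, hz,
        neg_one_mul]

theorem IsSpectralEnumeration.exists_remainder_eq (e : IsSpectralEnumeration q L ζ μ)
    (h : Admissible q L Q) {s : ℝ} (hs : s ∉ bandEdges ζ) (hb : s ∈ bands ζ) (x : ℝ) (i j : Fin 2) :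
    ∃ W : ℂ → ℂ, AnalyticAt ℂ W s ∧ ∀ᶠ z in 𝓝[offReal] (s : ℂ), remainder q L x z i j = W z := by
  obtain ⟨W, hW, hev⟩ := e.exists_weylCol h hs hb j
  have hps := fun j => (differentiable_ps h.cont h.bound i j x).analyticAt (s : ℂ)
  have hps0 := hps 0
  have hps1 := hps 1
  obtain rfl | rfl := fin_two j
  · refine ⟨fun z => (ps q i 0 x z * ((1 + I * W z) / 2) +
      ps q i 1 x z * ((1 - I * W z) / 2)) * exp (I * z * x) -
        (1 : Mat₂) i 0, by fun_prop, ?_⟩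
    filter_upwards [hev, self_mem_nhdsWithin] with z hz hzo
    rw [(h.remainder_eq hzo x i).1, hz, blochZS]
  · refine ⟨fun z => (ps q i 0 x z * ((1 + I * W z) / 2) +
      ps q i 1 x z * ((1 - I * W z) / 2)) * exp (-(I * z * x)) -
        (1 : Mat₂) i 1, by fun_prop, ?_⟩
    filter_upwards [hev, self_mem_nhdsWithin] with z hz hzo
    rw [(h.remainder_eq hzo x i).2, hz, blochZS]

theorem Admissible.differentiableAt_remainder (h : Admissible q L Q) (hz : z ∈ offReal)
    (x : ℝ) (i j : Fin 2) : DifferentiableAt ℂ (fun z => remainder q L x z i j) z := by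
  have hp : DifferentiableOn ℂ (weylPlus q L) offReal := fun z hz =>
    (h.differentiableAt_weylPlus hz).differentiableWithinAt
  have hm : DifferentiableOn ℂ (weylMinus q L) offReal := fun z hz =>
    (h.differentiableAt_weylMinus hz).differentiableWithinAt
  have hps0 := differentiable_ps h.cont h.bound i 0 x z
  have hps1 := differentiable_ps h.cont h.bound i 1 x z
  have hnhds := isOpen_offReal.mem_nhds hz
  obtain rfl | rfl := fin_two j
  · have hw : DifferentiableAt ℂ (weylCol q L 0) z :=
      (differentiableOn_pieceUpper hm hp).differentiableAt hnhds
    refine DifferentiableAt.congr_of_eventuallyEq (f := fun z =>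
      (ps q i 0 x z * ((1 + I * weylCol q L 0 z) / 2) +
      ps q i 1 x z * ((1 - I * weylCol q L 0 z) / 2)) * exp (I * z * x) -
        (1 : Mat₂) i 0) (by fun_prop) ?_
    filter_upwards [hnhds] with z hz using (h.remainder_eq hz x i).1
  · have hw : DifferentiableAt ℂ (weylCol q L 1) z :=
      (differentiableOn_pieceUpper hp hm).differentiableAt hnhds
    refine DifferentiableAt.congr_of_eventuallyEq (f := fun z =>
      (ps q i 0 x z * ((1 + I * weylCol q L 1 z) / 2) +
      ps q i 1 x z * ((1 - I * weylCol q L 1 z) / 2)) * exp (-(I * z * x)) -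
        (1 : Mat₂) i 1) (by fun_prop) ?_
    filter_upwards [hnhds] with z hz using (h.remainder_eq hz x i).2

/-! ### The domain `𝒟` -/

namespace IsSpectralEnumeration

variable (e : IsSpectralEnumeration q L ζ μ) (h : Admissible q L Q)
include e h

/-- Only finitely many gaps are longer than `π/L`, since `Δ = cos zL + O(1/z)`. -/
theorem bddAbove_gaps :
    BddAbove {r | ∃ j, IsOpenGap ζ j ∧ r = ζ (2 * j) - ζ (2 * j - 1)} := by
  obtain ⟨K, hK, hb⟩ := h.exists_asymptotics
  obtain ⟨N, hN⟩ := e.exists_forall_lt h (max K 1)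
  have hπ := Real.pi_pos
  have hL := h.pos
  obtain ⟨M, hM⟩ := ((finite_Icc (-(N : ℤ)) N).image fun j => ζ (2 * j) - ζ (2 * j - 1)).bddAbove
  refine ⟨max M (π / L), ?_⟩
  rintro r ⟨j, hj, rfl⟩
  by_cases hjN : j ∈ Icc (-(N : ℤ)) N
  · exact (hM (mem_image_of_mem _ hjN)).trans (le_max_left _ _)
  refine le_trans ?_ (le_max_right _ _)
  by_contra! hlt
  set n := ⌈ζ (2 * j - 1) * L / π - 1 / 2⌉ with hn
  set s := (2 * n + 1) * π / 2 / L with hs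
  have h1 := Int.le_ceil (ζ (2 * j - 1) * L / π - 1 / 2)
  have h2 := (Int.ceil_lt_add_one (ζ (2 * j - 1) * L / π - 1 / 2)).le
  rw [← hn, sub_le_iff_le_add, div_le_iff₀ hπ] at h1
  rw [← hn, ← sub_le_iff_le_add, le_sub_iff_add_le, le_div_iff₀ hπ] at h2
  rw [div_lt_iff₀ hL] at hlt
  have hsm : s ∈ Icc (ζ (2 * j - 1)) (ζ (2 * j)) := by
    rw [hs, mem_Icc, le_div_iff₀ hL, div_le_iff₀ hL]
    constructor <;> linarith
  have hsL : max K 1 < |s| := by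
    rw [mem_Icc, not_and_or, not_le, not_le] at hjN
    rcases hjN with hjN | hjN
    · exact lt_abs.2 (Or.inr (by linarith [(hN j).2 hjN, hsm.2]))
    · exact lt_abs.2 (Or.inl (by linarith [(hN j).1 hjN, hsm.1]))
  obtain ⟨hsK, hs1⟩ := max_lt_iff.1 hsL
  have h3 := (hb s (by rw [norm_real]; exact hs1.le)).2.1
  have hcos : cos (s * L) = 0 :=
    Complex.cos_eq_zero_iff.2 ⟨n, by
      have := ofReal_ne_zero.2 hL.ne'
      rw [hs]; push_cast; field_simp⟩
  rw [hcos, sub_zero, h.discriminant_eq, norm_real, norm_real, ofReal_im,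
    abs_zero, zero_mul, Real.exp_zero, mul_one, Real.norm_eq_abs, Real.norm_eq_abs] at h3
  have h4 : |dR q L s| < 1 := h3.trans_lt ((div_lt_one (by linarith)).2 hsK)
  have h5 := e.one_le_dR_sq h hsm
  rw [← sq_abs] at h5
  nlinarith [abs_nonneg (dR q L s)]

/-- Points of `𝒟` stay away from the closures of the open gaps. -/
theorem exists_delta :
    ∃ δ : ℝ, 0 < δ ∧ δ * L ≤ 1 ∧ ∀ z ∈ domainD ζ, ∀ s : ℝ, ‖z - s‖ ≤ 3 * δ →
      s ∉ bandEdges ζ ∧ s ∈ bands ζ := by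
  have hL := h.pos
  have hbd := e.bddAbove_gaps h
  suffices hδ : ∃ δ : ℝ, 0 < δ ∧ δ * L ≤ 1 ∧ ∀ j, IsOpenGap ζ j → 6 * δ ≤ maxGap ζ by
    obtain ⟨δ, h0, h1, h2⟩ := hδ
    refine ⟨δ, h0, h1, fun z hz s hs => ?_⟩
    have key : ∀ j, IsOpenGap ζ j → s ∉ Icc (ζ (2 * j - 1)) (ζ (2 * j)) := fun j hj hsj => by
      refine hz.2 j hj (mem_closedBall_iff_norm.2 ?_)
      have h3 := le_csSup hbd ⟨j, hj, rfl⟩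
      have h4 : |s - (ζ (2 * j) + ζ (2 * j - 1)) / 2| ≤ maxGap ζ / 2 := by
        rw [abs_le, maxGap]; constructor <;> linarith [hsj.1, hsj.2]
      have h5 := norm_sub_le_norm_sub_add_norm_sub z s (((ζ (2 * j) + ζ (2 * j - 1)) / 2 : ℝ) : ℂ)
      rw [← ofReal_sub, norm_real, Real.norm_eq_abs] at h5
      linarith [h2 j hj]
    constructor
    · rintro ⟨j, hj, rfl | rfl⟩
      · exact key j hj ⟨le_rfl, hj.le⟩
      · exact key j hj ⟨hj.le, le_rfl⟩
    · exact (e.exists_cover h s).resolve_right fun ⟨j, hj⟩ =>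
        key j (hj.1.trans hj.2) ⟨hj.1.le, hj.2.le⟩
  by_cases hex : ∃ j, IsOpenGap ζ j
  · obtain ⟨j, hj⟩ := hex
    have h0 : 0 < maxGap ζ := (sub_pos.2 hj).trans_le (le_csSup hbd ⟨j, hj, rfl⟩)
    refine ⟨min (maxGap ζ / 6) (1 / L), by positivity, ?_, fun _ _ => ?_⟩
    · rw [← le_div_iff₀ hL]; exact min_le_right _ _
    · linarith [min_le_left (maxGap ζ / 6) (1 / L)]
  · exact ⟨1 / L, by positivity, by rw [one_div_mul_cancel hL.ne'], fun j hj => absurd ⟨j, hj⟩ hex⟩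

/-- An estimate away from the zeros of `sin zL`, for a function that continues analytically through
the bands, holds in `𝒟`: the exceptional discs meeting `𝒟` contain no point of an open gap. -/
theorem exists_norm_le_domainD {f : ℂ → ℂ}
    (hf : ∀ z ∈ offReal, DifferentiableAt ℂ f z)
    (hloc : ∀ s : ℝ, s ∉ bandEdges ζ → s ∈ bands ζ → ∃ W : ℂ → ℂ, AnalyticAt ℂ W s ∧
      ∀ᶠ z in 𝓝[offReal] (s : ℂ), f z = W z) {φ : ℝ → ℝ → ℝ}
    (hφ : ∀ δ > 0, ∃ C K, ∀ z ∈ offReal, K ≤ ‖z‖ → (∀ n : ℤ, δ ≤ ‖z * L - n * π‖) →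
      ∀ t : ℝ, ‖z‖ ≤ 2 * t → t ≤ 2 * ‖z‖ → ‖f z‖ ≤ φ C t) :
    ∃ C K : ℝ, ∀ z ∈ domainD ζ, K ≤ ‖z‖ → ‖f z‖ ≤ φ C ‖z‖ := by
  obtain ⟨δ, hδ, hδL, hdom⟩ := e.exists_delta h
  have hL := h.pos
  obtain ⟨C, K, hK⟩ := hφ (δ * L) (by positivity)
  refine ⟨C, max (2 * K) (max K (6 * δ)), fun z hz hzK => ?_⟩
  simp only [max_le_iff] at hzK
  obtain ⟨hzK2, hzK, hzδ⟩ := hzK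
  by_cases hgood : ∀ n : ℤ, δ * L ≤ ‖z * L - n * π‖
  · exact hK z hz.1 hzK hgood _ (by linarith [norm_nonneg z]) (by linarith [norm_nonneg z])
  push Not at hgood
  obtain ⟨n, hn⟩ := hgood
  have hdist : ∀ (w : ℂ) (m : ℤ), ‖w * L - m * π‖ = ‖w - (m * π / L : ℝ)‖ * L :=
    fun w m => by
      have h1 : w * L - m * π = (w - (m * π / L : ℝ)) * (L : ℂ) := by
        push_cast
        rw [sub_mul, div_mul_cancel₀ _ (ofReal_ne_zero.2 hL.ne')]
      rw [h1, norm_mul, norm_real, Real.norm_eq_abs, abs_of_pos hL]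
  rw [hdist, mul_lt_mul_iff_left₀ hL] at hn
  set c : ℝ := n * π / L with hc
  refine norm_le_of_sphere (c := c) (r := 3 / 2 * δ) (fun w _ hw => hf w hw) (fun s hs => ?_)
    ⟨{w : ℂ | δ < ‖w - c‖ ∧ ‖w - c‖ < 2 * δ}, ?_, fun w hw => ?_, fun w hw hwo => ?_⟩ ?_ hz.1
  · obtain ⟨h1, h2⟩ := hdom z hz s (by
      have h1 := norm_sub_le_norm_sub_add_norm_sub z c s
      rw [norm_sub_rev (c : ℂ) s] at h1
      linarith [mem_closedBall_iff_norm.1 hs])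
    exact hloc s h1 h2
  · have hc : Continuous fun w : ℂ => ‖w - c‖ := (continuous_id.sub continuous_const).norm
    exact (isOpen_lt continuous_const hc).inter (isOpen_lt hc continuous_const)
  · rw [mem_sphere_iff_norm] at hw
    constructor <;> rw [hw] <;> linarith
  · have h1 := norm_sub_le_norm_sub_add_norm_sub z c w
    rw [norm_sub_rev (c : ℂ) w] at h1
    have h2 := norm_le_norm_add_norm_sub' z w
    have h3 := norm_le_norm_add_norm_sub' w z
    rw [norm_sub_rev w z] at h3
    have h4 := hw.2
    refine hK w hwo (by linarith) (fun m => ?_) _ (by linarith) (by linarith)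
    rw [hdist, mul_le_mul_iff_left₀ hL]
    rcases eq_or_ne m n with rfl | hmn
    · exact hw.1.le
    have h5 : 3 * δ ≤ |(m * π / L : ℝ) - c| := by
      have : (1 : ℝ) ≤ |(m : ℝ) - n| := by
        exact_mod_cast Int.one_le_abs (sub_ne_zero.2 hmn)
      rw [hc, ← sub_div, ← sub_mul, abs_div, abs_mul, abs_of_pos hL, abs_of_pos Real.pi_pos,
        le_div_iff₀ hL]
      nlinarith [Real.pi_gt_three]
    have h6 := norm_sub_le_norm_sub_add_norm_sub ((m * π / L : ℝ) : ℂ) w c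
    rw [← ofReal_sub, norm_real, Real.norm_eq_abs, norm_sub_rev _ w] at h6
    linarith
  · rw [mem_ball_iff_norm]; linarith

theorem exists_remainder_domainD
    (x : ℝ) : ∃ C K : ℝ, ∀ z ∈ domainD ζ, K ≤ ‖z‖ → ∀ i j, ‖remainder q L x z i j‖ ≤ C / ‖z‖ := by
  have key : ∀ p : Fin 2 × Fin 2, ∃ C K : ℝ, ∀ z ∈ domainD ζ, K ≤ ‖z‖ →
      ‖remainder q L x z p.1 p.2‖ ≤ C / ‖z‖ := fun p =>
    e.exists_norm_le_domainD h (φ := fun C t => C / t)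
      (fun z hz => h.differentiableAt_remainder hz x p.1 p.2)
      (fun s hs hb => e.exists_remainder_eq h hs hb x p.1 p.2) fun δ hδ => by
        obtain ⟨C, K, hC, hb⟩ := h.exists_remainder hδ x
        refine ⟨2 * C, max K 1, fun z hz hzK hd t ht _ => (hb z hz (by
          exact (le_max_left _ _).trans hzK) hd p.1 p.2).trans ?_⟩
        have h1 := (le_max_right _ _).trans hzK
        rw [div_le_div_iff₀ (by linarith) (by linarith)]
        nlinarith
  choose C K hb using key
  obtain ⟨C', hC'⟩ := Finite.exists_le C
  obtain ⟨K', hK'⟩ := Finite.exists_le K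
  exact ⟨C', K', fun z hz hzK i j => (hb (i, j) z hz ((hK' _).trans hzK)).trans
    (div_le_div_of_nonneg_right (hC' _) (norm_nonneg _))⟩

end IsSpectralEnumeration

/-! ### Normalization and growth of `Φ` in `𝒟` -/

theorem matPhi_eq_remainder (q : ℝ → ℂ) (L : ℝ) (μ : ℤ → ℝ) (S F : ℂ → ℂ) (x : ℝ) (z : ℂ) :
    matPhi q L μ S F x z = matU * (1 + remainder q L x z) * matB q L μ S F z := by
  have h1 : matU * matU⁻¹ = 1 := by
    rw [matU_inv]
    ext i j
    fin_cases i <;> fin_cases j <;> simp [matU, Matrix.mul_apply, Fin.sum_univ_two] <;>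
      ring_nf <;> simp
  have h2 : Commute (matB q L μ S F z) (expSigmaThree (I * z * x)) := by
    rw [matB, expSigmaThree]
    split_ifs <;> exact (Matrix.commute_diagonal _ _).smul_left _
  rw [matPhi, remainder, add_sub_cancel, Matrix.mul_assoc, h2.eq, ← Matrix.mul_assoc,
    ← Matrix.mul_assoc, ← Matrix.mul_assoc, h1, Matrix.one_mul]

namespace BranchData

variable (d : BranchData q L Q ζ μ A B g S F)
include d

theorem asymptotic (x : ℝ) : ∃ C K : ℝ, ∀ z ∈ domainD ζ, K ≤ ‖z‖ → ∃ N : Mat₂,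
      Φ x z = matU * (1 + N) * matB q L μ S F z ∧ ∀ i j, ‖N i j‖ ≤ C / ‖z‖ := by
  obtain ⟨C, K, hb⟩ := d.spec.exists_remainder_domainD d.adm x
  exact ⟨C, K, fun z hz hzK => ⟨_, matPhi_eq_remainder q L μ S F x z, hb z hz hzK⟩⟩

/-- `f⁰²/(Δ² - 1)` continues analytically through the real line off the band edges. -/
theorem exists_sq_div_eq {s : ℝ} (hs : s ∉ bandEdges ζ) :
    ∃ W : ℂ → ℂ, AnalyticAt ℂ W s ∧ ∀ᶠ z in 𝓝[offReal] (s : ℂ), f⁰ z ^ 2 / (Δ z ^ 2 - 1) = W z := by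
  obtain ⟨T, hT, -, hev⟩ := d.exists_quot hs
  have h1 : AnalyticAt ℂ (fun z => f⁰ z ^ 2) s :=
    ((d.spec.differentiable_fZero d.adm A B).pow 2).analyticAt _
  have h2 : AnalyticAt ℂ (fun z => T z ^ 4 * (Δ z ^ 2 - 1)) s :=
    (hT.pow 4).mul (d.adm.differentiable_sq_sub_one.analyticAt _)
  have h3 : ∀ᶠ z in 𝓝[upper] (s : ℂ), f⁰ z ^ 2 = T z ^ 4 * (Δ z ^ 2 - 1) := by
    filter_upwards [hev, self_mem_nhdsWithin] with z hz hzu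
    have hz' := upper_subset hzu
    rw [← hz, d.quot_pow hz', div_mul_cancel₀ _ (d.adm.discriminant_sq_sub_one_ne_zero hz')]
  have hle := nhdsWithin_le_of_subset_offReal upper_subset s
  have h4 := (h1.frequently_eq_iff_eventually_eq h2).1 (h3.frequently.filter_mono hle)
  refine ⟨fun z => T z ^ 4, hT.pow 4, ?_⟩
  filter_upwards [h4.filter_mono nhdsWithin_le_nhds, self_mem_nhdsWithin] with z hz hzo
  rw [hz, mul_div_cancel_right₀ _ (d.adm.discriminant_sq_sub_one_ne_zero hzo)]

theorem exists_norm_quot_le : ∃ C K : ℝ, ∀ z ∈ domainD ζ, K ≤ ‖z‖ →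
    ‖S z / F z‖ ^ 4 ≤ Real.exp (C * ‖z‖ ^ 2) := by
  obtain ⟨C, K, hb⟩ := d.spec.exists_norm_le_domainD d.adm
    (f := fun z => f⁰ z ^ 2 / (Δ z ^ 2 - 1))
    (φ := fun C t => Real.exp (C * t ^ 2)) (fun z hz =>
      ((d.spec.differentiable_fZero d.adm A B z).pow 2).div (d.adm.differentiable_sq_sub_one z)
        (d.adm.discriminant_sq_sub_one_ne_zero hz)) (fun s hs _ => d.exists_sq_div_eq hs)
    fun δ hδ => by
      obtain ⟨c, K, hc, hK, hb⟩ := d.adm.exists_lower_bound hδ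
      obtain ⟨c₀, hc₀, hf⟩ := d.spec.norm_fZero_le d.adm A B
      refine ⟨4 * (c⁻¹ + 2 * c₀), K, fun z _ hzK hd t ht _ => ?_⟩
      have hz1 : 1 ≤ ‖z‖ := hK.trans hzK
      have h1 := (hb z hzK hd).2.2
      have h2 : 1 ≤ Real.exp (|z.im| * L) ^ 2 :=
        one_le_pow₀ (Real.one_le_exp (mul_nonneg (abs_nonneg _) d.adm.pos.le))
      have h3 : c ≤ ‖Δ z ^ 2 - 1‖ := (le_mul_of_one_le_right hc.le h2).trans h1
      rw [norm_div, norm_pow]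
      calc ‖f⁰ z‖ ^ 2 / ‖Δ z ^ 2 - 1‖
          ≤ Real.exp (c₀ * ‖z‖ ^ 2) ^ 2 / c := by gcongr; exact hf z hz1
        _ = c⁻¹ * Real.exp (2 * c₀ * ‖z‖ ^ 2) := by
          rw [← Real.exp_nat_mul, div_eq_inv_mul]; push_cast; ring_nf
        _ ≤ Real.exp c⁻¹ * Real.exp (2 * c₀ * ‖z‖ ^ 2) := by
          gcongr; linarith [Real.add_one_le_exp c⁻¹]
        _ = Real.exp (c⁻¹ * 1 + 2 * c₀ * ‖z‖ ^ 2) := by rw [← Real.exp_add, mul_one]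
        _ ≤ Real.exp (c⁻¹ * ‖z‖ ^ 2 + 2 * c₀ * ‖z‖ ^ 2) := by
          gcongr; exact one_le_pow₀ hz1
        _ = Real.exp ((c⁻¹ + 2 * c₀) * ‖z‖ ^ 2) := by ring_nf
        _ ≤ Real.exp ((c⁻¹ + 2 * c₀) * (2 * t) ^ 2) := by gcongr
        _ = _ := by ring_nf
  refine ⟨C, K, fun z hz hzK => ?_⟩
  rw [← norm_pow, d.quot_pow hz.1]
  exact hb z hz hzK

theorem exists_growth_of_le (x : ℝ) : ∃ c M K : ℝ, 0 < c ∧ 0 < M ∧ ∀ z ∈ domainD ζ, K ≤ ‖z‖ →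
    ∀ i j, ‖Φ x z i j‖ ≤ M * Real.exp (c * ‖z‖ ^ 2) := by
  obtain ⟨C₁, K₁, h₁⟩ := d.spec.exists_remainder_domainD d.adm x
  obtain ⟨C₂, K₂, h₂⟩ := d.exists_norm_quot_le
  obtain ⟨a, ha, hp⟩ := d.spec.norm_signProduct_le d.adm 1
  obtain ⟨b, hb, hm⟩ := d.spec.norm_signProduct_le d.adm (-1)
  refine ⟨|C₂| + a + b + 1, 4 * (2 + |C₁|), max 1 (max K₁ K₂), by positivity, by positivity,
    fun z hz hzK i j => ?_⟩
  simp only [max_le_iff] at hzK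
  obtain ⟨hz1, hzK₁, hzK₂⟩ := hzK
  have hT : ‖S z / F z‖ ≤ 2 * Real.exp (|C₂| * ‖z‖ ^ 2) := by
    have h3 : Real.exp (C₂ * ‖z‖ ^ 2) ≤ Real.exp (|C₂| * ‖z‖ ^ 2) := by
      gcongr; exact le_abs_self _
    have h4 := (h₂ z hz hzK₂).trans h3
    have h5 : 1 ≤ Real.exp (|C₂| * ‖z‖ ^ 2) := Real.one_le_exp (by positivity)
    rcases le_total ‖S z / F z‖ 1 with h6 | h6
    · linarith
    · linarith [le_self_pow₀ h6 (four_ne_zero)]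
  have hN : ∀ k, ‖(1 + remainder q L x z) k j‖ ≤ 1 + |C₁| := fun k => by
    rw [Matrix.add_apply]
    refine (norm_add_le _ _).trans (add_le_add ?_ ((h₁ z hz hzK₁ k j).trans ?_))
    · rw [Matrix.one_apply]; split_ifs <;> simp
    · exact (div_le_div_of_nonneg_right (le_abs_self _) (norm_nonneg _)).trans
        (div_le_self (abs_nonneg _) hz1)
  have hU : ‖(matU * (1 + remainder q L x z)) i j‖ ≤ 2 * (1 + |C₁|) := by
    have h3 : ∀ k, ‖matU i k‖ = 1 := fun k => by fin_cases i <;> fin_cases k <;> simp [matU]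
    rw [Matrix.mul_apply, Fin.sum_univ_two]
    refine (norm_add_le _ _).trans ?_
    rw [norm_mul, norm_mul, h3, h3, one_mul, one_mul]
    linarith [hN 0, hN 1]
  have hsp : ∀ {u : ℂ}, u = 𝔣 1 z ∨ u = 𝔣 (-1) z → ‖u‖ ≤ Real.exp ((a + b) * ‖z‖ ^ 2) := by
    rintro u (rfl | rfl)
    · exact (hp z).trans (by gcongr; linarith)
    · exact (hm z).trans (by gcongr; linarith)
  have hB : ∃ u, (u = 𝔣 1 z ∨ u = 𝔣 (-1) z) ∧ ‖Φ x z i j‖ =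
        ‖(matU * (1 + remainder q L x z)) i j‖ * (‖S z / F z‖ * ‖u‖) := by
    rw [matPhi_eq_remainder, matB]
    split_ifs <;> rw [Matrix.mul_smul, Matrix.smul_apply, Matrix.mul_diagonal] <;>
      obtain rfl | rfl := fin_two j
    · refine ⟨𝔣 (-1) z, Or.inr rfl, ?_⟩
      rw [mul_div_assoc, smul_eq_mul, norm_mul, norm_mul, norm_mul, norm_I, one_mul]
      simp only [Matrix.cons_val_zero]; ring
    · refine ⟨𝔣 1 z, Or.inl rfl, ?_⟩
      rw [mul_div_assoc, smul_eq_mul, norm_mul, norm_mul, norm_mul, norm_I, one_mul]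
      simp only [Matrix.cons_val_one, Matrix.cons_val_fin_one]; ring
    · refine ⟨𝔣 1 z, Or.inl rfl, ?_⟩
      rw [smul_eq_mul, norm_mul, norm_mul]
      simp only [Matrix.cons_val_zero]; ring
    · refine ⟨𝔣 (-1) z, Or.inr rfl, ?_⟩
      rw [smul_eq_mul, norm_mul, norm_mul]
      simp only [Matrix.cons_val_one, Matrix.cons_val_fin_one]; ring
  obtain ⟨u, hu, hΦ⟩ := hB
  rw [hΦ]
  calc _ ≤ 2 * (1 + |C₁|) * (2 * Real.exp (|C₂| * ‖z‖ ^ 2) * Real.exp ((a + b) * ‖z‖ ^ 2)) := by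
        gcongr; exact hsp hu
    _ = 4 * (1 + |C₁|) * Real.exp ((|C₂| + a + b + 0) * ‖z‖ ^ 2) := by
        rw [mul_assoc 2 (Real.exp _), ← Real.exp_add]; ring_nf
    _ ≤ _ := by gcongr <;> norm_num

theorem exists_bound_of_le (x K : ℝ) : ∃ M : ℝ, ∀ z, ‖z‖ ≤ K → z ∈ domainD ζ →
    ∀ i j, ‖Φ x z i j‖ ≤ M := by
  obtain ⟨M, hM⟩ := (isCompact_closedBall (0 : ℂ) K).induction_on
    (p := fun s => ∃ M : ℝ, ∀ z ∈ s, z ∈ domainD ζ → ∀ i j, ‖Φ x z i j‖ ≤ M)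
    ⟨0, fun z hz => absurd hz (notMem_empty z)⟩
    (fun s t hst ⟨M, hM⟩ => ⟨M, fun z hz => hM z (hst hz)⟩)
    (fun s t ⟨M, hM⟩ ⟨M', hM'⟩ => ⟨max M M', fun z hz hzD i j => by
      rcases hz with hz | hz
      · exact (hM z hz hzD i j).trans (le_max_left _ _)
      · exact (hM' z hz hzD i j).trans (le_max_right _ _)⟩) fun p _ => by
    suffices h : ∃ M : ℝ, ∀ᶠ z in 𝓝 p, z ∈ domainD ζ → ∀ i j, ‖Φ x z i j‖ ≤ M by
      obtain ⟨M, hM⟩ := h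
      exact ⟨_, mem_nhdsWithin_of_mem_nhds hM, M, fun z hz => hz⟩
    have hlim : ∀ {l : Filter ℂ} {Y : Mat₂}, Tendsto (Φ x) l (𝓝 Y) →
        ∃ M : ℝ, ∀ᶠ z in l, ∀ i j, ‖Φ x z i j‖ ≤ M := fun {l Y} hY => by
      obtain ⟨M, hM⟩ := Finite.exists_le fun k : Fin 2 × Fin 2 => ‖Y k.1 k.2‖ + 1
      refine ⟨M, eventually_all.2 fun i => eventually_all.2 fun j => ?_⟩
      have h1 : Tendsto (fun z => ‖Φ x z i j‖) l (𝓝 ‖Y i j‖) :=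
        (tendsto_pi_nhds.1 (tendsto_pi_nhds.1 hY i) j).norm
      filter_upwards [h1.eventually_lt_const (lt_add_one _)] with z hz
      exact hz.le.trans (hM (i, j))
    by_cases hp : p ∈ offReal
    · obtain ⟨M, hM⟩ := hlim (l := 𝓝 p) (Y := Φ x p)
        (tendsto_pi_nhds.2 fun i => tendsto_pi_nhds.2 fun j =>
          ((d.differentiableOn_matPhi x i j).differentiableAt
            (isOpen_offReal.mem_nhds hp)).continuousAt)
      exact ⟨M, hM.mono fun z hz _ => hz⟩
    obtain ⟨s, rfl⟩ : ∃ s : ℝ, p = s := ⟨p.re, Complex.ext rfl (not_not.1 hp)⟩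
    by_cases hs : s ∈ bandEdges ζ
    · obtain ⟨δ, hδ, -, hdom⟩ := d.spec.exists_delta d.adm
      refine ⟨0, ?_⟩
      filter_upwards [closedBall_mem_nhds (s : ℂ) (show 0 < 3 * δ by positivity)] with z hz hzD
      exact absurd hs (hdom z hzD s (mem_closedBall_iff_norm.1 hz)).1
    · obtain ⟨Φp, Φm, hu, hl, -⟩ := d.boundary x
      obtain ⟨M, hM⟩ := hlim (hu s hs)
      obtain ⟨M', hM'⟩ := hlim (hl s hs)
      refine ⟨max M M', ?_⟩
      filter_upwards [eventually_nhdsWithin_iff.1 hM, eventually_nhdsWithin_iff.1 hM']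
        with z h1 h2 hz i j
      rcases lt_or_gt_of_ne hz.1 with hz | hz
      · exact (h2 hz i j).trans (le_max_right _ _)
      · exact (h1 hz i j).trans (le_max_left _ _)
  exact ⟨M, fun z hz => hM z (mem_closedBall_zero_iff.2 hz)⟩

theorem growth (x : ℝ) : ∃ c M : ℝ, 0 < c ∧ 0 < M ∧ ∀ z ∈ domainD ζ, ∀ i j,
    ‖Φ x z i j‖ ≤ M * Real.exp (c * ‖z‖ ^ 2) := by
  obtain ⟨c, M, K, hc, hM, hb⟩ := d.exists_growth_of_le x
  obtain ⟨M', hb'⟩ := d.exists_bound_of_le x K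
  refine ⟨c, max M M', hc, lt_max_of_lt_left hM, fun z hz i j => ?_⟩
  rcases le_total K ‖z‖ with h | h
  · exact (hb z hz h i j).trans (by gcongr; exact le_max_left _ _)
  · exact (hb' z h hz i j).trans ((le_max_right _ _).trans (le_mul_of_one_le_right
      (hM.le.trans (le_max_left _ _)) (Real.one_le_exp (by positivity))))

end BranchData

theorem IsSpectralEnumeration.ne_zero_of_mem_slitDomain (e : IsSpectralEnumeration q L ζ μ)
    (h : Admissible q L Q) (hz : z ∈ slitDomain (ζ (-2)) (ζ (-1))) :
    ms q 0 1 L z ≠ 0 ∧ Δ z ^ 2 - 1 ≠ 0 := by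
  by_cases hzo : z ∈ offReal
  · exact ⟨ms_ne_zero_of_im h hzo, h.discriminant_sq_sub_one_ne_zero hzo⟩
  obtain ⟨s, rfl⟩ : ∃ s : ℝ, z = s := ⟨z.re, Complex.ext rfl (not_not.1 hzo)⟩
  have hs : s ∈ Ioo (ζ (2 * -1)) (ζ (2 * -1 + 1)) := by
    norm_num; simpa using hz.resolve_left hzo
  have hlt := e.dR_sq_lt_one h hs
  refine ⟨mt h.ms_eq_zero_iff.1 (mR_ne_zero_of_sq_lt h hlt), ?_⟩
  rw [sub_ne_zero, Ne, h.discriminant_sq_eq_one_iff]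
  exact hlt.ne

end ZSP

end

theorem theoremt (q : ℝ → ℂ) (L : ℝ) (hL : 0 < L) (hper : ∀ x, q (x + L) = q x)
    (hq : ContDiffOn ℝ 2 q (Set.Icc 0 L)) (hne : ∃ x, q x ≠ 0) :
    (∃ ζ μ : ℤ → ℝ, ZSP.IsSpectralEnumeration q L ζ μ) ∧
    ∀ ζ μ : ℤ → ℝ, ZSP.IsSpectralEnumeration q L ζ μ →
      (∃ A₁ B₁ : ℂ, ZSP.IsHadamardConstants q L μ A₁ B₁) ∧
      (∃ g : ℝ, ZSP.IsClosestToZero (ZSP.zeroSignMovable q L ζ μ) g) ∧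
      ∀ A₁ B₁ : ℂ, ZSP.IsHadamardConstants q L μ A₁ B₁ →
      ∀ g : ℝ, ZSP.IsClosestToZero (ZSP.zeroSignMovable q L ζ μ) g →
        (∃ S : ℂ → ℂ, ZSP.IsSqrtBranch ζ (ZSP.countM (ZSP.zeroSignMovable q L ζ μ) g)
          (ZSP.fZero q L μ A₁ B₁) S) ∧
        (∃ F : ℂ → ℂ, ZSP.IsFourthRootBranch ζ (fun z => ZSP.discriminant q L z ^ 2 - 1) F) ∧
        ∀ S F : ℂ → ℂ,
          ZSP.IsSqrtBranch ζ (ZSP.countM (ZSP.zeroSignMovable q L ζ μ) g)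
            (ZSP.fZero q L μ A₁ B₁) S →
          ZSP.IsFourthRootBranch ζ (fun z => ZSP.discriminant q L z ^ 2 - 1) F →
          ∀ x : ℝ, ZSP.SolvesRHP (ZSP.bandEdges ζ)
            (ZSP.matV q L ζ μ (ZSP.countM (ZSP.zeroSignMovable q L ζ μ) g) x)
            (ZSP.matB q L μ S F) (ZSP.domainD ζ) (ZSP.matPhi q L μ S F x) := by
  obtain ⟨Q, h⟩ := ZSP.exists_admissible hL hper hq
  refine ⟨h.exists_isSpectralEnumeration, fun ζ μ e => ⟨e.exists_isHadamardConstants h,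
    e.exists_isClosestToZero h, fun A₁ B₁ hAB g hg => ?_⟩⟩
  have hab : ζ (-2) < ζ (-1) := by simpa using e.band_lt (-1)
  obtain ⟨s₀, hs₀⟩ := exists_between hab
  refine ⟨ZSP.exists_isSqrtBranch hab (e.differentiable_fZero h A₁ B₁)
    (fun z hz => (e.factors_ne_zero h hAB (e.ne_zero_of_mem_slitDomain h hz).1).1)
    fun s hs => e.countM_base h hg hs hs₀, ZSP.exists_isFourthRootBranch hab
    h.differentiable_sq_sub_one (fun z hz => (e.ne_zero_of_mem_slitDomain h hz).2) fun s hs => ?_,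
    fun S F hS hF x => ?_⟩
  · have hlt : ZSP.dR q L s ^ 2 < 1 := e.dR_sq_lt_one h (j := -1) (by norm_num; exact hs)
    have h1 : ZSP.discriminant q L s ^ 2 - 1 = ((ZSP.dR q L s ^ 2 - 1 : ℝ) : ℂ) := by
      rw [h.discriminant_eq]; push_cast; ring
    rw [h1, norm_real, Real.norm_eq_abs, abs_of_neg (by linarith)]
    push_cast; ring
  · have d : ZSP.BranchData q L Q ζ μ A₁ B₁ g S F := ⟨h, e, hAB, hg, hS, hF⟩
    exact ⟨d.differentiableOn_matPhi x, d.boundary x, d.quartic x, d.asymptotic x, d.growth x⟩
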